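/- Let $k$ be a field. All differential graded (DG) objects are $\mathbb Z$-graded $k$-vector spaces with a differential of degree $+1$. For a DG $k$-coalgebra $C$ (coassociative, counital), let $\mathrm{Chain}(C)$ be the category of DG left $C$-comodules, $\mathcal H(C)$ its quotient by the relation of homotopy ($f\sim g$ if $f-g=hd+dh$ for some $C$-colinear $h$ of degree $-1$), $\mathcal D(C)$ the localization of $\mathcal H(C)$ at the quasi-isomorphisms (with distinguished triangles those isomorphic to the images of mapping cone triangles), and $\mathcal H^+(C)\subseteq\mathcal H(C)$, $\mathcal D^+(C)\subseteq\mathcal D(C)$ the full subcategories of objects isomorphic to left bounded DG comodules. An object $Y\in\mathrm{Chain}(C)$ is called closed if $\mathrm{Hom}_{\mathcal H(C)}(M,Y)\to\mathrm{Hom}_{\mathcal D(C)}(M,Y)$ is bijective for all $M\in\mathrm{Chain}(C)$. Let $C$ and $D$ be DG $k$-coalgebras which are positively graded ($C_n=D_n=0$ for $n<0$), with $C$ bounded, and let $X$ be a bounded DG $D$-$C$-bicomodule which is closed as an object of $\mathrm{Chain}(D)$. For $M\in\mathrm{Chain}(C)$ let $X\Box_C M=\ker(\rho_X\otimes 1-1\otimes\rho_M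 : X\otimes M\to X\otimes C\otimes M)\in\mathrm{Chain}(D)$ be the cotensor product. Then the right derived functor $F=X\Box_C^R- : \mathcal D^+(C)\to\mathcal D^+(D)$ of $X\Box_C- : \mathcal H^+(C)\to\mathcal D^+(D)$ exists, and the following are equivalent: 1. $F$ is an equivalence of categories. 2. The following three conditions hold: (a) for all $n\in\mathbb Z$, $F$ induces an isomorphism $\mathrm{Hom}_{\mathcal D(C)}(C,C[n])\cong\mathrm{Hom}_{\mathcal D(D)}(X,X[n])$, where $F(C)$ and $F(C[n])$ are identified with $X$ and $X[n]$ through the canonical morphisms $X[n]\to X\Box_C C[n]\to F(C[n])$; (b) $F$ commutes with arbitrary products, i.e. with all (small) products that exist in $\mathcal D^+(C)$; (c) the smallest triangulated full subcategory of $\mathcal D^+(D)$, closed under isomorphisms, which contains $X$, is stable under arbitrary products (all small products that exist in $\mathcal D^+(D)$) and is stable under extensions by objects of $\mathrm{Chain}^+(k)$ (if it contains $M$ then it contains $M\otimes V$ for every left bounded complex $V$ of $k$-vector spaces), contains $D$. -/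

import Mathlib

open CategoryTheory
open scoped TensorProduct DirectSum

universe u

noncomputable section

/-- A differential `ℤ`-graded vector space over `k`: a vector space `V = ⨁ₙ Vₙ` with a
square-zero endomorphism `d` of degree `+1`. -/
structure DGVect (k : Type u) [Field k] where
  carrier : Type u
  [addCommGroup : AddCommGroup carrier]
  [module : Module k carrier]
  gr : ℤ → Submodule k carrier
  isInternal : DirectSum.IsInternal gr
  d : carrier →ₗ[k] carrier
  d_mem : ∀ {n : ℤ} {x : carrier}, x ∈ gr n → d x ∈ gr (n + 1)
  d_d : ∀ x, d (d x) = 0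

namespace DGVect

variable {k : Type u} [Field k]

instance : CoeSort (DGVect k) (Type u) := ⟨carrier⟩

attribute [instance] addCommGroup module

instance (V : DGVect k) : DirectSum.Decomposition V.gr := V.isInternal.chooseDecomposition

/-- `Vₙ = 0` for `n < 0`. -/
def Positive (V : DGVect k) : Prop := ∀ n : ℤ, n < 0 → V.gr n = ⊥

/-- Left bounded complexes. -/
def BoundedBelow (V : DGVect k) : Prop := ∃ a : ℤ, ∀ n : ℤ, n < a → V.gr n = ⊥

/-- Complexes bounded on both sides. -/
def Bounded (V : DGVect k) : Prop := ∃ a b : ℤ, ∀ n : ℤ, n < a ∨ b < n → V.gr n = ⊥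

lemma Positive.boundedBelow {V : DGVect k} (h : V.Positive) : V.BoundedBelow := ⟨0, h⟩

lemma Bounded.boundedBelow {V : DGVect k} (h : V.Bounded) : V.BoundedBelow := by
  obtain ⟨a, b, h⟩ := h
  exact ⟨a, fun n hn => h n (Or.inl hn)⟩

lemma linearMap_ext (V : DGVect k) {P : Type*} [AddCommGroup P] [Module k P] {f g : V →ₗ[k] P}
    (h : ∀ (n : ℤ) (x : V), x ∈ V.gr n → f x = g x) : f = g := by
  ext x
  induction x using DirectSum.Decomposition.inductionOn V.gr with
  | zero => simp
  | homogeneous m => exact h _ _ m.2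
  | add a b ha hb => simp [ha, hb]

/-- The sign operator: multiplication by `(-1)ⁿ` on `Vₙ`. -/
def sgn (V : DGVect k) : V →ₗ[k] V :=
  (DirectSum.toModule k ℤ V fun n => (n.negOnePow : ℤ) • (V.gr n).subtype) ∘ₗ
    (DirectSum.decomposeLinearEquiv V.gr).toLinearMap

lemma sgn_of_mem (V : DGVect k) {n : ℤ} {x : V} (hx : x ∈ V.gr n) :
    V.sgn x = (n.negOnePow : ℤ) • x := by
  lift x to V.gr n using hx
  simp [sgn]

lemma sgn_mem (V : DGVect k) {n : ℤ} {x : V} (hx : x ∈ V.gr n) : V.sgn x ∈ V.gr n := by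
  rw [sgn_of_mem V hx]
  exact zsmul_mem hx _

lemma sgn_sgn (V : DGVect k) (x : V) : V.sgn (V.sgn x) = x := by
  have : V.sgn ∘ₗ V.sgn = LinearMap.id := by
    refine V.linearMap_ext fun n x hx => ?_
    simp [sgn_of_mem V hx, smul_smul, ← Units.val_mul]
  exact LinearMap.congr_fun this x

lemma d_sgn (V : DGVect k) (x : V) : V.d (V.sgn x) = -V.sgn (V.d x) := by
  have : V.d ∘ₗ V.sgn = -(V.sgn ∘ₗ V.d) := by
    refine V.linearMap_ext fun n x hx => ?_
    simp [sgn_of_mem V hx, sgn_of_mem V (V.d_mem hx), Int.negOnePow_succ]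
  exact LinearMap.congr_fun this x

/-- The total homology `H(V) = ker d / im d`. -/
abbrev Homology (V : DGVect k) : Type u :=
  LinearMap.ker V.d ⧸ (LinearMap.range V.d).submoduleOf (LinearMap.ker V.d)

/-- Morphisms of differential graded vector spaces. -/
@[ext]
structure Hom (V W : DGVect k) where
  lin : V →ₗ[k] W
  mem : ∀ {n : ℤ} {x : V}, x ∈ V.gr n → lin x ∈ W.gr n
  comm : ∀ x, lin (V.d x) = W.d (lin x)

lemma Hom.sgn {V W : DGVect k} (f : Hom V W) (x : V) : f.lin (V.sgn x) = W.sgn (f.lin x) := by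
  have : f.lin ∘ₗ V.sgn = W.sgn ∘ₗ f.lin := by
    refine V.linearMap_ext fun n x hx => ?_
    simp [sgn_of_mem V hx, sgn_of_mem W (f.mem hx)]
  exact LinearMap.congr_fun this x

/-- The map induced in homology. -/
def Hom.homologyMap {V W : DGVect k} (f : Hom V W) : V.Homology →ₗ[k] W.Homology :=
  Submodule.mapQ _ _
    (f.lin.restrict (p := LinearMap.ker V.d) (q := LinearMap.ker W.d) fun x hx => by
      simp only [LinearMap.mem_ker] at hx ⊢
      rw [← f.comm, hx, map_zero])
    (by
      rintro ⟨x, hx⟩ ⟨y, hy⟩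
      exact ⟨f.lin y, by rw [← f.comm, hy]; rfl⟩)

/-! ### Tensor products -/

/-- `(V ⊗ W)ₙ = ⨁_{p + q = n} V_p ⊗ W_q`. -/
def tensorGr (V W : DGVect k) (n : ℤ) : Submodule k (V ⊗[k] W) :=
  Submodule.span k {t | ∃ p q : ℤ, p + q = n ∧ ∃ x ∈ V.gr p, ∃ y ∈ W.gr q, t = x ⊗ₜ[k] y}

lemma tmul_mem (V W : DGVect k) {p q n : ℤ} (h : p + q = n) {x : V} {y : W} (hx : x ∈ V.gr p)
    (hy : y ∈ W.gr q) : x ⊗ₜ[k] y ∈ tensorGr V W n :=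
  Submodule.subset_span ⟨p, q, h, x, hx, y, hy, rfl⟩

/-- To check that a linear map sends `(V ⊗ W)ₙ` into a submodule, homogeneous pure tensors
are enough. -/
lemma tensorGr_le (V W : DGVect k) {P : Type*} [AddCommGroup P] [Module k P]
    (f : V ⊗[k] W →ₗ[k] P) (n : ℤ) (S : Submodule k P)
    (h : ∀ p q : ℤ, p + q = n → ∀ x ∈ V.gr p, ∀ y ∈ W.gr q, f (x ⊗ₜ[k] y) ∈ S)
    {t : V ⊗[k] W} (ht : t ∈ tensorGr V W n) : f t ∈ S := by
  have : tensorGr V W n ≤ S.comap f := by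
    refine Submodule.span_le.2 ?_
    rintro _ ⟨p, q, hpq, x, hx, y, hy, rfl⟩
    exact h p q hpq x hx y hy
  exact this ht

lemma tensor_linearMap_ext (V W : DGVect k) {P : Type*} [AddCommGroup P] [Module k P]
    {f g : V ⊗[k] W →ₗ[k] P}
    (h : ∀ (p q : ℤ) (x : V) (y : W), x ∈ V.gr p → y ∈ W.gr q → f (x ⊗ₜ y) = g (x ⊗ₜ y)) :
    f = g := by
  refine TensorProduct.ext ?_
  refine V.linearMap_ext fun p x hx => W.linearMap_ext fun q y hy => ?_
  exact h p q x y hx hy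

/-- The decomposition of a tensor into its homogeneous components. -/
def tensorDecompose (V W : DGVect k) : V ⊗[k] W →ₗ[k] ⨁ n, tensorGr V W n :=
  (DirectSum.toModule k (ℤ × ℤ) _ fun i =>
      DirectSum.lof k ℤ (fun n => tensorGr V W n) (i.1 + i.2) ∘ₗ
        (TensorProduct.map (V.gr i.1).subtype (W.gr i.2).subtype).codRestrict
          (tensorGr V W (i.1 + i.2)) (fun t => by
            induction t with
            | zero => simp
            | tmul x y => exact tmul_mem V W rfl x.2 y.2
            | add a b ha hb => rw [map_add]; exact add_mem ha hb)) ∘ₗ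
    (TensorProduct.directSum k k (fun n => V.gr n) (fun n => W.gr n)).toLinearMap ∘ₗ
    TensorProduct.map (DirectSum.decomposeLinearEquiv V.gr).toLinearMap
      (DirectSum.decomposeLinearEquiv W.gr).toLinearMap

lemma tensorDecompose_tmul (V W : DGVect k) {p q n : ℤ} (h : p + q = n) {x : V} {y : W}
    (hx : x ∈ V.gr p) (hy : y ∈ W.gr q) :
    tensorDecompose V W (x ⊗ₜ y) =
      DirectSum.lof k ℤ (fun n => tensorGr V W n) n ⟨x ⊗ₜ y, tmul_mem V W h hx hy⟩ := by
  subst h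
  lift x to V.gr p using hx
  lift y to W.gr q using hy
  simp only [tensorDecompose, LinearMap.comp_apply, LinearEquiv.coe_coe, TensorProduct.map_tmul,
    DirectSum.decomposeLinearEquiv_apply_coe, TensorProduct.directSum_lof_tmul_lof,
    DirectSum.toModule_lof]
  rfl

lemma tensorGr_isInternal (V W : DGVect k) : DirectSum.IsInternal (tensorGr V W) := by
  let e := tensorDecompose V W
  let c := DirectSum.coeLinearMap (tensorGr V W)
  have h1 : c ∘ₗ e = LinearMap.id := by
    refine tensor_linearMap_ext V W fun p q x y hx hy => ?_
    simp [c, e, tensorDecompose_tmul V W rfl hx hy]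
  have h2 : e ∘ₗ c = LinearMap.id := by
    refine DirectSum.linearMap_ext _ fun n => ?_
    ext ⟨t, ht⟩ : 1
    simp only [LinearMap.comp_apply, c, DirectSum.coeLinearMap_lof, LinearMap.id_apply]
    have key : ∀ t (ht : t ∈ tensorGr V W n), e t =
        DirectSum.lof k ℤ (fun n => tensorGr V W n) n ⟨t, ht⟩ := by
      intro t ht
      induction ht using Submodule.span_induction with
      | mem t h =>
        obtain ⟨p, q, hpq, x, hx, y, hy, rfl⟩ := h
        exact tensorDecompose_tmul V W hpq hx hy
      | zero => rw [map_zero]; exact (map_zero (DirectSum.lof k ℤ (fun n => tensorGr V W n) n)).symm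
      | add a b ha hb iha ihb =>
        rw [map_add, iha, ihb, ← map_add]; rfl
      | smul r a ha iha =>
        rw [map_smul, iha, ← map_smul]; rfl
    exact key t ht
  exact ⟨fun a b hab => by
      have := congrArg e hab
      have h2' := fun z => LinearMap.congr_fun h2 z
      exact (h2' a).symm.trans (this.trans (h2' b)),
    fun t => ⟨e t, LinearMap.congr_fun h1 t⟩⟩

/-- The tensor product of differential graded vector spaces, with
`d (x ⊗ y) = d x ⊗ y + (-1)^|x| x ⊗ d y`. -/
abbrev tensor (V W : DGVect k) : DGVect k where
  carrier := V ⊗[k] W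
  gr := tensorGr V W
  isInternal := tensorGr_isInternal V W
  d := TensorProduct.map V.d LinearMap.id + TensorProduct.map V.sgn W.d
  d_mem := by
    intro n t ht
    refine tensorGr_le V W _ n _ (fun p q hpq x hx y hy => ?_) ht
    simp only [LinearMap.add_apply, TensorProduct.map_tmul, LinearMap.id_apply]
    exact add_mem (tmul_mem V W (by omega) (V.d_mem hx) hy)
      (tmul_mem V W (by omega) (V.sgn_mem hx) (W.d_mem hy))
  d_d := by
    intro t
    induction t with
    | zero => simp
    | tmul x y => simp [V.d_d, W.d_d, d_sgn, TensorProduct.neg_tmul]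
    | add a b ha hb => rw [map_add, map_add, ha, hb, add_zero]

lemma tensor_d_tmul (V W : DGVect k) (x : V) (y : W) :
    (tensor V W).d (x ⊗ₜ[k] y) = V.d x ⊗ₜ[k] y + V.sgn x ⊗ₜ[k] W.d y := rfl

lemma tensor_sgn_tmul (V W : DGVect k) (x : V) (y : W) :
    (tensor V W).sgn (x ⊗ₜ[k] y) = V.sgn x ⊗ₜ[k] W.sgn y := by
  have : (tensor V W).sgn = TensorProduct.map V.sgn W.sgn := by
    refine tensor_linearMap_ext V W fun p q x y hx hy => ?_
    have := (tensor V W).sgn_of_mem (n := p + q) (tmul_mem V W rfl hx hy)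
    refine this.trans ?_
    rw [TensorProduct.map_tmul, sgn_of_mem V hx, sgn_of_mem W hy]
    simp only [Int.negOnePow_add, Units.val_mul, ← Int.cast_smul_eq_zsmul k,
      TensorProduct.smul_tmul_smul, Int.cast_mul]
  exact LinearMap.congr_fun this _

lemma BoundedBelow.tensor {V W : DGVect k} (hV : V.BoundedBelow) (hW : W.BoundedBelow) :
    (tensor V W).BoundedBelow := by
  obtain ⟨a, ha⟩ := hV
  obtain ⟨b, hb⟩ := hW
  refine ⟨a + b, fun n hn => ?_⟩
  refine (Submodule.eq_bot_iff _).2 fun t ht => ?_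
  have := tensorGr_le V W LinearMap.id n ⊥ (fun p q hpq x hx y hy => ?_) ht
  · simpa using this
  · by_cases hp : p < a
    · rw [ha p hp, Submodule.mem_bot] at hx
      simp [hx]
    · rw [hb q (by omega), Submodule.mem_bot] at hy
      simp [hy]

/-- The tensor product of two morphisms. -/
def Hom.tensor {V W V' W' : DGVect k} (f : Hom V V') (g : Hom W W') :
    Hom (V.tensor W) (V'.tensor W') where
  lin := TensorProduct.map f.lin g.lin
  mem := by
    intro n t ht
    refine tensorGr_le V W _ n _ (fun p q hpq x hx y hy => ?_) ht
    exact tmul_mem V' W' hpq (f.mem hx) (g.mem hy)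
  comm := by
    intro t
    induction t using TensorProduct.induction_on with
    | zero => rw [map_zero, map_zero, map_zero]
    | tmul x y =>
      rw [tensor_d_tmul, map_add]
      simp only [TensorProduct.map_tmul, f.comm, g.comm, f.sgn]
      rfl
    | add a b ha hb => rw [map_add, map_add, ha, hb, map_add, map_add]

/-- The identity morphism. -/
def Hom.id (V : DGVect k) : Hom V V := ⟨LinearMap.id, fun h => h, fun _ => rfl⟩

/-- Composition of morphisms. -/
def Hom.comp {U V W : DGVect k} (g : Hom V W) (f : Hom U V) : Hom U W :=
  ⟨g.lin ∘ₗ f.lin, fun h => g.mem (f.mem h), fun x => by simp [f.comm, g.comm]⟩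

/-- The difference of two morphisms. -/
def Hom.sub {V W : DGVect k} (f g : Hom V W) : Hom V W :=
  ⟨f.lin - g.lin, fun h => sub_mem (f.mem h) (g.mem h), fun x => by simp [f.comm, g.comm]⟩

/-- The associator `U ⊗ (V ⊗ W) ≅ (U ⊗ V) ⊗ W`. -/
def assocInv (U V W : DGVect k) : Hom (U.tensor (V.tensor W)) ((U.tensor V).tensor W) where
  lin := (TensorProduct.assoc k U V W).symm.toLinearMap
  mem := by
    intro n t ht
    refine tensorGr_le U (V.tensor W) _ n _ (fun p q hpq x hx t ht => ?_) ht
    refine tensorGr_le V W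
      ((TensorProduct.assoc k U V W).symm.toLinearMap ∘ₗ TensorProduct.mk k U (V ⊗[k] W) x) q _
      (fun a b hab y hy z hz => ?_) ht
    exact tmul_mem (U.tensor V) W (p := p + a) (by omega) (tmul_mem U V rfl hx hy) hz
  comm := by
    intro t
    induction t using TensorProduct.induction_on with
    | zero => rw [map_zero, map_zero, map_zero]
    | add a b ha hb => rw [map_add, map_add, ha, hb, map_add, map_add]
    | tmul x t =>
      induction t using TensorProduct.induction_on with
      | zero => rw [TensorProduct.tmul_zero, map_zero, map_zero, map_zero]
      | add a b ha hb =>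
        rw [TensorProduct.tmul_add, map_add, map_add, ha, hb, map_add, map_add]
      | tmul y z =>
        rw [tensor_d_tmul, tensor_d_tmul]
        change _ = ((U.tensor V).tensor W).d ((x ⊗ₜ[k] y) ⊗ₜ[k] z)
        rw [tensor_d_tmul, tensor_d_tmul, tensor_sgn_tmul, TensorProduct.tmul_add,
          TensorProduct.add_tmul, map_add, map_add, add_assoc]
        rfl

/-- The associator in the other direction. -/
def assocHom (U V W : DGVect k) : Hom ((U.tensor V).tensor W) (U.tensor (V.tensor W)) where
  lin := (TensorProduct.assoc k U V W).toLinearMap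
  mem := by
    intro n t ht
    refine tensorGr_le (U.tensor V) W _ n _ (fun p q hpq t ht z hz => ?_) ht
    refine tensorGr_le U V
      ((TensorProduct.assoc k U V W).toLinearMap ∘ₗ (TensorProduct.mk k (U ⊗[k] V) W).flip z) p _
      (fun a b hab x hx y hy => ?_) ht
    exact tmul_mem U (V.tensor W) (q := b + q) (by omega) hx (tmul_mem V W rfl hy hz)
  comm := by
    intro t
    obtain ⟨t, rfl⟩ := (TensorProduct.assoc k U V W).symm.surjective t
    have := (assocInv U V W).comm t
    simp only [assocInv, LinearEquiv.coe_coe] at this ⊢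
    rw [← this, LinearEquiv.apply_symm_apply, LinearEquiv.apply_symm_apply]

/-! ### Kernels -/

lemma Hom.decompose {V W : DGVect k} (f : Hom V W) (x : V) (n : ℤ) :
    (DirectSum.decompose W.gr (f.lin x) n : W) = f.lin (DirectSum.decompose V.gr x n) := by
  induction x using DirectSum.Decomposition.inductionOn V.gr with
  | zero => simp
  | @homogeneous i m =>
    by_cases h : i = n
    · subst h
      rw [DirectSum.decompose_of_mem_same _ (f.mem m.2), DirectSum.decompose_of_mem_same _ m.2]
    · rw [DirectSum.decompose_of_mem_ne _ (f.mem m.2) h, DirectSum.decompose_of_mem_ne _ m.2 h,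
        map_zero]
  | add a b ha hb => simp [ha, hb]

/-- An injective morphism reflects degrees. -/
lemma Hom.mem_of_injective {V W : DGVect k} (f : Hom V W) (hf : Function.Injective f.lin) {n : ℤ}
    {x : V} (hx : f.lin x ∈ W.gr n) : x ∈ V.gr n := by
  have : (DirectSum.decompose V.gr x n : V) = x := by
    apply hf
    rw [← f.decompose, DirectSum.decompose_of_mem_same _ hx]
  rw [← this]
  exact SetLike.coe_mem _

lemma ker_isInternal {V W : DGVect k} (f : Hom V W) :
    DirectSum.IsInternal fun n => (V.gr n).comap (LinearMap.ker f.lin).subtype := by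
  classical
  refine DirectSum.isInternal_submodule_of_iSupIndep_of_iSup_eq_top ?_ ?_
  · have h := V.isInternal.submodule_iSupIndep
    rw [iSupIndep_def] at h ⊢
    intro i
    have hi := h i
    rw [Submodule.disjoint_def] at hi ⊢
    intro x hx hx'
    refine Subtype.ext (hi x hx ?_)
    have hle : (⨆ (j : ℤ) (_ : j ≠ i), (V.gr j).comap (LinearMap.ker f.lin).subtype) ≤
        (⨆ (j : ℤ) (_ : j ≠ i), V.gr j).comap (LinearMap.ker f.lin).subtype :=
      iSup₂_le fun j hj => Submodule.comap_mono (le_iSup₂_of_le j hj le_rfl)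
    exact hle hx'
  · refine eq_top_iff.2 fun x _ => ?_
    have hmem : ∀ n, (DirectSum.decompose V.gr (x : V) n : V) ∈ LinearMap.ker f.lin := fun n => by
      rw [LinearMap.mem_ker, ← f.decompose, LinearMap.mem_ker.1 x.2]
      simp
    have hx : x = ∑ n ∈ (DirectSum.decompose V.gr (x : V)).support,
        (⟨_, hmem n⟩ : LinearMap.ker f.lin) := by
      refine Subtype.ext ?_
      rw [AddSubmonoidClass.coe_finsetSum]
      exact (DirectSum.sum_support_decompose V.gr (x : V)).symm
    rw [hx]
    exact Submodule.sum_mem _ fun n _ => Submodule.mem_iSup_of_mem n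
      (SetLike.coe_mem (DirectSum.decompose V.gr (x : V) n))

/-- The kernel of a morphism of differential graded vector spaces. -/
abbrev ker {V W : DGVect k} (f : Hom V W) : DGVect k where
  carrier := LinearMap.ker f.lin
  gr n := (V.gr n).comap (LinearMap.ker f.lin).subtype
  isInternal := ker_isInternal f
  d := V.d.restrict fun x hx => by
    rw [LinearMap.mem_ker] at hx ⊢
    rw [f.comm, hx, map_zero]
  d_mem := fun hx => V.d_mem hx
  d_d := fun x => Subtype.ext (V.d_d x)

/-- The inclusion of the kernel. -/
def kerι {V W : DGVect k} (f : Hom V W) : Hom (ker f) V where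
  lin := (LinearMap.ker f.lin).subtype
  mem := fun h => h
  comm := fun _ => rfl

lemma kerι_injective {V W : DGVect k} (f : Hom V W) : Function.Injective (kerι f).lin :=
  Subtype.val_injective

lemma BoundedBelow.ker {V W : DGVect k} (f : Hom V W) (hV : V.BoundedBelow) :
    (ker f).BoundedBelow := by
  obtain ⟨a, ha⟩ := hV
  refine ⟨a, fun n hn => (Submodule.eq_bot_iff _).2 fun x hx => ?_⟩
  have hx' : (x : V) ∈ V.gr n := hx
  rw [ha n hn, Submodule.mem_bot] at hx'
  exact Subtype.ext hx'

/-- The degree shift `V[n]`, with `V[n]ⱼ = V_{n+j}` and the same differential, that is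
`V ⊗ k[n]`. -/
abbrev shift (V : DGVect k) (n : ℤ) : DGVect k where
  carrier := V
  gr j := V.gr (n + j)
  isInternal := by
    have h := V.isInternal
    rw [DirectSum.isInternal_submodule_iff_iSupIndep_and_iSup_eq_top] at h ⊢
    refine ⟨h.1.comp (add_right_injective n), ?_⟩
    rw [← h.2]
    exact (Equiv.addLeft n).iSup_comp (g := V.gr)
  d := V.d
  d_mem := fun hx => by rw [← add_assoc]; exact V.d_mem hx
  d_d := V.d_d

lemma BoundedBelow.shift {V : DGVect k} (hV : V.BoundedBelow) (n : ℤ) :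
    (V.shift n).BoundedBelow := by
  obtain ⟨a, ha⟩ := hV
  exact ⟨a - n, fun j hj => ha _ (by omega)⟩

end DGVect

/-- A differential graded coalgebra: a coassociative counital coalgebra in the monoidal category
of differential graded vector spaces. -/
structure DGCoalg (k : Type u) [Field k] extends DGVect k where
  comul : DGVect.Hom toDGVect (toDGVect.tensor toDGVect)
  counit : carrier →ₗ[k] k
  counit_of_mem : ∀ {n : ℤ} {x : carrier}, n ≠ 0 → x ∈ gr n → counit x = 0
  counit_d : ∀ x, counit (d x) = 0
  coassoc : ∀ x, TensorProduct.map comul.lin LinearMap.id (comul.lin x) =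
    (TensorProduct.assoc k carrier carrier carrier).symm
      (TensorProduct.map LinearMap.id comul.lin (comul.lin x))
  counit_comul : ∀ x,
    TensorProduct.lid k carrier (TensorProduct.map counit LinearMap.id (comul.lin x)) = x
  comul_counit : ∀ x,
    TensorProduct.rid k carrier (TensorProduct.map LinearMap.id counit (comul.lin x)) = x

variable {k : Type u} [Field k]

lemma DGCoalg.counit_sgn (C : DGCoalg k) (x : C.carrier) : C.counit (C.sgn x) = C.counit x := by
  have : C.counit ∘ₗ C.sgn = C.counit := by
    refine C.linearMap_ext fun n x hx => ?_
    by_cases hn : n = 0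
    · subst hn
      simp [C.sgn_of_mem hx]
    · simp [C.sgn_of_mem hx, C.counit_of_mem hn hx]
  exact LinearMap.congr_fun this x

/-- A differential graded left comodule over `C`. -/
structure DGComod (C : DGCoalg k) extends DGVect k where
  coact : DGVect.Hom toDGVect (C.toDGVect.tensor toDGVect)
  coact_coassoc : ∀ x, TensorProduct.map C.comul.lin LinearMap.id (coact.lin x) =
    (TensorProduct.assoc k C.carrier C.carrier carrier).symm
      (TensorProduct.map LinearMap.id coact.lin (coact.lin x))
  counit_coact : ∀ x,
    TensorProduct.lid k carrier (TensorProduct.map C.counit LinearMap.id (coact.lin x)) = x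

/-- `C` as a left comodule over itself. -/
abbrev DGCoalg.self (C : DGCoalg k) : DGComod C where
  toDGVect := C.toDGVect
  coact := C.comul
  coact_coassoc := C.coassoc
  counit_coact := C.counit_comul

/-- A differential graded `D`-`C`-bicomodule, i.e. a differential graded `D ⊗ Cᵒᵖ`-comodule:
commuting left `D`- and right `C`-coactions compatible with degrees and differentials. -/
structure DGBicomod (D C : DGCoalg k) extends DGComod D where
  coactR : DGVect.Hom toDGVect (toDGVect.tensor C.toDGVect)
  coactR_coassoc : ∀ x, TensorProduct.map coactR.lin LinearMap.id (coactR.lin x) =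
    (TensorProduct.assoc k carrier C.carrier C.carrier).symm
      (TensorProduct.map LinearMap.id C.comul.lin (coactR.lin x))
  counit_coactR : ∀ x,
    TensorProduct.rid k carrier (TensorProduct.map LinearMap.id C.counit (coactR.lin x)) = x
  coact_coactR : ∀ x, TensorProduct.map coact.lin LinearMap.id (coactR.lin x) =
    (TensorProduct.assoc k D.carrier carrier C.carrier).symm
      (TensorProduct.map LinearMap.id coactR.lin (coact.lin x))

namespace DGComod

variable {C D : DGCoalg k}

/-- Morphisms of differential graded comodules: colinear maps of degree `0` which commute with
the differentials. -/
@[ext]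
structure Hom (M N : DGComod C) extends DGVect.Hom M.toDGVect N.toDGVect where
  colin : ∀ x, N.coact.lin (lin x) = TensorProduct.map LinearMap.id lin (M.coact.lin x)

/-- The category `Chain(C)`. -/
instance : Category (DGComod C) where
  Hom := Hom
  id M := ⟨DGVect.Hom.id _, fun x => by simp [DGVect.Hom.id]⟩
  comp f g := ⟨DGVect.Hom.comp g.toHom f.toHom, fun x => by
    simp only [DGVect.Hom.comp, LinearMap.comp_apply, g.colin, f.colin]
    rw [← LinearMap.comp_apply, ← TensorProduct.map_comp, LinearMap.comp_id]⟩
  id_comp _ := rfl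
  comp_id _ := rfl
  assoc _ _ _ := rfl

@[ext]
lemma hom_ext {M N : DGComod C} {f g : M ⟶ N} (h : f.lin = g.lin) : f = g :=
  Hom.ext h

/-- A homotopy between morphisms `f, g : M ⟶ N`: a colinear map `h` of degree `-1` with
`f - g = h d + d h`. Colinearity of a map of degree `-1` is `ρ ∘ h = (1 ⊗ h) ∘ ρ` with the Koszul
rule `(1 ⊗ h)(c ⊗ m) = (-1)^|c| c ⊗ h m`. -/
structure Homotopy {M N : DGComod C} (f g : M ⟶ N) where
  h : M.carrier →ₗ[k] N.carrier
  mem : ∀ {n : ℤ} {x : M.carrier}, x ∈ M.gr n → h x ∈ N.gr (n - 1)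
  colin : ∀ x, N.coact.lin (h x) = TensorProduct.map C.sgn h (M.coact.lin x)
  eq : ∀ x, f.lin x - g.lin x = h (M.d x) + N.d (h x)

variable (C) in
/-- The homotopy relation on the morphisms of `Chain(C)`. -/
def homotopic : HomRel (DGComod C) := fun _ _ f g => Nonempty (Homotopy f g)

/-- The homotopy relation is an equivalence relation compatible with composition. -/
instance : Congruence (homotopic C) where
  equivalence :=
    { refl := fun f => ⟨⟨0, fun _ => by simp, fun x => by simp, fun x => by simp⟩⟩
      symm := by
        rintro f g ⟨h⟩
        refine ⟨⟨-h.h, fun hx => neg_mem (h.mem hx), fun x => ?_, fun x => ?_⟩⟩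
        · have : TensorProduct.map C.sgn (-h.h) = -TensorProduct.map C.sgn h.h :=
            TensorProduct.ext' fun a b => by simp [TensorProduct.tmul_neg]
          simp [this, h.colin]
        · rw [← neg_sub, h.eq]
          simp [add_comm]
      trans := by
        rintro f g e ⟨h⟩ ⟨h'⟩
        refine ⟨⟨h.h + h'.h, fun hx => add_mem (h.mem hx) (h'.mem hx), fun x => ?_, fun x => ?_⟩⟩
        · simp [TensorProduct.map_add_right, h.colin, h'.colin]
        · rw [← sub_add_sub_cancel _ (g.lin x), h.eq, h'.eq]
          simp only [LinearMap.add_apply, map_add]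
          abel }
  comp_left := by
    rintro M N P f g g' ⟨h⟩
    refine ⟨⟨h.h ∘ₗ f.lin, fun hx => h.mem (f.mem hx), fun x => ?_, fun x => ?_⟩⟩
    · simp only [LinearMap.comp_apply, h.colin, f.colin]
      rw [← LinearMap.comp_apply, ← TensorProduct.map_comp, LinearMap.comp_id]
    · simp only [LinearMap.comp_apply, f.comm]
      exact h.eq (f.lin x)
  comp_right := by
    rintro M N P f f' g ⟨h⟩
    refine ⟨⟨g.lin ∘ₗ h.h, fun hx => g.mem (h.mem hx), fun x => ?_, fun x => ?_⟩⟩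
    · simp only [LinearMap.comp_apply, h.colin, g.colin]
      rw [← LinearMap.comp_apply, ← TensorProduct.map_comp, LinearMap.id_comp]
    · simp only [LinearMap.comp_apply, ← g.comm, ← map_add, ← h.eq, map_sub]
      rfl

/-- A quasi-isomorphism: a morphism which induces an isomorphism in homology. -/
def IsQuasiIso {M N : DGComod C} (f : M ⟶ N) : Prop :=
  Function.Bijective f.homologyMap

/-- The extension `M ⊗ V` of a comodule `M` by a differential graded vector space `V`. -/
abbrev tensor (M : DGComod C) (V : DGVect k) : DGComod C where
  toDGVect := M.toDGVect.tensor V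
  coact := (DGVect.assocHom _ _ _).comp (M.coact.tensor (DGVect.Hom.id V))
  coact_coassoc := by
    have key : ∀ (t : C.carrier ⊗[k] M.carrier) (v : V),
        TensorProduct.map C.comul.lin LinearMap.id
          (TensorProduct.assoc k C.carrier M.carrier V (t ⊗ₜ v)) =
        TensorProduct.assoc k (C.carrier ⊗[k] C.carrier) M.carrier V
          (TensorProduct.map C.comul.lin LinearMap.id t ⊗ₜ v) := by
      intro t v
      induction t using TensorProduct.induction_on with
      | zero => simp
      | tmul c m => simp
      | add a b ha hb => simp only [TensorProduct.add_tmul, map_add, ha, hb]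
    have key2 : ∀ (t : C.carrier ⊗[k] M.carrier) (v : V),
        TensorProduct.map LinearMap.id ((TensorProduct.assoc k C.carrier M.carrier V).toLinearMap ∘ₗ
            TensorProduct.map M.coact.lin LinearMap.id)
          (TensorProduct.assoc k C.carrier M.carrier V (t ⊗ₜ v)) =
        TensorProduct.assoc k C.carrier C.carrier (M.carrier ⊗[k] V)
          (TensorProduct.assoc k (C.carrier ⊗[k] C.carrier) M.carrier V
            ((TensorProduct.assoc k C.carrier C.carrier M.carrier).symm
              (TensorProduct.map LinearMap.id M.coact.lin t) ⊗ₜ v)) := by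
      intro t v
      induction t using TensorProduct.induction_on with
      | zero => simp
      | add a b ha hb => simp only [TensorProduct.add_tmul, map_add, ha, hb]
      | tmul c m =>
        simp only [TensorProduct.assoc_tmul, TensorProduct.map_tmul, LinearMap.comp_apply,
          LinearMap.id_apply, LinearEquiv.coe_coe]
        induction M.coact.lin m using TensorProduct.induction_on with
        | zero => simp
        | add a b ha hb =>
          simp only [TensorProduct.add_tmul, TensorProduct.tmul_add, map_add, ha, hb]
        | tmul c' m' => simp
    intro x
    induction x using TensorProduct.induction_on with
    | zero => simp
    | add a b ha hb => simp only [map_add, ha, hb]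
    | tmul m v =>
      change TensorProduct.map C.comul.lin LinearMap.id
          (TensorProduct.assoc k C.carrier M.carrier V (M.coact.lin m ⊗ₜ v)) = _
      rw [key, M.coact_coassoc, LinearEquiv.eq_symm_apply]
      exact (key2 _ v).symm
  counit_coact := by
    have key : ∀ (t : C.carrier ⊗[k] M.carrier) (v : V),
        TensorProduct.lid k (M.carrier ⊗[k] V) (TensorProduct.map C.counit LinearMap.id
          (TensorProduct.assoc k C.carrier M.carrier V (t ⊗ₜ v))) =
        TensorProduct.lid k M.carrier (TensorProduct.map C.counit LinearMap.id t) ⊗ₜ v := by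
      intro t v
      induction t using TensorProduct.induction_on with
      | zero => simp
      | tmul c m => simp [TensorProduct.smul_tmul']
      | add a b ha hb => simp only [TensorProduct.add_tmul, map_add, ha, hb]
    intro x
    induction x using TensorProduct.induction_on with
    | zero => simp
    | add a b ha hb => simp only [map_add, ha, hb]
    | tmul m v =>
      refine (key (M.coact.lin m) v).trans ?_
      rw [M.counit_coact]

/-- The degree shift `M[n]`, with `M[n]ⱼ = M_{n+j}`. It is `M ⊗ k[n]`, so that neither the
differential nor the left coaction acquires a sign; `x ↦ (-1)^(n|x|) x` identifies it with the
version `k[n] ⊗ M` where both do. -/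
abbrev shift (M : DGComod C) (n : ℤ) : DGComod C where
  toDGVect := M.toDGVect.shift n
  coact :=
    { lin := M.coact.lin
      mem := fun {j x} hx => DGVect.tensorGr_le C.toDGVect M.toDGVect LinearMap.id (n + j)
        (DGVect.tensorGr C.toDGVect (M.toDGVect.shift n) j) (fun p q hpq c hc m hm =>
          DGVect.tmul_mem C.toDGVect (M.toDGVect.shift n) (p := p) (q := q - n) (by omega) hc
            (by simpa using hm)) (M.coact.mem hx)
      comm := M.coact.comm }
  coact_coassoc := M.coact_coassoc
  counit_coact := M.counit_coact

/-- The underlying complex of the cone of `f : M ⟶ N`: `Co(f)ₙ = M_{n+1} ⊕ Nₙ` with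
`d (m, n) = (-d m, f m + d n)`. -/
abbrev coneVect {M N : DGComod C} (f : M ⟶ N) : DGVect k where
  carrier := M.carrier × N.carrier
  gr n := (M.gr (n + 1)).prod (N.gr n)
  isInternal := by
    have hM := (DirectSum.isInternal_submodule_iff_iSupIndep_and_iSup_eq_top _).1 M.isInternal
    have hN := (DirectSum.isInternal_submodule_iff_iSupIndep_and_iSup_eq_top _).1 N.isInternal
    have hM1 : iSupIndep fun n => M.gr (n + 1) := hM.1.comp (add_left_injective 1)
    have hM2 : (⨆ n, M.gr (n + 1)) = ⊤ := by
      rw [← hM.2]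
      exact (Equiv.addRight (1 : ℤ)).iSup_comp (g := M.gr)
    refine DirectSum.isInternal_submodule_of_iSupIndep_of_iSup_eq_top ?_ ?_
    · rw [iSupIndep_def]
      intro i
      rw [Submodule.disjoint_def]
      rintro ⟨m, n⟩ ⟨hm, hn⟩ h
      have h1 : (⨆ (j : ℤ) (_ : j ≠ i), (M.gr (j + 1)).prod (N.gr j)) ≤
          (⨆ (j : ℤ) (_ : j ≠ i), M.gr (j + 1)).comap (LinearMap.fst k M.carrier N.carrier) :=
        iSup₂_le fun j hj x hx =>
          (le_iSup₂_of_le (f := fun j (_ : j ≠ i) => M.gr (j + 1)) j hj le_rfl) hx.1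
      have h2 : (⨆ (j : ℤ) (_ : j ≠ i), (M.gr (j + 1)).prod (N.gr j)) ≤
          (⨆ (j : ℤ) (_ : j ≠ i), N.gr j).comap (LinearMap.snd k M.carrier N.carrier) :=
        iSup₂_le fun j hj x hx =>
          (le_iSup₂_of_le (f := fun j (_ : j ≠ i) => N.gr j) j hj le_rfl) hx.2
      exact Prod.ext (Submodule.disjoint_def.1 (iSupIndep_def.1 hM1 i) m hm (h1 h))
        (Submodule.disjoint_def.1 (iSupIndep_def.1 hN.1 i) n hn (h2 h))
    · refine eq_top_iff.2 ?_
      rintro ⟨m, n⟩ -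
      have h1 : (⨆ j, M.gr (j + 1)) ≤ (⨆ j, (M.gr (j + 1)).prod (N.gr j)).comap
          (LinearMap.inl k M.carrier N.carrier) :=
        iSup_le fun j x hx =>
          (le_iSup (fun j => (M.gr (j + 1)).prod (N.gr j)) j) ⟨hx, zero_mem _⟩
      have h2 : (⨆ j, N.gr j) ≤ (⨆ j, (M.gr (j + 1)).prod (N.gr j)).comap
          (LinearMap.inr k M.carrier N.carrier) :=
        iSup_le fun j x hx =>
          (le_iSup (fun j => (M.gr (j + 1)).prod (N.gr j)) j) ⟨zero_mem _, hx⟩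
      have h3 : m ∈ ⨆ j, M.gr (j + 1) := by rw [hM2]; trivial
      have h4 : n ∈ ⨆ j, N.gr j := by rw [hN.2]; trivial
      have h5 := Submodule.mem_comap.1 (h1 h3)
      have h6 := Submodule.mem_comap.1 (h2 h4)
      simpa using add_mem h5 h6
  d := LinearMap.prod (-(M.d ∘ₗ LinearMap.fst k M.carrier N.carrier))
    (f.lin ∘ₗ LinearMap.fst k M.carrier N.carrier + N.d ∘ₗ LinearMap.snd k M.carrier N.carrier)
  d_mem := fun {n x} hx => ⟨neg_mem (M.d_mem hx.1), add_mem (f.mem hx.1) (N.d_mem hx.2)⟩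
  d_d := fun x => by simp [M.d_d, N.d_d, ← f.comm]

/-- The coaction on the cone: on `N` it is that of `N`, on the shifted copy of `M` it is that of
`M` with the Koszul sign `(-1)^|c|`. -/
def coneCoact (M N : DGComod C) :
    M.carrier × N.carrier →ₗ[k] C.carrier ⊗[k] (M.carrier × N.carrier) :=
  TensorProduct.map C.sgn (LinearMap.inl k _ _) ∘ₗ M.coact.lin ∘ₗ LinearMap.fst k _ _ +
    TensorProduct.map LinearMap.id (LinearMap.inr k _ _) ∘ₗ N.coact.lin ∘ₗ LinearMap.snd k _ _

/-- The coaction of the cone as a morphism of complexes. -/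
def coneCoactHom {M N : DGComod C} (f : M ⟶ N) :
    DGVect.Hom (coneVect f) (C.toDGVect.tensor (coneVect f)) where
  lin := coneCoact M N
  mem := fun {n x} hx => by
    refine add_mem ?_ ?_
    · refine DGVect.tensorGr_le C.toDGVect M.toDGVect
        (TensorProduct.map C.sgn (LinearMap.inl k M.carrier N.carrier)) (n + 1)
        (DGVect.tensorGr C.toDGVect (coneVect f) n) (fun p q hpq c hc m hm => ?_)
        (M.coact.mem hx.1)
      exact DGVect.tmul_mem C.toDGVect (coneVect f) (p := p) (q := q - 1) (by omega)
        (C.sgn_mem hc) ⟨by simpa using hm, zero_mem _⟩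
    · refine DGVect.tensorGr_le C.toDGVect N.toDGVect
        (TensorProduct.map LinearMap.id (LinearMap.inr k M.carrier N.carrier)) n
        (DGVect.tensorGr C.toDGVect (coneVect f) n) (fun p q hpq c hc m hm => ?_)
        (N.coact.mem hx.2)
      exact DGVect.tmul_mem C.toDGVect (coneVect f) (p := p) (q := q) hpq
        hc ⟨zero_mem _, hm⟩
  comm := by
    have h1 : ∀ t : C.carrier ⊗[k] M.carrier,
        (C.toDGVect.tensor (coneVect f)).d
          (TensorProduct.map C.sgn (LinearMap.inl k M.carrier N.carrier) t) =
        -TensorProduct.map C.sgn (LinearMap.inl k M.carrier N.carrier)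
          ((C.toDGVect.tensor M.toDGVect).d t) +
        TensorProduct.map LinearMap.id (LinearMap.inr k M.carrier N.carrier)
          (TensorProduct.map LinearMap.id f.lin t) := by
      intro t
      induction t using TensorProduct.induction_on with
      | zero => simp
      | add a b ha hb => simp only [map_add, ha, hb, neg_add]; abel
      | tmul c m =>
        have e : ((-M.d m, f.lin m) : M.carrier × N.carrier) =
          -LinearMap.inl k M.carrier N.carrier (M.d m) +
            LinearMap.inr k M.carrier N.carrier (f.lin m) := by simp
        rw [TensorProduct.map_tmul, DGVect.tensor_d_tmul, DGVect.tensor_d_tmul, map_add,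
          TensorProduct.map_tmul, TensorProduct.map_tmul, C.sgn_sgn, C.d_sgn]
        have e' : (coneVect f).d (LinearMap.inl k M.carrier N.carrier m) =
          (-M.d m, f.lin m) := by simp
        rw [e', e, TensorProduct.tmul_add, TensorProduct.tmul_neg, TensorProduct.neg_tmul]
        simp only [TensorProduct.map_tmul, LinearMap.id_apply]
        abel
    have h2 : ∀ t : C.carrier ⊗[k] N.carrier,
        (C.toDGVect.tensor (coneVect f)).d
          (TensorProduct.map LinearMap.id (LinearMap.inr k M.carrier N.carrier) t) =
        TensorProduct.map LinearMap.id (LinearMap.inr k M.carrier N.carrier)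
          ((C.toDGVect.tensor N.toDGVect).d t) := by
      intro t
      induction t using TensorProduct.induction_on with
      | zero => simp
      | add a b ha hb => simp only [map_add, ha, hb]
      | tmul c m => simp
    rintro ⟨m, n⟩
    have e1 := map_add (C.toDGVect.tensor (coneVect f)).d
      (TensorProduct.map C.sgn (LinearMap.inl k M.carrier N.carrier) (M.coact.lin m))
      (TensorProduct.map LinearMap.id (LinearMap.inr k M.carrier N.carrier) (N.coact.lin n))
    have e2 : TensorProduct.map C.sgn (LinearMap.inl k M.carrier N.carrier)
        (M.coact.lin (-M.d m)) = -TensorProduct.map C.sgn (LinearMap.inl k M.carrier N.carrier)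
          ((C.toDGVect.tensor M.toDGVect).d (M.coact.lin m)) := by
      rw [map_neg, map_neg, M.coact.comm]
    have e3 : TensorProduct.map LinearMap.id (LinearMap.inr k M.carrier N.carrier)
        (N.coact.lin (f.lin m + N.d n)) =
        TensorProduct.map LinearMap.id (LinearMap.inr k M.carrier N.carrier)
          (TensorProduct.map LinearMap.id f.lin (M.coact.lin m)) +
        TensorProduct.map LinearMap.id (LinearMap.inr k M.carrier N.carrier)
          ((C.toDGVect.tensor N.toDGVect).d (N.coact.lin n)) := by
      rw [map_add, map_add, f.colin, N.coact.comm]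
    refine Eq.trans (congrArg₂ (· + ·) e2 e3) (Eq.trans ?_ e1.symm)
    rw [h1, h2, add_assoc]

lemma cone_coassoc (M N : DGComod C) (x : M.carrier × N.carrier) :
    TensorProduct.map C.comul.lin LinearMap.id (coneCoact M N x) =
      (TensorProduct.assoc k C.carrier C.carrier (M.carrier × N.carrier)).symm
        (TensorProduct.map LinearMap.id (coneCoact M N) (coneCoact M N x)) := by
  have h1 : ∀ t : C.carrier ⊗[k] M.carrier,
      TensorProduct.map C.comul.lin LinearMap.id
        (TensorProduct.map C.sgn (LinearMap.inl k M.carrier N.carrier) t) =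
      TensorProduct.map (TensorProduct.map C.sgn C.sgn) (LinearMap.inl k M.carrier N.carrier)
        (TensorProduct.map C.comul.lin LinearMap.id t) := by
    intro t
    induction t using TensorProduct.induction_on with
    | zero => simp
    | add a b ha hb => simp only [map_add, ha, hb]
    | tmul c m =>
      have : (C.toDGVect.tensor C.toDGVect).sgn = TensorProduct.map C.sgn C.sgn :=
        TensorProduct.ext' fun x y => DGVect.tensor_sgn_tmul _ _ x y
      simp [C.comul.sgn, this]
  have h2 : ∀ t : C.carrier ⊗[k] M.carrier,
      TensorProduct.assoc k C.carrier C.carrier _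
        (TensorProduct.map (TensorProduct.map C.sgn C.sgn) (LinearMap.inl k M.carrier N.carrier)
        ((TensorProduct.assoc k C.carrier C.carrier M.carrier).symm
          (TensorProduct.map LinearMap.id M.coact.lin t))) =
      TensorProduct.map LinearMap.id (coneCoact M N)
        (TensorProduct.map C.sgn (LinearMap.inl k M.carrier N.carrier) t) := by
    intro t
    induction t using TensorProduct.induction_on with
    | zero => simp
    | add a b ha hb => simp only [map_add, ha, hb]
    | tmul c m =>
      simp only [TensorProduct.map_tmul, LinearMap.id_apply, coneCoact, LinearMap.add_apply,
        LinearMap.comp_apply, LinearMap.fst_apply, LinearMap.snd_apply, LinearMap.inl_apply,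
        map_zero, add_zero]
      induction M.coact.lin m using TensorProduct.induction_on with
      | zero => simp
      | add a b ha hb => simp only [TensorProduct.tmul_add, map_add, ha, hb]
      | tmul c' m' => simp
  have h3 : ∀ t : C.carrier ⊗[k] N.carrier,
      TensorProduct.map C.comul.lin LinearMap.id
        (TensorProduct.map LinearMap.id (LinearMap.inr k M.carrier N.carrier) t) =
      TensorProduct.map LinearMap.id (LinearMap.inr k M.carrier N.carrier)
        (TensorProduct.map C.comul.lin LinearMap.id t) := by
    intro t
    induction t using TensorProduct.induction_on with
    | zero => simp
    | add a b ha hb => simp only [map_add, ha, hb]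
    | tmul c m => simp
  have h4 : ∀ t : C.carrier ⊗[k] N.carrier,
      TensorProduct.assoc k C.carrier C.carrier _
        (TensorProduct.map LinearMap.id (LinearMap.inr k M.carrier N.carrier)
        ((TensorProduct.assoc k C.carrier C.carrier N.carrier).symm
          (TensorProduct.map LinearMap.id N.coact.lin t))) =
      TensorProduct.map LinearMap.id (coneCoact M N)
        (TensorProduct.map LinearMap.id (LinearMap.inr k M.carrier N.carrier) t) := by
    intro t
    induction t using TensorProduct.induction_on with
    | zero => simp
    | add a b ha hb => simp only [map_add, ha, hb]
    | tmul c m =>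
      simp only [TensorProduct.map_tmul, LinearMap.id_apply, coneCoact, LinearMap.add_apply,
        LinearMap.comp_apply, LinearMap.fst_apply, LinearMap.snd_apply, LinearMap.inr_apply,
        map_zero, zero_add]
      induction N.coact.lin m using TensorProduct.induction_on with
      | zero => simp
      | add a b ha hb => simp only [TensorProduct.tmul_add, map_add, ha, hb]
      | tmul c' m' => simp
  obtain ⟨m, n⟩ := x
  have e1 : coneCoact M N (m, n) =
    TensorProduct.map C.sgn (LinearMap.inl k M.carrier N.carrier) (M.coact.lin m) +
    TensorProduct.map LinearMap.id (LinearMap.inr k M.carrier N.carrier)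
      (N.coact.lin n) := rfl
  rw [LinearEquiv.eq_symm_apply, e1, map_add, map_add, map_add, h1, h3, M.coact_coassoc,
    N.coact_coassoc, h2, h4]

lemma cone_counit (M N : DGComod C) (x : M.carrier × N.carrier) :
    TensorProduct.lid k (M.carrier × N.carrier)
      (TensorProduct.map C.counit LinearMap.id (coneCoact M N x)) = x := by
  have h1 : ∀ t : C.carrier ⊗[k] M.carrier,
      TensorProduct.lid k _ (TensorProduct.map C.counit LinearMap.id
        (TensorProduct.map C.sgn (LinearMap.inl k M.carrier N.carrier) t)) =
      LinearMap.inl k M.carrier N.carrier (TensorProduct.lid k _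
        (TensorProduct.map C.counit LinearMap.id t)) := by
    intro t
    induction t using TensorProduct.induction_on with
    | zero => simp only [map_zero]
    | add a b ha hb => simp only [map_add, ha, hb]
    | tmul c m => simp [C.counit_sgn]
  have h2 : ∀ t : C.carrier ⊗[k] N.carrier,
      TensorProduct.lid k _ (TensorProduct.map C.counit LinearMap.id
        (TensorProduct.map LinearMap.id (LinearMap.inr k M.carrier N.carrier) t)) =
      LinearMap.inr k M.carrier N.carrier (TensorProduct.lid k _
        (TensorProduct.map C.counit LinearMap.id t)) := by
    intro t
    induction t using TensorProduct.induction_on with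
    | zero => simp only [map_zero]
    | add a b ha hb => simp only [map_add, ha, hb]
    | tmul c m => simp
  obtain ⟨m, n⟩ := x
  have e1 : coneCoact M N (m, n) =
    TensorProduct.map C.sgn (LinearMap.inl k M.carrier N.carrier) (M.coact.lin m) +
    TensorProduct.map LinearMap.id (LinearMap.inr k M.carrier N.carrier)
      (N.coact.lin n) := rfl
  rw [e1, map_add, map_add, h1, h2, M.counit_coact, N.counit_coact]
  simp

/-- The cone of a morphism of differential graded comodules. -/
abbrev cone {M N : DGComod C} (f : M ⟶ N) : DGComod C where
  toDGVect := coneVect f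
  coact := coneCoactHom f
  coact_coassoc := cone_coassoc M N
  counit_coact := cone_counit M N

/-! ### Kernels and cotensor products -/

lemma map_id_injective (W : DGVect k) {V V' : DGVect k} (f : DGVect.Hom V V')
    (hf : Function.Injective f.lin) :
    Function.Injective (TensorProduct.map (LinearMap.id : W →ₗ[k] W) f.lin) :=
  Module.Flat.lTensor_preserves_injective_linearMap (M := W.carrier) f.lin hf

lemma exists_lift_ker {V W : DGVect k} (φ : DGVect.Hom V W) (E : DGVect k)
    {t : E ⊗[k] V} (ht : TensorProduct.map (LinearMap.id : E →ₗ[k] E) φ.lin t = 0) :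
    t ∈ LinearMap.range (TensorProduct.map (LinearMap.id : E →ₗ[k] E) (DGVect.kerι φ).lin) := by
  have h := Module.Flat.ker_lTensor_eq (R := k) k E.carrier φ.lin
  have ht' : t ∈ LinearMap.ker (TensorProduct.AlgebraTensorModule.lTensor k E.carrier φ.lin) := ht
  rw [h] at ht'
  exact ht'

/-- The coaction induced on the kernel of a map `φ` out of a comodule `N`, where the coaction
of `N` maps `ker φ` into `ker (1 ⊗ φ) = C ⊗ ker φ`. -/
def kerCoactLin (N : DGComod C) {W : DGVect k} (φ : DGVect.Hom N.toDGVect W)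
    (h : ∀ z, φ.lin z = 0 →
      TensorProduct.map (LinearMap.id : C.carrier →ₗ[k] C.carrier) φ.lin (N.coact.lin z) = 0) :
    DGVect.ker φ →ₗ[k] C.carrier ⊗[k] (DGVect.ker φ).carrier :=
  (LinearEquiv.ofInjective _
      (map_id_injective C.toDGVect (DGVect.kerι φ) (DGVect.kerι_injective φ))).symm.toLinearMap ∘ₗ
    (N.coact.lin ∘ₗ (DGVect.kerι φ).lin).codRestrict _
      (fun z => exists_lift_ker φ C.toDGVect (h z.1 z.2))

lemma kerCoactLin_spec (N : DGComod C) {W : DGVect k} (φ : DGVect.Hom N.toDGVect W)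
    (h : ∀ z, φ.lin z = 0 →
      TensorProduct.map (LinearMap.id : C.carrier →ₗ[k] C.carrier) φ.lin (N.coact.lin z) = 0)
    (z : DGVect.ker φ) :
    TensorProduct.map (LinearMap.id : C.carrier →ₗ[k] C.carrier) (DGVect.kerι φ).lin
      (kerCoactLin N φ h z) = N.coact.lin ((DGVect.kerι φ).lin z) := by
  have := LinearEquiv.apply_symm_apply (LinearEquiv.ofInjective _
      (map_id_injective C.toDGVect (DGVect.kerι φ) (DGVect.kerι_injective φ)))
    ((N.coact.lin ∘ₗ (DGVect.kerι φ).lin).codRestrict _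
      (fun z => exists_lift_ker φ C.toDGVect (h z.1 z.2)) z)
  exact congrArg Subtype.val this

/-- The kernel of `φ` as a subcomodule of `N`. -/
abbrev ker (N : DGComod C) {W : DGVect k} (φ : DGVect.Hom N.toDGVect W)
    (h : ∀ z, φ.lin z = 0 →
      TensorProduct.map (LinearMap.id : C.carrier →ₗ[k] C.carrier) φ.lin (N.coact.lin z) = 0) :
    DGComod C where
  toDGVect := DGVect.ker φ
  coact :=
    { lin := kerCoactLin N φ h
      mem := fun {n z} hz => by
        refine ((DGVect.Hom.id C.toDGVect).tensor (DGVect.kerι φ)).mem_of_injective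
          (map_id_injective _ _ (DGVect.kerι_injective φ)) ?_
        have := kerCoactLin_spec N φ h z
        exact this ▸ N.coact.mem hz
      comm := fun z => by
        apply map_id_injective C.toDGVect (DGVect.kerι φ) (DGVect.kerι_injective φ)
        have := ((DGVect.Hom.id C.toDGVect).tensor (DGVect.kerι φ)).comm (kerCoactLin N φ h z)
        refine (kerCoactLin_spec N φ h _).trans (Eq.trans ?_ this.symm)
        have h2 := kerCoactLin_spec N φ h z
        rw [(DGVect.kerι φ).comm, N.coact.comm, ← h2]
        rfl }
  coact_coassoc := by
    intro z
    apply map_id_injective (C.toDGVect.tensor C.toDGVect) (DGVect.kerι φ)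
      (DGVect.kerι_injective φ)
    have h1 : ∀ t : C.carrier ⊗[k] (DGVect.ker φ).carrier,
        TensorProduct.map LinearMap.id (DGVect.kerι φ).lin
          (TensorProduct.map C.comul.lin LinearMap.id t) =
        TensorProduct.map C.comul.lin LinearMap.id
          (TensorProduct.map LinearMap.id (DGVect.kerι φ).lin t) := by
      intro t
      induction t using TensorProduct.induction_on with
      | zero => simp
      | add a b ha hb => simp only [map_add, ha, hb]
      | tmul c m => simp
    have h2 : ∀ t : C.carrier ⊗[k] (C.carrier ⊗[k] (DGVect.ker φ).carrier),
        TensorProduct.map LinearMap.id (DGVect.kerι φ).lin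
          ((TensorProduct.assoc k C.carrier C.carrier (DGVect.ker φ).carrier).symm t) =
        (TensorProduct.assoc k C.carrier C.carrier N.carrier).symm
          (TensorProduct.map LinearMap.id
            (TensorProduct.map LinearMap.id (DGVect.kerι φ).lin) t) := by
      intro t
      induction t using TensorProduct.induction_on with
      | zero => simp
      | add a b ha hb => simp only [map_add, ha, hb]
      | tmul c t =>
        induction t using TensorProduct.induction_on with
        | zero => simp
        | add a b ha hb => simp only [TensorProduct.tmul_add, map_add, ha, hb]
        | tmul c' m => simp
    have h3 : ∀ t : C.carrier ⊗[k] (DGVect.ker φ).carrier,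
        TensorProduct.map LinearMap.id (TensorProduct.map LinearMap.id (DGVect.kerι φ).lin)
          (TensorProduct.map LinearMap.id (kerCoactLin N φ h) t) =
        TensorProduct.map LinearMap.id N.coact.lin
          (TensorProduct.map LinearMap.id (DGVect.kerι φ).lin t) := by
      intro t
      induction t using TensorProduct.induction_on with
      | zero => simp
      | add a b ha hb => simp only [map_add, ha, hb]
      | tmul c m =>
        simp only [TensorProduct.map_tmul, LinearMap.id_apply]
        rw [kerCoactLin_spec]
    refine (h1 _).trans (Eq.trans ?_ (h2 _).symm)
    rw [h3, kerCoactLin_spec, N.coact_coassoc]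
  counit_coact := by
    intro z
    apply DGVect.kerι_injective φ
    have h1 : ∀ t : C.carrier ⊗[k] (DGVect.ker φ).carrier,
        (DGVect.kerι φ).lin (TensorProduct.lid k _
          (TensorProduct.map C.counit LinearMap.id t)) =
        TensorProduct.lid k _ (TensorProduct.map C.counit LinearMap.id
          (TensorProduct.map LinearMap.id (DGVect.kerι φ).lin t)) := by
      intro t
      induction t using TensorProduct.induction_on with
      | zero => simp
      | add a b ha hb => simp only [map_add, ha, hb]
      | tmul c m => simp
    refine (h1 _).trans ?_
    rw [kerCoactLin_spec, N.counit_coact]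

end DGComod

namespace DGBicomod


variable {C D : DGCoalg k}

/-- The map `ρ_X ⊗ 1 - 1 ⊗ ρ_M : X ⊗ M ⟶ X ⊗ C ⊗ M`. -/
def cotensorDiff (X : DGBicomod D C) (M : DGComod C) :
    DGVect.Hom (X.toDGVect.tensor M.toDGVect)
      ((X.toDGVect.tensor C.toDGVect).tensor M.toDGVect) :=
  (X.coactR.tensor (DGVect.Hom.id M.toDGVect)).sub
    ((DGVect.assocInv X.toDGVect C.toDGVect M.toDGVect).comp
      ((DGVect.Hom.id X.toDGVect).tensor M.coact))

lemma cotensorDiff_apply (X : DGBicomod D C) (M : DGComod C) (t : X.carrier ⊗[k] M.carrier) :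
    (X.cotensorDiff M).lin t = TensorProduct.map X.coactR.lin LinearMap.id t -
      (TensorProduct.assoc k X.carrier C.carrier M.carrier).symm
        (TensorProduct.map LinearMap.id M.coact.lin t) := rfl

lemma cotensor_aux (X : DGBicomod D C) (M : DGComod C) (z : X.carrier ⊗[k] M.carrier) :
    TensorProduct.map (LinearMap.id : D.carrier →ₗ[k] D.carrier) (X.cotensorDiff M).lin
      ((X.toDGComod.tensor M.toDGVect).coact.lin z) =
    TensorProduct.assoc k D.carrier (X.carrier ⊗[k] C.carrier) M.carrier
      (TensorProduct.map (TensorProduct.assoc k D.carrier X.carrier C.carrier).toLinearMap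
        LinearMap.id (TensorProduct.map (TensorProduct.map X.coact.lin LinearMap.id)
          LinearMap.id ((X.cotensorDiff M).lin z))) := by
  have h0 : TensorProduct.map (LinearMap.id : D.carrier →ₗ[k] D.carrier) (X.cotensorDiff M).lin =
      TensorProduct.map LinearMap.id (TensorProduct.map X.coactR.lin LinearMap.id) -
      TensorProduct.map LinearMap.id
        ((TensorProduct.assoc k X.carrier C.carrier M.carrier).symm.toLinearMap ∘ₗ
          TensorProduct.map LinearMap.id M.coact.lin) := by
    refine TensorProduct.ext' fun c t => ?_
    rw [LinearMap.sub_apply, TensorProduct.map_tmul, TensorProduct.map_tmul,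
      TensorProduct.map_tmul, ← TensorProduct.tmul_sub]
    rfl
  have h1 : ∀ (t : D.carrier ⊗[k] X.carrier) (m : M.carrier),
      TensorProduct.map LinearMap.id (TensorProduct.map X.coactR.lin LinearMap.id)
        (TensorProduct.assoc k D.carrier X.carrier M.carrier (t ⊗ₜ m)) =
      TensorProduct.assoc k D.carrier (X.carrier ⊗[k] C.carrier) M.carrier
        (TensorProduct.map LinearMap.id X.coactR.lin t ⊗ₜ m) := by
    intro t m
    induction t using TensorProduct.induction_on with
    | zero => simp
    | add a b ha hb => simp only [TensorProduct.add_tmul, map_add, ha, hb]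
    | tmul d x => simp
  have h2 : ∀ (t : D.carrier ⊗[k] X.carrier) (s : C.carrier ⊗[k] M.carrier),
      TensorProduct.map LinearMap.id
        (TensorProduct.assoc k X.carrier C.carrier M.carrier).symm.toLinearMap
        (TensorProduct.assoc k D.carrier X.carrier (C.carrier ⊗[k] M.carrier) (t ⊗ₜ s)) =
      TensorProduct.assoc k D.carrier (X.carrier ⊗[k] C.carrier) M.carrier
        (TensorProduct.map (TensorProduct.assoc k D.carrier X.carrier C.carrier).toLinearMap
          LinearMap.id
          ((TensorProduct.assoc k (D.carrier ⊗[k] X.carrier) C.carrier M.carrier).symm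
            (t ⊗ₜ s))) := by
    intro t s
    induction t using TensorProduct.induction_on with
    | zero => simp
    | add a b ha hb => simp only [TensorProduct.add_tmul, map_add, ha, hb]
    | tmul d x =>
      induction s using TensorProduct.induction_on with
      | zero => simp
      | add a b ha hb => simp only [TensorProduct.tmul_add, map_add, ha, hb]
      | tmul c m => simp
  have h3 : ∀ (t : D.carrier ⊗[k] X.carrier) (m : M.carrier),
      TensorProduct.map LinearMap.id
        ((TensorProduct.assoc k X.carrier C.carrier M.carrier).symm.toLinearMap ∘ₗ
          TensorProduct.map LinearMap.id M.coact.lin)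
        (TensorProduct.assoc k D.carrier X.carrier M.carrier (t ⊗ₜ m)) =
      TensorProduct.map LinearMap.id
        (TensorProduct.assoc k X.carrier C.carrier M.carrier).symm.toLinearMap
        (TensorProduct.assoc k D.carrier X.carrier (C.carrier ⊗[k] M.carrier)
          (t ⊗ₜ M.coact.lin m)) := by
    intro t m
    induction t using TensorProduct.induction_on with
    | zero => simp
    | add a b ha hb => simp only [TensorProduct.add_tmul, map_add, ha, hb]
    | tmul d x => simp
  have h4 : ∀ (x : X.carrier) (s : C.carrier ⊗[k] M.carrier),
      (TensorProduct.assoc k (D.carrier ⊗[k] X.carrier) C.carrier M.carrier).symm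
        (X.coact.lin x ⊗ₜ s) =
      TensorProduct.map (TensorProduct.map X.coact.lin LinearMap.id) LinearMap.id
        ((TensorProduct.assoc k X.carrier C.carrier M.carrier).symm (x ⊗ₜ s)) := by
    intro x s
    induction s using TensorProduct.induction_on with
    | zero => simp
    | add a b ha hb => simp only [TensorProduct.tmul_add, map_add, ha, hb]
    | tmul c m => simp
  induction z using TensorProduct.induction_on with
  | zero => simp only [map_zero]
  | add a b ha hb => simp only [map_add, ha, hb]
  | tmul x m =>
    have e : (X.toDGComod.tensor M.toDGVect).coact.lin (x ⊗ₜ m) =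
      TensorProduct.assoc k D.carrier X.carrier M.carrier (X.coact.lin x ⊗ₜ m) := rfl
    rw [e, h0, LinearMap.sub_apply, h1, h3, h2, h4, cotensorDiff_apply, map_sub, map_sub, map_sub]
    congr 2
    simp only [TensorProduct.map_tmul, LinearMap.id_apply, X.coact_coactR, LinearEquiv.coe_coe,
      LinearEquiv.apply_symm_apply]

lemma cotensorDiff_stable (X : DGBicomod D C) (M : DGComod C) (z : X.carrier ⊗[k] M.carrier)
    (hz : (X.cotensorDiff M).lin z = 0) :
    TensorProduct.map (LinearMap.id : D.carrier →ₗ[k] D.carrier) (X.cotensorDiff M).lin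
      ((X.toDGComod.tensor M.toDGVect).coact.lin z) = 0 := by
  rw [cotensor_aux, hz]
  simp only [map_zero]

/-- The cotensor product `X □_C M`, the kernel of `ρ_X ⊗ 1 - 1 ⊗ ρ_M`, with the left
`D`-coaction coming from `X`. -/
def cotensor (X : DGBicomod D C) (M : DGComod C) : DGComod D :=
  (X.toDGComod.tensor M.toDGVect).ker (X.cotensorDiff M) (X.cotensorDiff_stable M)

/-- The inclusion `X □_C M ⊆ X ⊗ M`. -/
def cotensorι (X : DGBicomod D C) (M : DGComod C) :
    DGVect.Hom (X.cotensor M).toDGVect (X.toDGVect.tensor M.toDGVect) :=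
  DGVect.kerι (X.cotensorDiff M)

lemma cotensorι_injective (X : DGBicomod D C) (M : DGComod C) :
    Function.Injective (X.cotensorι M).lin := Subtype.val_injective

lemma cotensorι_mem (X : DGBicomod D C) (M : DGComod C) (z : (X.cotensor M).carrier) :
    (X.cotensorDiff M).lin ((X.cotensorι M).lin z) = 0 := z.2

lemma cotensor_coact (X : DGBicomod D C) (M : DGComod C) (z : (X.cotensor M).carrier) :
    TensorProduct.map (LinearMap.id : D.carrier →ₗ[k] D.carrier) (X.cotensorι M).lin
      ((X.cotensor M).coact.lin z) =
    TensorProduct.assoc k D.carrier X.carrier M.carrier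
      (TensorProduct.map X.coact.lin LinearMap.id ((X.cotensorι M).lin z)) :=
  DGComod.kerCoactLin_spec _ _ (X.cotensorDiff_stable M) z

/-- Corestriction of a linear map to the cotensor product. -/
def cotensorLift (X : DGBicomod D C) (M : DGComod C) {P : Type u} [AddCommGroup P] [Module k P]
    (f : P →ₗ[k] X.carrier ⊗[k] M.carrier) (hf : ∀ p, (X.cotensorDiff M).lin (f p) = 0) :
    P →ₗ[k] (X.cotensor M).carrier :=
  f.codRestrict (LinearMap.ker (X.cotensorDiff M).lin) hf

lemma cotensorι_lift (X : DGBicomod D C) (M : DGComod C) {P : Type u} [AddCommGroup P] [Module k P]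
    (f : P →ₗ[k] X.carrier ⊗[k] M.carrier) (hf : ∀ p, (X.cotensorDiff M).lin (f p) = 0) (p : P) :
    (X.cotensorι M).lin (X.cotensorLift M f hf p) = f p := rfl

/-- A map `g : X ⊗ M → X ⊗ N` which is compatible with the defining maps restricts to
the cotensor products. -/
lemma cotensorDiff_map (X : DGBicomod D C) {M N : DGComod C}
    (a : X.carrier →ₗ[k] X.carrier) (b : C.carrier →ₗ[k] C.carrier)
    (g : M.carrier →ₗ[k] N.carrier)
    (ha : ∀ x, X.coactR.lin (a x) = TensorProduct.map a b (X.coactR.lin x))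
    (hg : ∀ m, N.coact.lin (g m) = TensorProduct.map b g (M.coact.lin m))
    (z : X.carrier ⊗[k] M.carrier) :
    (X.cotensorDiff N).lin (TensorProduct.map a g z) =
      TensorProduct.map (TensorProduct.map a b) g ((X.cotensorDiff M).lin z) := by
  have h1 : ∀ (x : X.carrier) (s : C.carrier ⊗[k] M.carrier),
      (TensorProduct.assoc k X.carrier C.carrier N.carrier).symm
        (a x ⊗ₜ TensorProduct.map b g s) =
      TensorProduct.map (TensorProduct.map a b) g
        ((TensorProduct.assoc k X.carrier C.carrier M.carrier).symm (x ⊗ₜ s)) := by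
    intro x s
    induction s using TensorProduct.induction_on with
    | zero => simp
    | add a b ha hb => simp only [TensorProduct.tmul_add, map_add, ha, hb]
    | tmul c m => simp
  induction z using TensorProduct.induction_on with
  | zero => simp only [map_zero]
  | add a b ha hb => simp only [map_add, ha, hb]
  | tmul x m =>
    rw [cotensorDiff_apply, cotensorDiff_apply, map_sub]
    simp only [TensorProduct.map_tmul, LinearMap.id_apply, ha, hg, h1]

/-- The restriction of `a ⊗ g` to the cotensor products. -/
def cotensorMapLin (X : DGBicomod D C) {M N : DGComod C}
    (a : X.carrier →ₗ[k] X.carrier) (b : C.carrier →ₗ[k] C.carrier)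
    (g : M.carrier →ₗ[k] N.carrier)
    (ha : ∀ x, X.coactR.lin (a x) = TensorProduct.map a b (X.coactR.lin x))
    (hg : ∀ m, N.coact.lin (g m) = TensorProduct.map b g (M.coact.lin m)) :
    (X.cotensor M).carrier →ₗ[k] (X.cotensor N).carrier :=
  X.cotensorLift N (TensorProduct.map a g ∘ₗ (X.cotensorι M).lin) fun z => by
    rw [LinearMap.comp_apply, cotensorDiff_map X a b g ha hg, cotensorι_mem, map_zero]

lemma cotensorMapLin_colin (X : DGBicomod D C) {M N : DGComod C}
    (a : X.carrier →ₗ[k] X.carrier) (b : C.carrier →ₗ[k] C.carrier)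
    (g : M.carrier →ₗ[k] N.carrier)
    (ha : ∀ x, X.coactR.lin (a x) = TensorProduct.map a b (X.coactR.lin x))
    (hg : ∀ m, N.coact.lin (g m) = TensorProduct.map b g (M.coact.lin m))
    (e : D.carrier →ₗ[k] D.carrier)
    (he : ∀ x, X.coact.lin (a x) = TensorProduct.map e a (X.coact.lin x))
    (z : (X.cotensor M).carrier) :
    (X.cotensor N).coact.lin (X.cotensorMapLin a b g ha hg z) =
      TensorProduct.map e (X.cotensorMapLin a b g ha hg) ((X.cotensor M).coact.lin z) := by
  apply DGComod.map_id_injective D.toDGVect (X.cotensorι N) (X.cotensorι_injective N)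
  have h1 : ∀ t : D.carrier ⊗[k] (X.cotensor M).carrier,
      TensorProduct.map LinearMap.id (X.cotensorι N).lin
        (TensorProduct.map e (X.cotensorMapLin a b g ha hg) t) =
      TensorProduct.map e (TensorProduct.map a g)
        (TensorProduct.map LinearMap.id (X.cotensorι M).lin t) := by
    intro t
    rw [← LinearMap.comp_apply, ← LinearMap.comp_apply, ← TensorProduct.map_comp,
      ← TensorProduct.map_comp]
    rfl
  have h3 : ∀ (t : D.carrier ⊗[k] X.carrier) (m : M.carrier),
      TensorProduct.assoc k D.carrier X.carrier N.carrier (TensorProduct.map e a t ⊗ₜ g m) =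
      TensorProduct.map e (TensorProduct.map a g)
        (TensorProduct.assoc k D.carrier X.carrier M.carrier (t ⊗ₜ m)) := by
    intro t m
    induction t using TensorProduct.induction_on with
    | zero => simp
    | add a b ha hb => simp only [TensorProduct.add_tmul, map_add, ha, hb]
    | tmul d x => simp
  have h2 : ∀ t : X.carrier ⊗[k] M.carrier,
      TensorProduct.assoc k D.carrier X.carrier N.carrier
        (TensorProduct.map X.coact.lin LinearMap.id (TensorProduct.map a g t)) =
      TensorProduct.map e (TensorProduct.map a g)
        (TensorProduct.assoc k D.carrier X.carrier M.carrier
          (TensorProduct.map X.coact.lin LinearMap.id t)) := by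
    intro t
    induction t using TensorProduct.induction_on with
    | zero => simp only [map_zero]
    | add a b ha hb => simp only [map_add, ha, hb]
    | tmul x m =>
      simp only [TensorProduct.map_tmul, LinearMap.id_apply]
      rw [← h3, ← he]
  rw [h1, cotensor_coact, cotensor_coact, ← h2, cotensorMapLin, cotensorι_lift,
    LinearMap.comp_apply]

/-- The functor `X □_C - : Chain(C) ⥤ Chain(D)`. -/
def cotensorFunctor (X : DGBicomod D C) : DGComod C ⥤ DGComod D where
  obj M := X.cotensor M
  map {M N} f :=
    { lin := X.cotensorMapLin LinearMap.id LinearMap.id f.lin (fun x => by simp) f.colin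
      mem := fun {n z} hz =>
        ((DGVect.Hom.id X.toDGVect).tensor f.toHom).mem (x := z.1) hz
      comm := fun z => Subtype.ext (((DGVect.Hom.id X.toDGVect).tensor f.toHom).comm z.1)
      colin := X.cotensorMapLin_colin _ _ _ _ _ LinearMap.id (fun x => by simp) }
  map_id M := by
    refine DGComod.hom_ext (LinearMap.ext fun z => Subtype.ext ?_)
    change TensorProduct.map LinearMap.id LinearMap.id z.1 = z.1
    simp
  map_comp {M N P} f g := by
    refine DGComod.hom_ext (LinearMap.ext fun z => Subtype.ext ?_)
    change TensorProduct.map LinearMap.id (g.lin ∘ₗ f.lin) z.1 =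
      TensorProduct.map LinearMap.id g.lin (TensorProduct.map LinearMap.id f.lin z.1)
    rw [← LinearMap.comp_apply, ← TensorProduct.map_comp, LinearMap.comp_id]

/-- `X □_C -` preserves homotopies. -/
lemma cotensorFunctor_homotopic (X : DGBicomod D C) {M N : DGComod C} (f g : M ⟶ N)
    (H : DGComod.homotopic C f g) :
    DGComod.homotopic D (X.cotensorFunctor.map f) (X.cotensorFunctor.map g) := by
  obtain ⟨H⟩ := H
  have hC : (X.toDGVect.tensor C.toDGVect).sgn = TensorProduct.map X.sgn C.sgn :=
    TensorProduct.ext' fun x y => DGVect.tensor_sgn_tmul _ _ x y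
  have hD : (D.toDGVect.tensor X.toDGVect).sgn = TensorProduct.map D.sgn X.sgn :=
    TensorProduct.ext' fun x y => DGVect.tensor_sgn_tmul _ _ x y
  refine ⟨⟨X.cotensorMapLin X.sgn C.sgn H.h (fun x => by rw [X.coactR.sgn, hC]) H.colin, ?_, ?_, ?_⟩⟩
  · intro n z hz
    refine DGVect.tensorGr_le X.toDGVect M.toDGVect (TensorProduct.map X.sgn H.h) n
      (DGVect.tensorGr X.toDGVect N.toDGVect (n - 1)) (fun p q hpq x hx y hy => ?_) hz
    exact DGVect.tmul_mem _ _ (q := q - 1) (by omega) (X.sgn_mem hx) (H.mem hy)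
  · exact X.cotensorMapLin_colin _ _ _ _ _ D.sgn (fun x => by rw [X.coact.sgn, hD])
  · have key : ∀ t : X.carrier ⊗[k] M.carrier,
        TensorProduct.map LinearMap.id f.lin t - TensorProduct.map LinearMap.id g.lin t =
        TensorProduct.map X.sgn H.h ((X.toDGVect.tensor M.toDGVect).d t) +
        (X.toDGVect.tensor N.toDGVect).d (TensorProduct.map X.sgn H.h t) := by
      intro t
      induction t using TensorProduct.induction_on with
      | zero => simp only [map_zero, sub_zero, add_zero]
      | add a b ha hb =>
        simp only [map_add]
        rw [add_sub_add_comm, ha, hb]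
        abel
      | tmul x m =>
        rw [TensorProduct.map_tmul, TensorProduct.map_tmul, TensorProduct.map_tmul,
          DGVect.tensor_d_tmul, DGVect.tensor_d_tmul, map_add, TensorProduct.map_tmul,
          TensorProduct.map_tmul, X.sgn_sgn, X.d_sgn, ← TensorProduct.tmul_sub, H.eq,
          TensorProduct.tmul_add, TensorProduct.neg_tmul]
        simp only [LinearMap.id_apply]
        abel
    intro z
    exact Subtype.ext (key z.1)

lemma BoundedBelow.cotensor {X : DGBicomod D C} {M : DGComod C} (hX : X.BoundedBelow)
    (hM : M.BoundedBelow) : (X.cotensor M).BoundedBelow :=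
  DGVect.BoundedBelow.ker _ (hX.tensor hM)

lemma toCotensor_aux (X : DGBicomod D C) {P : Type u} [AddCommGroup P] [Module k P]
    (i : P →ₗ[k] X.carrier ⊗[k] C.carrier) (l : X.carrier →ₗ[k] P)
    (h : ∀ x, i (l x) = X.coactR.lin x) (x : X.carrier) :
    TensorProduct.assoc k D.carrier X.carrier C.carrier
      (TensorProduct.map X.coact.lin LinearMap.id (X.coactR.lin x)) =
    TensorProduct.map LinearMap.id i (TensorProduct.map LinearMap.id l (X.coact.lin x)) := by
  have e : i ∘ₗ l = X.coactR.lin := LinearMap.ext h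
  have e' : TensorProduct.map (LinearMap.id : D.carrier →ₗ[k] D.carrier) (i ∘ₗ l) =
      TensorProduct.map LinearMap.id i ∘ₗ TensorProduct.map LinearMap.id l := by
    rw [← TensorProduct.map_comp, LinearMap.id_comp]
  rw [X.coact_coactR x, LinearEquiv.apply_symm_apply, ← e, e', LinearMap.comp_apply]

/-- The right coaction of `X` as a morphism `X ⟶ X □_C C` of `D`-comodules. -/
def toCotensor (X : DGBicomod D C) : X.toDGComod ⟶ X.cotensor C.self where
  lin := X.cotensorLift C.self X.coactR.lin fun x => by
    rw [cotensorDiff_apply]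
    exact sub_eq_zero.2 (X.coactR_coassoc x)
  mem := fun hx => X.coactR.mem hx
  comm := fun x => Subtype.ext (X.coactR.comm x)
  colin := fun x => by
    apply DGComod.map_id_injective D.toDGVect (X.cotensorι _) (X.cotensorι_injective _)
    refine (X.cotensor_coact _ _).trans ?_
    exact X.toCotensor_aux (X.cotensorι C.self).lin
      (X.cotensorLift C.self X.coactR.lin _) (fun _ => rfl) x

/-- The right coaction of `X` as a morphism `X[n] ⟶ X □_C C[n]` of `D`-comodules. -/
def toCotensorShift (X : DGBicomod D C) (n : ℤ) :
    X.toDGComod.shift n ⟶ X.cotensor (C.self.shift n) where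
  lin := X.cotensorLift (C.self.shift n) X.coactR.lin fun x => by
    rw [cotensorDiff_apply]
    exact sub_eq_zero.2 (X.coactR_coassoc x)
  mem := fun {j x} hx => DGVect.tensorGr_le X.toDGVect C.toDGVect LinearMap.id (n + j)
    (DGVect.tensorGr X.toDGVect (C.toDGVect.shift n) j) (fun p q hpq c hc m hm =>
      DGVect.tmul_mem X.toDGVect (C.toDGVect.shift n) (p := p) (q := q - n) (by omega) hc
        (by simpa using hm)) (X.coactR.mem hx)
  comm := fun x => Subtype.ext (X.coactR.comm x)
  colin := fun x => by
    apply DGComod.map_id_injective D.toDGVect (X.cotensorι _) (X.cotensorι_injective _)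
    refine (X.cotensor_coact _ _).trans ?_
    exact X.toCotensor_aux (X.cotensorι (C.self.shift n)).lin
      (X.cotensorLift _ X.coactR.lin _) (fun _ => rfl) x

end DGBicomod

/-! ### Homotopy categories and derived categories -/

section Derived

variable (C D : DGCoalg k)

/-- The homotopy category `H(C)`. -/
abbrev HCat : Type (u + 1) := CategoryTheory.Quotient (DGComod.homotopic C)

/-- The functor `Chain(C) ⥤ H(C)`. -/
abbrev toHCat : DGComod C ⥤ HCat C := CategoryTheory.Quotient.functor (DGComod.homotopic C)

/-- The class of quasi-isomorphisms in `H(C)`. -/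
def quasiIsos : MorphismProperty (HCat C) := fun M N f =>
  ∃ g : M.as ⟶ N.as, (toHCat C).map g = f ∧ DGComod.IsQuasiIso g

/-- The derived category `D(C)`, the localization of `H(C)` by the quasi-isomorphisms. -/
abbrev DCat : Type (u + 1) := (quasiIsos C).Localization

/-- The localization functor `H(C) ⥤ D(C)`. -/
abbrev toDCat : HCat C ⥤ DCat C := (quasiIsos C).Q

/-- The functor `Chain(C) ⥤ D(C)`. -/
abbrev chainToDCat : DGComod C ⥤ DCat C := toHCat C ⋙ toDCat C

/-- The objects of `H(C)` isomorphic to left bounded comodules. -/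
def isHPlus : ObjectProperty (HCat C) := fun A =>
  ∃ M : DGComod C, M.BoundedBelow ∧ Nonempty (A ≅ (toHCat C).obj M)

/-- The objects of `D(C)` isomorphic to left bounded comodules. -/
def isDPlus : ObjectProperty (DCat C) := fun A =>
  ∃ M : DGComod C, M.BoundedBelow ∧ Nonempty (A ≅ (chainToDCat C).obj M)

/-- `H⁺(C)`. -/
abbrev HPlus : Type (u + 1) := (isHPlus C).FullSubcategory

/-- `D⁺(C)`. -/
abbrev DPlus : Type (u + 1) := (isDPlus C).FullSubcategory

/-- The localization functor `H⁺(C) ⥤ D⁺(C)`. -/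
def toDPlus : HPlus C ⥤ DPlus C :=
  (isDPlus C).lift ((isHPlus C).ι ⋙ toDCat C) (by
    rintro ⟨A, M, hM, ⟨e⟩⟩
    exact ⟨M, hM, ⟨(toDCat C).mapIso e⟩⟩)

variable {C D}

/-- An object `X` of `Chain(C)` is closed if `Hom_{H(C)}(M, X) → Hom_{D(C)}(M, X)` is bijective
for all `M`. -/
def DGComod.IsClosed (X : DGComod C) : Prop :=
  ∀ M : DGComod C, Function.Bijective
    (fun f : (toHCat C).obj M ⟶ (toHCat C).obj X => (toDCat C).map f)

/-- A left bounded comodule as an object of `H⁺(C)`. -/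
def DGComod.inHPlus (M : DGComod C) (hM : M.BoundedBelow) : HPlus C :=
  ⟨(toHCat C).obj M, M, hM, ⟨Iso.refl _⟩⟩

/-- A left bounded comodule as an object of `D⁺(C)`. -/
def DGComod.inDPlus (M : DGComod C) (hM : M.BoundedBelow) : DPlus C :=
  ⟨(chainToDCat C).obj M, M, hM, ⟨Iso.refl _⟩⟩

namespace DGBicomod

/-- The functor `X □_C - : H(C) ⥤ H(D)`. -/
def cotensorH (X : DGBicomod D C) : HCat C ⥤ HCat D :=
  CategoryTheory.Quotient.lift _ (X.cotensorFunctor ⋙ toHCat D) fun _ _ f g h =>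
    CategoryTheory.Quotient.sound _ (X.cotensorFunctor_homotopic f g h)

/-- The functor `H⁺(C) ⥤ D⁺(D)` induced by `X □_C -` for `X` left bounded. -/
def cotensorPlus (X : DGBicomod D C) (hX : X.BoundedBelow) : HPlus C ⥤ DPlus D :=
  (isDPlus D).lift ((isHPlus C).ι ⋙ X.cotensorH ⋙ toDCat D) (by
    rintro ⟨A, M, hM, ⟨e⟩⟩
    exact ⟨X.cotensor M, BoundedBelow.cotensor hX hM,
      ⟨(X.cotensorH ⋙ toDCat D).mapIso e⟩⟩)

/-- `(F, α)` is the derived cotensor product `X □_C^R - : D⁺(C) ⥤ D⁺(D)`, that is the (total)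
right derived functor of `X □_C - : H⁺(C) ⥤ D⁺(D)`: its left Kan extension along the localization
functor `H⁺(C) ⥤ D⁺(C)`. -/
def IsDerivedCotensor (X : DGBicomod D C) (hX : X.BoundedBelow) (F : DPlus C ⥤ DPlus D)
    (α : X.cotensorPlus hX ⟶ toDPlus C ⋙ F) : Prop :=
  F.IsLeftKanExtension α

/-- The canonical morphism `X ⟶ X □_C C ⟶ F(C)` in `D⁺(D)`. -/
def unitMap (X : DGBicomod D C) (hX : X.BoundedBelow) (hC : C.BoundedBelow)
    {F : DPlus C ⥤ DPlus D} (α : X.cotensorPlus hX ⟶ toDPlus C ⋙ F) :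
    X.toDGComod.inDPlus hX ⟶ F.obj (C.self.inDPlus hC) :=
  (isDPlus D).homMk ((chainToDCat D).map X.toCotensor) ≫ α.app (C.self.inHPlus hC)

/-- The canonical morphism `X[n] ⟶ X □_C C[n] ⟶ F(C[n])` in `D⁺(D)`. -/
def unitMapShift (X : DGBicomod D C) (hX : X.BoundedBelow) (hC : C.BoundedBelow)
    {F : DPlus C ⥤ DPlus D} (α : X.cotensorPlus hX ⟶ toDPlus C ⋙ F) (n : ℤ) :
    (X.toDGComod.shift n).inDPlus (hX.shift n) ⟶ F.obj ((C.self.shift n).inDPlus (hC.shift n)) :=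
  (isDPlus D).homMk ((chainToDCat D).map (X.toCotensorShift n)) ≫
    α.app ((C.self.shift n).inHPlus (hC.shift n))

/-- For all `n`, `F` induces an isomorphism `Hom_{D(C)}(C, C[n]) ≅ Hom_{D(D)}(X, X[n])`, where
`X` and `X[n]` are identified with `F(C)` and `F(C[n])` through the canonical morphisms. -/
def InducesIsos (X : DGBicomod D C) (hX : X.BoundedBelow) (hC : C.BoundedBelow)
    {F : DPlus C ⥤ DPlus D} (α : X.cotensorPlus hX ⟶ toDPlus C ⋙ F) : Prop :=
  ∀ n : ℤ, ∃ e : (C.self.inDPlus hC ⟶ (C.self.shift n).inDPlus (hC.shift n)) ≃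
      (X.toDGComod.inDPlus hX ⟶ (X.toDGComod.shift n).inDPlus (hX.shift n)),
    ∀ f, X.unitMap hX hC α ≫ F.map f = e f ≫ X.unitMapShift hX hC α n

end DGBicomod

/-- `A ⟶ B ⟶ E ⟶ A[1]` are the vertices of a distinguished triangle in `D⁺(D)`, i.e. of a triangle
isomorphic to the image of the triangle `M ⟶ N ⟶ Co(f) ⟶ M[1]` of a morphism `f` of `Chain(D)`. -/
def IsTriangle (A B E : DPlus D) : Prop :=
  ∃ (M N : DGComod D) (f : M ⟶ N), Nonempty (A.obj ≅ (chainToDCat D).obj M) ∧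
    Nonempty (B.obj ≅ (chainToDCat D).obj N) ∧
    Nonempty (E.obj ≅ (chainToDCat D).obj (DGComod.cone f))

/-- A full subcategory of `D⁺(D)`, closed under isomorphisms, is triangulated and stable under
arbitrary products (those which exist in `D⁺(D)`) and under extensions by objects of
`Chain⁺(k)`. -/
structure IsStableTriangulated (P : ObjectProperty (DPlus D)) : Prop where
  of_iso : ∀ {A B : DPlus D}, (A ≅ B) → P A → P B
  zero : ∀ {A : DPlus D}, Limits.IsZero A → P A
  shift : ∀ {A B : DPlus D} (M : DGComod D) (n : ℤ), (A.obj ≅ (chainToDCat D).obj M) →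
    (B.obj ≅ (chainToDCat D).obj (M.shift n)) → P A → P B
  triangle₁ : ∀ {A B E : DPlus D}, IsTriangle A B E → P B → P E → P A
  triangle₂ : ∀ {A B E : DPlus D}, IsTriangle A B E → P A → P E → P B
  triangle₃ : ∀ {A B E : DPlus D}, IsTriangle A B E → P A → P B → P E
  product : ∀ {J : Type u} (A : J → DPlus D) (c : Limits.Fan A), Limits.IsLimit c →
    (∀ j, P (A j)) → P c.pt
  extension : ∀ {A B : DPlus D} (M : DGComod D) (V : DGVect k), V.BoundedBelow →
    (A.obj ≅ (chainToDCat D).obj M) → (B.obj ≅ (chainToDCat D).obj (M.tensor V)) → P A → P B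

/-- The objects of the smallest triangulated full subcategory of `D⁺(D)` which is stable under
arbitrary products and extensions by objects of `Chain⁺(k)` and contains `A`. -/
def generated (A : DPlus D) : ObjectProperty (DPlus D) := fun B =>
  ∀ P : ObjectProperty (DPlus D), IsStableTriangulated P → P A → P B

end Derived

end

/-! The proof reduces everything to bounded below closed comodules, called `Good`, and is then a
dévissage in the two arguments of Hom.

Resolutions. Let `M` be bounded below. The totalization of its cobar resolution `C ⊗ M ⟶ C ⊗ C ⊗ M ⟶
⋯` is quasi-isomorphic to `M` by an explicit linear contraction (`toRes_isQuasiIso`), and forgetting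
differentials it is cofree, `C ⊗ T`. Since `C` is positively graded, `T` is bounded below as well,
and a bounded below quasi-cofree comodule is closed (`Cogen.isClosed`): null homotopies of maps from
acyclic objects are built degree by degree. Hence `H⁺(C) ⥤ D⁺(C)` has a right adjoint given by
resolutions, the left Kan extension defining `F` exists, and on good comodules `F` is `X □ -` itself
(`isIso_app_of_local`, `derIso`).

Dévissage. Cutting `T` by degree gives a tower of quotients of `C ⊗ T`. Its layers are cofree
comodules `C ⊗ V` with `V` in a single degree, and its limit is the kernel of a surjective
endomorphism of the product of its stages (`shortExact_tow`, `shortExact_towers`). So a property of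
good comodules that is stable under quasi-isomorphisms, shifts, cones and uniformly bounded below
sequential products, and that holds for the `C ⊗ V`, holds for all of them (`Triangulated.of_good`).

An equivalence satisfies the conditions. Conditions (a) and (b) are formal once `X` is identified
with `X □ C` and so with `F(C)`. For (c), `X □ (C ⊗ V)` is `X ⊗ V`, so by dévissage a stable
triangulated subcategory containing `X` contains the whole image of `F`
(`IsStableTriangulated.of_cotensor`), hence `D`.

The conditions give full faithfulness. First the target is `C[j]`. As `X □ C[j] ≅ X[j]` is closed,
morphisms into it can be computed in the homotopy category. By (a) and the five lemma, bijectivity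
passes from the source `C` to the sources `C ⊗ V`, which are coproducts of shifts of `C`, and to the
finite stages of a tower. As `C` and `X` are bounded above, morphisms from `M` to `C[j]`, and from
`X □ M` to `X[j]`, only see one finite stage (`fullyFaithfulAt_self`). Then the target varies. By
(b) bijectivity passes to products of shifts of `C`, then to `C ⊗ V`, which is a retract of such a
product, and by dévissage to every good target (`bijective_map`).

The conditions give essential surjectivity. Given full faithfulness, the essential image of `F` is a
stable triangulated subcategory (`isStableTriangulated_essImage`). The delicate point is products: a
product existing in `D⁺(D)` bounds its factors uniformly, and this bound transfers to their
preimages because morphisms to shifts of `C` detect homology (`essImage_product`). The image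
contains `X`, hence `D` by (c), and `D` generates `D⁺(D)` by the same dévissage over `D`
(`IsStableTriangulated.of_self`). -/

noncomputable section
variable {k : Type u} [Field k]

/-! ### Graded linear algebra: projections, contractions and homology -/

namespace DGVect

/-- The projection onto the homogeneous component of degree `n`. -/
def proj (V : DGVect k) (n : ℤ) : V →ₗ[k] V :=
  (V.gr n).subtype ∘ₗ DirectSum.component k ℤ (fun n => V.gr n) n ∘ₗ
    (DirectSum.decomposeLinearEquiv V.gr).toLinearMap

lemma proj_apply (V : DGVect k) (n : ℤ) (x : V) :
    V.proj n x = (DirectSum.decompose V.gr x n : V) := rfl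

lemma proj_mem (V : DGVect k) (n : ℤ) (x : V) : V.proj n x ∈ V.gr n := by
  rw [proj_apply]
  exact SetLike.coe_mem _

lemma proj_of_mem (V : DGVect k) {n : ℤ} {x : V} (hx : x ∈ V.gr n) : V.proj n x = x := by
  rw [proj_apply, DirectSum.decompose_of_mem_same _ hx]

lemma proj_of_mem_ne (V : DGVect k) {m n : ℤ} {x : V} (hx : x ∈ V.gr m) (h : m ≠ n) :
    V.proj n x = 0 := by
  rw [proj_apply, DirectSum.decompose_of_mem_ne _ hx h]

lemma eq_zero_of_proj (V : DGVect k) {x : V} (h : ∀ n, V.proj n x = 0) : x = 0 := by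
  apply (DirectSum.decompose V.gr).injective
  rw [DirectSum.decompose_zero]
  ext n
  exact h n

lemma ext_proj (V : DGVect k) {x y : V} (h : ∀ n, V.proj n x = V.proj n y) : x = y :=
  sub_eq_zero.1 (V.eq_zero_of_proj fun n => by rw [map_sub, h, sub_self])

lemma mem_of_proj (V : DGVect k) {n : ℤ} {x : V} (h : ∀ m, m ≠ n → V.proj m x = 0) :
    x ∈ V.gr n := by
  have : V.proj n x = x := by
    refine V.ext_proj fun m => ?_
    by_cases hm : m = n
    · subst hm
      rw [V.proj_of_mem (V.proj_mem _ _)]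
    · rw [V.proj_of_mem_ne (V.proj_mem _ _) (Ne.symm hm), h m hm]
  exact this ▸ V.proj_mem n x

lemma homogeneous_induction (V : DGVect k) {P : V → Prop} (h0 : P 0)
    (hadd : ∀ x y, P x → P y → P (x + y)) (hh : ∀ n, ∀ x ∈ V.gr n, P x) (x : V) : P x := by
  induction x using DirectSum.Decomposition.inductionOn V.gr with
  | zero => exact h0
  | homogeneous m => exact hh _ _ m.2
  | add a b ha hb => exact hadd _ _ ha hb

lemma eq_zero_of_mem_of_ne (V : DGVect k) {m n : ℤ} {x : V} (h1 : x ∈ V.gr m) (h2 : x ∈ V.gr n)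
    (h : m ≠ n) : x = 0 := by
  rw [← V.proj_of_mem h2, V.proj_of_mem_ne h1 h]

/-- A linear map out of `V` given by its restrictions to the homogeneous components. -/
def glue (V : DGVect k) {P : Type*} [AddCommGroup P] [Module k P] (f : ℤ → V →ₗ[k] P) :
    V →ₗ[k] P :=
  (DirectSum.toModule k ℤ P fun n => f n ∘ₗ (V.gr n).subtype) ∘ₗ
    (DirectSum.decomposeLinearEquiv V.gr).toLinearMap

lemma glue_of_mem (V : DGVect k) {P : Type*} [AddCommGroup P] [Module k P]
    (f : ℤ → V →ₗ[k] P) {n : ℤ} {x : V} (hx : x ∈ V.gr n) : V.glue f x = f n x := by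
  lift x to V.gr n using hx
  simp [glue]

lemma proj_map {V W : DGVect k} (e : ℤ) {f : V →ₗ[k] W}
    (hf : ∀ {n : ℤ} {x : V}, x ∈ V.gr n → f x ∈ W.gr (n + e)) (n : ℤ) (x : V) :
    W.proj (n + e) (f x) = f (V.proj n x) := by
  induction x using V.homogeneous_induction with
  | h0 => simp
  | hadd a b ha hb => simp only [map_add, ha, hb]
  | hh m x hx =>
    by_cases h : m = n
    · subst h
      rw [V.proj_of_mem hx, W.proj_of_mem (hf hx)]
    · rw [V.proj_of_mem_ne hx h, W.proj_of_mem_ne (hf hx) (by omega), map_zero]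

lemma proj_d (V : DGVect k) (n : ℤ) (x : V) : V.proj (n + 1) (V.d x) = V.d (V.proj n x) :=
  proj_map 1 V.d_mem n x

lemma Hom.proj {V W : DGVect k} (f : Hom V W) (n : ℤ) (x : V) :
    W.proj n (f.lin x) = f.lin (V.proj n x) :=
  f.decompose x n

/-- A family of submodules with a compatible family of projections which spans is an internal
direct sum decomposition. -/
lemma isInternal_of_proj {P : Type*} [AddCommGroup P] [Module k P] (gr : ℤ → Submodule k P)
    (pr : ℤ → P →ₗ[k] P) (h1 : ∀ n, ∀ x ∈ gr n, pr n x = x)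
    (h2 : ∀ m n, m ≠ n → ∀ x ∈ gr m, pr n x = 0) (h3 : ∀ x, x ∈ ⨆ n, gr n) :
    DirectSum.IsInternal gr := by
  classical
  refine DirectSum.isInternal_submodule_of_iSupIndep_of_iSup_eq_top ?_
    (eq_top_iff.2 fun x _ => h3 x)
  rw [iSupIndep_def]
  intro i
  rw [Submodule.disjoint_def]
  intro x hx hx'
  have hle : (⨆ (j : ℤ) (_ : j ≠ i), gr j) ≤ LinearMap.ker (pr i) :=
    iSup₂_le fun j hj y hy => h2 j i hj y hy
  rw [← h1 i x hx]
  exact hle hx'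

/-- An acyclic complex: every cycle is a boundary. -/
def Acyclic (V : DGVect k) : Prop := ∀ x, V.d x = 0 → ∃ y, V.d y = x

/-- A linear contraction of degree `-1`. -/
lemma Acyclic.exists_contraction {V : DGVect k} (hV : V.Acyclic) :
    ∃ s : V →ₗ[k] V, (∀ {n : ℤ} {x : V}, x ∈ V.gr n → s x ∈ V.gr (n - 1)) ∧
      ∀ x, s (V.d x) + V.d (s x) = x := by
  -- Over a field the surjection of `V` onto the boundaries splits, and the splitting extends to all
  -- of `V`; so `d g1 d = d`.
  obtain ⟨g0, hg0⟩ := (V.d.rangeRestrict).exists_rightInverse_of_surjective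
    (LinearMap.range_eq_top.2 V.d.surjective_rangeRestrict)
  obtain ⟨g1, hg1⟩ := LinearMap.exists_extend g0
  have hg1' : ∀ x, V.d (g1 (V.d x)) = V.d x := fun x => by
    have e1 : g1 (V.d x) = g0 ⟨V.d x, LinearMap.mem_range_self _ x⟩ :=
      LinearMap.congr_fun hg1 ⟨V.d x, LinearMap.mem_range_self _ x⟩
    rw [e1]
    exact congrArg Subtype.val (LinearMap.congr_fun hg0 ⟨V.d x, LinearMap.mem_range_self _ x⟩)
  -- Keeping only the component of `g1` of degree `-1` does not spoil `d g d = d`, because `d` is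
  -- homogeneous.
  let g : V →ₗ[k] V := V.glue fun n => V.proj (n - 1) ∘ₗ g1
  have hgm : ∀ {n : ℤ} {x : V}, x ∈ V.gr n → g x ∈ V.gr (n - 1) := fun {n x} hx => by
    rw [V.glue_of_mem _ hx]
    exact V.proj_mem _ _
  have hg : ∀ x, V.d (g (V.d x)) = V.d x := by
    intro x
    have : V.d ∘ₗ g ∘ₗ V.d = V.d := by
      refine V.linearMap_ext fun n x hx => ?_
      simp only [LinearMap.comp_apply]
      rw [V.glue_of_mem _ (V.d_mem hx), LinearMap.comp_apply, ← V.proj_d, hg1',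
        show n + 1 - 1 + 1 = n + 1 by ring, V.proj_of_mem (V.d_mem hx)]
    exact LinearMap.congr_fun this x
  -- The correction makes the argument `x - g (d x)` a cycle, hence a boundary by acyclicity, and `d
  -- g` is the identity on boundaries.
  refine ⟨g ∘ₗ (LinearMap.id - g ∘ₗ V.d), fun {n x} hx => ?_, fun x => ?_⟩
  · refine hgm (sub_mem hx ?_)
    have := hgm (V.d_mem hx)
    simpa using this
  · have hx : V.d (x - g (V.d x)) = 0 := by rw [map_sub, hg, sub_self]
    obtain ⟨y, hy⟩ := hV _ hx
    simp only [LinearMap.comp_apply, LinearMap.sub_apply, LinearMap.id_apply, V.d_d, map_zero,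
      sub_zero]
    rw [← hy, hg, hy]
    abel

/-- A morphism is a quasi-isomorphism if and only if it is injective and surjective on cycles
modulo boundaries. -/
lemma Hom.homologyMap_bijective_iff {V W : DGVect k} (f : Hom V W) :
    Function.Bijective f.homologyMap ↔
      (∀ x, V.d x = 0 → ∀ y, f.lin x = W.d y → ∃ z, V.d z = x) ∧
      (∀ y, W.d y = 0 → ∃ x, V.d x = 0 ∧ ∃ z, y - f.lin x = W.d z) := by
  have key : ∀ x : LinearMap.ker V.d, f.homologyMap (Submodule.Quotient.mk x) =
      Submodule.Quotient.mk ⟨f.lin x, by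
        rw [LinearMap.mem_ker, ← f.comm, LinearMap.mem_ker.1 x.2, map_zero]⟩ := fun x => rfl
  constructor
  · rintro ⟨hi, hs⟩
    refine ⟨fun x hx y hy => ?_, fun y hy => ?_⟩
    · have h0 : f.homologyMap (Submodule.Quotient.mk ⟨x, hx⟩) = 0 := by
        rw [key, Submodule.Quotient.mk_eq_zero]
        exact ⟨y, hy.symm⟩
      have h1 := hi (h0.trans (map_zero _).symm)
      rw [Submodule.Quotient.mk_eq_zero] at h1
      exact h1
    · obtain ⟨q, hq⟩ := hs (Submodule.Quotient.mk ⟨y, hy⟩)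
      obtain ⟨⟨x, hx⟩, rfl⟩ := Submodule.Quotient.mk_surjective _ q
      rw [key] at hq
      have h1 := (Submodule.Quotient.eq _).1 hq.symm
      obtain ⟨z, hz⟩ := h1
      exact ⟨x, hx, z, hz.symm⟩
  · rintro ⟨hi, hs⟩
    constructor
    · rw [injective_iff_map_eq_zero]
      intro q hq
      obtain ⟨⟨x, hx⟩, rfl⟩ := Submodule.Quotient.mk_surjective _ q
      rw [key, Submodule.Quotient.mk_eq_zero] at hq
      obtain ⟨y, hy⟩ := hq
      rw [Submodule.Quotient.mk_eq_zero]
      exact hi x hx y hy.symm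
    · intro q
      obtain ⟨⟨y, hy⟩, rfl⟩ := Submodule.Quotient.mk_surjective _ q
      obtain ⟨x, hx, z, hz⟩ := hs y hy
      refine ⟨Submodule.Quotient.mk ⟨x, hx⟩, ?_⟩
      rw [key]
      refine ((Submodule.Quotient.eq _).2 ?_).symm
      exact ⟨z, hz.symm⟩

lemma Hom.homologyMap_comp {U V W : DGVect k} (g : Hom V W) (f : Hom U V) :
    (g.comp f).homologyMap = g.homologyMap ∘ₗ f.homologyMap := by
  refine Submodule.linearMap_qext _ (LinearMap.ext fun x => ?_)
  rfl

lemma Hom.homologyMap_id (V : DGVect k) : (Hom.id V).homologyMap = LinearMap.id := by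
  refine Submodule.linearMap_qext _ (LinearMap.ext fun x => ?_)
  rfl

/-- Linear maps which agree up to a linear homotopy induce the same map in homology. -/
lemma Hom.homologyMap_eq {V W : DGVect k} (f g : Hom V W) (h : V →ₗ[k] W)
    (H : ∀ x, f.lin x - g.lin x = h (V.d x) + W.d (h x)) : f.homologyMap = g.homologyMap := by
  refine Submodule.linearMap_qext _ (LinearMap.ext fun x => ?_)
  refine (Submodule.Quotient.eq _).2 ⟨h x, ?_⟩
  change W.d (h x) = f.lin x - g.lin x
  rw [H, LinearMap.mem_ker.1 x.2, map_zero, zero_add]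

end DGVect

/-! ### Twisted colinear maps, additive structure, quasi-isomorphisms -/

namespace DGComod

variable {C D : DGCoalg k}

/-- A linear map `f` is colinear up to `b` if `ρ f = (b ⊗ f) ρ`. -/
def Colin {M N : DGComod C} (b : C.carrier →ₗ[k] C.carrier) (f : M.carrier →ₗ[k] N.carrier) :
    Prop :=
  ∀ x, N.coact.lin (f x) = TensorProduct.map b f (M.coact.lin x)

lemma Colin.comp {M N P : DGComod C} {b b' : C.carrier →ₗ[k] C.carrier}
    {f : M.carrier →ₗ[k] N.carrier} {g : N.carrier →ₗ[k] P.carrier} (hg : Colin b' g)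
    (hf : Colin b f) : Colin (b' ∘ₗ b) (g ∘ₗ f) := fun x => by
  rw [LinearMap.comp_apply, hg, hf, ← LinearMap.comp_apply, ← TensorProduct.map_comp]

lemma Colin.add {M N : DGComod C} {b : C.carrier →ₗ[k] C.carrier}
    {f g : M.carrier →ₗ[k] N.carrier} (hf : Colin b f) (hg : Colin b g) : Colin b (f + g) :=
  fun x => by rw [LinearMap.add_apply, map_add, hf, hg, TensorProduct.map_add_right]; rfl

lemma Colin.neg {M N : DGComod C} {b : C.carrier →ₗ[k] C.carrier}
    {f : M.carrier →ₗ[k] N.carrier} (hf : Colin b f) : Colin b (-f) := fun x => by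
  have : TensorProduct.map b (-f) = -TensorProduct.map b f :=
    TensorProduct.ext' fun a c => by simp [TensorProduct.tmul_neg]
  rw [LinearMap.neg_apply, map_neg, hf, this]
  rfl

lemma Colin.sub {M N : DGComod C} {b : C.carrier →ₗ[k] C.carrier}
    {f g : M.carrier →ₗ[k] N.carrier} (hf : Colin b f) (hg : Colin b g) : Colin b (f - g) := by
  rw [sub_eq_add_neg]
  exact hf.add hg.neg

lemma Colin.zero {M N : DGComod C} (b : C.carrier →ₗ[k] C.carrier) :
    Colin b (0 : M.carrier →ₗ[k] N.carrier) := fun x => by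
  simp [TensorProduct.map_zero_right]

lemma Hom.colin' {M N : DGComod C} (f : M ⟶ N) : Colin LinearMap.id f.lin := f.colin

lemma _root_.DGVect.sgn_comp_sgn (V : DGVect k) : V.sgn ∘ₗ V.sgn = LinearMap.id :=
  LinearMap.ext V.sgn_sgn

lemma colin_sgn (M : DGComod C) : Colin C.sgn M.sgn := fun x => by
  have hC : (C.toDGVect.tensor M.toDGVect).sgn = TensorProduct.map C.sgn M.sgn :=
    TensorProduct.ext' fun x y => DGVect.tensor_sgn_tmul _ _ x y
  rw [M.coact.sgn, hC]

lemma colin_id (M : DGComod C) : Colin (M := M) (N := M) LinearMap.id LinearMap.id := fun x => by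
  simp

/-- If `h` is colinear of odd degree then `h d + d h` is colinear. -/
lemma Colin.boundary {M N : DGComod C} {h : M.carrier →ₗ[k] N.carrier} (hh : Colin C.sgn h) :
    Colin LinearMap.id (h ∘ₗ M.d + N.d ∘ₗ h) := fun x => by
  have key : ∀ t : C.carrier ⊗[k] M.carrier,
      TensorProduct.map C.sgn h ((C.toDGVect.tensor M.toDGVect).d t) +
        (C.toDGVect.tensor N.toDGVect).d (TensorProduct.map C.sgn h t) =
      TensorProduct.map LinearMap.id (h ∘ₗ M.d + N.d ∘ₗ h) t := by
    intro t
    induction t using TensorProduct.induction_on with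
    | zero => simp only [map_zero, add_zero]
    | add a b ha hb => rw [map_add, map_add, map_add, map_add, map_add, ← ha, ← hb]; abel
    | tmul c m =>
      rw [DGVect.tensor_d_tmul, map_add]
      simp only [TensorProduct.map_tmul, LinearMap.id_apply, LinearMap.add_apply,
        LinearMap.comp_apply]
      rw [C.sgn_sgn, C.d_sgn, TensorProduct.neg_tmul, TensorProduct.tmul_add]
      abel
  rw [LinearMap.add_apply, map_add, LinearMap.comp_apply, LinearMap.comp_apply, hh, M.coact.comm,
    N.coact.comm, hh, key]

section Preadditive

variable {M N : DGComod C}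

instance : Zero (M ⟶ N) :=
  ⟨{ lin := 0, mem := fun _ => zero_mem _, comm := fun _ => by simp, colin := Colin.zero _ }⟩

instance : Add (M ⟶ N) :=
  ⟨fun f g => { lin := f.lin + g.lin, mem := fun h => add_mem (f.mem h) (g.mem h),
                comm := fun x => by simp [f.comm, g.comm], colin := f.colin'.add g.colin' }⟩

instance : Neg (M ⟶ N) :=
  ⟨fun f => { lin := -f.lin, mem := fun h => neg_mem (f.mem h),
              comm := fun x => by simp [f.comm], colin := f.colin'.neg }⟩

instance : Sub (M ⟶ N) :=
  ⟨fun f g => { lin := f.lin - g.lin, mem := fun h => sub_mem (f.mem h) (g.mem h),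
                comm := fun x => by simp [f.comm, g.comm], colin := f.colin'.sub g.colin' }⟩

@[simp] lemma zero_lin : (0 : M ⟶ N).lin = 0 := rfl
@[simp] lemma add_lin (f g : M ⟶ N) : (f + g).lin = f.lin + g.lin := rfl
@[simp] lemma neg_lin (f : M ⟶ N) : (-f).lin = -f.lin := rfl
@[simp] lemma sub_lin (f g : M ⟶ N) : (f - g).lin = f.lin - g.lin := rfl
@[simp] lemma comp_lin {P : DGComod C} (f : M ⟶ N) (g : N ⟶ P) :
    (f ≫ g).lin = g.lin ∘ₗ f.lin := rfl
@[simp] lemma id_lin : (𝟙 M : M ⟶ M).lin = LinearMap.id := rfl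

instance : AddCommGroup (M ⟶ N) where
  add_assoc f g h := hom_ext (add_assoc _ _ _)
  zero_add f := hom_ext (zero_add _)
  add_zero f := hom_ext (add_zero _)
  add_comm f g := hom_ext (add_comm _ _)
  neg_add_cancel f := hom_ext (neg_add_cancel _)
  sub_eq_add_neg f g := hom_ext (sub_eq_add_neg _ _)
  nsmul := nsmulRec
  zsmul := zsmulRec

end Preadditive

instance : Preadditive (DGComod C) where
  add_comp _ _ _ f g h := hom_ext (by simp [LinearMap.comp_add])
  comp_add _ _ _ f g h := hom_ext (by simp [LinearMap.add_comp])

instance : Preadditive (HCat C) :=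
  CategoryTheory.Quotient.preadditive _ (by
    rintro M N f₁ f₂ g₁ g₂ ⟨H⟩ ⟨K⟩
    exact ⟨⟨H.h + K.h, fun hx => add_mem (H.mem hx) (K.mem hx),
      Colin.add (f := H.h) (g := K.h) H.colin K.colin, fun x => by
        simp only [add_lin, LinearMap.add_apply, map_add]
        rw [add_sub_add_comm, H.eq, K.eq]
        abel⟩⟩)

instance : (toHCat C).Additive := CategoryTheory.Quotient.functor_additive _ _

lemma toHCat_eq_iff {M N : DGComod C} (f g : M ⟶ N) :
    (toHCat C).map f = (toHCat C).map g ↔ homotopic C f g :=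
  CategoryTheory.Quotient.functor_map_eq_iff _ f g

lemma toHCat_eq_zero_iff {M N : DGComod C} (f : M ⟶ N) :
    (toHCat C).map f = 0 ↔ homotopic C f 0 := by
  rw [← toHCat_eq_iff, Functor.map_zero]

lemma exists_toHCat_map {M N : DGComod C} (f : (toHCat C).obj M ⟶ (toHCat C).obj N) :
    ∃ g : M ⟶ N, (toHCat C).map g = f := (toHCat C).map_surjective f

/-- A bijective morphism is an isomorphism. -/
def isoOfBijective {M N : DGComod C} (f : M ⟶ N) (hf : Function.Bijective f.lin) : M ≅ N where
  hom := f
  inv :=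
    { lin := (LinearEquiv.ofBijective f.lin hf).symm.toLinearMap
      mem := fun {n y} hy => f.toHom.mem_of_injective hf.1 (by
        have e : f.lin ((LinearEquiv.ofBijective f.lin hf).symm y) = y :=
          LinearEquiv.apply_symm_apply (LinearEquiv.ofBijective f.lin hf) y
        rw [← e] at hy
        exact hy)
      comm := fun y => hf.1 (by
        have e : ∀ y, f.lin ((LinearEquiv.ofBijective f.lin hf).symm y) = y :=
          LinearEquiv.apply_symm_apply (LinearEquiv.ofBijective f.lin hf)
        simp only [LinearEquiv.coe_coe]
        rw [f.comm, e, e])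
      colin := fun y => by
        obtain ⟨x, rfl⟩ := hf.2 y
        have e : ∀ x, (LinearEquiv.ofBijective f.lin hf).symm (f.lin x) = x :=
          LinearEquiv.symm_apply_apply (LinearEquiv.ofBijective f.lin hf)
        have e' : (LinearEquiv.ofBijective f.lin hf).symm.toLinearMap ∘ₗ f.lin = LinearMap.id :=
          LinearMap.ext e
        rw [f.colin, ← LinearMap.comp_apply (TensorProduct.map _ _), ← TensorProduct.map_comp, e']
        simp only [LinearEquiv.coe_coe, e]
        simp }
  hom_inv_id := hom_ext (LinearMap.ext fun x =>
    LinearEquiv.symm_apply_apply (LinearEquiv.ofBijective f.lin hf) x)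
  inv_hom_id := hom_ext (LinearMap.ext fun x =>
    LinearEquiv.apply_symm_apply (LinearEquiv.ofBijective f.lin hf) x)

lemma isIso_of_bijective {M N : DGComod C} (f : M ⟶ N) (hf : Function.Bijective f.lin) :
    IsIso f :=
  (isoOfBijective f hf).isIso_hom

lemma isQuasiIso_iff {M N : DGComod C} (f : M ⟶ N) : IsQuasiIso f ↔
    (∀ x, M.d x = 0 → ∀ y, f.lin x = N.d y → ∃ z, M.d z = x) ∧
      (∀ y, N.d y = 0 → ∃ x, M.d x = 0 ∧ ∃ z, y - f.lin x = N.d z) :=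
  f.toHom.homologyMap_bijective_iff

lemma IsQuasiIso.of_bijective {M N : DGComod C} {f : M ⟶ N} (hf : Function.Bijective f.lin) :
    IsQuasiIso f := by
  rw [isQuasiIso_iff]
  refine ⟨fun x hx y hy => ?_, fun y hy => ?_⟩
  · obtain ⟨z, rfl⟩ := hf.2 y
    exact ⟨z, hf.1 (by rw [hy, f.comm])⟩
  · obtain ⟨x, rfl⟩ := hf.2 y
    exact ⟨x, hf.1 (by rw [f.comm, hy, map_zero]), 0, by simp⟩

lemma homologyMap_comp {M N P : DGComod C} (f : M ⟶ N) (g : N ⟶ P) :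
    (f ≫ g).homologyMap = g.homologyMap ∘ₗ f.homologyMap :=
  g.toHom.homologyMap_comp f.toHom

lemma homologyMap_eq_of_homotopic {M N : DGComod C} {f g : M ⟶ N} (h : homotopic C f g) :
    f.homologyMap = g.homologyMap := by
  obtain ⟨H⟩ := h
  exact DGVect.Hom.homologyMap_eq _ _ H.h H.eq

variable (C) in
/-- Homology as a functor on the homotopy category. -/
def homologyFunctor : HCat C ⥤ Type u :=
  CategoryTheory.Quotient.lift _
    { obj := fun M => M.toDGVect.Homology
      map := fun f => ↾f.homologyMap
      map_id := fun M => by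
        ext x
        exact LinearMap.congr_fun (DGVect.Hom.homologyMap_id M.toDGVect) x
      map_comp := fun f g => by
        ext x
        exact LinearMap.congr_fun (homologyMap_comp f g) x }
    (fun _ _ f g h => by
      ext x
      exact LinearMap.congr_fun (homologyMap_eq_of_homotopic h) x)

lemma homologyFunctor_inverts : (quasiIsos C).IsInvertedBy (homologyFunctor C) := by
  rintro M N f ⟨g, rfl, hg⟩
  rw [isIso_iff_bijective]
  exact hg

/-- A morphism which becomes invertible in the derived category is a quasi-isomorphism. -/
lemma IsQuasiIso.of_isIso {M N : DGComod C} (f : M ⟶ N) (hf : IsIso ((chainToDCat C).map f)) :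
    IsQuasiIso f := by
  have h1 : IsIso ((homologyFunctor C).map ((toHCat C).map f)) := by
    -- Homology factors through the localization, so what becomes invertible there is invertible on
    -- homology.
    have e := Localization.fac (homologyFunctor C) homologyFunctor_inverts (quasiIsos C).Q
    have h2 : IsIso ((toDCat C ⋙ Localization.lift (homologyFunctor C) homologyFunctor_inverts
      (quasiIsos C).Q).map ((toHCat C).map f)) := by
      rw [Functor.comp_map]
      have : IsIso ((toDCat C).map ((toHCat C).map f)) := hf
      infer_instance
    exact (NatIso.isIso_map_iff e _).1 h2
  exact (isIso_iff_bijective _).1 h1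

lemma IsQuasiIso.isIso {M N : DGComod C} {f : M ⟶ N} (hf : IsQuasiIso f) :
    IsIso ((chainToDCat C).map f) :=
  Localization.inverts (quasiIsos C).Q (quasiIsos C) _ ⟨f, rfl, hf⟩

lemma IsQuasiIso.comp {M N P : DGComod C} {f : M ⟶ N} {g : N ⟶ P} (hf : IsQuasiIso f)
    (hg : IsQuasiIso g) : IsQuasiIso (f ≫ g) := by
  unfold IsQuasiIso
  rw [homologyMap_comp, LinearMap.coe_comp]
  exact Function.Bijective.comp hg hf

end DGComod

/-! ### Parity of composites of twisted colinear maps -/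

namespace DGComod

variable {C : DGCoalg k}

section Comp

variable {M N P : DGComod C} {f : M.carrier →ₗ[k] N.carrier} {g : N.carrier →ₗ[k] P.carrier}

lemma Colin.comp_even_even (hg : Colin LinearMap.id g) (hf : Colin LinearMap.id f) :
    Colin LinearMap.id (g ∘ₗ f) := by
  have := hg.comp hf
  rwa [LinearMap.comp_id] at this

lemma Colin.comp_even_odd (hg : Colin LinearMap.id g) (hf : Colin C.sgn f) :
    Colin C.sgn (g ∘ₗ f) := by
  have := hg.comp hf
  rwa [LinearMap.id_comp] at this

lemma Colin.comp_odd_even (hg : Colin C.sgn g) (hf : Colin LinearMap.id f) :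
    Colin C.sgn (g ∘ₗ f) := by
  have := hg.comp hf
  rwa [LinearMap.comp_id] at this

lemma Colin.comp_odd_odd (hg : Colin C.sgn g) (hf : Colin C.sgn f) :
    Colin LinearMap.id (g ∘ₗ f) := by
  have := hg.comp hf
  rwa [DGVect.sgn_comp_sgn] at this

end Comp

lemma Homotopy.colin' {M N : DGComod C} {f g : M ⟶ N} (H : Homotopy f g) : Colin C.sgn H.h :=
  H.colin

/-! ### Shifts -/

/-- The shift of a morphism. -/
def Hom.shift {M N : DGComod C} (f : M ⟶ N) (n : ℤ) : M.shift n ⟶ N.shift n where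
  lin := f.lin
  mem := fun hx => f.mem hx
  comm := f.comm
  colin := f.colin

lemma Hom.shift_homotopic {M N : DGComod C} {f g : M ⟶ N} (h : homotopic C f g) (n : ℤ) :
    homotopic C (Hom.shift f n) (Hom.shift g n) := by
  obtain ⟨H⟩ := h
  exact ⟨⟨H.h, fun {j x} hx => by
    have : H.h x ∈ N.gr (n + j - 1) := H.mem (n := n + j) (x := x) hx
    rwa [add_sub_assoc] at this, H.colin, H.eq⟩⟩

/-- Morphisms `M[n] ⟶ N` are the same as morphisms `M ⟶ N[-n]`. -/
def Hom.toShift {M N : DGComod C} {n : ℤ} (f : M.shift n ⟶ N) : M ⟶ N.shift (-n) where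
  lin := f.lin
  mem := fun {j x} hx => f.mem (n := -n + j) (x := x) (by simpa using hx)
  comm := f.comm
  colin := f.colin

/-- Morphisms `M ⟶ N[-n]` are the same as morphisms `M[n] ⟶ N`. -/
def Hom.ofShift {M N : DGComod C} {n : ℤ} (f : M ⟶ N.shift (-n)) : M.shift n ⟶ N where
  lin := f.lin
  mem := fun {j x} hx => by
    have := f.mem (n := n + j) (x := x) hx
    simpa using this
  comm := f.comm
  colin := f.colin

lemma Hom.toShift_homotopic_iff {M N : DGComod C} {n : ℤ} (f g : M.shift n ⟶ N) :
    homotopic C (Hom.toShift f) (Hom.toShift g) ↔ homotopic C f g := by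
  constructor
  · rintro ⟨H⟩
    exact ⟨⟨H.h, fun {j x} hx => by
      have : H.h x ∈ N.gr (-n + (n + j - 1)) := H.mem (n := n + j) (x := x) hx
      rwa [show -n + (n + j - 1) = j - 1 by ring] at this, H.colin, H.eq⟩⟩
  · rintro ⟨H⟩
    exact ⟨⟨H.h, fun {j x} hx => by
      have : H.h x ∈ N.gr (-n + j - 1) := H.mem (n := -n + j) (x := x) (by simpa using hx)
      rwa [show -n + j - 1 = -n + (j - 1) by ring] at this, H.colin, H.eq⟩⟩

/-- `M[a][b] ⟶ M[c]` for `a + b = c`. -/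
def shiftShift (M : DGComod C) {a b c : ℤ} (h : a + b = c) : (M.shift a).shift b ⟶ M.shift c where
  lin := LinearMap.id
  mem := fun {j x} hx => by
    have : x ∈ M.gr (a + (b + j)) := hx
    rwa [← add_assoc, h] at this
  comm := fun _ => rfl
  colin := colin_id M

/-- `M[a][b] ⟶ M` for `a + b = 0`. -/
def shiftShiftZero (M : DGComod C) {a b : ℤ} (h : a + b = 0) : (M.shift a).shift b ⟶ M where
  lin := LinearMap.id
  mem := fun {j x} hx => by
    have : x ∈ M.gr (a + (b + j)) := hx
    rwa [← add_assoc, h, zero_add] at this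
  comm := fun _ => rfl
  colin := colin_id M

lemma IsQuasiIso.shift {M N : DGComod C} {f : M ⟶ N} (hf : IsQuasiIso f) (n : ℤ) :
    IsQuasiIso (Hom.shift f n) := by
  rw [isQuasiIso_iff] at hf ⊢
  exact hf


/-! ### Cones -/

section Cone

variable {M N : DGComod C} (f : M ⟶ N)

/-- The cone of `f`, as an object whose underlying product is not unfolded. -/
def Co : DGComod C := cone f

/-- The first projection of the cone. -/
def coneFst : (Co f).carrier →ₗ[k] M.carrier := LinearMap.fst k M.carrier N.carrier

/-- The second projection of the cone. -/
def coneSnd : (Co f).carrier →ₗ[k] N.carrier := LinearMap.snd k M.carrier N.carrier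

/-- The inclusion of the source in the cone. -/
def coneInl : M.carrier →ₗ[k] (Co f).carrier := LinearMap.inl k M.carrier N.carrier

/-- The inclusion of the target in the cone. -/
def coneInr : N.carrier →ₗ[k] (Co f).carrier := LinearMap.inr k M.carrier N.carrier

@[simp] lemma coneFst_inl (x : M.carrier) : coneFst f (coneInl f x) = x := rfl
@[simp] lemma coneFst_inr (x : N.carrier) : coneFst f (coneInr f x) = 0 := rfl
@[simp] lemma coneSnd_inl (x : M.carrier) : coneSnd f (coneInl f x) = 0 := rfl
@[simp] lemma coneSnd_inr (x : N.carrier) : coneSnd f (coneInr f x) = x := rfl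
@[simp] lemma coneFst_d (x : (Co f).carrier) :
    coneFst f ((Co f).d x) = -M.d (coneFst f x) := rfl
@[simp] lemma coneSnd_d (x : (Co f).carrier) :
    coneSnd f ((Co f).d x) = f.lin (coneFst f x) + N.d (coneSnd f x) := rfl
lemma cone_ext {x y : (Co f).carrier} (h1 : coneFst f x = coneFst f y)
    (h2 : coneSnd f x = coneSnd f y) : x = y := Prod.ext h1 h2
lemma mem_cone_gr {n : ℤ} {x : (Co f).carrier} :
    x ∈ (Co f).gr n ↔ coneFst f x ∈ M.gr (n + 1) ∧ coneSnd f x ∈ N.gr n := Iff.rfl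
lemma cone_eq (x : (Co f).carrier) :
    x = coneInl f (coneFst f x) + coneInr f (coneSnd f x) :=
  cone_ext f (by simp) (by simp)

lemma coneInl_mem {n : ℤ} {x : M.carrier} (hx : x ∈ M.gr (n + 1)) :
    coneInl f x ∈ (Co f).gr n := (mem_cone_gr f).2 ⟨by simpa using hx, by simp⟩

lemma coneInr_mem {n : ℤ} {x : N.carrier} (hx : x ∈ N.gr n) :
    coneInr f x ∈ (Co f).gr n := (mem_cone_gr f).2 ⟨by simp, by simpa using hx⟩

lemma cone_d_inl (x : M.carrier) :
    (Co f).d (coneInl f x) = -coneInl f (M.d x) + coneInr f (f.lin x) :=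
  cone_ext f (by simp) (by simp)

lemma cone_d_inr (x : N.carrier) : (Co f).d (coneInr f x) = coneInr f (N.d x) :=
  cone_ext f (by simp) (by simp)

lemma Co_coact (x : (Co f).carrier) : (Co f).coact.lin x =
    TensorProduct.map C.sgn (coneInl f) (M.coact.lin (coneFst f x)) +
    TensorProduct.map LinearMap.id (coneInr f) (N.coact.lin (coneSnd f x)) := rfl

lemma colin_coneInl : Colin C.sgn (coneInl f) := fun x => by
  rw [Co_coact]
  simp

lemma colin_coneInr : Colin LinearMap.id (coneInr f) := fun x => by
  rw [Co_coact]
  simp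

lemma colin_coneFst : Colin C.sgn (coneFst f) := fun x => by
  have h1 : coneFst f ∘ₗ coneInl f = LinearMap.id := rfl
  have h2 : coneFst f ∘ₗ coneInr f = 0 := rfl
  rw [Co_coact, map_add, ← LinearMap.comp_apply (TensorProduct.map _ _),
    ← LinearMap.comp_apply (TensorProduct.map _ (coneFst f)) (TensorProduct.map _ (coneInr f)),
    ← TensorProduct.map_comp, ← TensorProduct.map_comp, C.sgn_comp_sgn, h1, h2]
  simp

lemma colin_coneSnd : Colin LinearMap.id (coneSnd f) := fun x => by
  have h1 : coneSnd f ∘ₗ coneInl f = 0 := rfl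
  have h2 : coneSnd f ∘ₗ coneInr f = LinearMap.id := rfl
  rw [Co_coact, map_add, ← LinearMap.comp_apply (TensorProduct.map _ _),
    ← LinearMap.comp_apply (TensorProduct.map _ (coneSnd f)) (TensorProduct.map _ (coneInr f)),
    ← TensorProduct.map_comp, ← TensorProduct.map_comp, h1, h2]
  simp

/-- The inclusion `N ⟶ Co(f)`. -/
def coneι : N ⟶ Co f where
  lin := coneInr f
  mem := coneInr_mem f
  comm := fun x => (cone_d_inr f x).symm
  colin := colin_coneInr f

/-- The projection `Co(f) ⟶ M[1]`. -/
def coneδ : Co f ⟶ M.shift 1 where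
  -- In the cone the copy of `M` carries `-d` and a Koszul-signed coaction, whereas `M.shift 1`
  -- carries neither sign. The sign operator intertwines the two conventions.
  lin := M.sgn ∘ₗ coneFst f
  mem := fun {n x} hx => by
    have : coneFst f x ∈ M.gr (1 + n) := by rw [add_comm]; exact hx.1
    exact M.sgn_mem this
  comm := fun x => by
    change M.sgn (coneFst f ((Co f).d x)) = M.d (M.sgn (coneFst f x))
    rw [M.d_sgn, coneFst_d, map_neg]
  colin := (colin_sgn M).comp_odd_odd (colin_coneFst f)

@[simp] lemma coneι_lin : (coneι f).lin = coneInr f := rfl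

variable {f}

/-- Maps into a cone. -/
def coneLift {A : DGComod C} (a : A.carrier →ₗ[k] M.carrier) (b : A.carrier →ₗ[k] N.carrier)
    (ham : ∀ {n : ℤ} {x}, x ∈ A.gr n → a x ∈ M.gr (n + 1))
    (hbm : ∀ {n : ℤ} {x}, x ∈ A.gr n → b x ∈ N.gr n)
    (ha : Colin C.sgn a) (hb : Colin LinearMap.id b)
    (had : ∀ x, a (A.d x) = -M.d (a x)) (hbd : ∀ x, b (A.d x) = f.lin (a x) + N.d (b x)) :
    A ⟶ Co f where
  lin := coneInl f ∘ₗ a + coneInr f ∘ₗ b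
  mem := fun hx => add_mem (coneInl_mem f (ham hx)) (coneInr_mem f (hbm hx))
  comm := fun x => cone_ext f (by simp [had]) (by simp [hbd])
  colin := ((colin_coneInl f).comp_odd_odd ha).add ((colin_coneInr f).comp_even_even hb)

/-- Maps out of a cone. -/
def coneDesc {A : DGComod C} (a : M.carrier →ₗ[k] A.carrier) (b : N.carrier →ₗ[k] A.carrier)
    (ham : ∀ {n : ℤ} {x}, x ∈ M.gr n → a x ∈ A.gr (n - 1))
    (hbm : ∀ {n : ℤ} {x}, x ∈ N.gr n → b x ∈ A.gr n)
    (ha : Colin C.sgn a) (hb : Colin LinearMap.id b)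
    (had : ∀ x, A.d (a x) = b (f.lin x) - a (M.d x)) (hbd : ∀ x, b (N.d x) = A.d (b x)) :
    Co f ⟶ A where
  lin := a ∘ₗ coneFst f + b ∘ₗ coneSnd f
  mem := fun {n x} hx => add_mem (by simpa using ham ((mem_cone_gr f).1 hx).1) (hbm hx.2)
  comm := fun x => by
    simp only [LinearMap.add_apply, LinearMap.comp_apply, coneFst_d, coneSnd_d, map_neg, map_add,
      had, hbd]
    abel
  colin := (ha.comp_odd_odd (colin_coneFst f)).add (hb.comp_even_even (colin_coneSnd f))

variable (f)

/-- The inclusion of `M` in the cone is the null homotopy, since its boundary is `f` followed by the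
inclusion of `N`. -/
lemma comp_coneι : homotopic C (f ≫ coneι f) 0 :=
  ⟨⟨coneInl f, fun {n x} hx => coneInl_mem f (by simpa using hx), colin_coneInl f,
    fun x => by simp [cone_d_inl]⟩⟩

lemma coneι_comp : coneι f ≫ coneδ f = 0 :=
  hom_ext (LinearMap.ext fun x => by
    change M.sgn (coneFst f (coneInr f x)) = 0
    simp)

lemma coneδ_comp : homotopic C (coneδ f ≫ Hom.shift f 1) 0 :=
  ⟨⟨N.sgn ∘ₗ coneSnd f, fun {n x} hx => by
      have : coneSnd f x ∈ N.gr (1 + (n - 1)) := by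
        simpa using ((mem_cone_gr f).1 hx).2
      exact N.sgn_mem this, (colin_sgn N).comp_odd_even (colin_coneSnd f), fun x => by
      have h1 : f.lin (M.sgn (coneFst f x)) = N.sgn (f.lin (coneFst f x)) := f.toHom.sgn _
      have h2 : (coneδ f ≫ Hom.shift f 1).lin x = f.lin (M.sgn (coneFst f x)) := rfl
      rw [h2, h1]
      simp only [zero_lin, LinearMap.zero_apply, sub_zero, LinearMap.comp_apply,
        coneSnd_d, map_add, N.d_sgn]
      abel⟩⟩

variable (A : DGComod C)

/-- A null homotopy with values in the cone has two components: the first is the desired chain map,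
the second a homotopy from its composite with `f` to the given map. This lemma and the five after it
express the exactness of Hom on the triangle of a cone. -/
lemma exists_comp_of_comp_coneι (g : A ⟶ N) (h : homotopic C (g ≫ coneι f) 0) :
    ∃ g' : A ⟶ M, homotopic C (g' ≫ f) g := by
  obtain ⟨K⟩ := h
  have hK : ∀ x, coneInr f (g.lin x) = K.h (A.d x) + (Co f).d (K.h x) := fun x => by
    simpa using K.eq x
  have h1 : ∀ x, coneFst f (K.h (A.d x)) = M.d (coneFst f (K.h x)) := fun x => by
    have := congrArg (coneFst f) (hK x)
    simp only [coneFst_inr, map_add, coneFst_d] at this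
    rw [eq_comm, ← sub_eq_add_neg, sub_eq_zero] at this
    exact this
  have h2 : ∀ x, g.lin x = coneSnd f (K.h (A.d x)) +
      (f.lin (coneFst f (K.h x)) + N.d (coneSnd f (K.h x))) := fun x => by
    simpa using congrArg (coneSnd f) (hK x)
  refine ⟨{ lin := coneFst f ∘ₗ K.h
            mem := fun hx => by simpa using ((mem_cone_gr f).1 (K.mem hx)).1
            comm := h1
            colin := (colin_coneFst f).comp_odd_odd K.colin' },
    Congruence.equivalence.symm ⟨⟨coneSnd f ∘ₗ K.h, fun hx => (K.mem hx).2,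
      (colin_coneSnd f).comp_even_odd K.colin', fun x => ?_⟩⟩⟩
  simp only [comp_lin, LinearMap.comp_apply]
  rw [h2]
  abel

/-- A contraction `a` of the first component of `g` can be pushed into the second: subtracting `f a`
makes that component a chain map, and `a` followed by the inclusion of `M` is the homotopy. -/
lemma exists_comp_of_comp_coneδ (g : A ⟶ Co f) (h : homotopic C (g ≫ coneδ f) 0) :
    ∃ g' : A ⟶ N, homotopic C (g' ≫ coneι f) g := by
  obtain ⟨K⟩ := h
  have hK : ∀ x, M.sgn (coneFst f (g.lin x)) = K.h (A.d x) + M.d (K.h x) := fun x => by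
    have := K.eq x
    simp only [zero_lin, LinearMap.zero_apply, sub_zero] at this
    exact this
  let a : A.carrier →ₗ[k] M.carrier := M.sgn ∘ₗ K.h
  have ha : ∀ x, coneFst f (g.lin x) = a (A.d x) - M.d (a x) := fun x => by
    rw [← M.sgn_sgn (coneFst f (g.lin x)), hK, map_add]
    change _ = M.sgn (K.h (A.d x)) - M.d (M.sgn (K.h x))
    rw [M.d_sgn]
    abel
  have hac : Colin LinearMap.id a := (colin_sgn M).comp_odd_odd (N := M) (f := K.h) K.colin'
  have ham : ∀ {n : ℤ} {x}, x ∈ A.gr n → a x ∈ M.gr n := fun {n x} hx => by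
    have := K.mem hx
    have h2 : K.h x ∈ M.gr n := by simpa using this
    exact M.sgn_mem h2
  have hg : ∀ x, coneSnd f (g.lin (A.d x)) =
      f.lin (coneFst f (g.lin x)) + N.d (coneSnd f (g.lin x)) := fun x => by
    rw [g.comm, coneSnd_d]
  refine ⟨{ lin := coneSnd f ∘ₗ g.lin - f.lin ∘ₗ a
            mem := fun hx => sub_mem (g.mem hx).2 (f.mem (ham hx))
            comm := fun x => ?_
            colin := ((colin_coneSnd f).comp_even_even g.colin').sub ((f.colin').comp_even_even hac) },
    Congruence.equivalence.symm ⟨⟨coneInl f ∘ₗ a, fun {n x} hx =>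
      coneInl_mem f (by simpa using ham hx), (colin_coneInl f).comp_odd_even hac, fun x => ?_⟩⟩⟩
  · simp only [LinearMap.sub_apply, LinearMap.comp_apply, map_sub, hg, ha]
    rw [f.comm]
    abel
  · refine cone_ext f ?_ ?_
    · simp [cone_d_inl, ha]
      abel
    · simp [cone_d_inl]

/-- A map to the cone amounts to a map to `M[1]` together with a null homotopy of its composite with
`f`. This is why the factorization holds on the nose. -/
lemma exists_comp_of_comp_shift (g : A ⟶ M.shift 1) (h : homotopic C (g ≫ Hom.shift f 1) 0) :
    ∃ g' : A ⟶ Co f, g' ≫ coneδ f = g := by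
  obtain ⟨K⟩ := h
  have hK : ∀ x, f.lin (g.lin x) = K.h (A.d x) + N.d (K.h x) := fun x => by
    have := K.eq x
    simp only [zero_lin, LinearMap.zero_apply, sub_zero] at this
    exact this
  refine ⟨coneLift (f := f) (M.sgn ∘ₗ g.lin) (N.sgn ∘ₗ K.h) (fun {n x} hx => ?_)
    (fun {n x} hx => ?_) ((colin_sgn M).comp_odd_even (N := M) (f := g.lin) g.colin')
    ((colin_sgn N).comp_odd_odd (N := N) (f := K.h) K.colin') (fun x => ?_) (fun x => ?_), ?_⟩
  · have h1 : g.lin x ∈ M.gr (1 + n) := g.mem hx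
    rw [add_comm] at h1
    exact M.sgn_mem h1
  · have h1 : K.h x ∈ N.gr (1 + (n - 1)) := K.mem hx
    exact N.sgn_mem (by simpa using h1)
  · change M.sgn (g.lin (A.d x)) = -M.d (M.sgn (g.lin x))
    rw [M.d_sgn, neg_neg, g.comm]
  · have h1 : f.lin (M.sgn (g.lin x)) = N.sgn (f.lin (g.lin x)) := f.toHom.sgn _
    change N.sgn (K.h (A.d x)) = f.lin (M.sgn (g.lin x)) + N.d (N.sgn (K.h x))
    rw [h1, hK, map_add, N.d_sgn]
    abel
  · refine hom_ext (LinearMap.ext fun x => ?_)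
    change M.sgn (M.sgn (g.lin x) + 0) = _
    rw [add_zero]
    exact M.sgn_sgn _

lemma exists_coneι_comp (g : N ⟶ A) (h : homotopic C (f ≫ g) 0) :
    ∃ g' : Co f ⟶ A, coneι f ≫ g' = g := by
  obtain ⟨K⟩ := h
  refine ⟨coneDesc (f := f) K.h g.lin K.mem g.mem K.colin' g.colin' (fun x => ?_) g.comm,
    hom_ext (LinearMap.ext fun x => ?_)⟩
  · have := K.eq x
    simp only [zero_lin, LinearMap.zero_apply, sub_zero] at this
    rw [eq_sub_iff_add_eq, add_comm]
    exact this.symm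
  · simp [coneDesc]

/-- The restriction of `g` to the copy of `M` is a chain map up to `g` composed with `f` on `N`;
subtracting the null homotopy `K` composed with `f` repairs this. -/
lemma exists_coneδ_comp (g : Co f ⟶ A) (h : homotopic C (coneι f ≫ g) 0) :
    ∃ g' : M.shift 1 ⟶ A, homotopic C (coneδ f ≫ g') g := by
  obtain ⟨K⟩ := h
  have hK : ∀ x, g.lin (coneInr f x) = K.h (N.d x) + A.d (K.h x) := fun x => by
    simpa using K.eq x
  let G : M.carrier →ₗ[k] A.carrier := (g.lin ∘ₗ coneInl f - K.h ∘ₗ f.lin) ∘ₗ M.sgn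
  have hG : ∀ m, G m = g.lin (coneInl f (M.sgn m)) - K.h (f.lin (M.sgn m)) := fun m => rfl
  refine ⟨{ lin := G
            mem := fun {n x} hx => ?_
            comm := fun x => ?_
            colin := ?_ },
    Congruence.equivalence.symm ⟨⟨K.h ∘ₗ coneSnd f, fun {n x} hx => K.mem hx.2,
      Colin.comp_odd_even K.colin' (colin_coneSnd f), fun x => ?_⟩⟩⟩
  · have hx' : M.sgn x ∈ M.gr (n + 1) := M.sgn_mem (by rw [add_comm]; exact hx)
    refine sub_mem (g.mem (n := n) (coneInl_mem f hx')) ?_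
    have := K.mem (f.mem hx')
    simpa using this
  · change G (M.d x) = A.d (G x)
    rw [hG, hG, map_sub, ← g.comm, cone_d_inl, M.d_sgn, map_neg, neg_neg, map_add, hK,
      ← f.comm, M.d_sgn, map_neg, map_neg]
    abel
  · exact ((g.colin'.comp_even_odd (colin_coneInl f)).sub
      (Colin.comp_odd_even K.colin' f.colin')).comp_odd_odd (colin_sgn M)
  · change g.lin x - G (M.sgn (coneFst f x)) =
      K.h (coneSnd f ((Co f).d x)) + A.d (K.h (coneSnd f x))
    rw [hG, M.sgn_sgn, coneSnd_d, map_add]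
    have h2 := congrArg g.lin (cone_eq f x)
    rw [map_add, hK] at h2
    rw [h2]
    abel

lemma exists_shift_comp (g : M.shift 1 ⟶ A) (h : homotopic C (coneδ f ≫ g) 0) :
    ∃ g' : N.shift 1 ⟶ A, homotopic C (Hom.shift f 1 ≫ g') g := by
  obtain ⟨K⟩ := h
  have hK : ∀ x, g.lin (M.sgn (coneFst f x)) = K.h ((Co f).d x) + A.d (K.h x) := fun x => by
    have := K.eq x
    simp only [zero_lin, LinearMap.zero_apply, sub_zero] at this
    exact this
  refine ⟨{ lin := K.h ∘ₗ coneInr f ∘ₗ N.sgn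
            mem := fun {n x} hx => ?_
            comm := fun x => ?_
            colin := ?_ },
    Congruence.equivalence.symm ⟨⟨K.h ∘ₗ coneInl f ∘ₗ M.sgn, fun {n x} hx => ?_, ?_,
      fun x => ?_⟩⟩⟩
  · have hx' : N.sgn x ∈ N.gr (n + 1) := N.sgn_mem (by rw [add_comm]; exact hx)
    have := K.mem (n := n + 1) (coneInr_mem f hx')
    simpa using this
  · have h1 := hK (coneInr f (N.sgn x))
    rw [coneFst_inr, map_zero, map_zero, cone_d_inr, N.d_sgn, map_neg, map_neg] at h1
    exact (neg_add_eq_zero.1 h1.symm)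
  · exact Colin.comp_odd_odd K.colin' ((colin_coneInr f).comp_even_odd (colin_sgn N))
  · have hx' : M.sgn x ∈ M.gr (n + 1) := M.sgn_mem (by rw [add_comm]; exact hx)
    exact K.mem (n := n) (coneInl_mem f hx')
  · exact Colin.comp_odd_even K.colin' ((colin_coneInl f).comp_odd_odd (colin_sgn M))
  · have h1 := hK (coneInl f (M.sgn x))
    rw [coneFst_inl, M.sgn_sgn, cone_d_inl, M.d_sgn, map_neg, neg_neg, map_add] at h1
    have h3 : f.lin (M.sgn x) = N.sgn (f.lin x) := f.toHom.sgn x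
    change g.lin x - K.h (coneInr f (N.sgn (f.lin x))) =
      K.h (coneInl f (M.sgn (M.d x))) + A.d (K.h (coneInl f (M.sgn x)))
    rw [h1, h3]
    abel

end Cone

end DGComod

/-! ### Functoriality of cones and short exact sequences -/

namespace DGComod

variable {C : DGCoalg k}

section ConeMap

variable {M N M' N' : DGComod C} {f : M ⟶ N} {f' : M' ⟶ N'}

/-- The morphism of cones induced by a square which commutes up to homotopy. -/
def coneMap (a : M ⟶ M') (b : N ⟶ N') (H : Homotopy (f ≫ b) (a ≫ f')) : Co f ⟶ Co f' where
  lin := coneInl f' ∘ₗ a.lin ∘ₗ coneFst f + coneInr f' ∘ₗ (b.lin ∘ₗ coneSnd f + H.h ∘ₗ coneFst f)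
  mem := fun {n x} hx => add_mem (coneInl_mem f' (a.mem ((mem_cone_gr f).1 hx).1))
    (coneInr_mem f' (add_mem (b.mem hx.2) (by simpa using H.mem ((mem_cone_gr f).1 hx).1)))
  comm := fun x => by
    have := H.eq (coneFst f x)
    simp only [comp_lin, LinearMap.comp_apply] at this
    refine cone_ext f' ?_ ?_
    · simp [a.comm]
    · simp only [LinearMap.add_apply, LinearMap.comp_apply, coneFst_d, coneSnd_d, map_neg, map_add,
        coneSnd_inl, coneSnd_inr, coneFst_inl, coneFst_inr, b.comm]
      rw [sub_eq_iff_eq_add] at this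
      rw [this]
      simp only [map_zero, neg_zero, add_zero, zero_add]
      abel
  colin := ((colin_coneInl f').comp_odd_odd (a.colin'.comp_even_odd (colin_coneFst f))).add
    ((colin_coneInr f').comp_even_even ((b.colin'.comp_even_even (colin_coneSnd f)).add
      (Colin.comp_odd_odd H.colin' (colin_coneFst f))))

lemma coneFst_coneMap (a : M ⟶ M') (b : N ⟶ N') (H : Homotopy (f ≫ b) (a ≫ f')) (x) :
    coneFst f' ((coneMap a b H).lin x) = a.lin (coneFst f x) := by
  simp [coneMap]

lemma coneSnd_coneMap (a : M ⟶ M') (b : N ⟶ N') (H : Homotopy (f ≫ b) (a ≫ f')) (x) :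
    coneSnd f' ((coneMap a b H).lin x) = b.lin (coneSnd f x) + H.h (coneFst f x) := by
  simp [coneMap]

lemma coneι_coneMap (a : M ⟶ M') (b : N ⟶ N') (H : Homotopy (f ≫ b) (a ≫ f')) :
    coneι f ≫ coneMap a b H = b ≫ coneι f' :=
  hom_ext (LinearMap.ext fun x => by
    refine cone_ext f' ?_ ?_
    · rw [comp_lin, LinearMap.comp_apply, coneFst_coneMap]
      simp
    · rw [comp_lin, LinearMap.comp_apply, coneSnd_coneMap]
      simp)

lemma coneMap_coneδ (a : M ⟶ M') (b : N ⟶ N') (H : Homotopy (f ≫ b) (a ≫ f')) :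
    coneMap a b H ≫ coneδ f' = coneδ f ≫ Hom.shift a 1 :=
  hom_ext (LinearMap.ext fun x => by
    change M'.sgn (coneFst f' ((coneMap a b H).lin x)) = a.lin (M.sgn (coneFst f x))
    rw [coneFst_coneMap]
    exact (a.toHom.sgn _).symm)

/-- The five lemma for the homology of the two cones, carried out on elements; `hH` records the
failure of the square to commute strictly. -/
lemma IsQuasiIso.coneMap {a : M ⟶ M'} {b : N ⟶ N'} (ha : IsQuasiIso a) (hb : IsQuasiIso b)
    (H : Homotopy (f ≫ b) (a ≫ f')) : IsQuasiIso (coneMap a b H) := by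
  rw [isQuasiIso_iff] at *
  obtain ⟨ai, as⟩ := ha
  obtain ⟨bi, bs⟩ := hb
  have hH : ∀ x, b.lin (f.lin x) = f'.lin (a.lin x) + (H.h (M.d x) + N'.d (H.h x)) := fun x => by
    have := H.eq x
    rw [sub_eq_iff_eq_add'] at this
    exact this
  constructor
  · intro x hx y hy
    have hx1 : M.d (coneFst f x) = 0 := by
      have := congrArg (coneFst f) hx
      rw [coneFst_d, map_zero, neg_eq_zero] at this
      exact this
    have hx2 : f.lin (coneFst f x) + N.d (coneSnd f x) = 0 := by
      have := congrArg (coneSnd f) hx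
      rwa [coneSnd_d, map_zero] at this
    have hy1 := congrArg (coneFst f') hy
    have hy2 := congrArg (coneSnd f') hy
    rw [coneFst_coneMap, coneFst_d] at hy1
    rw [coneSnd_coneMap, coneSnd_d] at hy2
    obtain ⟨m2, hm2⟩ := ai _ hx1 (-coneFst f' y) (by rw [hy1, map_neg])
    have hm3 : M'.d (coneFst f' y + a.lin m2) = 0 := by
      rw [map_add, ← a.comm, hm2, hy1]
      abel
    -- The primitive `m2` of the first component is only determined up to a cycle. The cycle `m4`
    -- corrects it so that the second component becomes a boundary too.
    obtain ⟨m4, hm4, m5, hm5⟩ := as _ hm3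
    have hn4 : N.d (coneSnd f x + f.lin m2 - f.lin m4) = 0 := by
      rw [map_sub, map_add, ← f.comm, ← f.comm, hm2, hm4, map_zero, sub_zero, add_comm]
      exact hx2
    have e1 := hH m2
    have e2 := hH m4
    rw [hm2] at e1
    rw [hm4, map_zero, zero_add] at e2
    have e3 := congrArg f'.lin hm5
    rw [map_sub, map_add, f'.comm] at e3
    obtain ⟨n4, hn4⟩ := bi _ hn4
      (coneSnd f' y + H.h m2 - H.h m4 + f'.lin m5) (by
        rw [map_sub, map_add, map_add, map_sub, map_add, e1, e2, ← e3,
          eq_sub_of_add_eq hy2]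
        abel)
    refine ⟨coneInl f (m4 - m2) + coneInr f n4, cone_ext f ?_ ?_⟩
    · simp [hm4, hm2]
    · simp [hn4]
  · intro y hy
    have hy1 : M'.d (coneFst f' y) = 0 := by
      have := congrArg (coneFst f') hy
      rw [coneFst_d, map_zero, neg_eq_zero] at this
      exact this
    have hy2 : f'.lin (coneFst f' y) + N'.d (coneSnd f' y) = 0 := by
      have := congrArg (coneSnd f') hy
      rwa [coneSnd_d, map_zero] at this
    obtain ⟨m, hm, z, hz⟩ := as _ hy1
    have e3 := congrArg f'.lin hz
    rw [map_sub, f'.comm] at e3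
    have e2 := hH m
    rw [hm, map_zero, zero_add] at e2
    obtain ⟨n0, hn0⟩ := bi (f.lin m) (by rw [← f.comm, hm, map_zero])
      (-coneSnd f' y + H.h m - f'.lin z) (by
        rw [e2, map_sub, map_add, map_neg, ← e3, eq_neg_of_add_eq_zero_left hy2]
        abel)
    obtain ⟨n1, hn1, z1, hz1⟩ := bs (coneSnd f' y + b.lin n0 - H.h m + f'.lin z) (by
        rw [map_add, map_sub, map_add, ← b.comm, hn0, e2, ← e3,
          eq_neg_of_add_eq_zero_left hy2]
        abel)
    refine ⟨coneInl f m + coneInr f (n1 - n0), cone_ext f ?_ ?_,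
      coneInl f' (-z) + coneInr f' z1, cone_ext f' ?_ ?_⟩
    · simp [hm]
    · simp [hn0, hn1]
    · rw [map_sub, coneFst_coneMap]
      simp [hz]
    · rw [map_sub, coneSnd_coneMap]
      simp [← hz1]
      abel

end ConeMap

section

variable {M N : DGComod C}

/-- The elementary form of the long exact homology sequence of the cone. It converts
quasi-isomorphisms into acyclic objects, which over a field are linearly contractible. -/
lemma isQuasiIso_iff_acyclic (f : M ⟶ N) : IsQuasiIso f ↔ (Co f).Acyclic := by
  rw [isQuasiIso_iff]
  constructor
  · rintro ⟨hi, hs⟩ x hx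
    have hx1 : M.d (coneFst f x) = 0 := by
      have := congrArg (coneFst f) hx
      rw [coneFst_d, map_zero, neg_eq_zero] at this
      exact this
    have hx2 : f.lin (coneFst f x) + N.d (coneSnd f x) = 0 := by
      have := congrArg (coneSnd f) hx
      rwa [coneSnd_d, map_zero] at this
    obtain ⟨z, hz⟩ := hi _ hx1 (-coneSnd f x) (by rw [map_neg, eq_neg_of_add_eq_zero_left hx2])
    obtain ⟨y, hy, w, hw⟩ := hs (coneSnd f x + f.lin z) (by
      rw [map_add, ← f.comm, hz, add_comm, hx2])
    refine ⟨coneInl f (y - z) + coneInr f w, cone_ext f ?_ ?_⟩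
    · simp [hy, hz]
    · simp [← hw]
  · intro h
    constructor
    · intro x hx y hy
      obtain ⟨z, hz⟩ := h (coneInl f x - coneInr f y) (cone_ext f (by simp [hx]) (by simp [hy]))
      refine ⟨-coneFst f z, ?_⟩
      have := congrArg (coneFst f) hz
      simpa using this
    · intro y hy
      obtain ⟨z, hz⟩ := h (coneInr f y) (cone_ext f (by simp) (by simp [hy]))
      have h1 := congrArg (coneFst f) hz
      have h2 := congrArg (coneSnd f) hz
      rw [coneFst_d, coneFst_inr, neg_eq_zero] at h1
      rw [coneSnd_d, coneSnd_inr] at h2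
      exact ⟨coneFst f z, h1, coneSnd f z, by rw [← h2]; abel⟩

variable {P : DGComod C}

/-- A short exact sequence of comodules. -/
structure ShortExact (i : M ⟶ N) (p : N ⟶ P) : Prop where
  zero : i ≫ p = 0
  injective : Function.Injective i.lin
  exact : ∀ x, p.lin x = 0 → ∃ y, i.lin y = x
  surjective : Function.Surjective p.lin

lemma ShortExact.apply {i : M ⟶ N} {p : N ⟶ P} (h : ShortExact i p) (x) : p.lin (i.lin x) = 0 :=
  LinearMap.congr_fun (congrArg (fun f : M ⟶ P => f.lin) h.zero) x

/-- The comparison of the cone of `i` with the cokernel. -/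
def ShortExact.fromCone {i : M ⟶ N} {p : N ⟶ P} (h : ShortExact i p) : Co i ⟶ P :=
  coneDesc (f := i) 0 p.lin (fun _ => by simp) p.mem (Colin.zero _) p.colin'
    (fun x => by simp [h.apply]) p.comm

/-- A diagram chase on elements, using exactness of the underlying vector spaces only: the sequence
need not split colinearly. -/
lemma ShortExact.fromCone_isQuasiIso {i : M ⟶ N} {p : N ⟶ P} (h : ShortExact i p) :
    IsQuasiIso h.fromCone := by
  have hf : ∀ x, h.fromCone.lin x = p.lin (coneSnd i x) := fun x => by
    simp [fromCone, coneDesc]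
  rw [isQuasiIso_iff]
  constructor
  · intro x hx c hc
    rw [hf] at hc
    have hx2 : i.lin (coneFst i x) + N.d (coneSnd i x) = 0 := by
      have := congrArg (coneSnd i) hx
      rwa [coneSnd_d, map_zero] at this
    obtain ⟨b1, rfl⟩ := h.surjective c
    obtain ⟨a1, ha1⟩ := h.exact (coneSnd i x - N.d b1) (by rw [map_sub, hc, p.comm, sub_self])
    have e : coneFst i x = -M.d a1 := by
      apply h.injective
      rw [eq_neg_of_add_eq_zero_left hx2, map_neg, i.comm, ha1, map_sub, N.d_d, sub_zero]
    refine ⟨coneInl i a1 + coneInr i b1, cone_ext i ?_ ?_⟩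
    · simp [e]
    · simp [ha1]
  · intro c hc
    obtain ⟨b, rfl⟩ := h.surjective c
    obtain ⟨a, ha⟩ := h.exact (N.d b) (by rw [p.comm, hc])
    refine ⟨coneInl i (-a) + coneInr i b, cone_ext i ?_ ?_, 0, ?_⟩
    · have : M.d a = 0 := h.injective (by rw [i.comm, ha, N.d_d, map_zero])
      simp [this]
    · simp [ha]
    · rw [hf]
      simp

/-- The comparison of the shifted kernel with the cone of `p`. -/
def ShortExact.toCone {i : M ⟶ N} {p : N ⟶ P} (h : ShortExact i p) : M.shift 1 ⟶ Co p where
  lin := coneInl p ∘ₗ i.lin ∘ₗ M.sgn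
  mem := fun {n x} hx => by
    have hx' : x ∈ M.gr (n + 1) := by rw [add_comm]; exact hx
    exact coneInl_mem p (i.mem (M.sgn_mem hx'))
  comm := fun x => by
    change coneInl p (i.lin (M.sgn (M.d x))) = (Co p).d (coneInl p (i.lin (M.sgn x)))
    rw [cone_d_inl, h.apply, ← i.comm, M.d_sgn]
    simp
  colin := (colin_coneInl p).comp_odd_odd (M := M) (i.colin'.comp_even_odd (colin_sgn M))

/-- The rotated form of `fromCone_isQuasiIso`: up to a shift, the kernel is the cone of the
surjection, so a triangulated class that contains the last two terms contains the first. -/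
lemma ShortExact.toCone_isQuasiIso {i : M ⟶ N} {p : N ⟶ P} (h : ShortExact i p) :
    IsQuasiIso h.toCone := by
  have hf : ∀ x : M.carrier, h.toCone.lin x = coneInl p (i.lin (M.sgn x)) := fun x => rfl
  rw [isQuasiIso_iff]
  constructor
  · intro x hx y hy
    rw [hf] at hy
    have h1 := congrArg (coneFst p) hy
    have h2 := congrArg (coneSnd p) hy
    rw [coneFst_inl, coneFst_d] at h1
    rw [coneSnd_inl, coneSnd_d] at h2
    obtain ⟨b1, hb1⟩ := h.surjective (coneSnd p y)
    rw [← hb1, ← p.comm, ← map_add] at h2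
    obtain ⟨a1, ha1⟩ := h.exact _ h2.symm
    refine ⟨M.sgn a1, ?_⟩
    have e : M.sgn x = -M.d a1 := by
      apply h.injective
      rw [h1, map_neg, i.comm, ha1, map_add, N.d_d, add_zero]
    change M.d (M.sgn a1) = x
    rw [M.d_sgn, ← map_neg, ← e, M.sgn_sgn]
  · intro y hy
    have h1 := congrArg (coneFst p) hy
    have h2 := congrArg (coneSnd p) hy
    rw [coneFst_d, map_zero, neg_eq_zero] at h1
    rw [coneSnd_d, map_zero] at h2
    obtain ⟨b1, hb1⟩ := h.surjective (coneSnd p y)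
    rw [← hb1, ← p.comm, ← map_add] at h2
    obtain ⟨a, ha⟩ := h.exact _ h2
    have ha0 : M.d a = 0 := h.injective (by
      rw [i.comm, ha, map_add, N.d_d, h1, add_zero, map_zero])
    refine ⟨M.sgn a, ?_, coneInl p b1, cone_ext p ?_ ?_⟩
    · change M.d (M.sgn a) = 0
      rw [M.d_sgn, ha0]
      simp
    · rw [hf, M.sgn_sgn, map_sub, coneFst_inl, ha]
      simp
    · rw [hf, map_sub, coneSnd_inl]
      simp [hb1]

/-- The triangle of a cone is, up to a shift, a short exact sequence. -/
lemma shortExact_cone (f : M ⟶ N) : ShortExact (coneι f) (coneδ f) where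
  zero := coneι_comp f
  injective := fun x y h => by
    have := congrArg (coneSnd f) h
    simpa using this
  exact := fun x hx => by
    have h1 : coneFst f x = 0 := by
      rw [← M.sgn_sgn (coneFst f x)]
      change M.sgn ((coneδ f).lin x) = 0
      rw [hx, map_zero]
    exact ⟨coneSnd f x, cone_ext f (by simp [h1]) (by simp)⟩
  surjective := fun x => ⟨coneInl f (M.sgn x), by
    change M.sgn (coneFst f (coneInl f (M.sgn x))) = x
    rw [coneFst_inl]
    exact M.sgn_sgn x⟩

end

/-! ### Exactness of the homotopy category -/

section Exact

variable {M N : DGComod C} (f : M ⟶ N) (A : DGComod C)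


/-- The three covariant sequences are the rows of the five lemma in `fullyFaithfulAt_cone_right`,
the three contravariant ones those in `fullyFaithfulAt_cone_left`. -/
lemma exact_coyoneda₁ : Function.Exact (Preadditive.rightComp ((toHCat C).obj A) ((toHCat C).map f))
    (Preadditive.rightComp ((toHCat C).obj A) ((toHCat C).map (coneι f))) := by
  intro y
  obtain ⟨g, rfl⟩ := exists_toHCat_map y
  constructor
  · intro h
    change (toHCat C).map g ≫ (toHCat C).map (coneι f) = 0 at h
    rw [← Functor.map_comp, toHCat_eq_zero_iff] at h
    obtain ⟨g', hg'⟩ := exists_comp_of_comp_coneι f A g h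
    exact ⟨(toHCat C).map g', by
      change (toHCat C).map g' ≫ (toHCat C).map f = _
      rw [← Functor.map_comp, toHCat_eq_iff]
      exact hg'⟩
  · rintro ⟨g', hg'⟩
    rw [← hg']
    change (g' ≫ (toHCat C).map f) ≫ (toHCat C).map (coneι f) = 0
    rw [Category.assoc, ← Functor.map_comp, (toHCat_eq_zero_iff _).2 (comp_coneι f),
      Limits.comp_zero]

lemma exact_coyoneda₂ : Function.Exact (Preadditive.rightComp ((toHCat C).obj A) ((toHCat C).map (coneι f)))
    (Preadditive.rightComp ((toHCat C).obj A) ((toHCat C).map (coneδ f))) := by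
  intro y
  obtain ⟨g, rfl⟩ := exists_toHCat_map y
  constructor
  · intro h
    change (toHCat C).map g ≫ (toHCat C).map (coneδ f) = 0 at h
    rw [← Functor.map_comp, toHCat_eq_zero_iff] at h
    obtain ⟨g', hg'⟩ := exists_comp_of_comp_coneδ f A g h
    exact ⟨(toHCat C).map g', by
      change (toHCat C).map g' ≫ (toHCat C).map _ = _
      rw [← Functor.map_comp, toHCat_eq_iff]
      exact hg'⟩
  · rintro ⟨g', hg'⟩
    rw [← hg']
    change (g' ≫ (toHCat C).map (coneι f)) ≫ (toHCat C).map (coneδ f) = 0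
    rw [Category.assoc, ← Functor.map_comp, coneι_comp, Functor.map_zero, Limits.comp_zero]

lemma exact_coyoneda₃ : Function.Exact (Preadditive.rightComp ((toHCat C).obj A) ((toHCat C).map (coneδ f)))
    (Preadditive.rightComp ((toHCat C).obj A) ((toHCat C).map (Hom.shift f 1))) := by
  intro y
  obtain ⟨g, rfl⟩ := exists_toHCat_map y
  constructor
  · intro h
    change (toHCat C).map g ≫ (toHCat C).map (Hom.shift f 1) = 0 at h
    rw [← Functor.map_comp, toHCat_eq_zero_iff] at h
    obtain ⟨g', hg'⟩ := exists_comp_of_comp_shift f A g h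
    exact ⟨(toHCat C).map g', by
      change (toHCat C).map g' ≫ (toHCat C).map _ = _
      rw [← Functor.map_comp, hg']⟩
  · rintro ⟨g', hg'⟩
    rw [← hg']
    change (g' ≫ (toHCat C).map (coneδ f)) ≫ (toHCat C).map (Hom.shift f 1) = 0
    rw [Category.assoc, ← Functor.map_comp, (toHCat_eq_zero_iff _).2 (coneδ_comp f),
      Limits.comp_zero]

lemma exact_yoneda₁ : Function.Exact (Preadditive.leftComp ((toHCat C).obj A) ((toHCat C).map (coneι f)))
    (Preadditive.leftComp ((toHCat C).obj A) ((toHCat C).map f)) := by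
  intro y
  obtain ⟨g, rfl⟩ := exists_toHCat_map y
  constructor
  · intro h
    change (toHCat C).map f ≫ (toHCat C).map g = 0 at h
    rw [← Functor.map_comp, toHCat_eq_zero_iff] at h
    obtain ⟨g', hg'⟩ := exists_coneι_comp f A g h
    exact ⟨(toHCat C).map g', by
      change (toHCat C).map _ ≫ (toHCat C).map g' = _
      rw [← Functor.map_comp, hg']⟩
  · rintro ⟨g', hg'⟩
    rw [← hg']
    change (toHCat C).map f ≫ (toHCat C).map (coneι f) ≫ g' = 0
    rw [← Category.assoc, ← Functor.map_comp, (toHCat_eq_zero_iff _).2 (comp_coneι f),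
      Limits.zero_comp]

lemma exact_yoneda₂ : Function.Exact (Preadditive.leftComp ((toHCat C).obj A) ((toHCat C).map (coneδ f)))
    (Preadditive.leftComp ((toHCat C).obj A) ((toHCat C).map (coneι f))) := by
  intro y
  obtain ⟨g, rfl⟩ := exists_toHCat_map y
  constructor
  · intro h
    change (toHCat C).map _ ≫ (toHCat C).map g = 0 at h
    rw [← Functor.map_comp, toHCat_eq_zero_iff] at h
    obtain ⟨g', hg'⟩ := exists_coneδ_comp f A g h
    exact ⟨(toHCat C).map g', by
      change (toHCat C).map _ ≫ (toHCat C).map g' = _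
      rw [← Functor.map_comp, toHCat_eq_iff]
      exact hg'⟩
  · rintro ⟨g', hg'⟩
    rw [← hg']
    change (toHCat C).map (coneι f) ≫ (toHCat C).map (coneδ f) ≫ g' = 0
    rw [← Category.assoc, ← Functor.map_comp, coneι_comp, Functor.map_zero, Limits.zero_comp]

lemma exact_yoneda₃ : Function.Exact (Preadditive.leftComp ((toHCat C).obj A) ((toHCat C).map (Hom.shift f 1)))
    (Preadditive.leftComp ((toHCat C).obj A) ((toHCat C).map (coneδ f))) := by
  intro y
  obtain ⟨g, rfl⟩ := exists_toHCat_map y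
  constructor
  · intro h
    change (toHCat C).map _ ≫ (toHCat C).map g = 0 at h
    rw [← Functor.map_comp, toHCat_eq_zero_iff] at h
    obtain ⟨g', hg'⟩ := exists_shift_comp f A g h
    exact ⟨(toHCat C).map g', by
      change (toHCat C).map _ ≫ (toHCat C).map g' = _
      rw [← Functor.map_comp, toHCat_eq_iff]
      exact hg'⟩
  · rintro ⟨g', hg'⟩
    rw [← hg']
    change (toHCat C).map (coneδ f) ≫ (toHCat C).map (Hom.shift f 1) ≫ g' = 0
    rw [← Category.assoc, ← Functor.map_comp, (toHCat_eq_zero_iff _).2 (coneδ_comp f),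
      Limits.zero_comp]

end Exact

end DGComod

namespace DGComod

variable {C : DGCoalg k}

/-! ### Closed comodules -/

/-- If precomposition with quasi-isomorphisms is bijective on `Hom_{H(C)}(-, N)`, then `N` is
closed. -/
lemma isClosed_of_local {N : DGComod C} (h : ∀ {A B : DGComod C} (s : A ⟶ B), IsQuasiIso s →
    Function.Bijective (fun f : (toHCat C).obj B ⟶ (toHCat C).obj N => (toHCat C).map s ≫ f)) :
    N.IsClosed := by
  -- The representable functor of `N` inverts quasi-isomorphisms, so it extends to the derived
  -- category. There it recovers a morphism to `N` from its image, which gives injectivity.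
  have hinv : (quasiIsos C).IsInvertedBy (yoneda.obj ((toHCat C).obj N)).rightOp := by
    rintro ⟨A⟩ ⟨B⟩ _ ⟨s, rfl, hs⟩
    have : IsIso ((yoneda.obj ((toHCat C).obj N)).map ((toHCat C).map s).op) :=
      (isIso_iff_bijective _).2 (h s hs)
    change IsIso ((yoneda.obj ((toHCat C).obj N)).map ((toHCat C).map s).op).op
    infer_instance
  intro M
  constructor
  · intro f g hfg
    let e := Localization.fac (yoneda.obj ((toHCat C).obj N)).rightOp hinv (toDCat C)
    have key : ∀ f : (toHCat C).obj M ⟶ (toHCat C).obj N,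
        (yoneda.obj ((toHCat C).obj N)).rightOp.map f = e.inv.app _ ≫
          (Localization.lift (yoneda.obj ((toHCat C).obj N)).rightOp hinv (toDCat C)).map
            ((toDCat C).map f) ≫ e.hom.app _ := fun f => by
      rw [← Functor.comp_map, e.hom.naturality, Iso.inv_hom_id_app_assoc]
    have h1 : (yoneda.obj ((toHCat C).obj N)).map f.op =
        (yoneda.obj ((toHCat C).obj N)).map g.op := by
      have : (yoneda.obj ((toHCat C).obj N)).rightOp.map f =
        (yoneda.obj ((toHCat C).obj N)).rightOp.map g := by
        rw [key, key]
        simp only at hfg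
        rw [hfg]
      exact Quiver.Hom.op_inj this
    have h2 := congrArg (fun φ => φ (𝟙 ((toHCat C).obj N))) h1
    simpa using h2
  · intro g
    -- For surjectivity: `P` consists of the morphisms along which "coming from `H(C)`" can be
    -- pulled back, for morphisms to `N`. It is stable under composition and contains the images of
    -- morphisms of `H(C)` and the formal inverses, hence everything; it is then applied to the
    -- identity of `N`.
    let P : MorphismProperty (DCat C) := fun A B g =>
      ∀ φ : B ⟶ (toDCat C).obj ((toHCat C).obj N),
        (∃ φ' : (Localization.Construction.objEquiv (quasiIsos C)).symm B ⟶ (toHCat C).obj N,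
          (toDCat C).map φ' = φ) →
        ∃ φ' : (Localization.Construction.objEquiv (quasiIsos C)).symm A ⟶ (toHCat C).obj N,
          (toDCat C).map φ' = g ≫ φ
    have hP : P = ⊤ := by
      have : P.IsStableUnderComposition := ⟨fun g g' hg hg' φ hφ => by
        rw [Category.assoc]
        exact hg _ (hg' φ hφ)⟩
      refine Localization.Construction.morphismProperty_eq_top P ?_ ?_
      · rintro A B f φ ⟨φ', rfl⟩
        exact ⟨f ≫ φ', (toDCat C).map_comp (Z := (toHCat C).obj N) f φ'⟩
      · rintro ⟨A⟩ ⟨B⟩ w ⟨s, rfl, hs⟩ φ ⟨φ', rfl⟩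
        obtain ⟨ψ, hψ⟩ := (h s hs).2 φ'
        refine ⟨ψ, ?_⟩
        have h1 : (toDCat C).map ((toHCat C).map s) ≫ (toDCat C).map ψ = (toDCat C).map φ' :=
          ((toDCat C).map_comp _ _).symm.trans (congrArg (toDCat C).map hψ)
        exact ((Iso.eq_inv_comp (Localization.Construction.wIso ((toHCat C).map s)
          ⟨s, rfl, hs⟩)).2 h1)
    have hg : P g := by rw [hP]; trivial
    obtain ⟨φ', h'⟩ := hg (𝟙 _) ⟨𝟙 _, CategoryTheory.Functor.map_id _ _⟩
    exact ⟨φ', h'.trans (Category.comp_id _)⟩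

/-- In `D(C)` precomposition with `s` is bijective because `s` is invertible, and closedness
transports this to `H(C)`. -/
lemma IsClosed.bijective_comp {N : DGComod C} (hN : N.IsClosed) {A B : DGComod C} (s : A ⟶ B)
    (hs : IsQuasiIso s) :
    Function.Bijective (fun f : (toHCat C).obj B ⟶ (toHCat C).obj N => (toHCat C).map s ≫ f) := by
  have := hs.isIso
  have h1 : Function.Bijective (fun f : (chainToDCat C).obj B ⟶ (chainToDCat C).obj N =>
      (chainToDCat C).map s ≫ f) :=
    ⟨fun f g h => (cancel_epi _).1 h, fun f => ⟨inv ((chainToDCat C).map s) ≫ f, by simp⟩⟩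
  refine (Function.Bijective.of_comp_iff' (hN A) _).1 ?_
  convert h1.comp (hN B) using 1
  ext f
  simp

/-- A morphism between shifts as a morphism between the unshifted comodules. -/
def Hom.unshift {M N : DGComod C} {n : ℤ} (f : M.shift n ⟶ N.shift n) : M ⟶ N where
  lin := f.lin
  mem := fun {j x} hx => by
    have := f.mem (n := j - n) (x := x) (by simpa using hx)
    simpa using this
  comm := f.comm
  colin := f.colin

lemma Hom.shift_homotopic_iff {M N : DGComod C} {f g : M ⟶ N} {n : ℤ} :
    homotopic C (Hom.shift f n) (Hom.shift g n) ↔ homotopic C f g := by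
  refine ⟨?_, fun h => Hom.shift_homotopic h n⟩
  rintro ⟨H⟩
  exact ⟨⟨H.h, fun {j x} hx => by
    have : H.h x ∈ N.gr (n + (j - n - 1)) := H.mem (n := j - n) (x := x) (by simpa using hx)
    rwa [show n + (j - n - 1) = j - 1 by ring] at this, H.colin, H.eq⟩⟩

lemma shift_null {N : DGComod C}
    (h : ∀ A : DGComod C, A.Acyclic → ∀ f : A ⟶ N, homotopic C f 0) (n : ℤ)
    (A : DGComod C) (hA : A.Acyclic) (f : A ⟶ N.shift n) : homotopic C f 0 := by
  let g : A.shift (-n) ⟶ N :=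
    { lin := f.lin
      mem := fun {j x} hx => by
        have := f.mem (n := -n + j) (x := x) hx
        simpa using this
      comm := f.comm
      colin := f.colin }
  obtain ⟨H⟩ := h (A.shift (-n)) hA g
  exact ⟨⟨H.h, fun {j x} hx => by
    have : H.h x ∈ N.gr (n + j - 1) := H.mem (n := n + j) (x := x) (by simpa using hx)
    rwa [add_sub_assoc] at this, H.colin, H.eq⟩⟩

/-- The zero endomorphism of an acyclic object is a quasi-isomorphism, so a closed target admits
only null-homotopic maps from it. Conversely the cone of a quasi-isomorphism is acyclic, and the
exact sequences of the cone make precomposition bijective. This is the criterion used to prove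
closedness in practice. -/
lemma isClosed_iff {N : DGComod C} : N.IsClosed ↔
    ∀ A : DGComod C, A.Acyclic → ∀ f : A ⟶ N, homotopic C f 0 := by
  constructor
  · intro hN A hA f
    have h0 : IsQuasiIso (0 : A ⟶ A) := by
      rw [isQuasiIso_iff]
      refine ⟨fun x hx _ _ => hA x hx, fun y hy => ?_⟩
      obtain ⟨z, rfl⟩ := hA y hy
      exact ⟨0, by simp, z, by simp⟩
    have := (hN.bijective_comp _ h0).1 (a₁ := (toHCat C).map f) (a₂ := 0) (by simp)
    rwa [toHCat_eq_zero_iff] at this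
  · intro h
    refine isClosed_of_local fun {A B} s hs => ?_
    have hco := (isQuasiIso_iff_acyclic s).1 hs
    constructor
    · intro f g hfg
      rw [← sub_eq_zero]
      obtain ⟨φ, hφ⟩ := exists_toHCat_map (f - g)
      rw [← hφ]
      have h1 : homotopic C (s ≫ φ) 0 := by
        rw [← toHCat_eq_zero_iff, Functor.map_comp, hφ, Preadditive.comp_sub, sub_eq_zero]
        exact hfg
      obtain ⟨ψ, hψ⟩ := exists_coneι_comp s N φ h1
      rw [← hψ, Functor.map_comp, (toHCat_eq_zero_iff _).2 (h _ hco ψ),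
        Limits.comp_zero]
    · intro f
      obtain ⟨φ, rfl⟩ := exists_toHCat_map f
      -- The obstruction to extending `φ` along `s` is a map from the acyclic cone of `s` to `N[1]`,
      -- which is null-homotopic.
      obtain ⟨ψ, hψ⟩ := exists_shift_comp s (N.shift 1) (Hom.shift φ 1) (shift_null h 1 _ hco _)
      refine ⟨(toHCat C).map (Hom.unshift ψ), ?_⟩
      simp only
      rw [← Functor.map_comp, toHCat_eq_iff, ← Hom.shift_homotopic_iff (n := 1)]
      exact hψ

lemma IsClosed.shift {N : DGComod C} (hN : N.IsClosed) (n : ℤ) : (N.shift n).IsClosed :=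
  isClosed_iff.2 (shift_null (isClosed_iff.1 hN) n)

lemma IsClosed.cone {M N : DGComod C} (f : M ⟶ N) (hM : M.IsClosed) (hN : N.IsClosed) :
    (Co f).IsClosed := by
  refine isClosed_iff.2 fun A hA g => ?_
  obtain ⟨g', hg'⟩ := exists_comp_of_comp_coneδ f A g (isClosed_iff.1 (hM.shift 1) A hA _)
  rw [← toHCat_eq_zero_iff, ← (toHCat_eq_iff _ _).2 hg', Functor.map_comp,
    (toHCat_eq_zero_iff _).2 (isClosed_iff.1 hN A hA g'), Limits.zero_comp]

lemma IsClosed.of_retract {M N : DGComod C} (hN : N.IsClosed) (i : M ⟶ N) (r : N ⟶ M)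
    (h : homotopic C (i ≫ r) (𝟙 M)) : M.IsClosed := by
  refine isClosed_iff.2 fun A hA g => ?_
  rw [← toHCat_eq_zero_iff]
  have h1 := (toHCat_eq_iff _ _).2 h
  rw [Functor.map_comp, CategoryTheory.Functor.map_id] at h1
  rw [← Category.comp_id ((toHCat C).map g), ← h1, ← Category.assoc, ← Functor.map_comp,
    (toHCat_eq_zero_iff _).2 (isClosed_iff.1 hN A hA _), Limits.zero_comp]

lemma IsClosed.of_bijective {M N : DGComod C} (hM : M.IsClosed) (i : M ⟶ N)
    (hi : Function.Bijective i.lin) : N.IsClosed :=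
  have := isIso_of_bijective i hi
  hM.of_retract (inv i) i ((toHCat_eq_iff _ _).1 (by rw [IsIso.inv_hom_id]))

/-- Closedness of the source yields a left inverse to composition, and injectivity for the closed
target shows that it is two-sided. -/
lemma IsQuasiIso.isIso_toHCat {M N : DGComod C} {f : M ⟶ N} (hf : IsQuasiIso f) (hM : M.IsClosed)
    (hN : N.IsClosed) : IsIso ((toHCat C).map f) := by
  obtain ⟨g, hg⟩ := (hM.bijective_comp f hf).2 (𝟙 _)
  refine ⟨g, hg, (hN.bijective_comp f hf).1 ?_⟩
  simp only at hg ⊢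
  rw [← Category.assoc, hg, Category.id_comp, Category.comp_id]

lemma IsClosed.exists_map {M N : DGComod C} (hN : N.IsClosed)
    (e : (chainToDCat C).obj M ⟶ (chainToDCat C).obj N) : ∃ f : M ⟶ N, (chainToDCat C).map f = e := by
  obtain ⟨g, rfl⟩ := (hN M).2 e
  obtain ⟨f, rfl⟩ := exists_toHCat_map g
  exact ⟨f, rfl⟩

/-- Morphisms to a closed object lift to chain maps, and invertibility in `D(C)` is visible on
homology. -/
lemma IsClosed.exists_quasiIso {M N : DGComod C} (hN : N.IsClosed)
    (e : (chainToDCat C).obj M ≅ (chainToDCat C).obj N) :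
    ∃ f : M ⟶ N, IsQuasiIso f ∧ (chainToDCat C).map f = e.hom := by
  obtain ⟨f, hf⟩ := hN.exists_map e.hom
  exact ⟨f, IsQuasiIso.of_isIso f (by rw [hf]; infer_instance), hf⟩

end DGComod

/-! ### Vanishing of tensors for degree reasons -/

namespace DGVect

/-- If the first factor lives in degrees `≥ 0`, a tensor of degree `n` only involves second factors
of degree `≤ n`. This is the main form in which the positivity of the coalgebra is used. -/
lemma tensor_eq_zero {V W : DGVect k} (hV : V.Positive) {P : Type*} [AddCommGroup P] [Module k P]
    (f : V ⊗[k] W →ₗ[k] P) (n : ℤ)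
    (h : ∀ (q : ℤ), q ≤ n → ∀ x : V, ∀ y ∈ W.gr q, f (x ⊗ₜ[k] y) = 0)
    {t : V ⊗[k] W} (ht : t ∈ tensorGr V W n) : f t = 0 := by
  have := tensorGr_le V W f n ⊥ (fun p q hpq x hx y hy => ?_) ht
  · simpa using this
  · by_cases hp : p < 0
    · rw [hV p hp, Submodule.mem_bot] at hx
      simp [hx]
    · simpa using h q (by omega) x y hy

/-- A bijective map of degree `0` reflects degrees. -/
lemma mem_of_map_mem {V W : DGVect k} {f : V →ₗ[k] W} (hf : ∀ {n : ℤ} {x : V}, x ∈ V.gr n → f x ∈ W.gr n)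
    (hi : Function.Injective f) {n : ℤ} {x : V} (hx : f x ∈ W.gr n) : x ∈ V.gr n := by
  refine V.mem_of_proj fun m hm => hi ?_
  have := proj_map 0 (f := f) (fun {n x} hx => by simpa using hf hx) m x
  simp only [add_zero] at this
  rw [← this, map_zero, W.proj_of_mem_ne hx (Ne.symm hm)]

end DGVect

namespace DGComod

variable {C : DGCoalg k}

/-! ### Quasi-cofree comodules -/

/-- A presentation of the underlying graded comodule of `M` as a cofree comodule `C ⊗ T`. -/
structure Cogen (M : DGComod C) where
  T : DGVect k
  π : M.carrier →ₗ[k] T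
  mem : ∀ {n : ℤ} {x : M.carrier}, x ∈ M.gr n → π x ∈ T.gr n
  bij : Function.Bijective
    (TensorProduct.map (LinearMap.id : C.carrier →ₗ[k] C.carrier) π ∘ₗ M.coact.lin)

/-- The properties of the sign operator and the identity used for twisted colinear maps. -/
structure IsTwist (b : C.carrier →ₗ[k] C.carrier) : Prop where
  comul : ∀ x, C.comul.lin (b x) = TensorProduct.map b b (C.comul.lin x)
  counit : ∀ x, C.counit (b x) = C.counit x
  mem : ∀ {n : ℤ} {x : C.carrier}, x ∈ C.gr n → b x ∈ C.gr n

lemma isTwist_id : IsTwist (C := C) LinearMap.id :=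
  ⟨fun x => by simp, fun _ => rfl, fun h => h⟩

lemma isTwist_sgn : IsTwist (C := C) C.sgn :=
  ⟨colin_sgn C.self, C.counit_sgn, fun h => C.sgn_mem h⟩

namespace Cogen

variable {M : DGComod C} (G : M.Cogen)

/-- The isomorphism `M ≅ C ⊗ T`. -/
def equiv : M.carrier ≃ₗ[k] C.carrier ⊗[k] G.T.carrier := LinearEquiv.ofBijective _ G.bij

lemma equiv_apply (x : M.carrier) :
    G.equiv x = TensorProduct.map LinearMap.id G.π (M.coact.lin x) := rfl

lemma equiv_mem {n : ℤ} {x : M.carrier} (hx : x ∈ M.gr n) :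
    G.equiv x ∈ DGVect.tensorGr C.toDGVect G.T n := by
  refine DGVect.tensorGr_le C.toDGVect M.toDGVect (TensorProduct.map LinearMap.id G.π) n _
    (fun p q hpq c hc m hm => ?_) (M.coact.mem hx)
  exact DGVect.tmul_mem _ _ hpq hc (G.mem hm)

lemma mem_of_equiv_mem {n : ℤ} {x : M.carrier} (hx : G.equiv x ∈ DGVect.tensorGr C.toDGVect G.T n) :
    x ∈ M.gr n :=
  DGVect.mem_of_map_mem (V := M.toDGVect) (W := C.toDGVect.tensor G.T)
    (f := G.equiv.toLinearMap) (fun hx => G.equiv_mem hx) G.equiv.injective hx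

lemma counit_equiv (x : M.carrier) :
    TensorProduct.lid k _ (TensorProduct.map C.counit LinearMap.id (G.equiv x)) = G.π x := by
  have h : ∀ t : C.carrier ⊗[k] M.carrier, TensorProduct.lid k _ (TensorProduct.map C.counit
      LinearMap.id (TensorProduct.map LinearMap.id G.π t)) =
      G.π (TensorProduct.lid k _ (TensorProduct.map C.counit LinearMap.id t)) := by
    intro t
    induction t using TensorProduct.induction_on with
    | zero => simp
    | add a b ha hb => simp only [map_add, ha, hb]
    | tmul c m => simp
  rw [equiv_apply, h, M.counit_coact]

lemma equiv_colin (x : M.carrier) :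
    TensorProduct.map LinearMap.id G.equiv.toLinearMap (M.coact.lin x) =
      TensorProduct.assoc k _ _ _ (TensorProduct.map C.comul.lin LinearMap.id (G.equiv x)) := by
  have h1 : ∀ t : C.carrier ⊗[k] M.carrier,
      TensorProduct.map C.comul.lin LinearMap.id (TensorProduct.map LinearMap.id G.π t) =
      TensorProduct.map LinearMap.id G.π (TensorProduct.map C.comul.lin LinearMap.id t) := by
    intro t
    induction t using TensorProduct.induction_on with
    | zero => simp
    | add a b ha hb => simp only [map_add, ha, hb]
    | tmul c m => simp
  have h2 : ∀ t : C.carrier ⊗[k] (C.carrier ⊗[k] M.carrier),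
      TensorProduct.assoc k _ _ _ (TensorProduct.map LinearMap.id G.π
        ((TensorProduct.assoc k _ _ _).symm t)) =
      TensorProduct.map LinearMap.id (TensorProduct.map LinearMap.id G.π) t := by
    intro t
    induction t using TensorProduct.induction_on with
    | zero => simp
    | add a b ha hb => simp only [map_add, ha, hb]
    | tmul c t =>
      induction t using TensorProduct.induction_on with
      | zero => simp
      | add a b ha hb => simp only [TensorProduct.tmul_add, map_add, ha, hb]
      | tmul c m => simp
  rw [equiv_apply, h1, M.coact_coassoc, h2, TensorProduct.map_map]
  rfl

section Lift

variable {A : DGComod C} {b : C.carrier →ₗ[k] C.carrier}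

/-- The `b`-twisted colinear map with a given projection to the cogenerators. -/
def lift (b : C.carrier →ₗ[k] C.carrier) (g : A.carrier →ₗ[k] G.T.carrier) :
    A.carrier →ₗ[k] M.carrier :=
  G.equiv.symm.toLinearMap ∘ₗ TensorProduct.map b g ∘ₗ A.coact.lin

lemma equiv_lift (g : A.carrier →ₗ[k] G.T.carrier) (x : A.carrier) :
    G.equiv (G.lift b g x) = TensorProduct.map b g (A.coact.lin x) :=
  G.equiv.apply_symm_apply _

/-- Existence in the universal property of `C ⊗ T`, for maps twisted by `b` as well. Applying the
injective map `1 ⊗ equiv` turns the claim into the coassociativity of `A` and the compatibility of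
`b` with the comultiplication. -/
lemma colin_lift (hb : IsTwist b) (g : A.carrier →ₗ[k] G.T.carrier) : Colin b (G.lift b g) := by
  intro x
  have hinj : Function.Injective
      (TensorProduct.map (LinearMap.id : C.carrier →ₗ[k] C.carrier) G.equiv.toLinearMap) :=
    Module.Flat.lTensor_preserves_injective_linearMap _ G.equiv.injective
  apply hinj
  rw [equiv_colin, equiv_lift]
  have h1 : ∀ t : C.carrier ⊗[k] A.carrier,
      TensorProduct.map C.comul.lin LinearMap.id (TensorProduct.map b g t) =
      TensorProduct.map (TensorProduct.map b b) g (TensorProduct.map C.comul.lin LinearMap.id t) := by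
    intro t
    induction t using TensorProduct.induction_on with
    | zero => simp
    | add a b ha hb => simp only [map_add, ha, hb]
    | tmul c m => simp [hb.comul]
  have h2 : ∀ t : C.carrier ⊗[k] (C.carrier ⊗[k] A.carrier),
      TensorProduct.assoc k _ _ _ (TensorProduct.map (TensorProduct.map b b) g
        ((TensorProduct.assoc k _ _ _).symm t)) =
      TensorProduct.map b (TensorProduct.map b g) t := by
    intro t
    induction t using TensorProduct.induction_on with
    | zero => simp
    | add a b ha hb => simp only [map_add, ha, hb]
    | tmul c t =>
      induction t using TensorProduct.induction_on with
      | zero => simp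
      | add a b ha hb => simp only [TensorProduct.tmul_add, map_add, ha, hb]
      | tmul c m => simp
  have h3 : G.equiv.toLinearMap ∘ₗ G.lift b g = TensorProduct.map b g ∘ₗ A.coact.lin :=
    LinearMap.ext fun x => G.equiv_lift g x
  rw [h1, A.coact_coassoc, h2, TensorProduct.map_map, TensorProduct.map_map, h3, LinearMap.id_comp,
    LinearMap.comp_id]

lemma π_lift (hb : IsTwist b) (g : A.carrier →ₗ[k] G.T.carrier) (x : A.carrier) :
    G.π (G.lift b g x) = g x := by
  have h : ∀ t : C.carrier ⊗[k] A.carrier, TensorProduct.lid k _ (TensorProduct.map C.counit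
      LinearMap.id (TensorProduct.map b g t)) =
      g (TensorProduct.lid k _ (TensorProduct.map C.counit LinearMap.id t)) := by
    intro t
    induction t using TensorProduct.induction_on with
    | zero => simp
    | add a b ha hb => simp only [map_add, ha, hb]
    | tmul c m => simp [hb.counit]
  rw [← counit_equiv, equiv_lift, h, A.counit_coact]

lemma equiv_colin_map {f : A.carrier →ₗ[k] M.carrier} (hf : Colin b f) (x : A.carrier) :
    G.equiv (f x) = TensorProduct.map b (G.π ∘ₗ f) (A.coact.lin x) := by
  rw [equiv_apply, hf x, ← LinearMap.comp_apply, ← TensorProduct.map_comp, LinearMap.id_comp]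

/-- Uniqueness in the universal property: a colinear map `f` is recovered from `π f` as `(b ⊗ π f)
ρ`. -/
lemma eq_of_π {f g : A.carrier →ₗ[k] M.carrier} (hf : Colin b f) (hg : Colin b g)
    (h : ∀ x, G.π (f x) = G.π (g x)) : f = g := by
  ext x
  apply G.equiv.injective
  rw [G.equiv_colin_map hf, G.equiv_colin_map hg,
    show G.π ∘ₗ f = G.π ∘ₗ g from LinearMap.ext h]

lemma lift_mem (hb : IsTwist b) {e : ℤ} {g : A.carrier →ₗ[k] G.T.carrier}
    (hg : ∀ {n : ℤ} {x : A.carrier}, x ∈ A.gr n → g x ∈ G.T.gr (n + e)) {n : ℤ} {x : A.carrier}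
    (hx : x ∈ A.gr n) : G.lift b g x ∈ M.gr (n + e) := by
  apply G.mem_of_equiv_mem
  rw [equiv_lift]
  refine DGVect.tensorGr_le C.toDGVect A.toDGVect (TensorProduct.map b g) n _
    (fun p q hpq c hc m hm => ?_) (A.coact.mem hx)
  exact DGVect.tmul_mem _ _ (by omega) (hb.mem hc) (hg hm)

/-- A twisted colinear map vanishes in low degrees if its projection to the cogenerators does. -/
lemma eq_zero_of_π (hC : C.Positive) {f : A.carrier →ₗ[k] M.carrier} (hf : Colin b f) {n : ℤ}
    (h : ∀ q ≤ n, ∀ x ∈ A.gr q, G.π (f x) = 0) {q : ℤ} (hq : q ≤ n) {x : A.carrier}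
    (hx : x ∈ A.gr q) : f x = 0 := by
  apply G.equiv.injective
  rw [map_zero, G.equiv_colin_map hf]
  refine DGVect.tensor_eq_zero hC _ q (fun p hp c y hy => ?_) (A.coact.mem hx)
  rw [TensorProduct.map_tmul, LinearMap.comp_apply, h p (by omega) y hy, TensorProduct.tmul_zero]

end Lift

/-- Bounded below quasi-cofree comodules over a positively graded coalgebra are closed. -/
lemma isClosed (hC : C.Positive) (hT : G.T.BoundedBelow) : M.IsClosed := by
  refine isClosed_iff.2 fun A hA f => ?_
  obtain ⟨s, hs, hsd⟩ := hA.exists_contraction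
  obtain ⟨a, ha⟩ := hT
  -- One step of the construction: a map vanishing below degree `n` is changed by a homotopy, itself
  -- zero in degrees `≤ n`, into a map vanishing below `n + 1`.
  have step : ∀ (n : ℤ) (g : A ⟶ M), (∀ q < n, ∀ x ∈ A.gr q, g.lin x = 0) →
      ∃ (h : A.carrier →ₗ[k] M.carrier) (g' : A ⟶ M), Colin C.sgn h ∧
        (∀ {m : ℤ} {x : A.carrier}, x ∈ A.gr m → h x ∈ M.gr (m + -1)) ∧
        (∀ q ≤ n, ∀ x ∈ A.gr q, h x = 0) ∧ (∀ q < n + 1, ∀ x ∈ A.gr q, g'.lin x = 0) ∧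
        ∀ x, g.lin x = g'.lin x + (h (A.d x) + M.d (h x)) := by
    intro n g hg
    -- The linear null homotopy `g s` is not colinear; only its projection to the cogenerators is
    -- kept and lifted back. In degrees `≤ n` the error is `π d g s`, which vanishes since `s`
    -- lowers the degree.
    let h := G.lift C.sgn (G.π ∘ₗ g.lin ∘ₗ s)
    have hc : Colin C.sgn h := G.colin_lift isTwist_sgn _
    have hm : ∀ {m : ℤ} {x : A.carrier}, x ∈ A.gr m → h x ∈ M.gr (m + -1) :=
      fun hx => G.lift_mem isTwist_sgn (e := -1) (g := G.π ∘ₗ g.lin ∘ₗ s)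
        (fun hx => G.mem (g.mem (hs hx))) hx
    have hπ : ∀ x, G.π (h x) = G.π (g.lin (s x)) := G.π_lift isTwist_sgn _
    have h0 : ∀ q ≤ n, ∀ x ∈ A.gr q, h x = 0 := fun q hq x hx =>
      G.eq_zero_of_π hC hc (n := n) (fun q hq x hx => by
        rw [hπ, hg (q - 1) (by omega) _ (hs hx), map_zero]) hq hx
    let g' : A ⟶ M :=
      { lin := g.lin - (h ∘ₗ A.d + M.d ∘ₗ h)
        mem := fun {m x} hx => by
          refine sub_mem (g.mem hx) (add_mem ?_ ?_)
          · simpa using hm (A.d_mem hx)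
          · simpa using M.d_mem (hm hx)
        comm := fun x => by simp [A.d_d, M.d_d, g.comm]
        colin := (Hom.colin' g).sub hc.boundary }
    have hg' : ∀ x, g'.lin x = g.lin x - (h (A.d x) + M.d (h x)) := fun _ => rfl
    refine ⟨h, g', hc, hm, h0, fun q hq x hx => ?_, fun x => by rw [hg']; abel⟩
    refine G.eq_zero_of_π hC g'.colin' (n := n) (fun q hq x hx => ?_) (by omega) hx
    rw [hg', h0 q hq x hx, map_zero, add_zero, map_sub, hπ, ← map_sub, ← map_sub,
      show x - s (A.d x) = A.d (s x) from (eq_sub_of_add_eq' (hsd x)).symm, g.comm,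
      hg (q - 1) (by omega) _ (hs hx), map_zero, map_zero]
  choose! h g' hc hm h0 hg0 heq using step
  let F : ℕ → (A ⟶ M) := fun n => Nat.rec f (fun n g => g' (a + n) g) n
  have hF : ∀ n : ℕ, F (n + 1) = g' (a + n) (F n) := fun n => rfl
  have hF0 : ∀ n : ℕ, ∀ q < a + n, ∀ x ∈ A.gr q, (F n).lin x = 0 := by
    intro n
    induction n with
    | zero =>
      intro q hq x hx
      refine G.eq_zero_of_π hC f.colin' (n := a - 1) (fun q hq x hx => ?_)
        (by simp at hq; omega) hx
      have := G.mem (f.mem hx)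
      rwa [ha q (by omega), Submodule.mem_bot] at this
    | succ n ih =>
      intro q hq x hx
      rw [hF]
      exact hg0 (a + n) (F n) ih q (by push_cast at hq; omega) x hx
  let H : ℕ → A.carrier →ₗ[k] M.carrier := fun N => ∑ n ∈ Finset.range N, h (a + n) (F n)
  have hH : ∀ N, H (N + 1) = H N + h (a + N) (F N) := fun N => Finset.sum_range_succ _ _
  have hHc : ∀ N, Colin C.sgn (H N) := by
    intro N
    induction N with
    | zero => exact Colin.zero _
    | succ N ih => rw [hH]; exact ih.add (hc _ _ (hF0 N))
  have hHm : ∀ N, ∀ {m : ℤ} {x : A.carrier}, x ∈ A.gr m → H N x ∈ M.gr (m + -1) := by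
    intro N m x hx
    induction N with
    | zero => exact zero_mem _
    | succ N ih => rw [hH]; exact add_mem ih (hm _ _ (hF0 N) hx)
  have hfH : ∀ N x, f.lin x = (F N).lin x + (H N (A.d x) + M.d (H N x)) := by
    intro N x
    induction N with
    | zero => simp [H, F]
    | succ N ih =>
      rw [ih, heq _ _ (hF0 N), hF, hH]
      simp only [LinearMap.add_apply, map_add]
      abel
  have hHs : ∀ N N' : ℕ, N ≤ N' → ∀ q ≤ a + N, ∀ x ∈ A.gr q, H N' x = H N x := by
    intro N N' hN
    induction N', hN using Nat.le_induction with
    | base => intros; rfl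
    | succ N' hN ih =>
      intro q hq x hx
      rw [hH, LinearMap.add_apply, ih q hq x hx, h0 _ _ (hF0 N') q (by omega) x hx, add_zero]
  -- The homotopy with index `n` vanishes in degrees `≤ a + n`, so in degree `p` only the indices
  -- below `p - a` contribute: the infinite sum of homotopies is finite in each degree.
  let K : A.carrier →ₗ[k] M.carrier := A.glue fun p => H (p - a).toNat
  have hK : ∀ (p : ℤ) (N : ℕ), p ≤ a + N → ∀ x ∈ A.gr p, K x = H N x := by
    intro p N hp x hx
    rw [A.glue_of_mem _ hx]
    exact (hHs _ _ (by omega) p (by omega) x hx).symm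
  refine ⟨⟨K, fun {m x} hx => ?_, fun x => ?_, fun x => ?_⟩⟩
  · rw [hK m (m - a).toNat (by omega) x hx]
    exact hHm (m - a).toNat hx
  · have key : M.coact.lin ∘ₗ K = TensorProduct.map C.sgn K ∘ₗ A.coact.lin := by
      refine A.linearMap_ext fun p x hx => ?_
      have hN : p ≤ a + (p - a).toNat := by omega
      rw [LinearMap.comp_apply, hK p _ hN x hx, hHc, ← sub_eq_zero, LinearMap.comp_apply,
        ← LinearMap.sub_apply]
      refine DGVect.tensor_eq_zero hC _ p (fun q hq c y hy => ?_) (A.coact.mem hx)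
      rw [LinearMap.sub_apply, TensorProduct.map_tmul, TensorProduct.map_tmul,
        hK q (p - a).toNat (by omega) y hy, sub_self]
    exact LinearMap.congr_fun key x
  · have key : f.lin = K ∘ₗ A.d + M.d ∘ₗ K := by
      refine A.linearMap_ext fun p x hx => ?_
      have hN : p + 1 ≤ a + (p + 1 - a).toNat := by omega
      rw [LinearMap.add_apply, LinearMap.comp_apply, LinearMap.comp_apply,
        hK (p + 1) _ hN _ (A.d_mem hx), hK p (p + 1 - a).toNat (by omega) x hx, hfH (p + 1 - a).toNat,
        hF0 _ p (by omega) x hx, zero_add]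
    rw [zero_lin, LinearMap.zero_apply, sub_zero]
    exact LinearMap.congr_fun key x

lemma boundedBelow (hC : C.Positive) (hT : G.T.BoundedBelow) : M.BoundedBelow := by
  obtain ⟨a, ha⟩ := hC.boundedBelow.tensor hT
  refine ⟨a, fun n hn => (Submodule.eq_bot_iff _).2 fun x hx => ?_⟩
  have := (Submodule.eq_bot_iff _).1 (ha n hn) _ (G.equiv_mem hx)
  simpa using this

/-- The extension of a quasi-cofree comodule. -/
def tensor (V : DGVect k) : (M.tensor V).Cogen where
  T := G.T.tensor V
  π := TensorProduct.map G.π LinearMap.id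
  mem := fun {n x} hx => DGVect.tensorGr_le M.toDGVect V (TensorProduct.map G.π LinearMap.id) n _
    (fun p q hpq m hm v hv => DGVect.tmul_mem _ _ hpq (G.mem hm) hv) hx
  bij := by
    have h : ∀ (t : C.carrier ⊗[k] M.carrier) (v : V.carrier),
        TensorProduct.map LinearMap.id (TensorProduct.map G.π LinearMap.id)
          (TensorProduct.assoc k _ _ _ (t ⊗ₜ[k] v)) =
        TensorProduct.assoc k _ _ _ (TensorProduct.map LinearMap.id G.π t ⊗ₜ[k] v) := by
      intro t v
      induction t using TensorProduct.induction_on with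
      | zero => simp
      | add a b ha hb => simp only [TensorProduct.add_tmul, map_add, ha, hb]
      | tmul c m => simp
    have e : TensorProduct.map (LinearMap.id : C.carrier →ₗ[k] C.carrier)
        (TensorProduct.map G.π LinearMap.id) ∘ₗ (M.tensor V).coact.lin =
        ((G.equiv.rTensor V.carrier).trans (TensorProduct.assoc k _ _ _)).toLinearMap := by
      refine TensorProduct.ext' fun m v => ?_
      exact h _ _
    rw [e]
    exact LinearEquiv.bijective _

end Cogen

/-- The cofree comodule `C ⊗ V`. -/
abbrev cofree (C : DGCoalg k) (V : DGVect k) : DGComod C := C.self.tensor V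

/-- The cogenerators of the cofree comodule. -/
def cofreeCogen (V : DGVect k) : (cofree C V).Cogen where
  T := V
  π := (TensorProduct.lid k V.carrier).toLinearMap ∘ₗ TensorProduct.map C.counit LinearMap.id
  mem := fun {n x} hx => by
    refine DGVect.tensorGr_le C.toDGVect V _ n _ (fun p q hpq c hc v hv => ?_) hx
    change C.counit c • v ∈ V.gr n
    by_cases hp : p = 0
    · obtain rfl : q = n := by omega
      exact Submodule.smul_mem _ _ hv
    · rw [C.counit_of_mem hp hc, zero_smul]
      exact zero_mem _
  bij := by
    have h : ∀ (t : C.carrier ⊗[k] C.carrier) (v : V.carrier),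
        TensorProduct.map LinearMap.id ((TensorProduct.lid k V.carrier).toLinearMap ∘ₗ
          TensorProduct.map C.counit LinearMap.id) (TensorProduct.assoc k _ _ _ (t ⊗ₜ[k] v)) =
        TensorProduct.rid k _ (TensorProduct.map LinearMap.id C.counit t) ⊗ₜ[k] v := by
      intro t v
      induction t using TensorProduct.induction_on with
      | zero => simp
      | add a b ha hb => simp only [TensorProduct.add_tmul, map_add, ha, hb]
      | tmul c m => simp [TensorProduct.smul_tmul]
    have e : TensorProduct.map (LinearMap.id : C.carrier →ₗ[k] C.carrier)
        ((TensorProduct.lid k V.carrier).toLinearMap ∘ₗ TensorProduct.map C.counit LinearMap.id)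
        ∘ₗ (cofree C V).coact.lin = LinearMap.id := by
      refine TensorProduct.ext' fun m v => ?_
      refine (h _ _).trans ?_
      rw [C.comul_counit]
      rfl
    exact e ▸ Function.bijective_id

end DGComod

namespace DGVect

/-! ### Totalizations -/

section Sum

variable (V : ℕ → DGVect k)

/-- The grading of `⨁ₙ Vₙ[-n]`. -/
def sumGr (j : ℤ) : Submodule k (⨁ n, (V n).carrier) where
  carrier := {x | ∀ n : ℕ, x n ∈ (V n).gr (j - n)}
  add_mem' := fun ha hb n => by rw [DirectSum.add_apply]; exact add_mem (ha n) (hb n)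
  zero_mem' := fun n => by rw [DirectSum.zero_apply]; exact zero_mem _
  smul_mem' := fun c x hx n => by
    rw [DirectSum.smul_apply]; exact Submodule.smul_mem _ _ (hx n)

lemma lof_mem_sumGr {j : ℤ} {n : ℕ} {x : (V n).carrier} (hx : x ∈ (V n).gr (j - n)) :
    DirectSum.lof k ℕ (fun n => (V n).carrier) n x ∈ sumGr V j := by
  intro m
  by_cases h : n = m
  · subst h
    rw [DirectSum.lof_apply]
    exact hx
  · rw [DirectSum.lof_eq_of, DirectSum.of_eq_of_ne _ _ _ (Ne.symm h)]
    exact zero_mem _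

lemma lof_mem_sumGr_add {j : ℤ} {n : ℕ} {x : (V n).carrier} (hx : x ∈ (V n).gr j) :
    DirectSum.lof k ℕ (fun n => (V n).carrier) n x ∈ sumGr V (j + n) :=
  lof_mem_sumGr V (by simpa using hx)

lemma sumGr_isInternal : DirectSum.IsInternal (sumGr V) := by
  let pr : ℤ → (⨁ n, (V n).carrier) →ₗ[k] (⨁ n, (V n).carrier) := fun j =>
    DirectSum.lmap fun n => (V n).proj (j - n)
  have hpr : ∀ j x n, pr j x n = (V n).proj (j - n) (x n) := fun j x n =>
    DirectSum.lmap_apply _ _ _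
  refine isInternal_of_proj _ pr (fun n x hx => ?_) (fun m n hmn x hx => ?_) fun x => ?_
  · ext i
    rw [hpr, (V i).proj_of_mem (hx i)]
  · ext i
    rw [hpr, (V i).proj_of_mem_ne (hx i) (by omega)]
    rfl
  · induction x using DirectSum.induction_on with
    | zero => exact zero_mem _
    | add x y hx hy => exact add_mem hx hy
    | of i x =>
      induction x using (V i).homogeneous_induction with
      | h0 => rw [map_zero]; exact zero_mem _
      | hadd x y hx hy => rw [map_add]; exact add_mem hx hy
      | hh n x hx =>
        exact Submodule.mem_iSup_of_mem (n + i) (lof_mem_sumGr_add V hx)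

/-- The graded vector space `⨁ₙ Vₙ[-n]` with zero differential. -/
def gradedSum : DGVect k where
  carrier := ⨁ n, (V n).carrier
  gr := sumGr V
  isInternal := sumGr_isInternal V
  d := 0
  d_mem := fun _ => zero_mem _
  d_d := fun _ => rfl

/-- To check that a map out of `⨁ₙ Vₙ[-n]` respects degrees, the summands are enough. -/
lemma sumGr_le {P : Type*} [AddCommGroup P] [Module k P] (f : (⨁ n, (V n).carrier) →ₗ[k] P)
    {j : ℤ} (S : Submodule k P)
    (h : ∀ (n : ℕ) (x : (V n).carrier), x ∈ (V n).gr (j - n) →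
      f (DirectSum.lof k ℕ (fun n => (V n).carrier) n x) ∈ S) {x : ⨁ n, (V n).carrier}
    (hx : x ∈ sumGr V j) : f x ∈ S := by
  classical
  rw [← DirectSum.sum_support_of x, map_sum]
  exact Submodule.sum_mem _ fun n _ => h n _ (hx n)

end Sum

end DGVect

/-! ### Totalizations of complexes of comodules -/

namespace DGComod

variable {C : DGCoalg k}

/-- A complex of comodules. -/
structure CoCx (C : DGCoalg k) where
  I : ℕ → DGComod C
  δ : ∀ n, I n ⟶ I (n + 1)
  δ_δ : ∀ n, δ n ≫ δ (n + 1) = 0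

namespace CoCx

variable (K : CoCx C)

/-- The inclusion of a summand of the totalization. -/
abbrev inc (n : ℕ) : (K.I n).carrier →ₗ[k] ⨁ n, (K.I n).carrier :=
  DirectSum.lof k ℕ (fun n => (K.I n).carrier) n

/-- The differential of the totalization. -/
def totD : (⨁ n, (K.I n).carrier) →ₗ[k] ⨁ n, (K.I n).carrier :=
  DirectSum.toModule k ℕ _ fun n =>
    -- The sign makes the internal differential and `δ` anticommute.
    K.inc n ∘ₗ (K.I n).d + K.inc (n + 1) ∘ₗ (K.δ n).lin ∘ₗ (K.I n).sgn

lemma totD_inc (n : ℕ) (x : (K.I n).carrier) : K.totD (K.inc n x) =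
    K.inc n ((K.I n).d x) + K.inc (n + 1) ((K.δ n).lin ((K.I n).sgn x)) := by
  rw [totD, DirectSum.toModule_lof]
  rfl

lemma δ_δ_apply (n : ℕ) (x : (K.I n).carrier) : (K.δ (n + 1)).lin ((K.δ n).lin x) = 0 :=
  LinearMap.congr_fun (congrArg (fun f => f.lin) (K.δ_δ n)) x

/-- The coaction of the totalization. -/
def totCoact : (⨁ n, (K.I n).carrier) →ₗ[k] C.carrier ⊗[k] ⨁ n, (K.I n).carrier :=
  DirectSum.toModule k ℕ _ fun n => TensorProduct.map LinearMap.id (K.inc n) ∘ₗ (K.I n).coact.lin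

lemma totCoact_inc (n : ℕ) (x : (K.I n).carrier) : K.totCoact (K.inc n x) =
    TensorProduct.map LinearMap.id (K.inc n) ((K.I n).coact.lin x) := by
  rw [totCoact, DirectSum.toModule_lof]
  rfl

/-- The underlying complex of the totalization. -/
abbrev totVect : DGVect k where
  carrier := ⨁ n, (K.I n).carrier
  gr := DGVect.sumGr fun n => (K.I n).toDGVect
  isInternal := DGVect.sumGr_isInternal _
  d := K.totD
  d_mem := fun {j x} hx => by
    refine DGVect.sumGr_le (fun n => (K.I n).toDGVect) K.totD _ (fun n x hx => ?_) hx
    refine (K.totD_inc n x).symm ▸ add_mem (DGVect.lof_mem_sumGr _ ?_) (DGVect.lof_mem_sumGr _ ?_)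
    · rw [show j + 1 - n = j - n + 1 by ring]
      exact (K.I n).d_mem hx
    · rw [show j + 1 - ((n + 1 : ℕ) : ℤ) = j - n by push_cast; ring]
      exact (K.δ n).mem ((K.I n).sgn_mem hx)
  d_d := fun x => by
    have : K.totD ∘ₗ K.totD = 0 := by
      refine DirectSum.linearMap_ext _ fun n => LinearMap.ext fun x => ?_
      simp only [LinearMap.comp_apply, LinearMap.zero_apply]
      rw [totD_inc, map_add, totD_inc, totD_inc, (K.I n).d_d, ← (K.δ n).comm, (K.I n).d_sgn,
        ← (K.δ n).sgn, δ_δ_apply]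
      simp
    exact LinearMap.congr_fun this x

/-- The totalization of a complex of comodules. -/
abbrev tot : DGComod C where
  toDGVect := K.totVect
  coact :=
    { lin := K.totCoact
      mem := fun {j x} hx => by
        refine DGVect.sumGr_le (fun n => (K.I n).toDGVect) K.totCoact _ (fun n x hx => ?_) hx
        refine (K.totCoact_inc n x).symm ▸ ?_
        refine DGVect.tensorGr_le C.toDGVect (K.I n).toDGVect _ _ _ (fun p q hpq c hc m hm => ?_)
          ((K.I n).coact.mem hx)
        exact DGVect.tmul_mem C.toDGVect K.totVect (q := q + n) (by omega) hc
          (DGVect.lof_mem_sumGr_add _ hm)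
      comm := fun x => by
        have : K.totCoact ∘ₗ K.totVect.d = (C.toDGVect.tensor K.totVect).d ∘ₗ K.totCoact := by
          refine DirectSum.linearMap_ext _ fun n => LinearMap.ext fun x => ?_
          have h : TensorProduct.map LinearMap.id (K.inc n) ∘ₗ
                (C.toDGVect.tensor (K.I n).toDGVect).d +
              TensorProduct.map LinearMap.id (K.inc (n + 1)) ∘ₗ TensorProduct.map LinearMap.id
                (K.δ n).lin ∘ₗ TensorProduct.map C.sgn (K.I n).sgn =
              (C.toDGVect.tensor K.totVect).d ∘ₗ TensorProduct.map LinearMap.id (K.inc n) := by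
            refine TensorProduct.ext' fun c m => ?_
            change TensorProduct.map LinearMap.id (K.inc n)
              (C.d c ⊗ₜ[k] m + C.sgn c ⊗ₜ[k] (K.I n).d m) + C.sgn c ⊗ₜ[k] K.inc (n + 1)
              ((K.δ n).lin ((K.I n).sgn m)) = C.d c ⊗ₜ[k] K.inc n m +
                C.sgn c ⊗ₜ[k] K.totD (K.inc n m)
            rw [totD_inc, TensorProduct.tmul_add, map_add, add_assoc]
            rfl
          change K.totCoact (K.totD (K.inc n x)) = (C.toDGVect.tensor K.totVect).d
            (K.totCoact (K.inc n x))
          rw [totD_inc, map_add, totCoact_inc, totCoact_inc, totCoact_inc, (K.δ n).colin,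
            (K.I n).coact.comm, colin_sgn (K.I n)]
          exact LinearMap.congr_fun h _
        exact LinearMap.congr_fun this x }
  coact_coassoc := fun x => by
    have : TensorProduct.map C.comul.lin LinearMap.id ∘ₗ K.totCoact =
        (TensorProduct.assoc k C.carrier C.carrier _).symm.toLinearMap ∘ₗ
          TensorProduct.map LinearMap.id K.totCoact ∘ₗ K.totCoact := by
      refine DirectSum.linearMap_ext _ fun n => LinearMap.ext fun x => ?_
      simp only [LinearMap.comp_apply, LinearEquiv.coe_coe]
      rw [totCoact_inc, TensorProduct.map_map, TensorProduct.map_map,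
        show K.totCoact ∘ₗ K.inc n = TensorProduct.map LinearMap.id (K.inc n) ∘ₗ
          (K.I n).coact.lin from LinearMap.ext (K.totCoact_inc n)]
      have h1 : TensorProduct.map (C.comul.lin ∘ₗ LinearMap.id)
          (LinearMap.id ∘ₗ K.inc n) ((K.I n).coact.lin x) =
          TensorProduct.map LinearMap.id (K.inc n) (TensorProduct.map C.comul.lin LinearMap.id
            ((K.I n).coact.lin x)) := by
        rw [TensorProduct.map_map]
        rfl
      have h2 : ∀ t : C.carrier ⊗[k] (C.carrier ⊗[k] (K.I n).carrier),
          TensorProduct.map LinearMap.id (K.inc n)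
            ((TensorProduct.assoc k C.carrier C.carrier _).symm t) =
          (TensorProduct.assoc k C.carrier C.carrier _).symm
            (TensorProduct.map LinearMap.id (TensorProduct.map LinearMap.id (K.inc n)) t) := by
        intro t
        induction t using TensorProduct.induction_on with
        | zero => simp
        | add a b ha hb => simp only [map_add, ha, hb]
        | tmul c t =>
          induction t using TensorProduct.induction_on with
          | zero => simp
          | add a b ha hb => simp only [TensorProduct.tmul_add, map_add, ha, hb]
          | tmul c m => simp
      rw [h1, (K.I n).coact_coassoc, h2, TensorProduct.map_map]
    exact LinearMap.congr_fun this x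
  counit_coact := fun x => by
    have : (TensorProduct.lid k _).toLinearMap ∘ₗ TensorProduct.map C.counit LinearMap.id ∘ₗ
        K.totCoact = LinearMap.id := by
      refine DirectSum.linearMap_ext _ fun n => LinearMap.ext fun x => ?_
      simp only [LinearMap.comp_apply, LinearEquiv.coe_coe, LinearMap.id_apply]
      have h : ∀ t : C.carrier ⊗[k] (K.I n).carrier, TensorProduct.lid k _
          (TensorProduct.map C.counit LinearMap.id (TensorProduct.map LinearMap.id (K.inc n) t)) =
          K.inc n (TensorProduct.lid k _ (TensorProduct.map C.counit LinearMap.id t)) := by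
        intro t
        induction t using TensorProduct.induction_on with
        | zero => simp
        | add a b ha hb => simp only [map_add, ha, hb]
        | tmul c m => simp
      rw [totCoact_inc, h, (K.I n).counit_coact]
    exact LinearMap.congr_fun this x

end CoCx

/-! ### Resolutions -/

/-- The coaction `M ⟶ C ⊗ M` as a morphism of comodules. -/
def toCofree (M : DGComod C) : M ⟶ cofree C M.toDGVect where
  lin := M.coact.lin
  mem := M.coact.mem
  comm := M.coact.comm
  colin := fun x => by
    have h : ∀ t : C.carrier ⊗[k] M.carrier, (cofree C M.toDGVect).coact.lin t =
        TensorProduct.assoc k _ _ _ (TensorProduct.map C.comul.lin LinearMap.id t) := fun t => rfl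
    rw [h, M.coact_coassoc, LinearEquiv.apply_symm_apply]

/-- The cofree comodule is functorial. -/
def cofreeMap {V W : DGVect k} (f : DGVect.Hom V W) : cofree C V ⟶ cofree C W where
  lin := TensorProduct.map LinearMap.id f.lin
  mem := ((DGVect.Hom.id C.toDGVect).tensor f).mem
  comm := ((DGVect.Hom.id C.toDGVect).tensor f).comm
  colin := fun x => by
    have key : (cofree C W).coact.lin ∘ₗ TensorProduct.map LinearMap.id f.lin =
        TensorProduct.map LinearMap.id (TensorProduct.map LinearMap.id f.lin) ∘ₗ
          (cofree C V).coact.lin := by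
      refine TensorProduct.ext' fun c v => ?_
      change TensorProduct.assoc k _ _ _ (C.comul.lin c ⊗ₜ[k] f.lin v) =
        TensorProduct.map LinearMap.id (TensorProduct.map LinearMap.id f.lin)
          (TensorProduct.assoc k _ _ _ (C.comul.lin c ⊗ₜ[k] v))
      induction C.comul.lin c using TensorProduct.induction_on with
      | zero => simp
      | add a b ha hb => simp only [TensorProduct.add_tmul, map_add, ha, hb]
      | tmul c c' => simp
    exact LinearMap.congr_fun key x

/-- The counit `C ⊗ V → V`. -/
def cofreeCounit (V : DGVect k) : DGVect.Hom (cofree C V).toDGVect V where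
  lin := (cofreeCogen V).π
  mem := (cofreeCogen V).mem
  comm := fun x => by
    have key : (cofreeCogen (C := C) V).π ∘ₗ (C.toDGVect.tensor V).d =
        V.d ∘ₗ (cofreeCogen (C := C) V).π := by
      refine TensorProduct.ext' fun c v => ?_
      refine (map_add (cofreeCogen (C := C) V).π (C.d c ⊗ₜ[k] v) (C.sgn c ⊗ₜ[k] V.d v)).trans ?_
      change C.counit (C.d c) • v + C.counit (C.sgn c) • V.d v = V.d (C.counit c • v)
      rw [C.counit_d, C.counit_sgn, zero_smul, zero_add, map_smul]
    exact LinearMap.congr_fun key x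

lemma cofreeCounit_tmul (V : DGVect k) (c : C.carrier) (v : V.carrier) :
    (cofreeCounit (C := C) V).lin (c ⊗ₜ[k] v) = C.counit c • v := rfl

lemma cofreeCounit_toCofree (M : DGComod C) (x : M.carrier) :
    (cofreeCounit M.toDGVect).lin (M.toCofree.lin x) = x := M.counit_coact x

lemma cofreeCounit_cofreeMap {V W : DGVect k} (f : DGVect.Hom V W) (x : (cofree C V).carrier) :
    (cofreeCounit W).lin ((cofreeMap (C := C) f).lin x) = f.lin ((cofreeCounit V).lin x) := by
  have key : (cofreeCounit W).lin ∘ₗ (cofreeMap (C := C) f).lin =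
      f.lin ∘ₗ (cofreeCounit (C := C) V).lin :=
    TensorProduct.ext' fun c v => (f.lin.map_smul (C.counit c) v).symm
  exact LinearMap.congr_fun key x

lemma map_cofreeCounit_coact (V : DGVect k) (x : (cofree C V).carrier) :
    TensorProduct.map LinearMap.id (cofreeCounit V).lin ((cofree C V).coact.lin x) = x := by
  have h : ∀ (t : C.carrier ⊗[k] C.carrier) (v : V.carrier),
      TensorProduct.map LinearMap.id (cofreeCounit (C := C) V).lin
        (TensorProduct.assoc k _ _ _ (t ⊗ₜ[k] v)) =
      TensorProduct.rid k _ (TensorProduct.map LinearMap.id C.counit t) ⊗ₜ[k] v := by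
    intro t v
    induction t using TensorProduct.induction_on with
    | zero => simp
    | add a b ha hb => simp only [TensorProduct.add_tmul, map_add, ha, hb]
    | tmul c m =>
      rw [TensorProduct.assoc_tmul, TensorProduct.map_tmul, cofreeCounit_tmul]
      simp [TensorProduct.smul_tmul]
  have key : TensorProduct.map LinearMap.id (cofreeCounit V).lin ∘ₗ (cofree C V).coact.lin =
      LinearMap.id :=
    TensorProduct.ext' fun c v => (h _ _).trans (by rw [C.comul_counit]; rfl)
  exact LinearMap.congr_fun key x

lemma toCofree_naturality {M N : DGComod C} (f : M ⟶ N) :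
    f ≫ N.toCofree = M.toCofree ≫ cofreeMap f.toHom :=
  hom_ext (LinearMap.ext f.colin)

lemma cofreeMap_comp {U V W : DGVect k} (f : DGVect.Hom U V) (g : DGVect.Hom V W) :
    cofreeMap (C := C) f ≫ cofreeMap g = cofreeMap (g.comp f) :=
  hom_ext (TensorProduct.ext' fun _ _ => rfl)

/-- A complex of comodules with an augmentation `M ⟶ I⁰` and a linear contraction. -/
structure CoRes (M : DGComod C) extends CoCx C where
  η : M ⟶ I 0
  ε : DGVect.Hom (I 0).toDGVect M.toDGVect
  s : ∀ n, DGVect.Hom (I (n + 1)).toDGVect (I n).toDGVect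
  η_δ : ∀ x, (δ 0).lin (η.lin x) = 0
  ε_η : ∀ x, ε.lin (η.lin x) = x
  s_δ_zero : ∀ x, (s 0).lin ((δ 0).lin x) = x - η.lin (ε.lin x)
  s_δ_succ : ∀ n x, (s (n + 1)).lin ((δ (n + 1)).lin x) = x - (δ n).lin ((s n).lin x)

namespace CoRes

variable {M : DGComod C} (K : M.CoRes)

/-- The augmentation. -/
def toTot : M ⟶ K.tot where
  lin := K.inc 0 ∘ₗ K.η.lin
  mem := fun {n x} hx => DGVect.lof_mem_sumGr (fun n => (K.I n).toDGVect) (by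
    simpa using K.η.mem hx)
  comm := fun x => by
    change K.inc 0 (K.η.lin (M.d x)) = K.totD (K.inc 0 (K.η.lin x))
    rw [CoCx.totD_inc, ← K.η.sgn, K.η_δ, map_zero, add_zero, K.η.comm]
  colin := fun x => by
    change K.totCoact (K.inc 0 (K.η.lin x)) = _
    rw [CoCx.totCoact_inc, K.η.colin, TensorProduct.map_map]
    rfl

/-- A linear retraction of the augmentation. -/
def ofTot : (⨁ n, (K.I n).carrier) →ₗ[k] M.carrier :=
  DirectSum.toModule k ℕ _ fun n => match n with
    | 0 => K.ε.lin
    | _ + 1 => 0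

lemma ofTot_inc_zero (x : (K.I 0).carrier) : K.ofTot (K.inc 0 x) = K.ε.lin x := by
  rw [ofTot, DirectSum.toModule_lof]

lemma ofTot_inc_succ (n : ℕ) (x : (K.I (n + 1)).carrier) : K.ofTot (K.inc (n + 1) x) = 0 := by
  rw [ofTot, DirectSum.toModule_lof]
  rfl

/-- The contracting homotopy of the totalization. -/
def totH : (⨁ n, (K.I n).carrier) →ₗ[k] ⨁ n, (K.I n).carrier :=
  DirectSum.toModule k ℕ _ fun n => match n with
    | 0 => 0
    | n + 1 => K.inc n ∘ₗ (K.s n).lin ∘ₗ (K.I (n + 1)).sgn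

lemma totH_inc_zero (x : (K.I 0).carrier) : K.totH (K.inc 0 x) = 0 := by
  rw [totH, DirectSum.toModule_lof]
  rfl

lemma totH_inc_succ (n : ℕ) (x : (K.I (n + 1)).carrier) :
    K.totH (K.inc (n + 1) x) = K.inc n ((K.s n).lin ((K.I (n + 1)).sgn x)) := by
  rw [totH, DirectSum.toModule_lof]
  rfl

/-- The contraction `s` of the augmented complex commutes with the internal differentials, so with
the sign built into `totH` it contracts the whole totalization onto the augmentation. No convergence
argument is needed. -/
lemma totH_eq (y : ⨁ n, (K.I n).carrier) :
    y = K.inc 0 (K.η.lin (K.ofTot y)) + (K.totH (K.totD y) + K.totD (K.totH y)) := by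
  have : LinearMap.id = K.inc 0 ∘ₗ K.η.lin ∘ₗ K.ofTot +
      (K.totH ∘ₗ K.totD + K.totD ∘ₗ K.totH) := by
    refine DirectSum.linearMap_ext _ fun n => LinearMap.ext fun x => ?_
    change K.inc n x = K.inc 0 (K.η.lin (K.ofTot (K.inc n x))) +
      (K.totH (K.totD (K.inc n x)) + K.totD (K.totH (K.inc n x)))
    match n, x with
    | 0, x =>
      rw [ofTot_inc_zero, totH_inc_zero, map_zero, add_zero, CoCx.totD_inc, map_add,
        totH_inc_zero, totH_inc_succ, zero_add, ← (K.δ 0).sgn, DGVect.sgn_sgn, K.s_δ_zero,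
        ← map_add, add_sub_cancel]
    | n + 1, x =>
      rw [ofTot_inc_succ, map_zero, map_zero, zero_add, CoCx.totD_inc, map_add, totH_inc_succ,
        totH_inc_succ, totH_inc_succ, CoCx.totD_inc, ← (K.δ (n + 1)).sgn, DGVect.sgn_sgn,
        ← (K.s n).comm, DGVect.d_sgn, ← (K.s n).sgn, DGVect.sgn_sgn, K.s_δ_succ, map_sub,
        map_neg, map_neg]
      abel
  exact LinearMap.congr_fun this y

lemma ofTot_d (y : ⨁ n, (K.I n).carrier) : K.ofTot (K.totD y) = M.d (K.ofTot y) := by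
  have : K.ofTot ∘ₗ K.totD = M.d ∘ₗ K.ofTot := by
    refine DirectSum.linearMap_ext _ fun n => LinearMap.ext fun x => ?_
    change K.ofTot (K.totD (K.inc n x)) = M.d (K.ofTot (K.inc n x))
    match n, x with
    | 0, x =>
      rw [CoCx.totD_inc, map_add, ofTot_inc_zero, ofTot_inc_succ, ofTot_inc_zero, add_zero,
        K.ε.comm]
    | n + 1, x =>
      rw [CoCx.totD_inc, map_add, ofTot_inc_succ, ofTot_inc_succ, ofTot_inc_succ, add_zero,
        map_zero]
  exact LinearMap.congr_fun this y

lemma toTot_isQuasiIso : IsQuasiIso K.toTot := by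
  rw [isQuasiIso_iff]
  refine ⟨fun x hx y hy => ⟨K.ofTot y, ?_⟩, fun y hy => ⟨K.ofTot y, ?_, K.totH y, ?_⟩⟩
  · have h : K.inc 0 (K.η.lin x) = K.totD y := hy
    rw [← ofTot_d, ← h, ofTot_inc_zero, K.ε_η]
  · have h : K.totD y = 0 := hy
    rw [← ofTot_d, h, map_zero]
  · have h : K.totD y = 0 := hy
    have := K.totH_eq y
    rw [h, map_zero, zero_add] at this
    exact sub_eq_of_eq_add' this

end CoRes

/-! ### The cobar resolution -/

section Bar

/-- The next differential in the resolution by cofree comodules. -/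
def barNext {A : DGComod C} (f : A ⟶ cofree C A.toDGVect) :
    cofree C A.toDGVect ⟶ cofree C (cofree C A.toDGVect).toDGVect :=
  (cofree C A.toDGVect).toCofree - cofreeMap f.toHom

/-- Naturality of the coaction. With `f` the coaction itself the first factor on the right vanishes,
which starts the induction proving that the differentials square to zero. -/
lemma comp_barNext {A : DGComod C} (f : A ⟶ cofree C A.toDGVect) :
    f ≫ barNext f = (A.toCofree - f) ≫ cofreeMap f.toHom := by
  rw [barNext, Preadditive.comp_sub, toCofree_naturality, Preadditive.sub_comp]

lemma toCofree_barNext (A : DGComod C) : A.toCofree ≫ barNext A.toCofree = 0 := by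
  rw [comp_barNext, sub_self, Limits.zero_comp]

lemma barNext_barNext {A : DGComod C} (f : A ⟶ cofree C A.toDGVect) (h : f ≫ barNext f = 0) :
    barNext f ≫ barNext (barNext f) = 0 := by
  -- For `barNext f` in place of `f`, the first factor in `comp_barNext` is `C ⊗ f`. The composite
  -- is therefore `C ⊗ (f ≫ barNext f)`, which is zero by hypothesis.
  have h1 : (cofree C A.toDGVect).toCofree - barNext f = cofreeMap f.toHom := sub_sub_cancel _ _
  rw [comp_barNext, h1, cofreeMap_comp]
  change cofreeMap (f ≫ barNext f).toHom = 0
  rw [h]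
  exact hom_ext (TensorProduct.ext' fun c _ => TensorProduct.tmul_zero _ c)

/-- Since the counit splits the coaction and is natural, it is a linear contraction of the
resolution in every degree. -/
lemma cofreeCounit_barNext {A : DGComod C} (f : A ⟶ cofree C A.toDGVect)
    (x : (cofree C A.toDGVect).carrier) :
    (cofreeCounit (cofree C A.toDGVect).toDGVect).lin ((barNext f).lin x) =
      x - f.lin ((cofreeCounit A.toDGVect).lin x) := by
  refine (map_sub (cofreeCounit (cofree C A.toDGVect).toDGVect).lin
    ((cofree C A.toDGVect).toCofree.lin x) ((cofreeMap (C := C) f.toHom).lin x)).trans ?_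
  rw [cofreeCounit_toCofree, cofreeCounit_cofreeMap]

/-- The sequence of comodules and differentials of the resolution. -/
def barSeq (M : DGComod C) : ℕ → Σ A : DGComod C, A ⟶ cofree C A.toDGVect
  | 0 => ⟨M, M.toCofree⟩
  | n + 1 => ⟨cofree C (barSeq M n).1.toDGVect, barNext (barSeq M n).2⟩

lemma barSeq_comp (M : DGComod C) : ∀ n, (M.barSeq n).2 ≫ barNext (M.barSeq n).2 = 0
  | 0 => toCofree_barNext M
  | n + 1 => barNext_barNext _ (barSeq_comp M n)

variable (M : DGComod C)

/-- The resolution of a comodule by cofree comodules. -/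
def barRes : M.CoRes where
  I n := cofree C (M.barSeq n).1.toDGVect
  δ n := barNext (M.barSeq n).2
  δ_δ n := barNext_barNext _ (M.barSeq_comp n)
  η := M.toCofree
  ε := cofreeCounit M.toDGVect
  s n := cofreeCounit (cofree C (M.barSeq n).1.toDGVect).toDGVect
  η_δ x := LinearMap.congr_fun (congrArg (fun f => f.lin) (toCofree_barNext M)) x
  ε_η := cofreeCounit_toCofree M
  s_δ_zero := cofreeCounit_barNext M.toCofree
  s_δ_succ n := cofreeCounit_barNext (barNext (M.barSeq n).2)

/-- The resolution of a comodule by a quasi-cofree comodule. -/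
def res : DGComod C := M.barRes.tot

/-- The augmentation of the resolution. -/
def toRes : M ⟶ M.res := M.barRes.toTot

lemma toRes_isQuasiIso : IsQuasiIso M.toRes := M.barRes.toTot_isQuasiIso

/-- A totalization of cofree comodules is quasi-cofree. -/
def CoCx.cogen (V : ℕ → DGVect k) (δ : ∀ n, cofree C (V n) ⟶ cofree C (V (n + 1)))
    (hδ : ∀ n, δ n ≫ δ (n + 1) = 0) : (CoCx.mk (fun n => cofree C (V n)) δ hδ).tot.Cogen where
  T := DGVect.gradedSum V
  π := DirectSum.lmap fun n => (cofreeCounit (C := C) (V n)).lin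
  mem := fun {j x} hx n => (cofreeCounit (C := C) (V n)).mem (hx n)
  bij := by
    let K : CoCx C := ⟨fun n => cofree C (V n), δ, hδ⟩
    have : TensorProduct.map (LinearMap.id : C.carrier →ₗ[k] C.carrier)
        (DirectSum.lmap fun n => (cofreeCounit (C := C) (V n)).lin) ∘ₗ K.totCoact =
        (TensorProduct.directSumRight k k C.carrier
          fun n => (V n).carrier).symm.toLinearMap := by
      refine DirectSum.linearMap_ext _ fun n => ?_
      have h1 : (DirectSum.lmap fun n => (cofreeCounit (C := C) (V n)).lin) ∘ₗ K.inc n =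
          DirectSum.lof k ℕ (fun n => (V n).carrier) n ∘ₗ (cofreeCounit (C := C) (V n)).lin :=
        LinearMap.ext fun y => DirectSum.lmap_lof _ _ _
      refine LinearMap.ext fun x => ?_
      change TensorProduct.map LinearMap.id _ (K.totCoact (K.inc n x)) = _
      rw [CoCx.totCoact_inc, TensorProduct.map_map, h1, LinearMap.id_comp,
        ← LinearMap.id_comp LinearMap.id, TensorProduct.map_comp, LinearMap.comp_apply]
      rw [show TensorProduct.map LinearMap.id (cofreeCounit (C := C) (V n)).lin
        ((K.I n).coact.lin x) = x from map_cofreeCounit_coact (V n) x]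
      revert x
      refine LinearMap.congr_fun (TensorProduct.ext' fun c v => ?_)
      exact (TensorProduct.directSumRight_symm_lof_tmul _ _ _ _ _).symm
    change Function.Bijective (TensorProduct.map (LinearMap.id : C.carrier →ₗ[k] C.carrier)
        (DirectSum.lmap fun n => (cofreeCounit (C := C) (V n)).lin) ∘ₗ K.totCoact)
    rw [this]
    exact LinearEquiv.bijective _

/-- The resolution is quasi-cofree. -/
def resCogen : M.res.Cogen :=
  CoCx.cogen (fun n => (M.barSeq n).1.toDGVect) (fun n => barNext (M.barSeq n).2)
    fun n => barNext_barNext _ (M.barSeq_comp n)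

/-- Tensoring with the positively graded `C` does not lower degrees, and the totalization moves the
later terms upwards; so the cogenerators begin no earlier than `M`. -/
lemma resCogen_gr {a : ℤ} (h : ∀ n < a, M.gr n = ⊥) (hC : C.Positive) :
    ∀ n < a, M.resCogen.T.gr n = ⊥ := by
  have h1 : ∀ i, ∀ n < a, (M.barSeq i).1.gr n = ⊥ := by
    intro i
    induction i with
    | zero => exact h
    | succ i ih =>
      intro n hn
      refine (Submodule.eq_bot_iff _).2 fun t ht => ?_
      refine DGVect.tensor_eq_zero (W := (M.barSeq i).1.toDGVect) hC LinearMap.id n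
        (fun q hq c y hy => ?_) ht
      rw [ih q (by omega), Submodule.mem_bot] at hy
      simp [hy]
  intro n hn
  refine (Submodule.eq_bot_iff _).2 fun x hx => ?_
  refine DFinsupp.ext fun i => ?_
  have := hx i
  rwa [h1 i _ (by omega), Submodule.mem_bot] at this

end Bar

end DGComod

/-- A tensor `t ∈ E ⊗ P` vanishes if its images under a jointly injective family of maps out of `P`
do. -/
lemma tensor_eq_zero_of_jointly_injective {E P : Type*} [AddCommGroup E] [Module k E]
    [AddCommGroup P] [Module k P] {J : Type*} {Q : J → Type*} [∀ j, AddCommGroup (Q j)]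
    [∀ j, Module k (Q j)] (p : ∀ j, P →ₗ[k] Q j) (hp : ∀ x, (∀ j, p j x = 0) → x = 0)
    {t : E ⊗[k] P} (ht : ∀ j, TensorProduct.map LinearMap.id (p j) t = 0) : t = 0 := by
  classical
  -- In coordinates with respect to a basis of `E`, a tensor is a finitely supported family in `P`,
  -- and the hypothesis applies to each coefficient.
  let B := Module.Basis.ofVectorSpace k E
  apply (TensorProduct.equivFinsuppOfBasisLeft B).injective
  rw [map_zero]
  ext i
  refine hp _ fun j => ?_
  have h : ∀ t : E ⊗[k] P, p j (TensorProduct.equivFinsuppOfBasisLeft B t i) =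
      TensorProduct.equivFinsuppOfBasisLeft B (TensorProduct.map LinearMap.id (p j) t) i := by
    intro t
    induction t using TensorProduct.induction_on with
    | zero => simp
    | add a b ha hb => simp only [map_add, Finsupp.add_apply, ha, hb]
    | tmul c x => simp
  rw [h, ht]
  simp

namespace DGVect

/-! ### Products of graded vector spaces -/

section Prod

variable {J : Type u} (V : J → DGVect k)

/-- The families of homogeneous elements of degree `p`. -/
def prodPiece (p : ℤ) : Submodule k (∀ j, (V j).carrier) :=
  Submodule.pi Set.univ fun j => (V j).gr p

lemma mem_prodPiece {p : ℤ} {x : ∀ j, (V j).carrier} :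
    x ∈ prodPiece V p ↔ ∀ j, x j ∈ (V j).gr p := by
  simp [prodPiece]

/-- The carrier of the graded product. -/
def prodCarrier : Submodule k (∀ j, (V j).carrier) := ⨆ p, prodPiece V p

lemma mem_prodCarrier {p : ℤ} {x : ∀ j, (V j).carrier} (hx : ∀ j, x j ∈ (V j).gr p) :
    x ∈ prodCarrier V :=
  Submodule.mem_iSup_of_mem p ((mem_prodPiece V).2 hx)

/-- A family of maps of the same degree restricts to the graded products. -/
lemma prodCarrier_map {W : J → DGVect k} (f : ∀ j, (V j).carrier →ₗ[k] (W j).carrier)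
    (e : ℤ → ℤ) (hf : ∀ j (p : ℤ), ∀ x ∈ (V j).gr p, f j x ∈ (W j).gr (e p))
    {x : ∀ j, (V j).carrier} (hx : x ∈ prodCarrier V) :
    (LinearMap.pi fun j => f j ∘ₗ LinearMap.proj j : _ →ₗ[k] ∀ j, (W j).carrier) x ∈
      prodCarrier W := by
  have : prodCarrier V ≤ (prodCarrier W).comap
      (LinearMap.pi fun j => f j ∘ₗ LinearMap.proj j) :=
    iSup_le fun p x hx => mem_prodCarrier W (p := e p) fun j =>
      hf j p _ ((mem_prodPiece V).1 hx j)
  exact this hx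

/-- The product of complexes in the graded sense. -/
def prod : DGVect k where
  carrier := prodCarrier V
  gr p := (prodPiece V p).comap (prodCarrier V).subtype
  isInternal := by
    let pr : ℤ → prodCarrier V →ₗ[k] prodCarrier V := fun p =>
      ((LinearMap.pi fun j => (V j).proj p ∘ₗ LinearMap.proj j : _ →ₗ[k] ∀ j, (V j).carrier)).restrict
        fun x hx => prodCarrier_map V (fun j => (V j).proj p) (fun _ => p)
          (fun j _ x _ => (V j).proj_mem p x) hx
    refine isInternal_of_proj _ pr (fun n x hx => ?_) (fun m n hmn x hx => ?_) fun x => ?_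
    · refine Subtype.ext (funext fun j => ?_)
      exact (V j).proj_of_mem ((mem_prodPiece V).1 hx j)
    · refine Subtype.ext (funext fun j => ?_)
      exact (V j).proj_of_mem_ne ((mem_prodPiece V).1 hx j) hmn
    · obtain ⟨x, hx⟩ := x
      induction hx using Submodule.iSup_induction' with
      | mem p x hx => exact Submodule.mem_iSup_of_mem p hx
      | zero => exact zero_mem _
      | add x y hx hy ihx ihy => exact add_mem ihx ihy
  d := ((LinearMap.pi fun j => (V j).d ∘ₗ LinearMap.proj j : _ →ₗ[k] ∀ j, (V j).carrier)).restrict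
    fun x hx => prodCarrier_map V (fun j => (V j).d) (fun p => p + 1)
      (fun j _ _ hx => (V j).d_mem hx) hx
  d_mem := fun {n x} hx => (mem_prodPiece V).2 fun j => (V j).d_mem ((mem_prodPiece V).1 hx j)
  d_d := fun x => Subtype.ext (funext fun j => (V j).d_d _)

/-- The projections of the graded product. -/
def prodProj (j : J) : Hom (prod V) (V j) where
  lin := LinearMap.proj j ∘ₗ (prodCarrier V).subtype
  mem := fun hx => (mem_prodPiece V).1 hx j
  comm := fun _ => rfl

lemma prod_ext {x y : (prod V).carrier} (h : ∀ j, (prodProj V j).lin x = (prodProj V j).lin y) :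
    x = y := Subtype.ext (funext h)

variable {V} in
lemma mem_prod_gr {p : ℤ} {x : (prod V).carrier} (h : ∀ j, (prodProj V j).lin x ∈ (V j).gr p) :
    x ∈ (prod V).gr p := (mem_prodPiece V).2 h

variable {A : DGVect k} (e : ℤ) (f : ∀ j, A →ₗ[k] (V j).carrier)
  (hf : ∀ j {n : ℤ} {x : A}, x ∈ A.gr n → f j x ∈ (V j).gr (n + e))

/-- The map to the graded product given by a family of maps of the same degree. -/
def prodLin : A →ₗ[k] (prod V).carrier :=
  (LinearMap.pi f).codRestrict (prodCarrier V) fun x => by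
    induction x using A.homogeneous_induction with
    | h0 => rw [map_zero]; exact zero_mem _
    | hadd x y hx hy => rw [map_add]; exact add_mem hx hy
    | hh n x hx => exact mem_prodCarrier V (p := n + e) fun j => hf j hx

lemma prodLin_mem {n : ℤ} {x : A} (hx : x ∈ A.gr n) :
    prodLin V e f hf x ∈ (prod V).gr (n + e) :=
  mem_prod_gr fun j => hf j hx

/-- The morphism to the graded product given by a family of morphisms. -/
def prodLift (f : ∀ j, Hom A (V j)) : Hom A (prod V) where
  lin := prodLin V 0 (fun j => (f j).lin) fun j n x hx => by simpa using (f j).mem hx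
  mem := fun {n x} hx => mem_prod_gr fun j => (f j).mem hx
  comm := fun x => prod_ext V fun j => (f j).comm x

end Prod

end DGVect

namespace DGComod

variable {C : DGCoalg k}

/-! ### Products of comodules -/

lemma ker_coact (N : DGComod C) {W : DGVect k} (φ : DGVect.Hom N.toDGVect W)
    (h : ∀ z, φ.lin z = 0 →
      TensorProduct.map (LinearMap.id : C.carrier →ₗ[k] C.carrier) φ.lin (N.coact.lin z) = 0) :
    Colin (M := N.ker φ h) (N := N) LinearMap.id (DGVect.kerι φ).lin :=
  fun z => (kerCoactLin_spec N φ h z).symm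

lemma Colin.of_injective {A M N : DGComod C} {b : C.carrier →ₗ[k] C.carrier}
    {i : M.carrier →ₗ[k] N.carrier} (hi : Colin LinearMap.id i) (hinj : Function.Injective i)
    {f : A.carrier →ₗ[k] M.carrier} (h : Colin (M := A) (N := N) b (i ∘ₗ f)) : Colin b f := by
  intro x
  have hinj' : Function.Injective
      (TensorProduct.map (LinearMap.id : C.carrier →ₗ[k] C.carrier) i) :=
    Module.Flat.lTensor_preserves_injective_linearMap _ hinj
  apply hinj'
  rw [← hi, TensorProduct.map_map, LinearMap.id_comp]
  exact h x

section Prod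

variable {J : Type u} (M : J → DGComod C)

/-- The component of the map whose kernel is the product of comodules. -/
def piDiff (j : J) : DGVect.Hom (cofree C (DGVect.prod fun j => (M j).toDGVect)).toDGVect
    (C.toDGVect.tensor (M j).toDGVect) :=
  ((cofreeMap (C := C) (DGVect.prodProj (fun j => (M j).toDGVect) j)).toHom).sub
    ((M j).coact.comp ((DGVect.prodProj (fun j => (M j).toDGVect) j).comp
      (cofreeCounit (DGVect.prod fun j => (M j).toDGVect))))

lemma piDiff_apply (j : J) (x : (cofree C (DGVect.prod fun j => (M j).toDGVect)).carrier) :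
    (piDiff M j).lin x =
      TensorProduct.map LinearMap.id (DGVect.prodProj (fun j => (M j).toDGVect) j).lin x -
      (M j).coact.lin ((DGVect.prodProj (fun j => (M j).toDGVect) j).lin
        ((cofreeCounit (DGVect.prod fun j => (M j).toDGVect)).lin x)) := rfl

/-- The comodule product is cut out of `C ⊗ ∏ Mⱼ` by requiring the `j`-th component of an element to
be the coaction of its own image under the counit. The condition is stable under the coaction
because `Mⱼ ⟶ C ⊗ Mⱼ` is colinear. -/
lemma map_piDiff (j : J) (z : (cofree C (DGVect.prod fun j => (M j).toDGVect)).carrier)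
    (hz : (piDiff M j).lin z = 0) :
    TensorProduct.map (LinearMap.id : C.carrier →ₗ[k] C.carrier) (piDiff M j).lin
      ((cofree C (DGVect.prod fun j => (M j).toDGVect)).coact.lin z) = 0 := by
  have hz' : TensorProduct.map LinearMap.id (DGVect.prodProj (fun j => (M j).toDGVect) j).lin z =
      (M j).coact.lin ((DGVect.prodProj (fun j => (M j).toDGVect) j).lin ((cofreeCounit (DGVect.prod fun j => (M j).toDGVect)).lin z)) := sub_eq_zero.1 hz
  have h0 : TensorProduct.map (LinearMap.id : C.carrier →ₗ[k] C.carrier) (piDiff M j).lin =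
      TensorProduct.map LinearMap.id (TensorProduct.map LinearMap.id (DGVect.prodProj (fun j => (M j).toDGVect) j).lin) -
      TensorProduct.map LinearMap.id ((M j).coact.lin ∘ₗ (DGVect.prodProj (fun j => (M j).toDGVect) j).lin) ∘ₗ
        TensorProduct.map LinearMap.id (cofreeCounit (DGVect.prod fun j => (M j).toDGVect)).lin := by
    refine TensorProduct.ext' fun c t => ?_
    exact TensorProduct.tmul_sub c _ _
  rw [h0, LinearMap.sub_apply, LinearMap.comp_apply, map_cofreeCounit_coact]
  have h1 : TensorProduct.map LinearMap.id (TensorProduct.map LinearMap.id (DGVect.prodProj (fun j => (M j).toDGVect) j).lin)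
      ((cofree C (DGVect.prod fun j => (M j).toDGVect)).coact.lin z) =
      (cofree C (M j).toDGVect).coact.lin (TensorProduct.map LinearMap.id (DGVect.prodProj (fun j => (M j).toDGVect) j).lin z) :=
    ((cofreeMap (C := C) (DGVect.prodProj (fun j => (M j).toDGVect) j)).colin z).symm
  have h2 : TensorProduct.map LinearMap.id ((M j).coact.lin ∘ₗ (DGVect.prodProj (fun j => (M j).toDGVect) j).lin) z =
      TensorProduct.map LinearMap.id (M j).coact.lin (TensorProduct.map LinearMap.id (DGVect.prodProj (fun j => (M j).toDGVect) j).lin z) := by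
    rw [TensorProduct.map_map]
    rfl
  rw [h1, h2, hz', sub_eq_zero]
  exact (M j).toCofree.colin _

/-- The map whose kernel is the product of comodules. -/
def piHom : DGVect.Hom (cofree C (DGVect.prod fun j => (M j).toDGVect)).toDGVect
    (DGVect.prod fun j => C.toDGVect.tensor (M j).toDGVect) :=
  DGVect.prodLift _ (piDiff M)

/-- Tensors with values in a graded product are detected by the projections, which reduces the claim
to a single component. -/
lemma piHom_stable (z : (cofree C (DGVect.prod fun j => (M j).toDGVect)).carrier)
    (hz : (piHom M).lin z = 0) :
    TensorProduct.map (LinearMap.id : C.carrier →ₗ[k] C.carrier) (piHom M).lin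
      ((cofree C (DGVect.prod fun j => (M j).toDGVect)).coact.lin z) = 0 := by
  refine tensor_eq_zero_of_jointly_injective
    (fun j => (DGVect.prodProj (fun j => C.toDGVect.tensor (M j).toDGVect) j).lin)
    (fun x hx => DGVect.prod_ext _ fun j => (hx j).trans (map_zero _).symm) fun j => ?_
  rw [TensorProduct.map_map, LinearMap.id_comp]
  refine map_piDiff M j z ?_
  have := congrArg (DGVect.prodProj (fun j => C.toDGVect.tensor (M j).toDGVect) j).lin hz
  rwa [map_zero] at this

/-- The product of a family of comodules. -/
def pi : DGComod C :=
  (cofree C (DGVect.prod fun j => (M j).toDGVect)).ker (piHom M) (piHom_stable M)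

/-- The embedding of the product in a cofree comodule. -/
def piIncl : pi M ⟶ cofree C (DGVect.prod fun j => (M j).toDGVect) where
  toHom := DGVect.kerι (piHom M)
  colin := ker_coact _ (piHom M) (piHom_stable M)

lemma piIncl_injective : Function.Injective (piIncl M).lin := DGVect.kerι_injective _

lemma map_proj_piIncl (j : J) (z : (pi M).carrier) :
    TensorProduct.map LinearMap.id (DGVect.prodProj (fun j => (M j).toDGVect) j).lin
      ((piIncl M).lin z) = (M j).coact.lin ((DGVect.prodProj (fun j => (M j).toDGVect) j).lin
        ((cofreeCounit (DGVect.prod fun j => (M j).toDGVect)).lin ((piIncl M).lin z))) := by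
  have h : (piHom M).lin ((piIncl M).lin z) = 0 := z.2
  have := congrArg (DGVect.prodProj (fun j => C.toDGVect.tensor (M j).toDGVect) j).lin h
  rw [map_zero] at this
  exact sub_eq_zero.1 this

/-- The projections of the product. -/
def piπ (j : J) : pi M ⟶ M j where
  toHom := (DGVect.prodProj (fun j => (M j).toDGVect) j).comp
    ((cofreeCounit (DGVect.prod fun j => (M j).toDGVect)).comp (piIncl M).toHom)
  colin := fun z => by
    refine (map_proj_piIncl M j z).symm.trans ?_
    have h : TensorProduct.map LinearMap.id (((DGVect.prodProj (fun j => (M j).toDGVect) j).lin ∘ₗ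
        (cofreeCounit (C := C) (DGVect.prod fun j => (M j).toDGVect)).lin) ∘ₗ (piIncl M).lin)
        ((pi M).coact.lin z) = TensorProduct.map LinearMap.id
          ((DGVect.prodProj (fun j => (M j).toDGVect) j).lin ∘ₗ
            (cofreeCounit (C := C) (DGVect.prod fun j => (M j).toDGVect)).lin)
          ((cofree C _).coact.lin ((piIncl M).lin z)) := by
      rw [(piIncl M).colin, TensorProduct.map_map, LinearMap.id_comp]
    refine Eq.trans ?_ h.symm
    rw [← LinearMap.id_comp (LinearMap.id (M := C.carrier)), TensorProduct.map_comp,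
      LinearMap.comp_apply, map_cofreeCounit_coact, LinearMap.id_comp]

lemma piπ_lin (j : J) (z : (pi M).carrier) : (piπ M j).lin z =
    (DGVect.prodProj (fun j => (M j).toDGVect) j).lin
      ((cofreeCounit (DGVect.prod fun j => (M j).toDGVect)).lin ((piIncl M).lin z)) := rfl

variable {M} {A : DGComod C} {b : C.carrier →ₗ[k] C.carrier}

/-- Twisted colinear maps to a product are determined by their components. -/
lemma pi_ext {f g : A.carrier →ₗ[k] (pi M).carrier} (hf : Colin b f) (hg : Colin b g)
    (h : ∀ j x, (piπ M j).lin (f x) = (piπ M j).lin (g x)) : f = g := by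
  have h1 : Colin (N := cofree C _) b ((piIncl M).lin ∘ₗ f) := by
    have := Colin.comp (piIncl M).colin' hf
    rwa [LinearMap.id_comp] at this
  have h2 : Colin (N := cofree C _) b ((piIncl M).lin ∘ₗ g) := by
    have := Colin.comp (piIncl M).colin' hg
    rwa [LinearMap.id_comp] at this
  have := (cofreeCogen (DGVect.prod fun j => (M j).toDGVect)).eq_of_π h1 h2 fun x => DGVect.prod_ext _ fun j => h j x
  exact LinearMap.ext fun x => piIncl_injective M (LinearMap.congr_fun this x)

section Lin

variable (hb : IsTwist b) (e : ℤ) (f : ∀ j, A.carrier →ₗ[k] (M j).carrier)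
  (hf : ∀ j {n : ℤ} {x : A.carrier}, x ∈ A.gr n → f j x ∈ (M j).gr (n + e))
  (hc : ∀ j, Colin b (f j))

/-- The twisted colinear map to the product with given components. -/
def piLin : A.carrier →ₗ[k] (pi M).carrier :=
  LinearMap.codRestrict (LinearMap.ker (piHom M).lin)
    ((cofreeCogen (DGVect.prod fun j => (M j).toDGVect)).lift b (DGVect.prodLin (fun j => (M j).toDGVect) e f hf)) fun x => by
      set g := DGVect.prodLin (fun j => (M j).toDGVect) e f hf
      set G := cofreeCogen (C := C) (DGVect.prod fun j => (M j).toDGVect)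
      refine DGVect.prod_ext _ fun j => ?_
      refine Eq.trans ?_ (map_zero _).symm
      refine (piDiff_apply M j _).trans (sub_eq_zero.2 ?_)
      have h1 : (cofreeCounit (C := C) (DGVect.prod fun j => (M j).toDGVect)).lin (G.lift b g x) = g x := G.π_lift hb g x
      have h2 : G.lift b g x = TensorProduct.map b g (A.coact.lin x) :=
        (map_cofreeCounit_coact _ _).symm.trans (G.equiv_lift (b := b) g x)
      rw [h1, h2, TensorProduct.map_map, LinearMap.id_comp]
      exact (hc j x).symm

lemma piIncl_piLin (x : A.carrier) : (piIncl M).lin (piLin hb e f hf hc x) =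
    (cofreeCogen (DGVect.prod fun j => (M j).toDGVect)).lift b (DGVect.prodLin (fun j => (M j).toDGVect) e f hf) x := rfl

lemma piπ_piLin (j : J) (x : A.carrier) : (piπ M j).lin (piLin hb e f hf hc x) = f j x := by
  have h1 : (cofreeCounit (C := C) (DGVect.prod fun j => (M j).toDGVect)).lin ((cofreeCogen (DGVect.prod fun j => (M j).toDGVect)).lift b
      (DGVect.prodLin (fun j => (M j).toDGVect) e f hf) x) = _ :=
    (cofreeCogen (C := C) (DGVect.prod fun j => (M j).toDGVect)).π_lift hb _ x
  exact congrArg (DGVect.prodProj (fun j => (M j).toDGVect) j).lin h1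

lemma piLin_mem {n : ℤ} {x : A.carrier} (hx : x ∈ A.gr n) :
    piLin hb e f hf hc x ∈ (pi M).gr (n + e) :=
  (cofreeCogen (DGVect.prod fun j => (M j).toDGVect)).lift_mem hb (fun hx => DGVect.prodLin_mem _ e f hf hx) hx

lemma colin_piLin : Colin b (piLin hb e f hf hc) :=
  Colin.of_injective (piIncl M).colin' (piIncl_injective M) ((cofreeCogen (DGVect.prod fun j => (M j).toDGVect)).colin_lift hb _)

end Lin

/-- The morphism to the product with given components. -/
def piLift (f : ∀ j, A ⟶ M j) : A ⟶ pi M where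
  lin := piLin isTwist_id 0 (fun j => (f j).lin) (fun j n x hx => by simpa using (f j).mem hx)
    fun j => (f j).colin'
  mem := fun {n x} hx => by
    have := piLin_mem isTwist_id 0 (fun j => (f j).lin)
      (fun j n x hx => by simpa using (f j).mem hx) (fun j => (f j).colin') hx
    simpa using this
  comm := fun x => by
    apply piIncl_injective M
    -- Inside the cofree comodule the map is the coaction of `A` followed by `C ⊗ (fⱼ)`, a composite
    -- of chain maps.
    have h : ∀ x, (piIncl M).lin (piLin isTwist_id 0 (fun j => (f j).lin)
      (fun j n x hx => by simpa using (f j).mem hx) (fun j => (f j).colin') x) =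
      (cofreeMap (DGVect.prodLift _ fun j => (f j).toHom)).lin (A.toCofree.lin x) := fun x => by
        refine (piIncl_piLin _ _ _ _ _ _).trans ?_
        exact (map_cofreeCounit_coact _ _).symm.trans ((cofreeCogen (DGVect.prod fun j => (M j).toDGVect)).equiv_lift _ x)
    rw [(piIncl M).comm, h, h, A.toCofree.comm, (cofreeMap _).comm]
  colin := colin_piLin _ _ _ _ _

lemma piLift_π (f : ∀ j, A ⟶ M j) (j : J) : piLift f ≫ piπ M j = f j :=
  hom_ext (LinearMap.ext fun x => piπ_piLin isTwist_id 0 (fun j => (f j).lin)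
    (fun j n x hx => by simpa using (f j).mem hx) (fun j => (f j).colin') j x)

/-- The universal property also holds for sign-twisted maps of degree `-1`, so homotopies of the
components assemble to one homotopy. Hence the product remains a product in `H(C)`. -/
lemma pi_homotopic {f g : A ⟶ pi M} (h : ∀ j, homotopic C (f ≫ piπ M j) (g ≫ piπ M j)) :
    homotopic C f g := by
  have H := fun j => (h j).some
  let K : A.carrier →ₗ[k] (pi M).carrier := piLin isTwist_sgn (-1) (fun j => (H j).h)
    (fun j n x hx => (H j).mem hx) (fun j => (H j).colin)
  have hK : Colin C.sgn K := colin_piLin _ _ _ _ _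
  have hπ : ∀ j x, (piπ M j).lin (K x) = (H j).h x := piπ_piLin _ _ _ _ _
  refine ⟨⟨K, fun hx => piLin_mem _ _ _ _ _ hx, hK, fun x => ?_⟩⟩
  refine LinearMap.congr_fun (pi_ext (f := f.lin - g.lin) (g := K ∘ₗ A.d + (pi M).d ∘ₗ K)
    (f.colin'.sub g.colin') hK.boundary fun j x => ?_) x
  simp only [LinearMap.sub_apply, LinearMap.add_apply, LinearMap.comp_apply, map_sub, map_add]
  rw [hπ, (piπ M j).comm, hπ]
  exact (H j).eq x

lemma pi_gr (hC : C.Positive) {a : ℤ} (h : ∀ j, ∀ n < a, (M j).gr n = ⊥) :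
    ∀ n < a, (pi M).gr n = ⊥ := by
  intro n hn
  refine (Submodule.eq_bot_iff _).2 fun z hz => piIncl_injective M ?_
  rw [map_zero]
  refine DGVect.tensor_eq_zero hC LinearMap.id n (fun q hq c y hy => ?_) ((piIncl M).mem hz)
  have : y = 0 := DGVect.prod_ext _ fun j => by
    have := (DGVect.prodProj (fun j => (M j).toDGVect) j).mem hy
    rw [h j q (by omega), Submodule.mem_bot] at this
    rw [this, map_zero]
  rw [this, TensorProduct.tmul_zero, map_zero]

lemma isClosed_pi (h : ∀ j, (M j).IsClosed) : (pi M).IsClosed :=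
  isClosed_iff.2 fun A hA _ => pi_homotopic fun j => by
    rw [Limits.zero_comp]
    exact isClosed_iff.1 (h j) A hA _

end Prod

end DGComod

namespace DGComod

variable {C : DGCoalg k}

/-! ### Quotients -/

/-- A graded subcomodule stable under the differential. -/
structure IsSub (M : DGComod C) (S : Submodule k M.carrier) : Prop where
  proj : ∀ x ∈ S, ∀ n, M.proj n x ∈ S
  d : ∀ x ∈ S, M.d x ∈ S
  coact : ∀ x ∈ S, TensorProduct.map (LinearMap.id : C.carrier →ₗ[k] C.carrier) S.mkQ
    (M.coact.lin x) = 0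

section Quot

variable {M : DGComod C} {S : Submodule k M.carrier} (hS : M.IsSub S)

/-- The underlying complex of the quotient of a comodule. -/
abbrev quotVect : DGVect k where
  carrier := M.carrier ⧸ S
  gr n := (M.gr n).map S.mkQ
  isInternal := by
    refine DGVect.isInternal_of_proj _
      (fun n => S.mapQ S (M.proj n) fun x hx => hS.proj x hx n) ?_ ?_ ?_
    · rintro n _ ⟨x, hx, rfl⟩
      rw [Submodule.mkQ_apply, Submodule.mapQ_apply, M.proj_of_mem hx]
    · rintro m n hmn _ ⟨x, hx, rfl⟩
      rw [Submodule.mkQ_apply, Submodule.mapQ_apply, M.proj_of_mem_ne hx hmn, Submodule.Quotient.mk_zero]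
    · intro x
      obtain ⟨x, rfl⟩ := S.mkQ_surjective x
      induction x using M.homogeneous_induction with
      | h0 => rw [map_zero]; exact zero_mem _
      | hadd x y hx hy => rw [map_add]; exact add_mem hx hy
      | hh n x hx => exact Submodule.mem_iSup_of_mem n ⟨x, hx, rfl⟩
  d := S.mapQ S M.d hS.d
  d_mem := by
    rintro n _ ⟨x, hx, rfl⟩
    exact ⟨M.d x, M.d_mem hx, rfl⟩
  d_d := fun x => by
    obtain ⟨x, rfl⟩ := S.mkQ_surjective x
    rw [Submodule.mkQ_apply, Submodule.mapQ_apply, Submodule.mapQ_apply, M.d_d,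
      Submodule.Quotient.mk_zero]

/-- The coaction of the quotient. -/
def quotCoact : M.carrier ⧸ S →ₗ[k] C.carrier ⊗[k] (M.carrier ⧸ S) :=
  S.liftQ (TensorProduct.map LinearMap.id S.mkQ ∘ₗ M.coact.lin) hS.coact

lemma quotCoact_mk (x : M.carrier) : quotCoact hS (S.mkQ x) =
    TensorProduct.map LinearMap.id S.mkQ (M.coact.lin x) := rfl

/-- The quotient of a comodule by a subcomodule. -/
def quot : DGComod C where
  toDGVect := quotVect hS
  coact :=
    { lin := quotCoact hS
      mem := by
        rintro n _ ⟨x, hx, rfl⟩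
        rw [quotCoact_mk]
        refine DGVect.tensorGr_le C.toDGVect M.toDGVect _ _ _ (fun p q hpq c hc m hm => ?_)
          (M.coact.mem hx)
        exact DGVect.tmul_mem C.toDGVect (quotVect hS) hpq hc ⟨m, hm, rfl⟩
      comm := fun x => by
        obtain ⟨x, rfl⟩ := S.mkQ_surjective x
        have h : TensorProduct.map LinearMap.id S.mkQ ∘ₗ (C.toDGVect.tensor M.toDGVect).d =
            (C.toDGVect.tensor (quotVect hS)).d ∘ₗ TensorProduct.map LinearMap.id S.mkQ := by
          refine TensorProduct.ext' fun c m => ?_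
          exact (map_add (TensorProduct.map LinearMap.id S.mkQ) (C.d c ⊗ₜ[k] m)
            (C.sgn c ⊗ₜ[k] M.d m))
        refine (quotCoact_mk hS (M.d x)).trans ?_
        rw [M.coact.comm]
        exact LinearMap.congr_fun h _ }
  coact_coassoc := fun x => by
    obtain ⟨x, rfl⟩ := S.mkQ_surjective x
    change TensorProduct.map C.comul.lin LinearMap.id (quotCoact hS (S.mkQ x)) =
      (TensorProduct.assoc k C.carrier C.carrier _).symm
        (TensorProduct.map LinearMap.id (quotCoact hS) (quotCoact hS (S.mkQ x)))
    rw [quotCoact_mk, TensorProduct.map_map, TensorProduct.map_map,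
      show quotCoact hS ∘ₗ S.mkQ = TensorProduct.map LinearMap.id S.mkQ ∘ₗ M.coact.lin from rfl]
    have h1 : TensorProduct.map (C.comul.lin ∘ₗ LinearMap.id) (LinearMap.id ∘ₗ S.mkQ)
        (M.coact.lin x) = TensorProduct.map LinearMap.id S.mkQ
          (TensorProduct.map C.comul.lin LinearMap.id (M.coact.lin x)) := by
      rw [TensorProduct.map_map]
      rfl
    have h2 : ∀ t : C.carrier ⊗[k] (C.carrier ⊗[k] M.carrier),
        TensorProduct.map LinearMap.id S.mkQ
          ((TensorProduct.assoc k C.carrier C.carrier _).symm t) =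
        (TensorProduct.assoc k C.carrier C.carrier _).symm
          (TensorProduct.map LinearMap.id (TensorProduct.map LinearMap.id S.mkQ) t) := by
      intro t
      induction t using TensorProduct.induction_on with
      | zero => simp
      | add a b ha hb => simp only [map_add, ha, hb]
      | tmul c t =>
        induction t using TensorProduct.induction_on with
        | zero => simp
        | add a b ha hb => simp only [TensorProduct.tmul_add, map_add, ha, hb]
        | tmul c m => simp
    rw [h1, M.coact_coassoc, h2, TensorProduct.map_map]
  counit_coact := fun x => by
    obtain ⟨x, rfl⟩ := S.mkQ_surjective x
    have h : ∀ t : C.carrier ⊗[k] M.carrier, TensorProduct.lid k _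
        (TensorProduct.map C.counit LinearMap.id (TensorProduct.map LinearMap.id S.mkQ t)) =
        S.mkQ (TensorProduct.lid k _ (TensorProduct.map C.counit LinearMap.id t)) := by
      intro t
      induction t using TensorProduct.induction_on with
      | zero => simp
      | add a b ha hb => simp only [map_add, ha, hb]
      | tmul c m => simp
    exact (h _).trans (congrArg S.mkQ (M.counit_coact x))

/-- The projection to the quotient. -/
def quotMk : M ⟶ quot hS where
  lin := S.mkQ
  mem := fun {_ x} hx => ⟨x, hx, rfl⟩
  comm := fun _ => rfl
  colin := fun _ => rfl

lemma quotMk_surjective : Function.Surjective (quotMk hS).lin := S.mkQ_surjective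

lemma quotMk_eq_zero {x : M.carrier} : (quotMk hS).lin x = 0 ↔ x ∈ S :=
  Submodule.Quotient.mk_eq_zero S

lemma quot_mem_gr {n : ℤ} {x : (quot hS).carrier} (hx : x ∈ (quot hS).gr n) :
    ∃ y ∈ M.gr n, (quotMk hS).lin y = x := hx

/-- The hypothesis says that the kernel `S` is acyclic; cycles are lifted and boundaries corrected
inside `S`. -/
lemma quotMk_isQuasiIso (h : ∀ x ∈ S, M.d x = 0 → ∃ y ∈ S, M.d y = x) :
    IsQuasiIso (quotMk hS) := by
  rw [isQuasiIso_iff]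
  refine ⟨fun x hx y hy => ?_, fun y hy => ?_⟩
  · obtain ⟨y, rfl⟩ := quotMk_surjective hS y
    rw [← (quotMk hS).comm, ← sub_eq_zero, ← map_sub, quotMk_eq_zero] at hy
    obtain ⟨z, hz, hz'⟩ := h _ hy (by rw [map_sub, hx, M.d_d, sub_zero])
    exact ⟨z + y, by rw [map_add, hz', sub_add_cancel]⟩
  · obtain ⟨y, rfl⟩ := quotMk_surjective hS y
    rw [← (quotMk hS).comm, quotMk_eq_zero] at hy
    obtain ⟨z, hz, hz'⟩ := h _ hy (M.d_d _)
    refine ⟨y - z, by rw [map_sub, hz', sub_self], 0, ?_⟩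
    rw [map_zero, map_sub, (quotMk_eq_zero hS).2 hz, sub_zero, sub_self]

end Quot

/-- Factorization of a morphism through a surjective one. -/
def homDesc {M N P : DGComod C} (p : M ⟶ N) (hp : Function.Surjective p.lin) (f : M ⟶ P)
    (g : N.carrier →ₗ[k] P.carrier) (hg : ∀ x, g (p.lin x) = f.lin x)
    (hm : ∀ {n : ℤ} {x : N.carrier}, x ∈ N.gr n → ∃ y ∈ M.gr n, p.lin y = x) : N ⟶ P where
  lin := g
  mem := fun hx => by
    obtain ⟨y, hy, rfl⟩ := hm hx
    rw [hg]
    exact f.mem hy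
  comm := fun x => by
    obtain ⟨x, rfl⟩ := hp x
    rw [← p.comm, hg, hg, f.comm]
  colin := fun x => by
    obtain ⟨x, rfl⟩ := hp x
    rw [hg, f.colin, p.colin, TensorProduct.map_map, LinearMap.id_comp,
      show g ∘ₗ p.lin = f.lin from LinearMap.ext hg]

/-- A surjective morphism lifts homogeneous elements. -/
lemma exists_mem_of_surjective {M N : DGComod C} (p : M ⟶ N) (hp : Function.Surjective p.lin)
    {n : ℤ} {x : N.carrier} (hx : x ∈ N.gr n) : ∃ y ∈ M.gr n, p.lin y = x := by
  obtain ⟨y, rfl⟩ := hp x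
  exact ⟨M.proj n y, M.proj_mem n y, by rw [← p.toHom.proj, N.proj_of_mem hx]⟩

/-! ### Truncation -/

section Trunc

variable (M : DGComod C) (a : ℤ)

/-- The subcomodule generated by the elements of degree less than `a`. -/
def truncSub : Submodule k M.carrier :=
  Submodule.span k {x | ∃ p < a, x ∈ M.gr p ∨ ∃ y ∈ M.gr p, M.d y = x}

variable {M a}

lemma mem_truncSub {p : ℤ} (hp : p < a) {x : M.carrier} (hx : x ∈ M.gr p) : x ∈ M.truncSub a :=
  Submodule.subset_span ⟨p, hp, Or.inl hx⟩

lemma d_mem_truncSub {p : ℤ} (hp : p < a) {x : M.carrier} (hx : x ∈ M.gr p) :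
    M.d x ∈ M.truncSub a :=
  Submodule.subset_span ⟨p, hp, Or.inr ⟨x, hx, rfl⟩⟩

/-- By positivity the coaction of an element of degree `p` only involves elements of degree `≤ p` in
the second factor. For `d y` the differential is applied to the coaction of `y`, whose second
factors and their differentials all lie in the span. -/
lemma truncSub_isSub (hC : C.Positive) : M.IsSub (M.truncSub a) where
  proj := fun x hx n => by
    induction hx using Submodule.span_induction with
    | zero => rw [map_zero]; exact zero_mem _
    | add x y _ _ hx hy => rw [map_add]; exact add_mem hx hy
    | smul r x _ hx => rw [map_smul]; exact Submodule.smul_mem _ _ hx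
    | mem x hx =>
      obtain ⟨p, hp, hx | ⟨y, hy, rfl⟩⟩ := hx
      · by_cases h : p = n
        · subst h
          rw [M.proj_of_mem hx]
          exact mem_truncSub hp hx
        · rw [M.proj_of_mem_ne hx h]
          exact zero_mem _
      · by_cases h : p + 1 = n
        · subst h
          rw [M.proj_of_mem (M.d_mem hy)]
          exact d_mem_truncSub hp hy
        · rw [M.proj_of_mem_ne (M.d_mem hy) h]
          exact zero_mem _
  d := fun x hx => by
    induction hx using Submodule.span_induction with
    | zero => rw [map_zero]; exact zero_mem _
    | add x y _ _ hx hy => rw [map_add]; exact add_mem hx hy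
    | smul r x _ hx => rw [map_smul]; exact Submodule.smul_mem _ _ hx
    | mem x hx =>
      obtain ⟨p, hp, hx | ⟨y, hy, rfl⟩⟩ := hx
      · exact d_mem_truncSub hp hx
      · rw [M.d_d]
        exact zero_mem _
  coact := fun x hx => by
    induction hx using Submodule.span_induction with
    | zero => rw [map_zero, map_zero]
    | add x y _ _ hx hy => rw [map_add, map_add, hx, hy, add_zero]
    | smul r x _ hx => rw [map_smul, map_smul, hx, smul_zero]
    | mem x hx =>
      obtain ⟨p, hp, hx | ⟨y, hy, rfl⟩⟩ := hx
      · refine DGVect.tensor_eq_zero hC _ p (fun q hq c y hy => ?_) (M.coact.mem hx)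
        rw [TensorProduct.map_tmul, Submodule.mkQ_apply,
          (Submodule.Quotient.mk_eq_zero _).2 (mem_truncSub (by omega) hy), TensorProduct.tmul_zero]
      · rw [M.coact.comm]
        refine DGVect.tensor_eq_zero hC (TensorProduct.map LinearMap.id (M.truncSub a).mkQ ∘ₗ
          (C.toDGVect.tensor M.toDGVect).d) p (fun q hq c y hy => ?_) (M.coact.mem hy)
        rw [LinearMap.comp_apply, DGVect.tensor_d_tmul, map_add, TensorProduct.map_tmul,
          TensorProduct.map_tmul, Submodule.mkQ_apply, Submodule.mkQ_apply,
          (Submodule.Quotient.mk_eq_zero _).2 (mem_truncSub (by omega) hy),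
          (Submodule.Quotient.mk_eq_zero _).2 (d_mem_truncSub (by omega) hy),
          TensorProduct.tmul_zero, TensorProduct.tmul_zero, add_zero]

/-- A comodule over a positively graded coalgebra with vanishing homology in degrees `< a` is
quasi-isomorphic to a comodule in degrees `≥ a`. -/
lemma exists_trunc (hC : C.Positive)
    (h : ∀ p < a, ∀ x ∈ M.gr p, M.d x = 0 → ∃ y ∈ M.gr (p - 1), M.d y = x) :
    ∃ (N : DGComod C) (f : M ⟶ N), IsQuasiIso f ∧ ∀ n < a, N.gr n = ⊥ := by
  refine ⟨quot (truncSub_isSub (M := M) (a := a) hC), quotMk _, quotMk_isQuasiIso _ ?_, ?_⟩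
  · intro x hx hd
    -- Below degree `a` the components of a cycle bound by hypothesis. From degree `a` on, the span
    -- only contains boundaries of elements of degree `a - 1`, which bound inside the span by
    -- construction.
    have key : ∀ n, ∃ y ∈ M.truncSub a, M.d y = M.proj n x := by
      intro n
      have hS := truncSub_isSub (M := M) (a := a) hC
      by_cases hn : n < a
      · obtain ⟨y, hy, hy'⟩ := h n hn (M.proj n x) (M.proj_mem n x)
          (by rw [← M.proj_d, hd, map_zero])
        exact ⟨y, mem_truncSub (by omega) hy, hy'⟩
      · clear hd
        induction hx using Submodule.span_induction with
        | zero => exact ⟨0, zero_mem _, by simp⟩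
        | add x y _ _ hx hy =>
          obtain ⟨u, hu, hu'⟩ := hx
          obtain ⟨v, hv, hv'⟩ := hy
          exact ⟨u + v, add_mem hu hv, by rw [map_add, map_add, hu', hv']⟩
        | smul r x _ hx =>
          obtain ⟨u, hu, hu'⟩ := hx
          exact ⟨r • u, Submodule.smul_mem _ _ hu, by rw [map_smul, map_smul, hu']⟩
        | mem x hx =>
          obtain ⟨p, hp, hx | ⟨y, hy, rfl⟩⟩ := hx
          · exact ⟨0, zero_mem _, by rw [map_zero, M.proj_of_mem_ne hx (by omega)]⟩
          · by_cases h : p + 1 = n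
            · subst h
              exact ⟨y, mem_truncSub hp hy, by rw [M.proj_of_mem (M.d_mem hy)]⟩
            · exact ⟨0, zero_mem _, by rw [map_zero, M.proj_of_mem_ne (M.d_mem hy) h]⟩
    choose y hy hy' using key
    classical
    refine ⟨∑ n ∈ (DirectSum.decompose M.gr x).support, y n, Submodule.sum_mem _ fun n _ => hy n, ?_⟩
    rw [map_sum, Finset.sum_congr rfl fun n _ => hy' n]
    exact DirectSum.sum_support_decompose M.gr x
  · intro n hn
    refine (Submodule.eq_bot_iff _).2 fun x hx => ?_
    obtain ⟨y, hy, rfl⟩ := quot_mem_gr _ hx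
    exact (quotMk_eq_zero _).2 (mem_truncSub hn hy)

end Trunc

end DGComod

/-! ### Cutting a graded vector space by degree -/

namespace DGVect

/-- The projection onto the part of degree less than `n`. -/
def below (V : DGVect k) (n : ℤ) : V →ₗ[k] V :=
  V.glue fun p => if p < n then LinearMap.id else 0

lemma below_of_lt (V : DGVect k) {n p : ℤ} (h : p < n) {x : V} (hx : x ∈ V.gr p) :
    V.below n x = x := by
  rw [below, V.glue_of_mem _ hx, if_pos h]
  rfl

lemma below_of_le (V : DGVect k) {n p : ℤ} (h : n ≤ p) {x : V} (hx : x ∈ V.gr p) :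
    V.below n x = 0 := by
  rw [below, V.glue_of_mem _ hx, if_neg (not_lt.2 h)]
  rfl

lemma below_mem (V : DGVect k) (n : ℤ) {p : ℤ} {x : V} (hx : x ∈ V.gr p) :
    V.below n x ∈ V.gr p := by
  by_cases h : p < n
  · rwa [V.below_of_lt h hx]
  · rw [V.below_of_le (not_lt.1 h) hx]
    exact zero_mem _

lemma below_below (V : DGVect k) {m n : ℤ} (h : m ≤ n) (x : V) :
    V.below m (V.below n x) = V.below m x := by
  have : V.below m ∘ₗ V.below n = V.below m := by
    refine V.linearMap_ext fun p x hx => ?_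
    rw [LinearMap.comp_apply]
    by_cases hp : p < n
    · rw [V.below_of_lt hp hx]
    · rw [V.below_of_le (not_lt.1 hp) hx, V.below_of_le (by omega) hx, map_zero]
  exact LinearMap.congr_fun this x

lemma below_succ (V : DGVect k) (n : ℤ) (x : V) :
    V.below (n + 1) x = V.below n x + V.proj n x := by
  have : V.below (n + 1) = V.below n + V.proj n := by
    refine V.linearMap_ext fun p x hx => ?_
    rw [LinearMap.add_apply]
    rcases lt_trichotomy p n with h | rfl | h
    · rw [V.below_of_lt h hx, V.below_of_lt (by omega) hx, V.proj_of_mem_ne hx h.ne, add_zero]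
    · rw [V.below_of_lt (by omega) hx, V.below_of_le le_rfl hx, V.proj_of_mem hx, zero_add]
    · rw [V.below_of_le (by omega) hx, V.below_of_le h.le hx, V.proj_of_mem_ne hx h.ne', add_zero]
  exact LinearMap.congr_fun this x

/-- The same graded vector space with zero differential. -/
abbrev forget (V : DGVect k) : DGVect k :=
  { V with d := 0, d_mem := fun _ => zero_mem _, d_d := fun _ => rfl }

/-- The part of degree less than `n`, with zero differential. -/
def lower (V : DGVect k) (n : ℤ) : DGVect k :=
  ker (V := V.forget) (W := V.forget)
    ⟨LinearMap.id - V.below n, fun hx => sub_mem hx (V.below_mem n hx), fun _ => by simp⟩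

/-- The inclusion of the part of degree less than `n`. -/
def lowerι (V : DGVect k) (n : ℤ) : (V.lower n).carrier →ₗ[k] V.carrier := Submodule.subtype _

lemma below_lowerι (V : DGVect k) (n : ℤ) (x : (V.lower n).carrier) :
    V.below n (V.lowerι n x) = V.lowerι n x := (sub_eq_zero.1 (LinearMap.mem_ker.1 x.2)).symm

/-- The part of degree `n`, with zero differential. -/
def slice (V : DGVect k) (n : ℤ) : DGVect k :=
  ker (V := V.forget) (W := V.forget)
    ⟨LinearMap.id - V.proj n, fun {p x} hx => sub_mem hx (by
      by_cases h : p = n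
      · subst h
        rwa [V.proj_of_mem hx]
      · rw [V.proj_of_mem_ne hx h]
        exact zero_mem _), fun _ => by simp⟩

/-- The inclusion of the part of degree `n`. -/
def sliceι (V : DGVect k) (n : ℤ) : (V.slice n).carrier →ₗ[k] V.carrier := Submodule.subtype _

lemma sliceι_injective (V : DGVect k) (n : ℤ) : Function.Injective (V.sliceι n) :=
  Subtype.val_injective

lemma sliceι_mem (V : DGVect k) (n : ℤ) (x : (V.slice n).carrier) : V.sliceι n x ∈ V.gr n := by
  have : V.sliceι n x = V.proj n (V.sliceι n x) := sub_eq_zero.1 (LinearMap.mem_ker.1 x.2)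
  rw [this]
  exact V.proj_mem _ _

/-- The projection onto the part of degree `n`. -/
def toSlice (V : DGVect k) (n : ℤ) : V.carrier →ₗ[k] (V.slice n).carrier :=
  (V.proj n).codRestrict _ fun x => by
    change V.proj n x - V.proj n (V.proj n x) = 0
    rw [V.proj_of_mem (V.proj_mem n x), sub_self]

/-- A complex concentrated in degree `n`. -/
def Concentrated (V : DGVect k) (n : ℤ) : Prop := ∀ p, p ≠ n → V.gr p = ⊥

lemma slice_concentrated (V : DGVect k) (n : ℤ) : (V.slice n).Concentrated n := by
  intro p hp
  refine (Submodule.eq_bot_iff _).2 fun x hx => V.sliceι_injective n ?_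
  rw [map_zero]
  exact V.eq_zero_of_mem_of_ne hx (V.sliceι_mem n x) hp

lemma Concentrated.boundedBelow {V : DGVect k} {n : ℤ} (h : V.Concentrated n) : V.BoundedBelow :=
  ⟨n, fun p hp => h p hp.ne⟩

lemma Concentrated.mem {V : DGVect k} {n : ℤ} (h : V.Concentrated n) (x : V) : x ∈ V.gr n :=
  V.mem_of_proj fun m hm => by
    have := V.proj_mem m x
    rwa [h m hm, Submodule.mem_bot] at this

lemma Concentrated.d_eq_zero {V : DGVect k} {n : ℤ} (h : V.Concentrated n) (x : V) : V.d x = 0 := by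
  have := V.d_mem (h.mem x)
  rwa [h (n + 1) (by omega), Submodule.mem_bot] at this

end DGVect

namespace DGComod

variable {C : DGCoalg k}

/-! ### The tower of a quasi-cofree comodule -/

namespace Cogen

variable {M : DGComod C} (G : M.Cogen)

/-- The idempotent endomorphism corresponding to the cogenerators of degree less than `n`. -/
def idem (n : ℤ) : M.carrier →ₗ[k] M.carrier := G.lift LinearMap.id (G.T.below n ∘ₗ G.π)

lemma colin_idem (n : ℤ) : Colin LinearMap.id (G.idem n) := G.colin_lift isTwist_id _

lemma π_idem (n : ℤ) (x : M.carrier) : G.π (G.idem n x) = G.T.below n (G.π x) :=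
  G.π_lift isTwist_id _ x

lemma idem_mem (n : ℤ) {p : ℤ} {x : M.carrier} (hx : x ∈ M.gr p) : G.idem n x ∈ M.gr p := by
  have := G.lift_mem isTwist_id (e := 0) (g := G.T.below n ∘ₗ G.π)
    (fun {p x} hx => by simpa using G.T.below_mem n (G.mem hx)) hx
  rwa [add_zero] at this

lemma idem_idem {m n : ℤ} (h : m ≤ n) (x : M.carrier) :
    G.idem m (G.idem n x) = G.idem m x := by
  refine LinearMap.congr_fun (G.eq_of_π (f := G.idem m ∘ₗ G.idem n)
    (Colin.comp_even_even (G.colin_idem m) (G.colin_idem n)) (G.colin_idem m) fun x => ?_) x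
  rw [LinearMap.comp_apply, π_idem, π_idem, π_idem, G.T.below_below h]

lemma equiv_idem (n : ℤ) (x : M.carrier) :
    G.equiv (G.idem n x) = TensorProduct.map LinearMap.id (G.T.below n) (G.equiv x) := by
  rw [idem, equiv_lift, equiv_apply, TensorProduct.map_map, LinearMap.id_comp]

lemma idem_of_lt (hC : C.Positive) {n p : ℤ} (hp : p < n) {x : M.carrier} (hx : x ∈ M.gr p) :
    G.idem n x = x := by
  have := G.eq_zero_of_π hC (f := LinearMap.id - G.idem n) (n := n - 1)
    ((colin_id M).sub (G.colin_idem n)) (fun q hq x hx => by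
      rw [LinearMap.sub_apply, LinearMap.id_apply, map_sub, π_idem,
        G.T.below_of_lt (by omega) (G.mem hx), sub_self]) (by omega) hx
  rw [LinearMap.sub_apply, LinearMap.id_apply, sub_eq_zero] at this
  exact this.symm

lemma idem_eq_zero {a : ℤ} (ha : ∀ n < a, G.T.gr n = ⊥) {n : ℤ} (hn : n ≤ a) : G.idem n = 0 := by
  refine G.eq_of_π (G.colin_idem n) (Colin.zero _) fun x => ?_
  rw [π_idem, LinearMap.zero_apply, map_zero]
  have : G.T.below n = 0 := G.T.linearMap_ext fun p x hx => by
    by_cases h : p < n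
    · rw [ha p (by omega), Submodule.mem_bot] at hx
      rw [hx, map_zero, map_zero]
    · rw [G.T.below_of_le (not_lt.1 h) hx, LinearMap.zero_apply]
  rw [this, LinearMap.zero_apply]

/-- The difference `x - idem n x` has no components in degrees below `n`, so its differential lives
in degrees `≥ n + 1`, where `below (n + 1)` is zero. This is why the differential respects the
filtration by degree of cogenerators. -/
lemma below_π_d (hC : C.Positive) (n : ℤ) (x : M.carrier) :
    G.T.below (n + 1) (G.π (M.d (x - G.idem n x))) = 0 := by
  have : G.T.below (n + 1) ∘ₗ G.π ∘ₗ M.d ∘ₗ (LinearMap.id - G.idem n) = 0 := by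
    refine M.linearMap_ext fun p x hx => ?_
    simp only [LinearMap.comp_apply, LinearMap.sub_apply, LinearMap.id_apply,
      LinearMap.zero_apply]
    by_cases hp : p < n
    · rw [G.idem_of_lt hC hp hx, sub_self, map_zero, map_zero, map_zero]
    · exact G.T.below_of_le (p := p + 1) (by omega)
        (G.mem (M.d_mem (sub_mem hx (G.idem_mem n hx))))
  exact LinearMap.congr_fun this x

/-- On the kernel of `idem n`, the part of the differential which moves cogenerators only reaches
degrees `≥ n + 1`; modulo these, only the differential of `C` is left. Both the stability of the
kernel and the cofreeness of the layers follow. -/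
lemma equiv_idem_d (hC : C.Positive) {n : ℤ} {y : M.carrier} (hy : G.idem n y = 0) :
    G.equiv (G.idem (n + 1) (M.d y)) =
      TensorProduct.map C.d LinearMap.id (G.equiv (G.idem (n + 1) y)) := by
  have h1 : TensorProduct.map C.sgn (G.T.below (n + 1) ∘ₗ G.π ∘ₗ M.d) (M.coact.lin y) = 0 := by
    have h2 : M.coact.lin y = TensorProduct.map LinearMap.id (LinearMap.id - G.idem n)
        (M.coact.lin y) := by
      rw [← (colin_id M).sub (G.colin_idem n) y, LinearMap.sub_apply, hy, sub_zero]
      rfl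
    rw [h2, TensorProduct.map_map]
    have h3 : (G.T.below (n + 1) ∘ₗ G.π ∘ₗ M.d) ∘ₗ (LinearMap.id - G.idem n) = 0 :=
      LinearMap.ext fun x => G.below_π_d hC n x
    rw [h3, TensorProduct.map_zero_right, LinearMap.zero_apply]
  have h2 : TensorProduct.map LinearMap.id (G.T.below (n + 1) ∘ₗ G.π) ∘ₗ
      (C.toDGVect.tensor M.toDGVect).d =
      TensorProduct.map C.d LinearMap.id ∘ₗ
        TensorProduct.map LinearMap.id (G.T.below (n + 1) ∘ₗ G.π) +
      TensorProduct.map C.sgn (G.T.below (n + 1) ∘ₗ G.π ∘ₗ M.d) := by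
    refine TensorProduct.ext' fun c m => ?_
    exact map_add (TensorProduct.map LinearMap.id (G.T.below (n + 1) ∘ₗ G.π)) (C.d c ⊗ₜ[k] m)
      (C.sgn c ⊗ₜ[k] M.d m)
  rw [idem, equiv_lift, equiv_lift, M.coact.comm]
  refine (LinearMap.congr_fun h2 (M.coact.lin y)).trans ?_
  rw [LinearMap.add_apply, h1, add_zero]
  rfl

lemma idem_d (hC : C.Positive) {n : ℤ} {y : M.carrier} (hy : G.idem n y = 0) :
    G.idem n (M.d y) = 0 := by
  apply G.equiv.injective
  rw [← G.idem_idem (show n ≤ n + 1 by omega), equiv_idem, G.equiv_idem_d hC hy,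
    TensorProduct.map_map, LinearMap.id_comp, LinearMap.comp_id, map_zero,
    show TensorProduct.map C.d (G.T.below n) = TensorProduct.map C.d LinearMap.id ∘ₗ
      TensorProduct.map LinearMap.id (G.T.below n) by
        rw [← TensorProduct.map_comp, LinearMap.id_comp, LinearMap.comp_id],
    LinearMap.comp_apply, ← equiv_idem, G.idem_idem (by omega), hy, map_zero, map_zero]

lemma isSub_ker_idem (hC : C.Positive) (n : ℤ) : M.IsSub (LinearMap.ker (G.idem n)) where
  proj := fun x hx p => by
    have := DGVect.proj_map (V := M.toDGVect) (W := M.toDGVect) 0 (f := G.idem n)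
      (fun {q x} hx => by simpa using G.idem_mem n hx) p x
    rw [LinearMap.mem_ker] at hx ⊢
    rw [← this, hx, map_zero]
  d := fun x hx => G.idem_d hC hx
  coact := fun x hx => by
    have h : (LinearMap.ker (G.idem n)).mkQ = (LinearMap.ker (G.idem n)).mkQ ∘ₗ G.idem n := by
      refine LinearMap.ext fun x => ?_
      rw [LinearMap.comp_apply, ← sub_eq_zero, ← map_sub, Submodule.mkQ_apply,
        Submodule.Quotient.mk_eq_zero, LinearMap.mem_ker, map_sub, G.idem_idem le_rfl, sub_self]
    rw [h, ← LinearMap.id_comp LinearMap.id, TensorProduct.map_comp, LinearMap.comp_apply,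
      ← G.colin_idem n x, LinearMap.mem_ker.1 hx, map_zero, map_zero]

variable (hC : C.Positive)

/-- The quotient of `M` with the cogenerators of degree less than `n`. -/
def tow (n : ℤ) : DGComod C := quot (G.isSub_ker_idem hC n)

/-- The projection of `M` to the tower. -/
def toTow (n : ℤ) : M ⟶ G.tow hC n := quotMk _

lemma toTow_surjective (n : ℤ) : Function.Surjective (G.toTow hC n).lin := quotMk_surjective _

lemma toTow_eq_zero {n : ℤ} {x : M.carrier} : (G.toTow hC n).lin x = 0 ↔ G.idem n x = 0 :=
  quotMk_eq_zero _

lemma toTow_idem {m n : ℤ} (h : m ≤ n) (x : M.carrier) :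
    (G.toTow hC m).lin (G.idem n x) = (G.toTow hC m).lin x := by
  rw [← sub_eq_zero, ← map_sub, toTow_eq_zero, map_sub, G.idem_idem h, sub_self]

/-- The section of the projection of `M` to the tower. -/
def ofTow (n : ℤ) : (G.tow hC n).carrier →ₗ[k] M.carrier :=
  (LinearMap.ker (G.idem n)).liftQ (G.idem n) le_rfl

lemma ofTow_toTow (n : ℤ) (x : M.carrier) : G.ofTow hC n ((G.toTow hC n).lin x) = G.idem n x := rfl

lemma toTow_ofTow (n : ℤ) (x : (G.tow hC n).carrier) :
    (G.toTow hC n).lin (G.ofTow hC n x) = x := by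
  obtain ⟨x, rfl⟩ := G.toTow_surjective hC n x
  rw [ofTow_toTow, G.toTow_idem hC le_rfl]

lemma ofTow_mem (n : ℤ) {p : ℤ} {x : (G.tow hC n).carrier} (hx : x ∈ (G.tow hC n).gr p) :
    G.ofTow hC n x ∈ M.gr p := by
  obtain ⟨y, hy, rfl⟩ := exists_mem_of_surjective _ (G.toTow_surjective hC n) hx
  rw [ofTow_toTow]
  exact G.idem_mem n hy

lemma colin_ofTow (n : ℤ) : Colin LinearMap.id (G.ofTow hC n) := fun x => by
  obtain ⟨x, rfl⟩ := G.toTow_surjective hC n x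
  rw [ofTow_toTow, G.colin_idem n, (G.toTow hC n).colin, TensorProduct.map_map, LinearMap.id_comp]
  rfl

/-- The transition maps of the tower. -/
def towMap {m n : ℤ} (h : m ≤ n) : G.tow hC n ⟶ G.tow hC m :=
  homDesc (G.toTow hC n) (G.toTow_surjective hC n) (G.toTow hC m)
    ((G.toTow hC m).lin ∘ₗ G.ofTow hC n) (fun x => G.toTow_idem hC h x)
    (exists_mem_of_surjective _ (G.toTow_surjective hC n))

lemma towMap_toTow {m n : ℤ} (h : m ≤ n) (x : M.carrier) :
    (G.towMap hC h).lin ((G.toTow hC n).lin x) = (G.toTow hC m).lin x := G.toTow_idem hC h x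

lemma towMap_towMap {l m n : ℤ} (h : l ≤ m) (h' : m ≤ n) (x : (G.tow hC n).carrier) :
    (G.towMap hC h).lin ((G.towMap hC h').lin x) = (G.towMap hC (h.trans h')).lin x := by
  obtain ⟨x, rfl⟩ := G.toTow_surjective hC n x
  simp only [towMap_toTow]

lemma towMap_refl {n : ℤ} (x : (G.tow hC n).carrier) : (G.towMap hC le_rfl).lin x = x := by
  obtain ⟨x, rfl⟩ := G.toTow_surjective hC n x
  rw [towMap_toTow]

lemma proj_eq_zero_of_idem (hC : C.Positive) {n p : ℤ} (hp : p < n) {x : M.carrier}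
    (hx : G.idem n x = 0) : M.proj p x = 0 := by
  rw [← G.idem_of_lt hC hp (M.proj_mem p x)]
  exact (G.isSub_ker_idem hC n).proj x hx p

/-- The tower is stationary in each degree: below degree `m` every stage from `m` on agrees with
`M`. -/
lemma towMap_injective_of_lt {m n p : ℤ} (h : m ≤ n) (hp : p < m) {x y : (G.tow hC n).carrier}
    (hx : x ∈ (G.tow hC n).gr p) (hy : y ∈ (G.tow hC n).gr p)
    (hxy : (G.towMap hC h).lin x = (G.towMap hC h).lin y) : x = y := by
  rw [← sub_eq_zero, ← map_sub] at hxy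
  rw [← sub_eq_zero]
  obtain ⟨z, hz, hz'⟩ := exists_mem_of_surjective _ (G.toTow_surjective hC n) (sub_mem hx hy)
  rw [← hz', towMap_toTow, toTow_eq_zero, G.idem_of_lt hC hp hz] at hxy
  rw [← hz', hxy, map_zero]

/-- The cogenerators of the tower. -/
def towπ (n : ℤ) : (G.tow hC n).carrier →ₗ[k] (G.T.lower n).carrier :=
  ((G.T.below n ∘ₗ G.π) ∘ₗ G.ofTow hC n).codRestrict _ fun x => by
    change G.T.below n _ - G.T.below n (G.T.below n _) = 0
    rw [G.T.below_below le_rfl, sub_self]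

lemma lowerι_towπ_toTow (n : ℤ) :
    (G.T.lowerι n ∘ₗ G.towπ hC n) ∘ₗ (G.toTow hC n).lin = G.T.below n ∘ₗ G.π := by
  refine LinearMap.ext fun x => ?_
  change G.T.below n (G.π (G.ofTow hC n ((G.toTow hC n).lin x))) = _
  rw [ofTow_toTow, π_idem, G.T.below_below le_rfl]
  rfl

lemma map_lowerι_map_towπ (n : ℤ) (x : M.carrier) :
    TensorProduct.map LinearMap.id (G.T.lowerι n) (TensorProduct.map LinearMap.id (G.towπ hC n)
      ((G.tow hC n).coact.lin ((G.toTow hC n).lin x))) = G.equiv (G.idem n x) := by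
  rw [(G.toTow hC n).colin, TensorProduct.map_map, TensorProduct.map_map, lowerι_towπ_toTow, idem,
    equiv_lift]
  rfl

lemma towπ_bijective (n : ℤ) : Function.Bijective
    (TensorProduct.map LinearMap.id (G.towπ hC n) ∘ₗ (G.tow hC n).coact.lin) := by
  constructor
  · intro x y hxy
    obtain ⟨x, rfl⟩ := G.toTow_surjective hC n x
    obtain ⟨y, rfl⟩ := G.toTow_surjective hC n y
    have := congrArg (TensorProduct.map LinearMap.id (G.T.lowerι n)) hxy
    rw [LinearMap.comp_apply, LinearMap.comp_apply, map_lowerι_map_towπ,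
      map_lowerι_map_towπ] at this
    rw [← G.toTow_idem hC le_rfl x, ← G.toTow_idem hC le_rfl y, G.equiv.injective this]
  · intro t
    have hι : Function.Injective (TensorProduct.map (LinearMap.id : C.carrier →ₗ[k] C.carrier)
        (G.T.lowerι n)) :=
      Module.Flat.lTensor_preserves_injective_linearMap _ Subtype.val_injective
    refine ⟨(G.toTow hC n).lin (G.equiv.symm (TensorProduct.map LinearMap.id (G.T.lowerι n) t)),
      hι ?_⟩
    rw [LinearMap.comp_apply, map_lowerι_map_towπ, equiv_idem, LinearEquiv.apply_symm_apply,
      TensorProduct.map_map, show G.T.below n ∘ₗ G.T.lowerι n = G.T.lowerι n from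
        LinearMap.ext (G.T.below_lowerι n), LinearMap.id_comp]

/-- The members of the tower are quasi-cofree. -/
def towCogen (n : ℤ) : (G.tow hC n).Cogen where
  T := G.T.lower n
  π := G.towπ hC n
  mem := fun hx => G.T.below_mem n (G.mem (G.ofTow_mem hC n hx))
  bij := G.towπ_bijective hC n

lemma towCogen_boundedBelow (hT : G.T.BoundedBelow) (n : ℤ) :
    (G.towCogen hC n).T.BoundedBelow :=
  DGVect.BoundedBelow.ker _ (V := G.T.forget) hT

/-- The layers of the tower, as graded maps to `M`. -/
def layer (n : ℤ) : (cofree C (G.T.slice n)).carrier →ₗ[k] M.carrier :=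
  G.lift LinearMap.id (G.T.sliceι n ∘ₗ (cofreeCounit (G.T.slice n)).lin)

lemma equiv_layer (n : ℤ) (x : (cofree C (G.T.slice n)).carrier) :
    G.equiv (G.layer n x) = TensorProduct.map LinearMap.id (G.T.sliceι n) x := by
  rw [layer, equiv_lift, ← LinearMap.id_comp LinearMap.id, TensorProduct.map_comp,
    LinearMap.comp_apply, map_cofreeCounit_coact, LinearMap.id_comp]

lemma below_sliceι_of_lt {m n : ℤ} (h : n < m) :
    G.T.below m ∘ₗ G.T.sliceι n = G.T.sliceι n :=
  LinearMap.ext fun x => G.T.below_of_lt h (G.T.sliceι_mem n x)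

lemma idem_layer (n : ℤ) (x : (cofree C (G.T.slice n)).carrier) : G.idem n (G.layer n x) = 0 := by
  apply G.equiv.injective
  rw [equiv_idem, equiv_layer, TensorProduct.map_map, map_zero,
    show G.T.below n ∘ₗ G.T.sliceι n = 0 from
      LinearMap.ext fun x => G.T.below_of_le le_rfl (G.T.sliceι_mem n x),
    TensorProduct.map_zero_right, LinearMap.zero_apply]

lemma idem_succ_layer (n : ℤ) (x : (cofree C (G.T.slice n)).carrier) :
    G.idem (n + 1) (G.layer n x) = G.layer n x := by
  apply G.equiv.injective
  rw [equiv_idem, equiv_layer, TensorProduct.map_map, G.below_sliceι_of_lt (by omega),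
    LinearMap.id_comp]

/-- The layers of the tower. -/
def layerHom (n : ℤ) : cofree C (G.T.slice n) ⟶ G.tow hC (n + 1) where
  lin := (G.toTow hC (n + 1)).lin ∘ₗ G.layer n
  mem := fun {p x} hx => by
    refine (G.toTow hC (n + 1)).mem ?_
    have := G.lift_mem (A := cofree C (G.T.slice n)) isTwist_id (e := 0)
      (g := G.T.sliceι n ∘ₗ (cofreeCounit (G.T.slice n)).lin) (fun {p x} hx => by
        rw [add_zero]
        exact (cofreeCounit (C := C) (G.T.slice n)).mem hx) hx
    rwa [add_zero] at this
  comm := fun x => by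
    rw [LinearMap.comp_apply, LinearMap.comp_apply, ← (G.toTow hC (n + 1)).comm, ← sub_eq_zero,
      ← map_sub, toTow_eq_zero]
    apply G.equiv.injective
    rw [map_sub, map_sub, map_zero, sub_eq_zero, G.equiv_idem_d hC (G.idem_layer n x),
      idem_succ_layer, idem_succ_layer, equiv_layer, equiv_layer]
    have : TensorProduct.map LinearMap.id (G.T.sliceι n) ∘ₗ (cofree C (G.T.slice n)).d =
        TensorProduct.map C.d LinearMap.id ∘ₗ
          TensorProduct.map LinearMap.id (G.T.sliceι n) := by
      refine TensorProduct.ext' fun c v => ?_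
      refine (map_add (TensorProduct.map LinearMap.id (G.T.sliceι n)) (C.d c ⊗ₜ[k] v)
        (C.sgn c ⊗ₜ[k] (G.T.slice n).d v)).trans ?_
      rw [(G.T.slice_concentrated n).d_eq_zero, TensorProduct.tmul_zero, map_zero, add_zero]
      rfl
    exact LinearMap.congr_fun this x
  colin := Colin.comp_even_even (G.toTow hC (n + 1)).colin' (G.colin_lift isTwist_id _)

lemma layerHom_lin (n : ℤ) (x : (cofree C (G.T.slice n)).carrier) :
    (G.layerHom hC n).lin x = (G.toTow hC (n + 1)).lin (G.layer n x) := rfl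

/-- As graded comodules this is `C` tensored with the split sequence formed by the cogenerators of
degree `n`, those of degree at most `n`, and those of degree below `n`. That the kernel is cofree as
a DG comodule, with zero differential on its cogenerators, is `equiv_idem_d`. -/
lemma shortExact_tow (n : ℤ) :
    ShortExact (G.layerHom hC n) (G.towMap hC (show n ≤ n + 1 by omega)) where
  zero := by
    refine hom_ext (LinearMap.ext fun x => ?_)
    change (G.towMap hC (show n ≤ n + 1 by omega)).lin ((G.toTow hC (n + 1)).lin (G.layer n x)) = 0
    rw [towMap_toTow, toTow_eq_zero, idem_layer]
  injective := by
    refine (injective_iff_map_eq_zero _).2 fun x hx => ?_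
    rw [layerHom_lin, toTow_eq_zero, idem_succ_layer] at hx
    have hι : Function.Injective (TensorProduct.map (LinearMap.id : C.carrier →ₗ[k] C.carrier)
        (G.T.sliceι n)) :=
      Module.Flat.lTensor_preserves_injective_linearMap _ (G.T.sliceι_injective n)
    apply hι
    rw [← equiv_layer, hx, map_zero, map_zero]
  exact := by
    intro x hx
    obtain ⟨x, rfl⟩ := G.toTow_surjective hC _ x
    rw [towMap_toTow, toTow_eq_zero] at hx
    refine ⟨TensorProduct.map LinearMap.id (G.T.toSlice n) (G.equiv x), ?_⟩
    rw [layerHom_lin, ← sub_eq_zero, ← map_sub, toTow_eq_zero, map_sub, idem_succ_layer,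
      sub_eq_zero]
    apply G.equiv.injective
    rw [equiv_layer, TensorProduct.map_map, equiv_idem, LinearMap.id_comp,
      show G.T.sliceι n ∘ₗ G.T.toSlice n = G.T.proj n from rfl,
      show G.T.below (n + 1) = G.T.below n + G.T.proj n from
        LinearMap.ext (G.T.below_succ n), TensorProduct.map_add_right, LinearMap.add_apply,
      ← equiv_idem, hx, map_zero, zero_add]
  surjective := fun x => by
    obtain ⟨x, rfl⟩ := G.toTow_surjective hC _ x
    exact ⟨(G.toTow hC (n + 1)).lin x, G.towMap_toTow hC _ x⟩

end Cogen

end DGComod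

/-! ### The limit of the tower -/

namespace DGComod

variable {C : DGCoalg k}

/-- The product is not a set of families, but an element of it in `C ⊗ ∏ Mⱼ` is determined by the
coactions of its components, by `map_proj_piIncl`. -/
lemma pi_elem_ext {J : Type u} {M : J → DGComod C} {x y : (pi M).carrier}
    (h : ∀ j, (piπ M j).lin x = (piπ M j).lin y) : x = y := by
  rw [← sub_eq_zero]
  apply piIncl_injective M
  rw [map_zero]
  refine tensor_eq_zero_of_jointly_injective
    (fun j => (DGVect.prodProj (fun j => (M j).toDGVect) j).lin)
    (fun x hx => DGVect.prod_ext _ fun j => (hx j).trans (map_zero _).symm) fun j => ?_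
  refine (map_proj_piIncl M j (x - y)).trans ?_
  rw [← piπ_lin, map_sub, h, sub_self, map_zero]

lemma comp_apply {M N P : DGComod C} (f : M ⟶ N) (g : N ⟶ P) (x : M.carrier) :
    (f ≫ g).lin x = g.lin (f.lin x) := rfl

namespace Cogen

variable {M : DGComod C} (G : M.Cogen) (hC : C.Positive) (a : ℤ)

/-- The tower as a sequence. -/
abbrev towSeq (j : ULift.{u} ℕ) : DGComod C := G.tow hC (a + (j.down : ℤ))

/-- The map of `M` to the product of the tower. -/
def toTowers : M ⟶ pi (G.towSeq hC a) := piLift fun j => G.toTow hC (a + (j.down : ℤ))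

/-- The endomorphism of the product of the tower whose kernel is the limit. -/
def towDiff : pi (G.towSeq hC a) ⟶ pi (G.towSeq hC a) :=
  piLift fun j => piπ (G.towSeq hC a) j - piπ (G.towSeq hC a) ⟨j.down + 1⟩ ≫
    G.towMap hC (by push_cast; omega)

lemma π_toTowers (j : ULift.{u} ℕ) (x : M.carrier) :
    (piπ (G.towSeq hC a) j).lin ((G.toTowers hC a).lin x) =
      (G.toTow hC (a + (j.down : ℤ))).lin x := by
  rw [← comp_apply, toTowers, piLift_π]

lemma π_towDiff (j : ULift.{u} ℕ) (x : (pi (G.towSeq hC a)).carrier) :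
    (piπ (G.towSeq hC a) j).lin ((G.towDiff hC a).lin x) =
      (piπ (G.towSeq hC a) j).lin x - (G.towMap hC (by push_cast; omega)).lin
        ((piπ (G.towSeq hC a) ⟨j.down + 1⟩).lin x) := by
  rw [← comp_apply, towDiff, piLift_π]
  rfl

lemma π_eq_towMap {z : (pi (G.towSeq hC a)).carrier} (hz : (G.towDiff hC a).lin z = 0)
    {m n : ℕ} (h : m ≤ n) : (piπ (G.towSeq hC a) ⟨m⟩).lin z =
      (G.towMap hC (show a + (m : ℤ) ≤ a + (n : ℤ) by omega)).lin
        ((piπ (G.towSeq hC a) ⟨n⟩).lin z) := by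
  induction n, h using Nat.le_induction with
  | base => exact (G.towMap_refl hC _).symm
  | succ n hmn ih =>
    have := G.π_towDiff hC a ⟨n⟩ z
    rw [hz, map_zero, eq_comm, sub_eq_zero] at this
    rw [ih, this, towMap_towMap]

lemma toTow_ofTow_le {m n : ℤ} (h : m ≤ n) (x : (G.tow hC n).carrier) :
    (G.toTow hC m).lin (G.ofTow hC n x) = (G.towMap hC h).lin x := by
  rw [← G.towMap_toTow hC h, toTow_ofTow]

/-- The preimage in `M` of a compatible family. -/
def glueTow : (pi (G.towSeq hC a)).carrier →ₗ[k] M.carrier :=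
  (pi (G.towSeq hC a)).toDGVect.glue fun p =>
    G.ofTow hC _ ∘ₗ (piπ (G.towSeq hC a) ⟨(p + 1 - a).toNat⟩).lin

lemma glueTow_mem {p : ℤ} {z : (pi (G.towSeq hC a)).carrier}
    (hz : z ∈ (pi (G.towSeq hC a)).gr p) : G.glueTow hC a z ∈ M.gr p := by
  rw [glueTow, DGVect.glue_of_mem _ _ hz]
  exact G.ofTow_mem hC _ ((piπ (G.towSeq hC a) _).mem hz)

/-- In degree `p` the stage with index `p + 1 - a` already agrees with `M`, so the preimage is read
off there. Earlier stages match by compatibility of the family, later ones because the transition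
maps are injective in degree `p`. -/
lemma toTowers_glueTow_of_mem {p : ℤ} {z : (pi (G.towSeq hC a)).carrier}
    (hz : z ∈ (pi (G.towSeq hC a)).gr p) (h : (G.towDiff hC a).lin z = 0) :
    (G.toTowers hC a).lin (G.glueTow hC a z) = z := by
  refine pi_elem_ext fun j => ?_
  obtain ⟨n⟩ := j
  have hn : p < a + ((p + 1 - a).toNat : ℤ) := by omega
  have hg : G.glueTow hC a z =
      G.ofTow hC _ ((piπ (G.towSeq hC a) ⟨(p + 1 - a).toNat⟩).lin z) := by
    rw [glueTow, DGVect.glue_of_mem _ _ hz]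
    rfl
  rw [π_toTowers]
  rcases le_total n (p + 1 - a).toNat with hle | hle
  · rw [hg, G.toTow_ofTow_le hC (show a + (n : ℤ) ≤ a + ((p + 1 - a).toNat : ℤ) by omega), ← G.π_eq_towMap hC a h hle]
  · refine G.towMap_injective_of_lt hC (show a + ((p + 1 - a).toNat : ℤ) ≤ a + (n : ℤ) by omega) hn
      ((G.toTow hC _).mem (G.glueTow_mem hC a hz)) ((piπ (G.towSeq hC a) ⟨n⟩).mem hz) ?_
    rw [towMap_toTow, hg, toTow_ofTow, ← G.π_eq_towMap hC a h hle]

/-- The components of a section of `towDiff`. -/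
def towSection : ∀ n : ℕ, (pi (G.towSeq hC a)).carrier →ₗ[k] (G.tow hC (a + (n : ℤ))).carrier
  | 0 => 0
  -- The recursion solves `xₙ - (image of xₙ₊₁) = zₙ` by lifting `xₙ - zₙ` along the colinear
  -- section `ofTow`.
  | n + 1 => (G.toTow hC (a + ((n + 1 : ℕ) : ℤ))).lin ∘ₗ G.ofTow hC (a + (n : ℤ)) ∘ₗ
      (towSection n - (piπ (G.towSeq hC a) ⟨n⟩).lin)

lemma colin_towSection (n : ℕ) : Colin LinearMap.id (G.towSection hC a n) := by
  induction n with
  | zero => exact Colin.zero _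
  | succ n ih =>
    exact Colin.comp_even_even (G.toTow hC _).colin' (Colin.comp_even_even (G.colin_ofTow hC _)
      (ih.sub (piπ (G.towSeq hC a) ⟨n⟩).colin'))

lemma towSection_mem (n : ℕ) {p : ℤ} {z : (pi (G.towSeq hC a)).carrier}
    (hz : z ∈ (pi (G.towSeq hC a)).gr p) :
    G.towSection hC a n z ∈ (G.tow hC (a + (n : ℤ))).gr p := by
  induction n with
  | zero => exact zero_mem _
  | succ n ih =>
    exact (G.toTow hC _).mem (G.ofTow_mem hC _ (sub_mem ih ((piπ (G.towSeq hC a) ⟨n⟩).mem hz)))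

/-- A Mittag-Leffler argument. Because the transition maps have colinear sections of degree `0`, the
recursive solution is given by colinear maps and so defines a map to the product of comodules. -/
lemma towDiff_surjective : Function.Surjective (G.towDiff hC a).lin := by
  intro z
  have h1 : ∀ (j : ULift.{u} ℕ) {p : ℤ} {z : (pi (G.towSeq hC a)).carrier},
      z ∈ (pi (G.towSeq hC a)).gr p →
        G.towSection hC a j.down z ∈ (G.towSeq hC a j).gr (p + 0) := fun j p z hz => by
    rw [add_zero]
    exact G.towSection_mem hC a j.down hz
  refine ⟨piLin (M := G.towSeq hC a) isTwist_id 0 (fun j => G.towSection hC a j.down) h1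
    (fun j => G.colin_towSection hC a j.down) z, pi_elem_ext fun j => ?_⟩
  obtain ⟨n⟩ := j
  rw [π_towDiff, piπ_piLin, piπ_piLin]
  change G.towSection hC a n z - (G.towMap hC _).lin ((G.toTow hC (a + ((n + 1 : ℕ) : ℤ))).lin
    (G.ofTow hC _ (G.towSection hC a n z - (piπ (G.towSeq hC a) ⟨n⟩).lin z))) = _
  rw [towMap_toTow, toTow_ofTow]
  abel

/-- A quasi-cofree comodule is the (derived) limit of its tower. -/
lemma shortExact_towers : ShortExact (G.toTowers hC a) (G.towDiff hC a) where
  zero := by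
    refine hom_ext (LinearMap.ext fun x => pi_elem_ext fun j => ?_)
    rw [comp_apply, π_towDiff, π_toTowers, π_toTowers, towMap_toTow, sub_self]
    exact (map_zero _).symm
  injective := by
    refine (injective_iff_map_eq_zero _).2 fun x hx => ?_
    refine M.eq_zero_of_proj fun p => ?_
    have hp : p < a + ((p + 1 - a).toNat : ℤ) := by omega
    refine G.proj_eq_zero_of_idem hC hp ?_
    rw [← G.toTow_eq_zero hC, ← G.π_toTowers hC a ⟨(p + 1 - a).toNat⟩, hx, map_zero]
  exact := by
    intro z hz
    refine ⟨G.glueTow hC a z, DGVect.ext_proj _ fun p => ?_⟩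
    have h1 := DGVect.proj_map (V := (pi (G.towSeq hC a)).toDGVect) (W := M.toDGVect) 0
      (f := G.glueTow hC a) (fun {q x} hx => by
        rw [add_zero]
        exact G.glueTow_mem hC a hx) p z
    rw [add_zero] at h1
    rw [(G.toTowers hC a).toHom.proj, h1]
    refine G.toTowers_glueTow_of_mem hC a (DGVect.proj_mem _ p z) ?_
    rw [← (G.towDiff hC a).toHom.proj, hz, map_zero]
  surjective := G.towDiff_surjective hC a

end Cogen

end DGComod

/-! ### Dévissage of bounded below closed comodules -/

namespace DGComod

variable {C : DGCoalg k}

/-- The left bounded closed comodules. -/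
structure Good (M : DGComod C) : Prop where
  bounded : M.BoundedBelow
  closed : M.IsClosed

lemma Cogen.good {M : DGComod C} (G : M.Cogen) (hC : C.Positive) (hT : G.T.BoundedBelow) :
    M.Good := ⟨G.boundedBelow hC hT, G.isClosed hC hT⟩

lemma Good.shift {M : DGComod C} (h : M.Good) (n : ℤ) : (M.shift n).Good :=
  ⟨h.bounded.shift n, h.closed.shift n⟩

lemma boundedBelow_cone {M N : DGComod C} (f : M ⟶ N) (hM : M.BoundedBelow)
    (hN : N.BoundedBelow) : (Co f).BoundedBelow := by
  obtain ⟨a, ha⟩ := hM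
  obtain ⟨b, hb⟩ := hN
  refine ⟨min (a - 1) b, fun n hn => (Submodule.eq_bot_iff _).2 fun x hx => ?_⟩
  have h := (mem_cone_gr f).1 hx
  rw [ha _ (by omega), hb _ (by omega), Submodule.mem_bot, Submodule.mem_bot] at h
  exact cone_ext f (h.1.trans (map_zero _).symm) (h.2.trans (map_zero _).symm)

lemma Good.cone {M N : DGComod C} (f : M ⟶ N) (hM : M.Good) (hN : N.Good) : (Co f).Good :=
  ⟨boundedBelow_cone f hM.bounded hN.bounded, hM.closed.cone f hN.closed⟩

lemma good_cofree (hC : C.Positive) {V : DGVect k} (hV : V.BoundedBelow) : (cofree C V).Good :=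
  (cofreeCogen V).good hC hV

lemma resCogen_boundedBelow (hC : C.Positive) {M : DGComod C} (hM : M.BoundedBelow) :
    M.resCogen.T.BoundedBelow := by
  obtain ⟨a, ha⟩ := hM
  exact ⟨a, M.resCogen_gr ha hC⟩

lemma good_res (hC : C.Positive) {M : DGComod C} (hM : M.BoundedBelow) : M.res.Good :=
  M.resCogen.good hC (resCogen_boundedBelow hC hM)

lemma Cogen.tow_gr {M : DGComod C} (G : M.Cogen) (hC : C.Positive) {a : ℤ}
    (h : ∀ n < a, M.gr n = ⊥) (m : ℤ) : ∀ n < a, (G.tow hC m).gr n = ⊥ := by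
  intro n hn
  refine (Submodule.eq_bot_iff _).2 fun x hx => ?_
  obtain ⟨y, hy, rfl⟩ := exists_mem_of_surjective _ (G.toTow_surjective hC m) hx
  rw [h n hn, Submodule.mem_bot] at hy
  rw [hy, map_zero]

/-- A class of left bounded closed comodules which is triangulated. -/
structure Triangulated (Q : DGComod C → Prop) : Prop where
  quasiIso : ∀ {M N : DGComod C} (f : M ⟶ N), IsQuasiIso f → M.Good → N.Good → (Q M ↔ Q N)
  shift : ∀ {M : DGComod C} (n : ℤ), M.Good → Q M → Q (M.shift n)
  cone : ∀ {M N : DGComod C} (f : M ⟶ N), M.Good → N.Good → Q M → Q N → Q (Co f)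

namespace Triangulated

variable {Q : DGComod C → Prop}

lemma of_shift (hQ : Triangulated Q) {M : DGComod C} (hM : M.Good) {n : ℤ} (h : Q (M.shift n)) : Q M :=
  (hQ.quasiIso (M.shiftShiftZero (add_neg_cancel n)) (.of_bijective Function.bijective_id)
    ((hM.shift n).shift (-n)) hM).1 (hQ.shift (-n) (hM.shift n) h)

variable {M N P : DGComod C} {i : M ⟶ N} {p : N ⟶ P}

lemma left (hQ : Triangulated Q) (h : ShortExact i p) (hM : M.Good) (hN : N.Good) (hP : P.Good) (h₂ : Q N)
    (h₃ : Q P) : Q M :=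
  hQ.of_shift hM ((hQ.quasiIso h.toCone h.toCone_isQuasiIso (hM.shift 1) (hN.cone p hP)).2
    (hQ.cone p hN hP h₂ h₃))

/-- The kernel, shifted, is the cone of `p`, and `N[1]` is the cone of `P ⟶ Co p`; so membership of
the outer terms gives that of the middle one after undoing a shift. -/
lemma middle (hQ : Triangulated Q) (h : ShortExact i p) (hM : M.Good) (hN : N.Good) (hP : P.Good) (h₁ : Q M)
    (h₃ : Q P) : Q N := by
  have hp : Q (Co p) := (hQ.quasiIso h.toCone h.toCone_isQuasiIso (hM.shift 1) (hN.cone p hP)).1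
    (hQ.shift 1 hM h₁)
  exact hQ.of_shift hN ((hQ.quasiIso (shortExact_cone p).fromCone
    (shortExact_cone p).fromCone_isQuasiIso (hP.cone _ (hN.cone p hP)) (hN.shift 1)).1
      (hQ.cone _ hP (hN.cone p hP) h₃ hp))

/-- Induction along the tower, each stage being an extension of the previous one by a cofree layer;
the stage at the lower bound `a` of the cogenerators is zero. -/
lemma tow (hQ : Triangulated Q) (hC : C.Positive)
    (hE : ∀ (V : DGVect k) (n : ℤ), V.Concentrated n → Q (cofree C V)) (G : M.Cogen) {a : ℤ}
    (ha : ∀ n < a, G.T.gr n = ⊥) (m : ℕ) : Q (G.tow hC (a + m)) := by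
  have hg : ∀ n, (G.tow hC n).Good := fun n =>
    (G.towCogen hC n).good hC (G.towCogen_boundedBelow hC ⟨a, ha⟩ n)
  induction m with
  | zero =>
    have h1 : ∀ x y : (G.tow hC (a + (0 : ℕ))).carrier, x = y := by
      have : ∀ x : (G.tow hC (a + (0 : ℕ))).carrier, x = 0 := fun x => by
        obtain ⟨x, rfl⟩ := G.toTow_surjective hC _ x
        rw [G.toTow_eq_zero hC, G.idem_eq_zero ha (by simp)]
        rfl
      exact fun x y => (this x).trans (this y).symm
    have h2 : ∀ x : (G.T.slice (a - 1)).carrier, x = 0 := fun x => by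
      have h := G.T.sliceι_mem (a - 1) x
      rw [ha _ (by omega), Submodule.mem_bot] at h
      exact G.T.sliceι_injective _ (h.trans (map_zero _).symm)
    have h3 : ∀ x : (cofree C (G.T.slice (a - 1))).carrier, x = 0 := fun x => by
      induction x using TensorProduct.induction_on with
      | zero => rfl
      | tmul c v => rw [h2 v, TensorProduct.tmul_zero]
      | add x y hx hy => rw [hx, hy, add_zero]
    refine (hQ.quasiIso (0 : cofree C (G.T.slice (a - 1)) ⟶ _) (.of_bijective ⟨?_, ?_⟩)
      (good_cofree hC (G.T.slice_concentrated _).boundedBelow) (hg _)).1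
      (hE _ _ (G.T.slice_concentrated _))
    · exact fun x y _ => (h3 x).trans (h3 y).symm
    · exact fun y => ⟨0, h1 _ _⟩
  | succ m ih =>
    have := hQ.middle (G.shortExact_tow hC (a + m))
      (good_cofree hC (G.T.slice_concentrated _).boundedBelow) (hg _) (hg _)
      (hE _ _ (G.T.slice_concentrated _)) ih
    rw [add_assoc] at this
    push_cast
    exact this

/-- The left bounded closed comodules are generated under products by the cofree comodules on
complexes concentrated in one degree. -/
theorem of_good (hQ : Triangulated Q) (hC : C.Positive)
    (hpi : ∀ M : ULift.{u} ℕ → DGComod C, (∃ a : ℤ, ∀ j, ∀ n < a, (M j).gr n = ⊥) →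
      (∀ j, (M j).Good) → (∀ j, Q (M j)) → Q (DGComod.pi M))
    (hE : ∀ (V : DGVect k) (n : ℤ), V.Concentrated n → Q (cofree C V)) (hM : M.Good) : Q M := by
  obtain ⟨a, ha⟩ := resCogen_boundedBelow hC hM.bounded
  have hg : ∀ n, (M.resCogen.tow hC n).Good := fun n =>
    (M.resCogen.towCogen hC n).good hC (M.resCogen.towCogen_boundedBelow hC ⟨a, ha⟩ n)
  obtain ⟨b, hb⟩ := (good_res hC hM.bounded).bounded
  -- All stages are quotients of the resolution, hence bounded below by the same integer, and so is
  -- their product.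
  have hgr := fun j : ULift.{u} ℕ => M.resCogen.tow_gr hC hb (a + (j.down : ℤ))
  have hp : (DGComod.pi (M.resCogen.towSeq hC a)).Good :=
    ⟨⟨b, pi_gr hC hgr⟩, isClosed_pi fun j => (hg _).closed⟩
  have hQp : Q (DGComod.pi (M.resCogen.towSeq hC a)) := hpi _ ⟨b, hgr⟩ (fun j => hg _)
    fun j => hQ.tow hC hE M.resCogen ha j.down
  -- The resolution is the kernel of a surjective endomorphism of the product of the stages, so two
  -- copies of the product suffice.
  exact (hQ.quasiIso M.toRes M.toRes_isQuasiIso hM (good_res hC hM.bounded)).2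
    (hQ.left (M.resCogen.shortExact_towers hC a) (good_res hC hM.bounded) hp hp hQp hQp)

end Triangulated

end DGComod

/-! ### Shifts seen as identity maps of nonzero degree -/

namespace DGComod

variable {C : DGCoalg k}

/-- The identity, as a linear map from `M[n]` to `M`. -/
def unshift (M : DGComod C) (n : ℤ) : (M.shift n).carrier →ₗ[k] M.carrier := LinearMap.id

/-- The identity, as a linear map from `M` to `M[n]`. -/
def reshift (M : DGComod C) (n : ℤ) : M.carrier →ₗ[k] (M.shift n).carrier := LinearMap.id

lemma colin_unshift (M : DGComod C) (n : ℤ) :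
    Colin (M := M.shift n) (N := M) LinearMap.id (M.unshift n) := colin_id M

lemma colin_reshift (M : DGComod C) (n : ℤ) :
    Colin (M := M) (N := M.shift n) LinearMap.id (M.reshift n) := colin_id M

lemma unshift_mem (M : DGComod C) (n : ℤ) {j : ℤ} {x : (M.shift n).carrier}
    (hx : x ∈ (M.shift n).gr j) : M.unshift n x ∈ M.gr (j + n) := by
  rw [add_comm]
  exact hx

lemma unshift_d (M : DGComod C) (n : ℤ) (x : (M.shift n).carrier) :
    M.unshift n ((M.shift n).d x) = M.d (M.unshift n x) := rfl

namespace Hom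

variable {M N : DGComod C} {n : ℤ}

/-- A morphism to `N[n]`, given by a linear map of degree `n`. -/
def mkShift (l : M.carrier →ₗ[k] N.carrier)
    (mem : ∀ (j : ℤ) (z : M.carrier), z ∈ M.gr j → l z ∈ N.gr (n + j))
    (comm : ∀ z, l (M.d z) = N.d (l z)) (colin : Colin LinearMap.id l) : M ⟶ N.shift n where
  lin := l
  mem := mem _ _
  comm := comm
  colin := colin

section

variable {l : M.carrier →ₗ[k] N.carrier}
    {mem : ∀ (j : ℤ) (z : M.carrier), z ∈ M.gr j → l z ∈ N.gr (n + j)}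
    {comm : ∀ z, l (M.d z) = N.d (l z)} {colin : Colin LinearMap.id l}

lemma unshift_mkShift (z : M.carrier) : N.unshift n ((mkShift l mem comm colin).lin z) = l z := rfl

lemma mkShift_bijective (h : Function.Bijective l) :
    Function.Bijective (mkShift l mem comm colin).lin := h

end

lemma shift_ext {f g : M ⟶ N.shift n}
    (h : ∀ z, N.unshift n (f.lin z) = N.unshift n (g.lin z)) : f = g :=
  hom_ext (LinearMap.ext h)

lemma unshift_shift (f : M ⟶ N) (z : (M.shift n).carrier) :
    N.unshift n ((Hom.shift f n).lin z) = f.lin (M.unshift n z) := rfl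

lemma unshift_comp_shift (f : M ⟶ N) :
    N.unshift n ∘ₗ (Hom.shift f n).lin = f.lin ∘ₗ M.unshift n := rfl

end Hom

lemma unshift_coneδ {M N : DGComod C} (f : M ⟶ N) (z : (Co f).carrier) :
    M.unshift 1 ((coneδ f).lin z) = M.sgn (coneFst f z) := rfl

lemma unshift_comp_coneδ {M N : DGComod C} (f : M ⟶ N) :
    M.unshift 1 ∘ₗ (coneδ f).lin = M.sgn ∘ₗ coneFst f := rfl

end DGComod

namespace DGBicomod

open DGComod

variable {C D : DGCoalg k} (X : DGBicomod D C)

/-! ### The cotensor product -/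

section Lin

variable {M N : DGComod C}

lemma cotensor_ext {z w : (X.cotensor M).carrier}
    (h : (X.cotensorι M).lin z = (X.cotensorι M).lin w) : z = w := X.cotensorι_injective M h

lemma coactR_sgn (x : X.carrier) :
    X.coactR.lin (X.sgn x) = TensorProduct.map X.sgn C.sgn (X.coactR.lin x) := by
  have h : (X.toDGVect.tensor C.toDGVect).sgn = TensorProduct.map X.sgn C.sgn :=
    TensorProduct.ext' fun x y => DGVect.tensor_sgn_tmul _ _ x y
  rw [X.coactR.sgn, h]

/-- The map induced on cotensor products by a colinear map of even degree. -/
def cotensorEven (g : M.carrier →ₗ[k] N.carrier) (hg : Colin LinearMap.id g) :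
    (X.cotensor M).carrier →ₗ[k] (X.cotensor N).carrier :=
  X.cotensorMapLin LinearMap.id LinearMap.id g (fun x => by simp) hg

/-- The map induced on cotensor products by a colinear map of odd degree. -/
def cotensorOdd (g : M.carrier →ₗ[k] N.carrier) (hg : Colin C.sgn g) :
    (X.cotensor M).carrier →ₗ[k] (X.cotensor N).carrier :=
  X.cotensorMapLin X.sgn C.sgn g X.coactR_sgn hg

variable {g : M.carrier →ₗ[k] N.carrier}

lemma cotensorι_even (hg : Colin LinearMap.id g) (z : (X.cotensor M).carrier) :
    (X.cotensorι N).lin (X.cotensorEven g hg z) =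
      TensorProduct.map LinearMap.id g ((X.cotensorι M).lin z) := rfl

lemma cotensorι_odd (hg : Colin C.sgn g) (z : (X.cotensor M).carrier) :
    (X.cotensorι N).lin (X.cotensorOdd g hg z) =
      TensorProduct.map X.sgn g ((X.cotensorι M).lin z) := rfl

lemma colin_cotensorEven (hg : Colin LinearMap.id g) :
    Colin LinearMap.id (X.cotensorEven g hg) :=
  X.cotensorMapLin_colin _ _ _ _ _ LinearMap.id (fun x => by simp)

lemma colin_cotensorOdd (hg : Colin C.sgn g) : Colin D.sgn (X.cotensorOdd g hg) :=
  X.cotensorMapLin_colin _ _ _ _ _ D.sgn (colin_sgn X.toDGComod)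

/-- The map `X □ f`. -/
def cotMap (f : M ⟶ N) : X.cotensor M ⟶ X.cotensor N := X.cotensorFunctor.map f

lemma cotMap_id (M : DGComod C) : X.cotMap (𝟙 M) = 𝟙 (X.cotensor M) :=
  CategoryTheory.Functor.map_id X.cotensorFunctor M

lemma cotMap_comp {P : DGComod C} (f : M ⟶ N) (g : N ⟶ P) :
    X.cotMap (f ≫ g) = X.cotMap f ≫ X.cotMap g := X.cotensorFunctor.map_comp f g

lemma cotensorι_map (f : M ⟶ N) (z : (X.cotensor M).carrier) :
    (X.cotensorι N).lin ((X.cotMap f).lin z) =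
      TensorProduct.map LinearMap.id f.lin ((X.cotensorι M).lin z) := rfl

lemma cotensorEven_mem (hg : Colin LinearMap.id g) {e : ℤ}
    (hm : ∀ {n : ℤ} {x : M.carrier}, x ∈ M.gr n → g x ∈ N.gr (n + e)) {n : ℤ}
    {z : (X.cotensor M).carrier} (hz : z ∈ (X.cotensor M).gr n) :
    X.cotensorEven g hg z ∈ (X.cotensor N).gr (n + e) :=
  DGVect.tensorGr_le X.toDGVect M.toDGVect (TensorProduct.map LinearMap.id g) n
    (DGVect.tensorGr X.toDGVect N.toDGVect (n + e))
    (fun _ _ hpq _ hx _ hm' => DGVect.tmul_mem _ _ (by omega) hx (hm hm')) hz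

lemma cotensorOdd_mem (hg : Colin C.sgn g) {e : ℤ}
    (hm : ∀ {n : ℤ} {x : M.carrier}, x ∈ M.gr n → g x ∈ N.gr (n + e)) {n : ℤ}
    {z : (X.cotensor M).carrier} (hz : z ∈ (X.cotensor M).gr n) :
    X.cotensorOdd g hg z ∈ (X.cotensor N).gr (n + e) :=
  DGVect.tensorGr_le X.toDGVect M.toDGVect (TensorProduct.map X.sgn g) n
    (DGVect.tensorGr X.toDGVect N.toDGVect (n + e))
    (fun _ _ hpq _ hx _ hm' => DGVect.tmul_mem _ _ (by omega) (X.sgn_mem hx) (hm hm')) hz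

lemma cotensorι_d (z : (X.cotensor M).carrier) : (X.cotensorι M).lin ((X.cotensor M).d z) =
    (X.toDGVect.tensor M.toDGVect).d ((X.cotensorι M).lin z) := (X.cotensorι M).comm z

lemma cotensorι_sgn (z : (X.cotensor M).carrier) : (X.cotensorι M).lin ((X.cotensor M).sgn z) =
    TensorProduct.map X.sgn M.sgn ((X.cotensorι M).lin z) := by
  have h : (X.toDGVect.tensor M.toDGVect).sgn = TensorProduct.map X.sgn M.sgn :=
    TensorProduct.ext' fun x y => DGVect.tensor_sgn_tmul _ _ x y
  rw [(X.cotensorι M).sgn, h]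

end Lin

lemma cotMap_add {M N : DGComod C} (f g : M ⟶ N) : X.cotMap (f + g) = X.cotMap f + X.cotMap g := by
  refine hom_ext (LinearMap.ext fun z => X.cotensor_ext ?_)
  change TensorProduct.map LinearMap.id (f.lin + g.lin) ((X.cotensorι M).lin z) =
    TensorProduct.map LinearMap.id f.lin ((X.cotensorι M).lin z) +
      TensorProduct.map LinearMap.id g.lin ((X.cotensorι M).lin z)
  rw [TensorProduct.map_add_right, LinearMap.add_apply]

/-- The map `X □ f` for a morphism `f` of the homotopy category. -/
def cotHFun {M N : DGComod C} (f : (toHCat C).obj M ⟶ (toHCat C).obj N) :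
    (toHCat D).obj (X.cotensor M) ⟶ (toHCat D).obj (X.cotensor N) := X.cotensorH.map f

lemma cotHFun_map {M N : DGComod C} (f : M ⟶ N) :
    X.cotHFun ((toHCat C).map f) = (toHCat D).map (X.cotMap f) := rfl

/-- The map `X □ f` for a morphism `f` of the homotopy category, as a homomorphism. -/
def cotH {M N : DGComod C} : ((toHCat C).obj M ⟶ (toHCat C).obj N) →+
    ((toHCat D).obj (X.cotensor M) ⟶ (toHCat D).obj (X.cotensor N)) :=
  AddMonoidHom.mk' X.cotHFun fun f g => by
    obtain ⟨f, rfl⟩ := exists_toHCat_map f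
    obtain ⟨g, rfl⟩ := exists_toHCat_map g
    rw [← Functor.map_add, cotHFun_map, cotHFun_map, cotHFun_map, cotMap_add, Functor.map_add]

lemma cotH_map {M N : DGComod C} (f : M ⟶ N) :
    X.cotH ((toHCat C).map f) = (toHCat D).map (X.cotMap f) := X.cotHFun_map f

lemma cotH_comp {M N P : DGComod C} (f : (toHCat C).obj M ⟶ (toHCat C).obj N)
    (g : (toHCat C).obj N ⟶ (toHCat C).obj P) : X.cotH (f ≫ g) = X.cotH f ≫ X.cotH g := by
  obtain ⟨f, rfl⟩ := exists_toHCat_map f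
  obtain ⟨g, rfl⟩ := exists_toHCat_map g
  rw [← Functor.map_comp, cotH_map, cotH_map, cotH_map, cotMap_comp, Functor.map_comp]

lemma cotH_id (M : DGComod C) :
    X.cotH (𝟙 ((toHCat C).obj M)) = 𝟙 ((toHCat D).obj (X.cotensor M)) := by
  rw [← CategoryTheory.Functor.map_id, cotH_map, cotMap_id, CategoryTheory.Functor.map_id]

/-! ### Compatibility with shifts -/

section Shift

lemma cotensorEven_d {M N : DGComod C} {g : M.carrier →ₗ[k] N.carrier} (hg : Colin LinearMap.id g)
    (hd : ∀ x, g (M.d x) = N.d (g x)) (z : (X.cotensor M).carrier) :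
    X.cotensorEven g hg ((X.cotensor M).d z) = (X.cotensor N).d (X.cotensorEven g hg z) := by
  have h : TensorProduct.map LinearMap.id g ∘ₗ (X.toDGVect.tensor M.toDGVect).d =
      (X.toDGVect.tensor N.toDGVect).d ∘ₗ TensorProduct.map LinearMap.id g :=
    TensorProduct.ext' fun x m => by
      rw [LinearMap.comp_apply, DGVect.tensor_d_tmul, map_add, TensorProduct.map_tmul,
        TensorProduct.map_tmul, LinearMap.comp_apply, TensorProduct.map_tmul,
        DGVect.tensor_d_tmul, hd]
      rfl
  refine X.cotensor_ext ?_
  rw [cotensorι_even, cotensorι_d, cotensorι_d, cotensorι_even]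
  exact LinearMap.congr_fun h ((X.cotensorι M).lin z)

lemma cotensorEven_leftInverse {M N : DGComod C} {g : M.carrier →ₗ[k] N.carrier}
    {g' : N.carrier →ₗ[k] M.carrier} (hg : Colin LinearMap.id g) (hg' : Colin LinearMap.id g')
    (h : g' ∘ₗ g = LinearMap.id) (z : (X.cotensor M).carrier) :
    X.cotensorEven g' hg' (X.cotensorEven g hg z) = z := by
  refine X.cotensor_ext ?_
  rw [cotensorι_even, cotensorι_even, TensorProduct.map_map, h, LinearMap.id_comp,
    TensorProduct.map_id, LinearMap.id_apply]

/-- The comparison `X □ M[n] ⟶ (X □ M)[n]`. -/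
def cotensorShift (M : DGComod C) (n : ℤ) :
    X.cotensor (M.shift n) ⟶ (X.cotensor M).shift n :=
  Hom.mkShift (X.cotensorEven (M.unshift n) (M.colin_unshift n))
    (fun j z hz => by
      rw [add_comm]
      exact X.cotensorEven_mem (M.colin_unshift n) (fun hx => M.unshift_mem n hx) hz)
    (X.cotensorEven_d (M.colin_unshift n) fun x => M.unshift_d n x)
    (X.colin_cotensorEven (M.colin_unshift n))

lemma unshift_cotensorShift (M : DGComod C) (n : ℤ) (z : (X.cotensor (M.shift n)).carrier) :
    (X.cotensor M).unshift n ((X.cotensorShift M n).lin z) =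
      X.cotensorEven (M.unshift n) (M.colin_unshift n) z := Hom.unshift_mkShift z

lemma cotensorι_unshift (M : DGComod C) (n : ℤ) (z : (X.cotensor (M.shift n)).carrier) :
    (X.cotensorι M).lin ((X.cotensor M).unshift n ((X.cotensorShift M n).lin z)) =
      TensorProduct.map LinearMap.id (M.unshift n) ((X.cotensorι (M.shift n)).lin z) := by
  rw [unshift_cotensorShift, cotensorι_even]

lemma cotensorShift_bijective (M : DGComod C) (n : ℤ) :
    Function.Bijective (X.cotensorShift M n).lin :=
  Hom.mkShift_bijective ⟨Function.LeftInverse.injective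
    (X.cotensorEven_leftInverse (M.colin_unshift n) (M.colin_reshift n) rfl),
    Function.RightInverse.surjective
      (X.cotensorEven_leftInverse (M.colin_reshift n) (M.colin_unshift n) rfl)⟩

lemma cotensorShift_naturality {M N : DGComod C} (f : M ⟶ N) (n : ℤ) :
    X.cotMap (Hom.shift f n) ≫ X.cotensorShift N n =
      X.cotensorShift M n ≫ Hom.shift (X.cotMap f) n := by
  refine Hom.shift_ext fun z => ?_
  rw [DGComod.comp_apply, DGComod.comp_apply, Hom.unshift_shift, unshift_cotensorShift,
    unshift_cotensorShift]
  refine X.cotensor_ext ?_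
  rw [cotensorι_even, cotensorι_map, cotensorι_map, cotensorι_even, TensorProduct.map_map,
    TensorProduct.map_map, Hom.unshift_comp_shift]

end Shift

/-! ### Compatibility with cones -/

section Cone

variable {M N : DGComod C} (f : M ⟶ N)

/-- The sign on the factor `X` is the Koszul sign for moving the projection of degree one past it;
with it the projection anticommutes with the differentials. -/
lemma cotensorOdd_coneFst_d (z : (X.cotensor (Co f)).carrier) :
    X.cotensorOdd (coneFst f) (colin_coneFst f) ((X.cotensor (Co f)).d z) =
      -(X.cotensor M).d (X.cotensorOdd (coneFst f) (colin_coneFst f) z) := by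
  have h : TensorProduct.map X.sgn (coneFst f) ∘ₗ (X.toDGVect.tensor (Co f).toDGVect).d =
      -((X.toDGVect.tensor M.toDGVect).d ∘ₗ TensorProduct.map X.sgn (coneFst f)) := by
    refine TensorProduct.ext' fun x y => ?_
    rw [LinearMap.neg_apply, LinearMap.comp_apply, LinearMap.comp_apply, DGVect.tensor_d_tmul,
      TensorProduct.map_tmul, DGVect.tensor_d_tmul, X.sgn_sgn, X.d_sgn]
    refine (map_add (TensorProduct.map X.sgn (coneFst f)) (X.d x ⊗ₜ[k] y)
      (X.sgn x ⊗ₜ[k] (Co f).d y)).trans ?_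
    rw [TensorProduct.map_tmul, TensorProduct.map_tmul, X.sgn_sgn, coneFst_d, TensorProduct.tmul_neg,
      TensorProduct.neg_tmul, neg_add, neg_neg]
  refine X.cotensor_ext ?_
  rw [cotensorι_odd, cotensorι_d, map_neg, cotensorι_d, cotensorι_odd]
  exact LinearMap.congr_fun h ((X.cotensorι (Co f)).lin z)

lemma cotensorEven_coneSnd_d (z : (X.cotensor (Co f)).carrier) :
    X.cotensorEven (coneSnd f) (colin_coneSnd f) ((X.cotensor (Co f)).d z) =
      (X.cotMap f).lin (X.cotensorOdd (coneFst f) (colin_coneFst f) z) +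
      (X.cotensor N).d (X.cotensorEven (coneSnd f) (colin_coneSnd f) z) := by
  have h : TensorProduct.map LinearMap.id (coneSnd f) ∘ₗ
      (X.toDGVect.tensor (Co f).toDGVect).d =
      TensorProduct.map LinearMap.id f.lin ∘ₗ TensorProduct.map X.sgn (coneFst f) +
      (X.toDGVect.tensor N.toDGVect).d ∘ₗ TensorProduct.map LinearMap.id (coneSnd f) := by
    refine TensorProduct.ext' fun x y => ?_
    rw [LinearMap.add_apply, LinearMap.comp_apply, LinearMap.comp_apply, LinearMap.comp_apply,
      DGVect.tensor_d_tmul, TensorProduct.map_tmul, TensorProduct.map_tmul, TensorProduct.map_tmul,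
      DGVect.tensor_d_tmul]
    refine (map_add (TensorProduct.map LinearMap.id (coneSnd f)) (X.d x ⊗ₜ[k] y)
      (X.sgn x ⊗ₜ[k] (Co f).d y)).trans ?_
    rw [TensorProduct.map_tmul, TensorProduct.map_tmul, coneSnd_d, TensorProduct.tmul_add]
    simp only [LinearMap.id_apply]
    abel
  refine X.cotensor_ext ?_
  rw [cotensorι_even, cotensorι_d, map_add, cotensorι_map, cotensorι_d, cotensorι_even,
    cotensorι_odd]
  exact LinearMap.congr_fun h ((X.cotensorι (Co f)).lin z)

/-- The comparison `X □ Co(f) ⟶ Co(X □ f)`. -/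
def cotensorCone : X.cotensor (Co f) ⟶ Co (X.cotMap f) :=
  coneLift (f := X.cotMap f) (A := X.cotensor (Co f))
    (X.cotensorOdd (coneFst f) (colin_coneFst f)) (X.cotensorEven (coneSnd f) (colin_coneSnd f))
    (fun hz => X.cotensorOdd_mem _ (fun hx => ((mem_cone_gr f).1 hx).1) hz)
    (fun hz => by
      have := X.cotensorEven_mem (colin_coneSnd f) (e := 0) (fun hx => by
        rw [add_zero]
        exact ((mem_cone_gr f).1 hx).2) hz
      rwa [add_zero] at this)
    (X.colin_cotensorOdd _) (X.colin_cotensorEven _) (X.cotensorOdd_coneFst_d f)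
    (X.cotensorEven_coneSnd_d f)

lemma coneFst_cotensorCone (z : (X.cotensor (Co f)).carrier) :
    coneFst (X.cotMap f) ((X.cotensorCone f).lin z) =
      X.cotensorOdd (coneFst f) (colin_coneFst f) z := by
  change coneFst _ (coneInl _ _ + coneInr _ _) = _
  rw [map_add, coneFst_inl, coneFst_inr, add_zero]

lemma coneSnd_cotensorCone (z : (X.cotensor (Co f)).carrier) :
    coneSnd (X.cotMap f) ((X.cotensorCone f).lin z) =
      X.cotensorEven (coneSnd f) (colin_coneSnd f) z := by
  change coneSnd _ (coneInl _ _ + coneInr _ _) = _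
  rw [map_add, coneSnd_inl, coneSnd_inr, zero_add]

lemma cotensor_cone_eq (z : (X.cotensor (Co f)).carrier) :
    X.cotensorOdd (coneInl f) (colin_coneInl f) (X.cotensorOdd (coneFst f) (colin_coneFst f) z) +
      X.cotensorEven (coneInr f) (colin_coneInr f)
        (X.cotensorEven (coneSnd f) (colin_coneSnd f) z) = z := by
  have h : TensorProduct.map X.sgn (coneInl f) ∘ₗ TensorProduct.map X.sgn (coneFst f) +
      TensorProduct.map LinearMap.id (coneInr f) ∘ₗ TensorProduct.map LinearMap.id (coneSnd f) =
      LinearMap.id := by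
    refine TensorProduct.ext' fun x y => ?_
    rw [LinearMap.add_apply, LinearMap.comp_apply, LinearMap.comp_apply, TensorProduct.map_tmul,
      TensorProduct.map_tmul, TensorProduct.map_tmul, TensorProduct.map_tmul, X.sgn_sgn,
      LinearMap.id_apply, LinearMap.id_apply, ← TensorProduct.tmul_add, ← cone_eq]
    rfl
  refine X.cotensor_ext ?_
  rw [map_add]
  exact LinearMap.congr_fun h ((X.cotensorι (Co f)).lin z)

lemma cotensorCone_bijective : Function.Bijective (X.cotensorCone f).lin := by
  constructor
  · intro z w h
    have h1 := congrArg (coneFst (X.cotMap f)) h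
    have h2 := congrArg (coneSnd (X.cotMap f)) h
    rw [coneFst_cotensorCone, coneFst_cotensorCone] at h1
    rw [coneSnd_cotensorCone, coneSnd_cotensorCone] at h2
    rw [← X.cotensor_cone_eq f z, ← X.cotensor_cone_eq f w, h1, h2]
  · intro y
    refine ⟨X.cotensorOdd (coneInl f) (colin_coneInl f) (coneFst _ y) +
      X.cotensorEven (coneInr f) (colin_coneInr f) (coneSnd _ y), cone_ext _ ?_ ?_⟩
    · rw [coneFst_cotensorCone]
      refine X.cotensor_ext ?_
      rw [cotensorι_odd, map_add, cotensorι_odd, cotensorι_even, map_add, TensorProduct.map_map,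
        TensorProduct.map_map, show coneFst f ∘ₗ coneInl f = LinearMap.id from rfl,
        show coneFst f ∘ₗ coneInr f = 0 from rfl, DGVect.sgn_comp_sgn, TensorProduct.map_id,
        TensorProduct.map_zero_right, LinearMap.zero_apply, add_zero]
      rfl
    · rw [coneSnd_cotensorCone]
      refine X.cotensor_ext ?_
      rw [cotensorι_even, map_add, cotensorι_odd, cotensorι_even, map_add, TensorProduct.map_map,
        TensorProduct.map_map, show coneSnd f ∘ₗ coneInl f = 0 from rfl,
        show coneSnd f ∘ₗ coneInr f = LinearMap.id from rfl, LinearMap.id_comp,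
        LinearMap.id_comp, TensorProduct.map_id, TensorProduct.map_zero_right, LinearMap.zero_apply, zero_add]
      rfl

lemma map_coneι_cotensorCone :
    X.cotMap (coneι f) ≫ X.cotensorCone f = coneι (X.cotMap f) := by
  refine hom_ext (LinearMap.ext fun z => cone_ext _ ?_ ?_)
  · refine (X.coneFst_cotensorCone f _).trans (X.cotensor_ext ?_)
    rw [cotensorι_odd, cotensorι_map, TensorProduct.map_map, coneι_lin,
      show coneFst f ∘ₗ coneInr f = 0 from rfl, TensorProduct.map_zero_right]
    rfl
  · refine (X.coneSnd_cotensorCone f _).trans (X.cotensor_ext ?_)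
    rw [cotensorι_even, cotensorι_map, TensorProduct.map_map, coneι_lin,
      show coneSnd f ∘ₗ coneInr f = LinearMap.id from rfl, LinearMap.id_comp,
      TensorProduct.map_id]
    rfl

lemma cotensorCone_coneδ : X.cotensorCone f ≫ coneδ (X.cotMap f) =
    X.cotMap (coneδ f) ≫ X.cotensorShift M 1 := by
  refine Hom.shift_ext fun z => X.cotensor_ext ?_
  rw [DGComod.comp_apply, DGComod.comp_apply, unshift_coneδ, cotensorι_unshift, cotensorι_map,
    coneFst_cotensorCone, cotensorι_sgn, cotensorι_odd, TensorProduct.map_map,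
    TensorProduct.map_map, DGVect.sgn_comp_sgn, unshift_comp_coneδ, LinearMap.id_comp]

end Cone

/-! ### Cotensor products with cofree comodules -/

lemma coactR_injective : Function.Injective X.coactR.lin := fun x y h => by
  rw [← X.counit_coactR x, h, X.counit_coactR]

/-- Applying the counit to the last factor of the equation defining `X □ M` shows that `1 ⊗ counit`
inverts the right coaction. The map `e` lets the argument serve both `C` and its shifts. -/
lemma cotensor_self_eq (M : DGComod C) (e : M.carrier →ₗ[k] C.carrier)
    (he : ∀ m, TensorProduct.map LinearMap.id e (M.coact.lin m) = C.comul.lin (e m))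
    (z : (X.cotensor M).carrier) :
    X.coactR.lin (TensorProduct.rid k X.carrier (TensorProduct.map LinearMap.id (C.counit ∘ₗ e)
      ((X.cotensorι M).lin z))) = TensorProduct.map LinearMap.id e ((X.cotensorι M).lin z) := by
  have hz := X.cotensorι_mem M z
  rw [cotensorDiff_apply, sub_eq_zero] at hz
  set t := (X.cotensorι M).lin z
  have h1 : ∀ t : X.carrier ⊗[k] M.carrier,
      X.coactR.lin (TensorProduct.rid k X.carrier
        (TensorProduct.map LinearMap.id (C.counit ∘ₗ e) t)) =
      TensorProduct.rid k (X.carrier ⊗[k] C.carrier)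
        (TensorProduct.map LinearMap.id (C.counit ∘ₗ e)
          (TensorProduct.map X.coactR.lin LinearMap.id t)) := by
    intro t
    induction t using TensorProduct.induction_on with
    | zero => simp
    | add a b ha hb => simp only [map_add, ha, hb]
    | tmul x m => simp
  have h2 : ∀ (x : X.carrier) (s : C.carrier ⊗[k] M.carrier),
      TensorProduct.rid k (X.carrier ⊗[k] C.carrier)
        (TensorProduct.map LinearMap.id (C.counit ∘ₗ e)
          ((TensorProduct.assoc k X.carrier C.carrier M.carrier).symm (x ⊗ₜ s))) =
      x ⊗ₜ TensorProduct.rid k C.carrier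
        (TensorProduct.map LinearMap.id C.counit (TensorProduct.map LinearMap.id e s)) := by
    intro x s
    induction s using TensorProduct.induction_on with
    | zero => simp
    | add a b ha hb => simp only [map_add, TensorProduct.tmul_add, ha, hb]
    | tmul c m => simp [TensorProduct.tmul_smul]
  have h3 : ∀ t : X.carrier ⊗[k] M.carrier,
      TensorProduct.rid k (X.carrier ⊗[k] C.carrier)
        (TensorProduct.map LinearMap.id (C.counit ∘ₗ e)
          ((TensorProduct.assoc k X.carrier C.carrier M.carrier).symm
            (TensorProduct.map LinearMap.id M.coact.lin t))) =
      TensorProduct.map LinearMap.id e t := by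
    intro t
    induction t using TensorProduct.induction_on with
    | zero => simp
    | add a b ha hb => simp only [map_add, ha, hb]
    | tmul x m =>
      rw [TensorProduct.map_tmul, h2, he, C.comul_counit]
      rfl
  rw [h1, hz, h3]

lemma toCotensorShift_bijective (n : ℤ) : Function.Bijective (X.toCotensorShift n).lin := by
  constructor
  · intro x y h
    exact X.coactR_injective (congrArg (X.cotensorι (C.self.shift n)).lin h)
  · intro z
    refine ⟨TensorProduct.rid k X.carrier (TensorProduct.map LinearMap.id
      (C.counit ∘ₗ LinearMap.id) ((X.cotensorι (C.self.shift n)).lin z)), X.cotensor_ext ?_⟩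
    refine (X.cotensor_self_eq (C.self.shift n) LinearMap.id (fun m => ?_) z).trans ?_
    · rw [TensorProduct.map_id]
      rfl
    · rw [TensorProduct.map_id]
      rfl

lemma toCotensor_bijective : Function.Bijective X.toCotensor.lin := by
  constructor
  · intro x y h
    exact X.coactR_injective (congrArg (X.cotensorι C.self).lin h)
  · intro z
    refine ⟨TensorProduct.rid k X.carrier (TensorProduct.map LinearMap.id
      (C.counit ∘ₗ LinearMap.id) ((X.cotensorι C.self).lin z)), X.cotensor_ext ?_⟩
    refine (X.cotensor_self_eq C.self LinearMap.id (fun m => ?_) z).trans ?_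
    · rw [TensorProduct.map_id]
      rfl
    · rw [TensorProduct.map_id]
      rfl

/-- The comparison `(X □ N) ⊗ V ⟶ X □ (N ⊗ V)` as a linear map to `X ⊗ (N ⊗ V)`. -/
def cotensorTensorAux (N : DGComod C) (V : DGVect k) :
    DGVect.Hom ((X.cotensor N).tensor V).toDGVect (X.toDGVect.tensor (N.tensor V).toDGVect) :=
  (DGVect.assocHom X.toDGVect N.toDGVect V).comp ((X.cotensorι N).tensor (DGVect.Hom.id V))

lemma cotensorDiff_assoc (N : DGComod C) (V : DGVect k)
    (t : (X.carrier ⊗[k] N.carrier) ⊗[k] V.carrier) :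
    (X.cotensorDiff (N.tensor V)).lin (TensorProduct.assoc k X.carrier N.carrier V.carrier t) =
      TensorProduct.assoc k (X.carrier ⊗[k] C.carrier) N.carrier V.carrier
        (TensorProduct.map (X.cotensorDiff N).lin LinearMap.id t) := by
  have h2 : ∀ (x : X.carrier) (s : C.carrier ⊗[k] N.carrier) (v : V.carrier),
      (TensorProduct.assoc k X.carrier C.carrier (N.carrier ⊗[k] V.carrier)).symm
        (x ⊗ₜ TensorProduct.assoc k C.carrier N.carrier V.carrier (s ⊗ₜ v)) =
      TensorProduct.assoc k (X.carrier ⊗[k] C.carrier) N.carrier V.carrier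
        ((TensorProduct.assoc k X.carrier C.carrier N.carrier).symm (x ⊗ₜ s) ⊗ₜ v) := by
    intro x s v
    induction s using TensorProduct.induction_on with
    | zero => simp
    | add a b ha hb => simp only [TensorProduct.add_tmul, TensorProduct.tmul_add, map_add, ha, hb]
    | tmul c m => simp
  have h1 : ∀ (s : X.carrier ⊗[k] C.carrier) (n : N.carrier) (v : V.carrier),
      s ⊗ₜ[k] (n ⊗ₜ[k] v) = TensorProduct.assoc k (X.carrier ⊗[k] C.carrier) N.carrier V.carrier
        ((s ⊗ₜ n) ⊗ₜ v) := fun s n v => rfl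
  induction t using TensorProduct.induction_on with
  | zero => simp only [map_zero]
  | add a b ha hb => simp only [map_add, ha, hb]
  | tmul t v =>
    induction t using TensorProduct.induction_on with
    | zero => simp only [TensorProduct.zero_tmul, map_zero]
    | add a b ha hb => simp only [TensorProduct.add_tmul, map_add, ha, hb]
    | tmul x n =>
      rw [TensorProduct.map_tmul, X.cotensorDiff_apply N, TensorProduct.sub_tmul, map_sub,
        TensorProduct.assoc_tmul]
      refine (X.cotensorDiff_apply (N.tensor V) _).trans ?_
      refine congrArg₂ (· - ·) ?_ ?_
      · exact h1 _ _ _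
      · exact h2 _ _ _

/-- The comparison `(X □ N) ⊗ V ⟶ X □ (N ⊗ V)`. -/
def cotensorTensor (N : DGComod C) (V : DGVect k) :
    (X.cotensor N).tensor V ⟶ X.cotensor (N.tensor V) where
  lin := X.cotensorLift (N.tensor V) (X.cotensorTensorAux N V).lin fun t => by
    refine (X.cotensorDiff_assoc N V _).trans ?_
    have : TensorProduct.map (X.cotensorDiff N).lin LinearMap.id ∘ₗ
        TensorProduct.map (X.cotensorι N).lin (LinearMap.id : V.carrier →ₗ[k] V.carrier) = 0 := by
      refine TensorProduct.ext' fun z v => ?_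
      rw [LinearMap.comp_apply, TensorProduct.map_tmul, TensorProduct.map_tmul, cotensorι_mem,
        TensorProduct.zero_tmul]
      rfl
    have h := LinearMap.congr_fun this t
    exact (congrArg _ h).trans (map_zero _)
  mem := fun hx => (X.cotensorTensorAux N V).mem hx
  comm := fun x => X.cotensor_ext ((X.cotensorTensorAux N V).comm x)
  colin := fun t => by
    apply map_id_injective D.toDGVect (X.cotensorι _) (X.cotensorι_injective _)
    refine (X.cotensor_coact _ _).trans ?_
    rw [TensorProduct.map_map]
    have h1 : ∀ (s : D.carrier ⊗[k] X.carrier) (n : N.carrier) (v : V.carrier),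
        TensorProduct.assoc k D.carrier X.carrier (N.carrier ⊗[k] V.carrier) (s ⊗ₜ (n ⊗ₜ v)) =
        TensorProduct.map LinearMap.id (TensorProduct.assoc k X.carrier N.carrier V.carrier).toLinearMap
          (TensorProduct.assoc k D.carrier (X.carrier ⊗[k] N.carrier) V.carrier
            (TensorProduct.assoc k D.carrier X.carrier N.carrier (s ⊗ₜ n) ⊗ₜ v)) := by
      intro s n v
      induction s using TensorProduct.induction_on with
      | zero => simp
      | add a b ha hb => simp only [TensorProduct.add_tmul, map_add, ha, hb]
      | tmul d x => simp
    have h2 : ∀ (s : X.carrier ⊗[k] N.carrier) (v : V.carrier),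
        TensorProduct.assoc k D.carrier X.carrier (N.carrier ⊗[k] V.carrier)
          (TensorProduct.map X.coact.lin LinearMap.id
            (TensorProduct.assoc k X.carrier N.carrier V.carrier (s ⊗ₜ v))) =
        TensorProduct.map LinearMap.id (TensorProduct.assoc k X.carrier N.carrier V.carrier).toLinearMap
          (TensorProduct.assoc k D.carrier (X.carrier ⊗[k] N.carrier) V.carrier
            (TensorProduct.assoc k D.carrier X.carrier N.carrier
              (TensorProduct.map X.coact.lin LinearMap.id s) ⊗ₜ v)) := by
      intro s v
      induction s using TensorProduct.induction_on with
      | zero => simp only [TensorProduct.zero_tmul, map_zero]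
      | add a b ha hb => simp only [TensorProduct.add_tmul, map_add, ha, hb]
      | tmul x n => exact h1 _ _ _
    have h3 : ∀ (s : D.carrier ⊗[k] (X.cotensor N).carrier) (v : V.carrier),
        TensorProduct.assoc k D.carrier (X.carrier ⊗[k] N.carrier) V.carrier
          (TensorProduct.map LinearMap.id (X.cotensorι N).lin s ⊗ₜ v) =
        TensorProduct.map LinearMap.id (TensorProduct.map (X.cotensorι N).lin LinearMap.id)
          (TensorProduct.assoc k D.carrier (X.cotensor N).carrier V.carrier (s ⊗ₜ v)) := by
      intro s v
      induction s using TensorProduct.induction_on with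
      | zero => simp only [TensorProduct.zero_tmul, map_zero]
      | add a b ha hb => simp only [TensorProduct.add_tmul, map_add, ha, hb]
      | tmul x n => simp
    induction t using TensorProduct.induction_on with
    | zero => simp only [map_zero]
    | add a b ha hb => simp only [map_add, ha, hb]
    | tmul z v =>
      refine (h2 ((X.cotensorι N).lin z) v).trans ?_
      rw [← cotensor_coact, h3, TensorProduct.map_map]
      rfl

/-- Over a field, tensoring with `V` is exact, so it commutes with the kernel defining the cotensor
product. -/
lemma cotensorTensor_bijective (N : DGComod C) (V : DGVect k) :
    Function.Bijective (X.cotensorTensor N V).lin := by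
  constructor
  · intro z w h
    have h' := congrArg (X.cotensorι (N.tensor V)).lin h
    have h1 := (TensorProduct.assoc k X.carrier N.carrier V.carrier).injective h'
    exact Module.Flat.rTensor_preserves_injective_linearMap (M := V.carrier) _
      (X.cotensorι_injective N) h1
  · intro z
    have h := X.cotensorι_mem (N.tensor V) z
    obtain ⟨t, ht⟩ := (TensorProduct.assoc k X.carrier N.carrier V.carrier).surjective
      ((X.cotensorι (N.tensor V)).lin z)
    rw [← ht] at h
    have h0 := (TensorProduct.assoc k (X.carrier ⊗[k] C.carrier) N.carrier V.carrier).injective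
      (((X.cotensorDiff_assoc N V t).symm.trans h).trans (map_zero _).symm)
    have hex : Function.Exact (X.cotensorι N).lin (X.cotensorDiff N).lin :=
      LinearMap.exact_subtype_ker_map _
    obtain ⟨w, hw⟩ := (Module.Flat.rTensor_exact V.carrier hex t).1 h0
    refine ⟨w, X.cotensor_ext ?_⟩
    rw [← ht, ← hw]
    rfl

end DGBicomod

namespace DGComod

variable {C : DGCoalg k}

/-! ### Extensions by complexes of vector spaces -/

/-- The extension of a morphism by a complex. -/
def tensorMap {M N : DGComod C} (f : M ⟶ N) (V : DGVect k) : M.tensor V ⟶ N.tensor V where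
  toHom := f.toHom.tensor (DGVect.Hom.id V)
  colin := fun t => by
    have h : ∀ (s : C.carrier ⊗[k] M.carrier) (v : V.carrier),
        TensorProduct.assoc k C.carrier N.carrier V.carrier
          (TensorProduct.map LinearMap.id f.lin s ⊗ₜ v) =
        TensorProduct.map LinearMap.id (TensorProduct.map f.lin LinearMap.id)
          (TensorProduct.assoc k C.carrier M.carrier V.carrier (s ⊗ₜ v)) := by
      intro s v
      induction s using TensorProduct.induction_on with
      | zero => simp only [TensorProduct.zero_tmul, map_zero]
      | add a b ha hb => simp only [TensorProduct.add_tmul, map_add, ha, hb]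
      | tmul c m => simp
    induction t using TensorProduct.induction_on with
    | zero => simp only [map_zero]
    | add a b ha hb => simp only [map_add, ha, hb]
    | tmul m v =>
      change TensorProduct.assoc k C.carrier N.carrier V.carrier (N.coact.lin (f.lin m) ⊗ₜ v) = _
      rw [f.colin, h]
      rfl

lemma tensorMap_bijective {M N : DGComod C} (f : M ⟶ N) (V : DGVect k)
    (hf : Function.Bijective f.lin) : Function.Bijective (tensorMap f V).lin :=
  (TensorProduct.congr (LinearEquiv.ofBijective f.lin hf) (LinearEquiv.refl k V.carrier)).bijective

/-- A quasi-isomorphism is a linear homotopy equivalence. -/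
lemma IsQuasiIso.exists_inverse {M N : DGComod C} {f : M ⟶ N} (hf : IsQuasiIso f) :
    ∃ (g : N.carrier →ₗ[k] M.carrier) (h : N.carrier →ₗ[k] N.carrier)
      (a : M.carrier →ₗ[k] M.carrier),
      (∀ {n : ℤ} {x}, x ∈ N.gr n → g x ∈ M.gr n) ∧
      (∀ {n : ℤ} {x}, x ∈ N.gr n → h x ∈ N.gr (n - 1)) ∧
      (∀ {n : ℤ} {x}, x ∈ M.gr n → a x ∈ M.gr (n - 1)) ∧
      (∀ x, g (N.d x) = M.d (g x)) ∧ (∀ x, f.lin (g x) + (h (N.d x) + N.d (h x)) = x) ∧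
      ∀ x, g (f.lin x) + (a (M.d x) + M.d (a x)) = x := by
  -- The cone of `f` has a linear contraction; its matrix entries are a homotopy inverse of `f` and
  -- the two homotopies.
  obtain ⟨s, hs, hsd⟩ := ((isQuasiIso_iff_acyclic f).1 hf).exists_contraction
  refine ⟨coneFst f ∘ₗ s ∘ₗ coneInr f, coneSnd f ∘ₗ s ∘ₗ coneInr f, -(coneFst f ∘ₗ s ∘ₗ coneInl f),
    fun {n x} hx => ?_, fun {n x} hx => ?_, fun {n x} hx => ?_, fun x => ?_, fun x => ?_,
    fun x => ?_⟩
  · have := ((mem_cone_gr f).1 (hs (coneInr_mem f hx))).1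
    rwa [sub_add_cancel] at this
  · exact ((mem_cone_gr f).1 (hs (coneInr_mem f hx))).2
  · have := ((mem_cone_gr f).1 (hs (coneInl_mem f (n := n - 1) (by rwa [sub_add_cancel])))).1
    rw [sub_add_cancel] at this
    exact neg_mem this
  · have := congrArg (coneFst f) (hsd (coneInr f x))
    rw [cone_d_inr, map_add, coneFst_d, coneFst_inr, ← sub_eq_add_neg, sub_eq_zero] at this
    exact this
  · have := congrArg (coneSnd f) (hsd (coneInr f x))
    rw [cone_d_inr, map_add, coneSnd_d, coneSnd_inr] at this
    refine Eq.trans ?_ this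
    simp only [LinearMap.comp_apply]
    abel
  · have := congrArg (coneFst f) (hsd (coneInl f x))
    rw [cone_d_inl, map_add, coneFst_d, coneFst_inl, map_add, map_add, map_neg, map_neg] at this
    refine Eq.trans ?_ this
    simp only [LinearMap.neg_apply, LinearMap.comp_apply, map_neg]
    abel

lemma IsQuasiIso.of_inverse {M N : DGComod C} {f : M ⟶ N} (g : N.carrier →ₗ[k] M.carrier)
    (h : N.carrier →ₗ[k] N.carrier) (a : M.carrier →ₗ[k] M.carrier)
    (hg : ∀ x, g (N.d x) = M.d (g x)) (h1 : ∀ x, f.lin (g x) + (h (N.d x) + N.d (h x)) = x)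
    (h2 : ∀ x, g (f.lin x) + (a (M.d x) + M.d (a x)) = x) : IsQuasiIso f := by
  rw [isQuasiIso_iff]
  refine ⟨fun x hx y hy => ⟨g y + a x, ?_⟩, fun y hy => ⟨g y, ?_, h y, ?_⟩⟩
  · have := h2 x
    rw [hx, map_zero, zero_add, hy, hg, ← map_add] at this
    exact this
  · rw [← hg, hy, map_zero]
  · have := h1 y
    rw [hy, map_zero, zero_add] at this
    rw [sub_eq_iff_eq_add, add_comm, this]

lemma sgn_of_odd {M N : DGComod C} {h : M.carrier →ₗ[k] N.carrier}
    (hm : ∀ {n : ℤ} {x}, x ∈ M.gr n → h x ∈ N.gr (n - 1)) (x : M.carrier) :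
    N.sgn (h x) = -h (M.sgn x) := by
  have : N.sgn ∘ₗ h = -(h ∘ₗ M.sgn) := by
    refine M.linearMap_ext fun n x hx => ?_
    simp [DGVect.sgn_of_mem _ hx, DGVect.sgn_of_mem _ (hm hx), Int.negOnePow_sub]
  exact LinearMap.congr_fun this x

/-- The terms involving the differential of `V` cancel, because a map of odd degree anticommutes
with the sign operator. -/
lemma tensor_homotopy {M : DGComod C} (V : DGVect k) {h : M.carrier →ₗ[k] M.carrier}
    (hm : ∀ {n : ℤ} {x}, x ∈ M.gr n → h x ∈ M.gr (n - 1)) :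
    TensorProduct.map h LinearMap.id ∘ₗ (M.tensor V).d +
      (M.tensor V).d ∘ₗ TensorProduct.map h LinearMap.id =
    TensorProduct.map (h ∘ₗ M.d + M.d ∘ₗ h) LinearMap.id := by
  refine TensorProduct.ext' fun m v => ?_
  have h1 : (M.tensor V).d (m ⊗ₜ v) = M.d m ⊗ₜ v + M.sgn m ⊗ₜ V.d v := rfl
  have h2 : (M.tensor V).d (h m ⊗ₜ v) = M.d (h m) ⊗ₜ v + M.sgn (h m) ⊗ₜ V.d v := rfl
  rw [LinearMap.add_apply, LinearMap.comp_apply, LinearMap.comp_apply, TensorProduct.map_tmul,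
    TensorProduct.map_tmul, LinearMap.id_apply, h1, h2, sgn_of_odd hm, map_add,
    TensorProduct.map_tmul, TensorProduct.map_tmul, LinearMap.add_apply, TensorProduct.add_tmul,
    TensorProduct.neg_tmul]
  simp only [LinearMap.id_apply, LinearMap.comp_apply]
  abel

/-- Over a field a quasi-isomorphism is a linear homotopy equivalence, and the data of such an
equivalence can be tensored with `V`. -/
lemma IsQuasiIso.tensorMap {M N : DGComod C} {f : M ⟶ N} (hf : IsQuasiIso f) (V : DGVect k) :
    IsQuasiIso (tensorMap f V) := by
  obtain ⟨g, h, a, hgm, hhm, ham, hg, h1, h2⟩ := hf.exists_inverse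
  refine IsQuasiIso.of_inverse (TensorProduct.map g LinearMap.id)
    (TensorProduct.map h LinearMap.id) (TensorProduct.map a LinearMap.id) ?_ ?_ ?_
  · exact (DGVect.Hom.tensor ⟨g, hgm, hg⟩ (DGVect.Hom.id V)).comm
  · have e : TensorProduct.map f.lin (LinearMap.id : V.carrier →ₗ[k] V.carrier) ∘ₗ
        TensorProduct.map g LinearMap.id + TensorProduct.map (h ∘ₗ N.d + N.d ∘ₗ h) LinearMap.id =
        LinearMap.id := by
      refine TensorProduct.ext' fun m v => ?_
      rw [LinearMap.add_apply, LinearMap.comp_apply, TensorProduct.map_tmul, TensorProduct.map_tmul,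
        TensorProduct.map_tmul, LinearMap.id_apply, LinearMap.id_apply, ← TensorProduct.add_tmul]
      exact congrArg (· ⊗ₜ[k] v) (h1 m)
    rw [← tensor_homotopy V hhm] at e
    exact LinearMap.congr_fun e
  · have e : TensorProduct.map g (LinearMap.id : V.carrier →ₗ[k] V.carrier) ∘ₗ
        TensorProduct.map f.lin LinearMap.id +
          TensorProduct.map (a ∘ₗ M.d + M.d ∘ₗ a) LinearMap.id = LinearMap.id := by
      refine TensorProduct.ext' fun m v => ?_
      rw [LinearMap.add_apply, LinearMap.comp_apply, TensorProduct.map_tmul, TensorProduct.map_tmul,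
        TensorProduct.map_tmul, LinearMap.id_apply, LinearMap.id_apply, ← TensorProduct.add_tmul]
      exact congrArg (· ⊗ₜ[k] v) (h2 m)
    rw [← tensor_homotopy V ham] at e
    exact LinearMap.congr_fun e

/-! ### Maps out of an extension -/

section Coprod

variable (M : DGComod C) {V : DGVect k} {q : ℤ} (hV : V.Concentrated q)

/-- The map `M[-q] ⟶ M ⊗ V` given by a vector of degree `q`. -/
def tensorIncl (v : V.carrier) : M.shift (-q) ⟶ M.tensor V where
  lin := (TensorProduct.mk k M.carrier V.carrier).flip v
  mem := fun {n x} hx => DGVect.tmul_mem M.toDGVect V (p := -q + n) (by omega) hx (hV.mem v)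
  comm := fun x => by
    change M.d x ⊗ₜ[k] v = M.d x ⊗ₜ[k] v + M.sgn x ⊗ₜ[k] V.d v
    rw [hV.d_eq_zero, TensorProduct.tmul_zero, add_zero]
  colin := fun x => by
    have h : ∀ s : C.carrier ⊗[k] M.carrier,
        TensorProduct.assoc k C.carrier M.carrier V.carrier (s ⊗ₜ v) =
        TensorProduct.map LinearMap.id ((TensorProduct.mk k M.carrier V.carrier).flip v) s := by
      intro s
      induction s using TensorProduct.induction_on with
      | zero => simp only [TensorProduct.zero_tmul, map_zero]
      | add a b ha hb => simp only [TensorProduct.add_tmul, map_add, ha, hb]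
      | tmul c m => simp
    exact h _

variable {ι : Type*} (B : Module.Basis ι k V.carrier)

variable {M} in
lemma tensor_basis_ext {P : Type*} [AddCommGroup P] [Module k P]
    {f g : M.carrier ⊗[k] V.carrier →ₗ[k] P}
    (h : ∀ m i, f (m ⊗ₜ B i) = g (m ⊗ₜ B i)) : f = g :=
  TensorProduct.ext (LinearMap.ext fun m => B.ext fun i => h m i)

variable {N : DGComod C} (f : ι → M.carrier →ₗ[k] N.carrier)

/-- The linear map out of `M ⊗ V` with given components. -/
def tensorDesc : M.carrier ⊗[k] V.carrier →ₗ[k] N.carrier :=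
  TensorProduct.lift ((B.constr k : (ι → N.carrier) ≃ₗ[k] _).toLinearMap ∘ₗ LinearMap.pi f)

lemma tensorDesc_tmul (m : M.carrier) (i : ι) : M.tensorDesc B f (m ⊗ₜ B i) = f i m := by
  simp [tensorDesc, Module.Basis.constr_basis]

lemma tensorDesc_tmul_mem {S : Submodule k N.carrier} {m : M.carrier} (h : ∀ i, f i m ∈ S)
    (v : V.carrier) : M.tensorDesc B f (m ⊗ₜ v) ∈ S := by
  have : ⊤ ≤ S.comap (M.tensorDesc B f ∘ₗ TensorProduct.mk k M.carrier V.carrier m) := by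
    rw [← B.span_eq, Submodule.span_le]
    rintro _ ⟨i, rfl⟩
    change M.tensorDesc B f (m ⊗ₜ B i) ∈ S
    rw [tensorDesc_tmul]
    exact h i
  exact this (Submodule.mem_top (x := v))

lemma tensorDesc_mem {e : ℤ} (h : ∀ i {n : ℤ} {x : M.carrier}, x ∈ M.gr n → f i x ∈ N.gr (n + e))
    (hV : V.Concentrated q) {n : ℤ} {t : (M.tensor V).carrier} (ht : t ∈ (M.tensor V).gr n) :
    M.tensorDesc B f t ∈ N.gr (n - q + e) := by
  refine DGVect.tensorGr_le M.toDGVect V (M.tensorDesc B f) n _ (fun p r hpr m hm v hv => ?_) ht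
  by_cases hr : r = q
  · subst hr
    refine M.tensorDesc_tmul_mem B f (fun i => ?_) v
    rw [show n - r = p by omega]
    exact h i hm
  · rw [hV r hr, Submodule.mem_bot] at hv
    rw [hv, TensorProduct.tmul_zero, map_zero]
    exact zero_mem _

lemma colin_tensorDesc {b : C.carrier →ₗ[k] C.carrier} (h : ∀ i, Colin b (f i)) :
    Colin (M := M.tensor V) (N := N) b (M.tensorDesc B f) := by
  have h1 : ∀ i (s : C.carrier ⊗[k] M.carrier), TensorProduct.map b (M.tensorDesc B f)
      (TensorProduct.assoc k C.carrier M.carrier V.carrier (s ⊗ₜ B i)) =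
      TensorProduct.map b (f i) s := by
    intro i s
    induction s using TensorProduct.induction_on with
    | zero => simp only [TensorProduct.zero_tmul, map_zero]
    | add a b ha hb => simp only [TensorProduct.add_tmul, map_add, ha, hb]
    | tmul c m => simp [tensorDesc_tmul]
  have : N.coact.lin ∘ₗ M.tensorDesc B f =
      TensorProduct.map b (M.tensorDesc B f) ∘ₗ (M.tensor V).coact.lin := by
    refine tensor_basis_ext B fun m i => ?_
    refine Eq.trans ?_ (h1 i (M.coact.lin m)).symm
    rw [LinearMap.comp_apply, tensorDesc_tmul, h i m]
  exact LinearMap.congr_fun this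

lemma tensor_d_basis (hV : V.Concentrated q) (m : M.carrier) (v : V.carrier) :
    (M.tensor V).d (m ⊗ₜ v) = M.d m ⊗ₜ v := by
  change M.d m ⊗ₜ[k] v + M.sgn m ⊗ₜ[k] V.d v = _
  rw [hV.d_eq_zero, TensorProduct.tmul_zero, add_zero]

/-- For `V` concentrated in degree `q`, the extension `M ⊗ V` is a coproduct of copies of `M[-q]`
in the homotopy category. -/
lemma tensorIncl_bijective (N : DGComod C) : Function.Bijective
    (fun (f : (toHCat C).obj (M.tensor V) ⟶ (toHCat C).obj N) (i : ι) =>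
      (toHCat C).map (M.tensorIncl hV (B i)) ≫ f) := by
  constructor
  · intro f g hfg
    obtain ⟨f, rfl⟩ := exists_toHCat_map f
    obtain ⟨g, rfl⟩ := exists_toHCat_map g
    have H : ∀ i, homotopic C (M.tensorIncl hV (B i) ≫ f) (M.tensorIncl hV (B i) ≫ g) :=
      fun i => (toHCat_eq_iff _ _).1 (by simpa only [Functor.map_comp] using congrFun hfg i)
    let K := fun i => (H i).some
    rw [toHCat_eq_iff]
    refine ⟨⟨M.tensorDesc B fun i => (K i).h, fun {n x} hx => ?_,
      M.colin_tensorDesc B _ fun i => (K i).colin, fun x => ?_⟩⟩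
    · have := M.tensorDesc_mem B (fun i => (K i).h) (e := q - 1) (fun i {n x} hx => by
        have := (K i).mem (n := q + n) (x := x) (by simpa using hx)
        rwa [show q + n - 1 = n + (q - 1) by ring] at this) hV hx
      rwa [show n - q + (q - 1) = n - 1 by ring] at this
    · refine LinearMap.congr_fun (tensor_basis_ext B (f := f.lin - g.lin) (g := M.tensorDesc B
        (fun i => (K i).h) ∘ₗ (M.tensor V).d + N.d ∘ₗ M.tensorDesc B fun i => (K i).h)
        fun m i => ?_) x
      rw [LinearMap.sub_apply, LinearMap.add_apply, LinearMap.comp_apply, LinearMap.comp_apply,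
        M.tensor_d_basis hV, tensorDesc_tmul, tensorDesc_tmul]
      exact (K i).eq m
  · intro g
    choose g' hg' using fun i => exists_toHCat_map (g i)
    have hc : Colin (M := M.tensor V) (N := N) LinearMap.id (M.tensorDesc B fun i => (g' i).lin) :=
      M.colin_tensorDesc B _ fun i => (g' i).colin
    have hm : ∀ {n : ℤ} {x : (M.tensor V).carrier}, x ∈ (M.tensor V).gr n →
        M.tensorDesc B (fun i => (g' i).lin) x ∈ N.gr n := fun {n x} hx => by
      have := M.tensorDesc_mem B (fun i => (g' i).lin) (e := q) (fun i {n x} hx =>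
        (g' i).mem (n := n + q) (x := x) (by
          change x ∈ M.gr _
          rwa [show -q + (n + q) = n by ring])) hV hx
      rwa [sub_add_cancel] at this
    have hd : ∀ x, M.tensorDesc B (fun i => (g' i).lin) ((M.tensor V).d x) =
        N.d (M.tensorDesc B (fun i => (g' i).lin) x) := by
      refine LinearMap.congr_fun (tensor_basis_ext B (f := M.tensorDesc B
        (fun i => (g' i).lin) ∘ₗ (M.tensor V).d) (g := N.d ∘ₗ M.tensorDesc B fun i => (g' i).lin)
        fun m i => ?_)
      rw [LinearMap.comp_apply, LinearMap.comp_apply, M.tensor_d_basis hV, tensorDesc_tmul,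
        tensorDesc_tmul]
      exact (g' i).comm m
    refine ⟨(toHCat C).map ⟨⟨M.tensorDesc B fun i => (g' i).lin, hm, hd⟩, hc⟩,
      funext fun i => ?_⟩
    rw [← hg']
    refine ((toHCat C).map_comp _ _).symm.trans
      (congrArg _ (hom_ext (LinearMap.ext fun m => ?_)))
    exact M.tensorDesc_tmul B _ m i

end Coprod

end DGComod

/-! ### Kan extensions along left adjoints -/

section Kan

variable {A B E : Type*} [Category A] [Category B] [Category E] {Q : A ⥤ B}

/-- An object `a` is local for `Q` if `Hom(b, a) ⟶ Hom(Q b, Q a)` is bijective for all `b`. -/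
def IsLocalObj (Q : A ⥤ B) (a : A) : Prop :=
  ∀ b : A, Function.Bijective (fun f : b ⟶ a => Q.map f)

/-- If `b ≅ Q (G b)` with `G b` local, then `Hom(Q a, b) = Hom(Q a, Q (G b)) = Hom(a, G b)`; so the
local replacements form a right adjoint. -/
lemma isLeftAdjoint_of_local (h : ∀ b : B, ∃ a : A, IsLocalObj Q a ∧ Nonempty (b ≅ Q.obj a)) :
    Q.IsLeftAdjoint := by
  choose G hG hG' using h
  let e : ∀ a b, (Q.obj a ⟶ b) ≃ (a ⟶ G b) := fun a b =>
    ((hG' b).some.homToEquiv).trans (Equiv.ofBijective _ (hG b a)).symm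
  refine (Adjunction.adjunctionOfEquivRight e fun a' a b f g => ?_).isLeftAdjoint
  apply (Equiv.ofBijective _ (hG b a')).injective
  have h1 : ∀ a (x : Q.obj a ⟶ b), Q.map (e a b x) = x ≫ (hG' b).some.hom := fun a x =>
    (Equiv.ofBijective _ (hG b a)).apply_symm_apply _
  change Q.map (e a' b (Q.map f ≫ g)) = Q.map (f ≫ e a b g)
  rw [Functor.map_comp, h1, h1, Category.assoc]

/-- Locality lifts the counit at `Q a` to a morphism `G (Q a) ⟶ a`, which the triangle identity
shows to be inverse to the unit. -/
lemma isIso_unit_of_local {G : B ⥤ A} (adj : Q ⊣ G) {a : A} (h : IsLocalObj Q a) :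
    IsIso (adj.unit.app a) := by
  obtain ⟨g, hg⟩ := (h (G.obj (Q.obj a))).2 (adj.counit.app (Q.obj a))
  refine ⟨g, (h a).1 ?_, (adj.homEquiv _ _).symm.injective ?_⟩
  · change Q.map (adj.unit.app a ≫ g) = Q.map (𝟙 a)
    rw [Functor.map_comp, show Q.map g = _ from hg, CategoryTheory.Functor.map_id]
    exact adj.left_triangle_components a
  · have e : Q.map (g ≫ adj.unit.app a) ≫ adj.counit.app (Q.obj a) =
        Q.map (𝟙 (G.obj (Q.obj a))) ≫ adj.counit.app (Q.obj a) := by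
      have h1 := adj.left_triangle_components a
      dsimp only [Functor.id_obj, Functor.comp_obj] at h1 ⊢
      rw [Functor.map_comp, Category.assoc, h1, Category.comp_id, CategoryTheory.Functor.map_id,
        Category.id_comp]
      exact hg
    rw [adj.homEquiv_counit, adj.homEquiv_counit]
    exact e

/-- The left Kan extension along a left adjoint. -/
lemma isLeftKanExtension_of_adjunction {G : B ⥤ A} (adj : Q ⊣ G) (P : A ⥤ E) :
    (G ⋙ P).IsLeftKanExtension ((adj.whiskerLeft E).unit.app P) :=
  ⟨⟨mkInitialOfLeftAdjoint _ (adj.whiskerLeft E) P⟩⟩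

/-- By uniqueness the Kan extension is the one built from the right adjoint, whose structure map at
`a` is `P` applied to the unit, an isomorphism for local `a`. In this sense a derived functor is
computed on local objects by the original functor. -/
lemma isIso_app_of_local [Q.IsLeftAdjoint] {P : A ⥤ E} {F : B ⥤ E} (α : P ⟶ Q ⋙ F)
    (hα : F.IsLeftKanExtension α) {a : A} (h : IsLocalObj Q a) : IsIso (α.app a) := by
  let adj := Adjunction.ofIsLeftAdjoint Q
  have h1 := isLeftKanExtension_of_adjunction adj P
  let e := (Q.rightAdjoint ⋙ P).leftKanExtensionUnique ((adj.whiskerLeft E).unit.app P) F α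
  have h2 : ((adj.whiskerLeft E).unit.app P).app a ≫ e.hom.app (Q.obj a) = α.app a := by
    have := (Q.rightAdjoint ⋙ P).descOfIsLeftKanExtension_fac_app
      ((adj.whiskerLeft E).unit.app P) F α a
    simpa [e] using this
  have h3 : IsIso (((adj.whiskerLeft E).unit.app P).app a) := by
    have := isIso_unit_of_local adj h
    rw [Adjunction.whiskerLeft_unit_app_app]
    infer_instance
  rw [← h2]
  infer_instance

end Kan

/-! ### The derived category -/

section

variable {C D : DGCoalg k}

open DGComod

/-- The isomorphism of the derived category given by a quasi-isomorphism. -/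
def DGComod.IsQuasiIso.iso {M N : DGComod C} {f : M ⟶ N} (hf : IsQuasiIso f) :
    (chainToDCat C).obj M ≅ (chainToDCat C).obj N :=
  @asIso _ _ _ _ ((chainToDCat C).map f) hf.isIso

/-- Closedness is exactly locality; being full subcategories, `H⁺` and `D⁺` inherit it. -/
lemma isLocalObj_toDPlus {M : DGComod C} (hM : M.Good) :
    IsLocalObj (toDPlus C) (M.inHPlus hM.bounded) := by
  intro B
  constructor
  · intro f g hfg
    have := congrArg (fun f => f.hom) hfg
    exact (isHPlus C).hom_ext ((hM.closed B.obj.as).1 this)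
  · intro g
    obtain ⟨f, hf⟩ := (hM.closed B.obj.as).2 g.hom
    exact ⟨(isHPlus C).homMk f, (isDPlus C).hom_ext hf⟩

/-- Isomorphisms in `D⁺(C)`. -/
def isoDPlus {A B : DPlus C} (e : A.obj ≅ B.obj) : A ≅ B := (isDPlus C).fullyFaithfulι.preimageIso e

lemma exists_good (hC : C.Positive) (A : DPlus C) :
    ∃ (M : DGComod C) (hM : M.Good), Nonempty (A ≅ M.inDPlus hM.bounded) := by
  obtain ⟨A, M, hM, ⟨e⟩⟩ := A
  exact ⟨M.res, good_res hC hM, ⟨isoDPlus (e ≪≫ M.toRes_isQuasiIso.iso)⟩⟩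

lemma toDPlus_isLeftAdjoint (hC : C.Positive) : (toDPlus C).IsLeftAdjoint :=
  isLeftAdjoint_of_local fun A => by
    obtain ⟨M, hM, ⟨e⟩⟩ := exists_good hC A
    exact ⟨_, isLocalObj_toDPlus hM, ⟨e⟩⟩

lemma exists_isDerivedCotensor (hC : C.Positive) (X : DGBicomod D C) (hX : X.BoundedBelow) :
    ∃ (F : DPlus C ⥤ DPlus D) (α : X.cotensorPlus hX ⟶ toDPlus C ⋙ F),
      X.IsDerivedCotensor hX F α := by
  have := toDPlus_isLeftAdjoint hC
  exact ⟨_, _, isLeftKanExtension_of_adjunction (Adjunction.ofIsLeftAdjoint (toDPlus C)) _⟩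

end

/-! ### Products in terms of Hom sets -/

section Fan

open Limits

variable {A : Type*} [Category A] {J : Type*} {Z : J → A}

lemma isLimit_fan_of_bijective (c : Fan Z)
    (h : ∀ B : A, Function.Bijective (fun (f : B ⟶ c.pt) (j : J) => f ≫ c.proj j)) :
    Nonempty (IsLimit c) := by
  choose l hl using fun (s : Fan Z) => (h s.pt).2 fun j => s.proj j
  exact ⟨Fan.IsLimit.mk c l (fun s j => congrFun (hl s) j) fun s m hm =>
    (h s.pt).1 (funext fun j => (hm j).trans (congrFun (hl s) j).symm)⟩

lemma bijective_of_isLimit_fan {c : Fan Z} (hc : IsLimit c) (B : A) :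
    Function.Bijective (fun (f : B ⟶ c.pt) (j : J) => f ≫ c.proj j) :=
  ⟨fun _ _ h => Fan.IsLimit.hom_ext hc _ _ fun j => congrFun h j,
    fun g => ⟨Fan.IsLimit.lift hc g, funext fun j => Fan.IsLimit.fac hc g j⟩⟩

end Fan

/-- The ground field as a complex. -/
abbrev DGVect.unit (k : Type u) [Field k] : DGVect k where
  carrier := k
  gr n := if n = 0 then ⊤ else ⊥
  isInternal := by
    refine DGVect.isInternal_of_proj _ (fun n => if n = 0 then LinearMap.id else 0) ?_ ?_ ?_
    · intro n x hx
      by_cases h : n = 0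
      · simp [h]
      · rw [if_neg h, Submodule.mem_bot] at hx
        simp [hx]
    · intro m n hmn x hx
      by_cases h : n = 0
      · rw [if_neg (by omega), Submodule.mem_bot] at hx
        simp [hx]
      · simp [h]
    · exact fun x => Submodule.mem_iSup_of_mem 0 (by simp)
  d := 0
  d_mem := fun _ => zero_mem _
  d_d := fun _ => rfl

lemma DGVect.unit_boundedBelow : (DGVect.unit k).BoundedBelow := ⟨0, fun _ hn => if_neg hn.ne⟩

/-! ### Products in the bounded below derived category -/

namespace DGComod

variable {C : DGCoalg k}

/-- `C` is cofree over itself. -/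
def selfCogen (C : DGCoalg k) : C.self.Cogen where
  T := DGVect.unit k
  π := C.counit
  mem := fun {n x} hx => by
    by_cases h : n = 0
    · subst h
      exact Submodule.mem_top
    · rw [C.counit_of_mem h hx]
      exact zero_mem _
  bij := by
    have h : ∀ x, TensorProduct.map LinearMap.id C.counit (C.comul.lin x) =
        (TensorProduct.rid k C.carrier).symm x := fun x => by
      rw [LinearEquiv.eq_symm_apply]
      exact C.comul_counit x
    have : ⇑(TensorProduct.map LinearMap.id C.counit ∘ₗ C.comul.lin) =
        (TensorProduct.rid k C.carrier).symm := funext h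
    change Function.Bijective ⇑(TensorProduct.map LinearMap.id C.counit ∘ₗ C.comul.lin)
    rw [this]
    exact LinearEquiv.bijective _

lemma good_self (hC : C.Positive) : C.self.Good :=
  (selfCogen C).good hC DGVect.unit_boundedBelow

/-- The morphism of `D⁺(C)` given by a morphism of `H(C)`. -/
def dmap {M N : DGComod C} (hM : M.BoundedBelow) (hN : N.BoundedBelow)
    (f : (toHCat C).obj M ⟶ (toHCat C).obj N) : M.inDPlus hM ⟶ N.inDPlus hN :=
  (toDPlus C).map (X := M.inHPlus hM) (Y := N.inHPlus hN) ((isHPlus C).homMk f)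

lemma dmap_comp {M N P : DGComod C} (hM : M.BoundedBelow) (hN : N.BoundedBelow)
    (hP : P.BoundedBelow) (f : (toHCat C).obj M ⟶ (toHCat C).obj N)
    (g : (toHCat C).obj N ⟶ (toHCat C).obj P) :
    dmap hM hP (f ≫ g) = dmap hM hN f ≫ dmap hN hP g :=
  (toDPlus C).map_comp (X := M.inHPlus hM) (Y := N.inHPlus hN) (Z := P.inHPlus hP)
    ((isHPlus C).homMk f) ((isHPlus C).homMk g)

lemma dmap_bijective {M N : DGComod C} (hM : M.BoundedBelow) (hN : N.Good) :
    Function.Bijective (dmap hM hN.bounded) := by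
  constructor
  · intro f g hfg
    exact (hN.closed M).1 (congrArg (fun f => f.hom) hfg)
  · intro g
    obtain ⟨f, hf⟩ := (hN.closed M).2 g.hom
    exact ⟨f, (isDPlus C).hom_ext hf⟩

lemma pi_bijective {J : Type u} (N : J → DGComod C) (M : DGComod C) : Function.Bijective
    (fun (f : (toHCat C).obj M ⟶ (toHCat C).obj (pi N)) (j : J) =>
      f ≫ (toHCat C).map (piπ N j)) := by
  constructor
  · intro f g h
    obtain ⟨f, rfl⟩ := exists_toHCat_map f
    obtain ⟨g, rfl⟩ := exists_toHCat_map g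
    rw [toHCat_eq_iff]
    exact pi_homotopic fun j => (toHCat_eq_iff _ _).1
      (by simpa only [Functor.map_comp] using congrFun h j)
  · intro g
    choose g' hg' using fun j => exists_toHCat_map (g j)
    refine ⟨(toHCat C).map (piLift g'), funext fun j => ?_⟩
    rw [← hg']
    refine ((toHCat C).map_comp _ _).symm.trans ?_
    rw [piLift_π]

/-- A product of comodules, as a fan in `D⁺(C)`. -/
def piFan {J : Type u} {N : J → DGComod C} (hN : ∀ j, (N j).BoundedBelow)
    (hp : (pi N).BoundedBelow) : Limits.Fan fun j => (N j).inDPlus (hN j) :=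
  Limits.Fan.mk ((pi N).inDPlus hp) fun j => dmap hp (hN j) ((toHCat C).map (piπ N j))

/-- The comodule product is a product in `H(C)`, and since the factors and the product are closed,
morphisms into them are the same in the derived category. The bound `hp` is what places the product
in `D⁺(C)`. -/
lemma isLimit_piFan {J : Type u} {N : J → DGComod C} (hN : ∀ j, (N j).Good)
    (hp : (pi N).BoundedBelow) :
    Nonempty (Limits.IsLimit (piFan (fun j => (hN j).bounded) hp)) := by
  refine isLimit_fan_of_bijective _ fun B => ?_
  obtain ⟨B, M, hM, ⟨e⟩⟩ := B
  let e' : (⟨B, M, hM, ⟨e⟩⟩ : DPlus C) ≅ M.inDPlus hM := isoDPlus e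
  have hg : (pi N).Good := ⟨hp, isClosed_pi fun j => (hN j).closed⟩
  have key : Function.Bijective (fun (f : M.inDPlus hM ⟶ (pi N).inDPlus hp) (j : J) =>
      f ≫ dmap hp (hN j).bounded ((toHCat C).map (piπ N j))) := by
    have h1 : (fun (f : M.inDPlus hM ⟶ (pi N).inDPlus hp) (j : J) =>
        f ≫ dmap hp (hN j).bounded ((toHCat C).map (piπ N j))) ∘ dmap hM hp =
        (fun g j => dmap hM (hN j).bounded (g j)) ∘ fun f j => f ≫ (toHCat C).map (piπ N j) :=
      funext fun f => funext fun j => (dmap_comp hM hp (hN j).bounded f _).symm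
    refine (Function.Bijective.of_comp_iff _ (dmap_bijective hM hg)).1 ?_
    rw [h1]
    exact (Function.Bijective.piMap fun j => dmap_bijective hM (hN j)).comp (pi_bijective N M)
  have h2 : (fun (f : (⟨B, M, hM, ⟨e⟩⟩ : DPlus C) ⟶ (pi N).inDPlus hp) (j : J) =>
      f ≫ dmap hp (hN j).bounded ((toHCat C).map (piπ N j))) =
      (fun g j => e'.hom ≫ g j) ∘ (fun (f : M.inDPlus hM ⟶ (pi N).inDPlus hp) (j : J) =>
        f ≫ dmap hp (hN j).bounded ((toHCat C).map (piπ N j))) ∘ fun f => e'.inv ≫ f := by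
    funext f j
    simp
  change Function.Bijective (fun (f : (⟨B, M, hM, ⟨e⟩⟩ : DPlus C) ⟶ (pi N).inDPlus hp) (j : J) =>
      f ≫ dmap hp (hN j).bounded ((toHCat C).map (piπ N j)))
  rw [h2]
  exact (Function.Bijective.piMap fun j => e'.symm.homFromEquiv.bijective).comp
    (key.comp e'.homFromEquiv.bijective)

end DGComod

/-! ### The derived functor on good comodules -/

namespace DGBicomod

open DGComod

variable {C D : DGCoalg k} (X : DGBicomod D C)

/-- `X □ -` is bijective on the morphisms from `M` to `N`, as a map from `H(C)` to `D(D)`. -/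
def FullyFaithfulAt (M N : DGComod C) : Prop :=
  Function.Bijective fun f : (toHCat C).obj M ⟶ (toHCat C).obj N => (toDCat D).map (X.cotH f)

section Derived

variable {X} {hX : X.BoundedBelow} {F : DPlus C ⥤ DPlus D}
  {α : X.cotensorPlus hX ⟶ toDPlus C ⋙ F}

/-- The comparison of `X □ M` with the derived functor. -/
def derIso (hC : C.Positive) (hα : X.IsDerivedCotensor hX F α) {M : DGComod C} (hM : M.Good) :
    (X.cotensor M).inDPlus (BoundedBelow.cotensor hX hM.bounded) ≅ F.obj (M.inDPlus hM.bounded) :=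
  haveI := toDPlus_isLeftAdjoint hC
  @asIso _ _ _ _ (α.app (M.inHPlus hM.bounded)) (isIso_app_of_local α hα (isLocalObj_toDPlus hM))

lemma derIso_naturality (hC : C.Positive) (hα : X.IsDerivedCotensor hX F α) {M N : DGComod C}
    (hM : M.Good) (hN : N.Good) (f : (toHCat C).obj M ⟶ (toHCat C).obj N) :
    (derIso hC hα hM).hom ≫ F.map (dmap hM.bounded hN.bounded f) =
      dmap (BoundedBelow.cotensor hX hM.bounded) (BoundedBelow.cotensor hX hN.bounded) (X.cotH f) ≫
        (derIso hC hα hN).hom :=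
  (α.naturality (X := M.inHPlus hM.bounded) (Y := N.inHPlus hN.bounded)
    ((isHPlus C).homMk f)).symm

/-- Conjugating by `derIso` turns the action of `F` on morphisms between good comodules into that of
`X □ -`, so the rest of the argument can work with chain-level constructions. -/
lemma fullyFaithfulAt_iff (hC : C.Positive) (hα : X.IsDerivedCotensor hX F α) {M N : DGComod C}
    (hM : M.Good) (hN : N.Good) : X.FullyFaithfulAt M N ↔
      Function.Bijective (fun f : M.inDPlus hM.bounded ⟶ N.inDPlus hN.bounded => F.map f) := by
  rw [← Function.Bijective.of_comp_iff _ (dmap_bijective hM.bounded hN)]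
  have h1 : (fun f : M.inDPlus hM.bounded ⟶ N.inDPlus hN.bounded => F.map f) ∘
      dmap hM.bounded hN.bounded = (fun g => (derIso hC hα hM).inv ≫ (isDPlus D).homMk g ≫
        (derIso hC hα hN).hom) ∘ fun f => (toDCat D).map (X.cotH f) := by
    funext f
    exact (Iso.eq_inv_comp _).2 (derIso_naturality hC hα hM hN f)
  have h2 : Function.Bijective fun g : (chainToDCat D).obj (X.cotensor M) ⟶
      (chainToDCat D).obj (X.cotensor N) =>
        (derIso hC hα hM).inv ≫ (isDPlus D).homMk g ≫ (derIso hC hα hN).hom := by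
    refine ((derIso hC hα hM).homCongr (derIso hC hα hN)).bijective.comp ?_
    exact ⟨fun f g h => congrArg (fun f => f.hom) h, fun f => ⟨f.hom, rfl⟩⟩
  rw [h1]
  exact (Function.Bijective.of_comp_iff' h2 _).symm

lemma exists_unitMap (hC : C.Positive) (hα : X.IsDerivedCotensor hX F α) :
    IsIso (X.unitMap hX hC.boundedBelow α) := by
  have h1 : IsIso ((isDPlus D).homMk (X := X.toDGComod.inDPlus hX)
      (Y := (X.cotensor C.self).inDPlus (BoundedBelow.cotensor hX hC.boundedBelow))
      ((chainToDCat D).map X.toCotensor)) :=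
    (isoDPlus (A := X.toDGComod.inDPlus hX)
      (B := (X.cotensor C.self).inDPlus (BoundedBelow.cotensor hX hC.boundedBelow))
      (IsQuasiIso.of_bijective X.toCotensor_bijective).iso).isIso_hom
  have h2 : IsIso (α.app (C.self.inHPlus hC.boundedBelow)) :=
    (derIso hC hα (good_self hC)).isIso_hom
  exact @IsIso.comp_isIso _ _ _ _ _ _ _ h1 h2

lemma exists_unitMapShift (hC : C.Positive) (hα : X.IsDerivedCotensor hX F α) (n : ℤ) :
    IsIso (X.unitMapShift hX hC.boundedBelow α n) := by
  have h1 : IsIso ((isDPlus D).homMk (X := (X.toDGComod.shift n).inDPlus (hX.shift n))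
      (Y := (X.cotensor (C.self.shift n)).inDPlus
        (BoundedBelow.cotensor hX (hC.boundedBelow.shift n)))
      ((chainToDCat D).map (X.toCotensorShift n))) :=
    (isoDPlus (A := (X.toDGComod.shift n).inDPlus (hX.shift n))
      (B := (X.cotensor (C.self.shift n)).inDPlus
        (BoundedBelow.cotensor hX (hC.boundedBelow.shift n)))
      (IsQuasiIso.of_bijective (X.toCotensorShift_bijective n)).iso).isIso_hom
  have h2 : IsIso (α.app ((C.self.shift n).inHPlus (hC.boundedBelow.shift n))) :=
    (derIso hC hα ((good_self hC).shift n)).isIso_hom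
  exact @IsIso.comp_isIso _ _ _ _ _ _ _ h1 h2

/-- The comparison maps are isomorphisms, because `X ≅ X □ C` and `C` is good. The bijection
required in condition (a) is thus forced to be `F` conjugated by them. -/
lemma inducesIsos_iff (hC : C.Positive) (hα : X.IsDerivedCotensor hX F α) :
    X.InducesIsos hX hC.boundedBelow α ↔ ∀ n : ℤ, Function.Bijective
      (fun f : C.self.inDPlus hC.boundedBelow ⟶
        (C.self.shift n).inDPlus (hC.boundedBelow.shift n) => F.map f) := by
  have := exists_unitMap hC hα
  have := exists_unitMapShift hC hα
  refine forall_congr' fun n => ⟨?_, fun h => ?_⟩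
  · rintro ⟨e, he⟩
    have h1 : (fun f : C.self.inDPlus hC.boundedBelow ⟶
        (C.self.shift n).inDPlus (hC.boundedBelow.shift n) => F.map f) =
        ((asIso (X.unitMap hX hC.boundedBelow α)).homCongr
          (asIso (X.unitMapShift hX hC.boundedBelow α n))) ∘ e := by
      funext f
      exact (IsIso.eq_inv_comp _).2 (he f)
    rw [h1]
    exact (Equiv.bijective _).comp e.bijective
  · refine ⟨(Equiv.ofBijective _ h).trans ((asIso (X.unitMap hX hC.boundedBelow α)).homCongr
      (asIso (X.unitMapShift hX hC.boundedBelow α n))).symm, fun f => ?_⟩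
    simp [Iso.homCongr]

end Derived

end DGBicomod

/-! ### Moving shifts between source and target -/

namespace DGComod

variable {C : DGCoalg k}

lemma Hom.shift_comp {M N P : DGComod C} (f : M ⟶ N) (g : N ⟶ P) (n : ℤ) :
    Hom.shift (f ≫ g) n = Hom.shift f n ≫ Hom.shift g n := rfl

lemma shift_shiftShiftZero {M N : DGComod C} (f : M ⟶ N) {a b : ℤ} (h : a + b = 0) :
    Hom.shift (Hom.shift f a) b ≫ N.shiftShiftZero h = M.shiftShiftZero h ≫ f := rfl

lemma Hom.shift_toShift {M N : DGComod C} {n : ℤ} (g : M.shift n ⟶ N) :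
    Hom.shift (Hom.toShift g) n ≫ N.shiftShiftZero (neg_add_cancel n) = g := rfl

lemma Hom.eq_toShift {M N : DGComod C} {n : ℤ} {f : M ⟶ N.shift (-n)} {g : M.shift n ⟶ N}
    (h : Hom.shift f n ≫ N.shiftShiftZero (neg_add_cancel n) = g) : f = Hom.toShift g := by
  subst h
  rfl

lemma comp_shift_eq {M N P : DGComod C} {a b : ℤ} {f : M ⟶ N.shift b} {g : N ⟶ P.shift a}
    {e : M ⟶ P} (h : a + b = 0)
    (H : ∀ z, P.unshift a (g.lin (N.unshift b (f.lin z))) = e.lin z) :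
    f ≫ Hom.shift g b ≫ P.shiftShiftZero h = e :=
  hom_ext (LinearMap.ext H)

lemma unshift_comp_unshift {M : DGComod C} {a b : ℤ} (h : a + b = 0) :
    M.unshift a ∘ₗ (M.shift a).unshift b = (M.shiftShiftZero h).lin := rfl

/-- Morphisms `M[n] ⟶ N` in `H(C)` are the same as morphisms `M ⟶ N[-n]`. -/
def toShiftH {M N : DGComod C} {n : ℤ} (f : (toHCat C).obj (M.shift n) ⟶ (toHCat C).obj N) :
    (toHCat C).obj M ⟶ (toHCat C).obj (N.shift (-n)) :=
  (toHCat C).map (Hom.toShift (exists_toHCat_map f).choose)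

lemma toShiftH_map {M N : DGComod C} {n : ℤ} (f : M.shift n ⟶ N) :
    toShiftH ((toHCat C).map f) = (toHCat C).map (Hom.toShift f) := by
  rw [toShiftH, toHCat_eq_iff, Hom.toShift_homotopic_iff, ← toHCat_eq_iff]
  exact (exists_toHCat_map ((toHCat C).map f)).choose_spec

lemma toShiftH_bijective (M N : DGComod C) (n : ℤ) : Function.Bijective
    (toShiftH : ((toHCat C).obj (M.shift n) ⟶ (toHCat C).obj N) → _) := by
  constructor
  · intro f g h
    obtain ⟨f, rfl⟩ := exists_toHCat_map f
    obtain ⟨g, rfl⟩ := exists_toHCat_map g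
    rw [toShiftH_map, toShiftH_map, toHCat_eq_iff, Hom.toShift_homotopic_iff] at h
    exact (toHCat_eq_iff _ _).2 h
  · intro g
    obtain ⟨g, rfl⟩ := exists_toHCat_map g
    exact ⟨(toHCat C).map (Hom.ofShift g), toShiftH_map _⟩

lemma isIso_toHCat_of_bijective {M N : DGComod C} (f : M ⟶ N) (hf : Function.Bijective f.lin) :
    IsIso ((toHCat C).map f) :=
  have := isIso_of_bijective f hf
  inferInstance

end DGComod

/-! ### Full faithfulness under retracts and shifts -/

namespace DGBicomod

open DGComod

variable {C D : DGCoalg k} {X : DGBicomod D C}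

namespace FullyFaithfulAt

variable {M M' N N' : DGComod C}

lemma of_retract_left (h : X.FullyFaithfulAt M' N) (i : (toHCat C).obj M ⟶ (toHCat C).obj M')
    (r : (toHCat C).obj M' ⟶ (toHCat C).obj M) (hir : i ≫ r = 𝟙 _) : X.FullyFaithfulAt M N := by
  constructor
  · intro f g hfg
    have : r ≫ f = r ≫ g := h.1 (by
      simp only [cotH_comp, Functor.map_comp]
      exact congrArg ((toDCat D).map (X.cotH r) ≫ ·) hfg)
    rw [← Category.id_comp f, ← Category.id_comp g, ← hir, Category.assoc, this, Category.assoc]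
  · intro g
    obtain ⟨f, hf⟩ := h.2 ((toDCat D).map (X.cotH r) ≫ g)
    refine ⟨i ≫ f, ?_⟩
    simp only at hf ⊢
    rw [cotH_comp, Functor.map_comp, hf, ← Category.assoc, ← Functor.map_comp, ← cotH_comp, hir,
      cotH_id, CategoryTheory.Functor.map_id, Category.id_comp]

lemma of_retract_right (h : X.FullyFaithfulAt M N') (i : (toHCat C).obj N ⟶ (toHCat C).obj N')
    (r : (toHCat C).obj N' ⟶ (toHCat C).obj N) (hir : i ≫ r = 𝟙 _) : X.FullyFaithfulAt M N := by
  constructor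
  · intro f g hfg
    have : f ≫ i = g ≫ i := h.1 (by
      simp only [cotH_comp, Functor.map_comp]
      exact congrArg (· ≫ (toDCat D).map (X.cotH i)) hfg)
    rw [← Category.comp_id f, ← Category.comp_id g, ← hir, ← Category.assoc, this, Category.assoc]
  · intro g
    obtain ⟨f, hf⟩ := h.2 (g ≫ (toDCat D).map (X.cotH i))
    refine ⟨f ≫ r, ?_⟩
    simp only at hf ⊢
    rw [cotH_comp, Functor.map_comp, hf, Category.assoc, ← Functor.map_comp, ← cotH_comp, hir,
      cotH_id, CategoryTheory.Functor.map_id, Category.comp_id]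

lemma iff_left (f : (toHCat C).obj M ⟶ (toHCat C).obj M') [IsIso f] :
    X.FullyFaithfulAt M N ↔ X.FullyFaithfulAt M' N :=
  ⟨fun h => h.of_retract_left (inv f) f (IsIso.inv_hom_id f),
    fun h => h.of_retract_left f (inv f) (IsIso.hom_inv_id f)⟩

lemma iff_right (f : (toHCat C).obj N ⟶ (toHCat C).obj N') [IsIso f] :
    X.FullyFaithfulAt M N ↔ X.FullyFaithfulAt M N' :=
  ⟨fun h => h.of_retract_right (inv f) f (IsIso.inv_hom_id f),
    fun h => h.of_retract_right f (inv f) (IsIso.hom_inv_id f)⟩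

end FullyFaithfulAt

variable (M : DGComod C) {N : DGComod C} {Y : DGComod D}

/-- The map `g ↦ (X □ g) u`. -/
def cotComp (u : X.cotensor N ⟶ Y) : ((toHCat C).obj M ⟶ (toHCat C).obj N) →+
    ((toHCat D).obj (X.cotensor M) ⟶ (toHCat D).obj Y) :=
  (Preadditive.rightComp _ ((toHCat D).map u)).comp X.cotH

lemma cotComp_apply (u : X.cotensor N ⟶ Y) (g : (toHCat C).obj M ⟶ (toHCat C).obj N) :
    cotComp M u g = X.cotH g ≫ (toHCat D).map u := rfl

/-- Replacing `X □ N` by a quasi-isomorphic closed `Y` allows Hom in `D(D)` to be computed in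
`H(D)`. The condition becomes the bijectivity of a homomorphism of abelian groups, to which the five
lemma applies. -/
lemma fullyFaithfulAt_iff_cotComp {u : X.cotensor N ⟶ Y} (hu : IsQuasiIso u) (hY : Y.IsClosed) :
    X.FullyFaithfulAt M N ↔ Function.Bijective (cotComp M u) := by
  rw [← Function.Bijective.of_comp_iff' (hY (X.cotensor M))]
  have h : (fun f : (toHCat D).obj (X.cotensor M) ⟶ (toHCat D).obj Y => (toDCat D).map f) ∘
      cotComp M u = hu.iso.homToEquiv ∘ fun f => (toDCat D).map (X.cotH f) := by
    funext f
    exact (toDCat D).map_comp (X.cotH f) ((toHCat D).map u)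
  rw [h]
  exact (Function.Bijective.of_comp_iff' (Equiv.bijective _) _).symm

lemma fullyFaithfulAt_iff_cotH (hN : (X.cotensor N).IsClosed) :
    X.FullyFaithfulAt M N ↔ Function.Bijective
      (X.cotH : ((toHCat C).obj M ⟶ (toHCat C).obj N) →+ _) :=
  Function.Bijective.of_comp_iff' (hN (X.cotensor M)) _

lemma cotensorShift_shiftShiftZero {a b : ℤ} (h : a + b = 0) :
    X.cotensorShift (N.shift a) b ≫ Hom.shift (X.cotensorShift N a) b ≫
      (X.cotensor N).shiftShiftZero h = X.cotMap (N.shiftShiftZero h) := by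
  refine comp_shift_eq h fun z => X.cotensor_ext ?_
  rw [cotensorι_unshift, cotensorι_unshift, cotensorι_map, TensorProduct.map_map,
    LinearMap.id_comp, unshift_comp_unshift h]

lemma cotensorShift_shiftShiftZero_assoc {a b : ℤ} (h : a + b = 0) (u : X.cotensor N ⟶ Y) :
    X.cotensorShift (N.shift a) b ≫ Hom.shift (X.cotensorShift N a) b ≫
      (X.cotensor N).shiftShiftZero h ≫ u = X.cotMap (N.shiftShiftZero h) ≫ u := by
  rw [← cotensorShift_shiftShiftZero, Category.assoc, Category.assoc]

lemma toShiftH_cotComp {n : ℤ} (u : X.cotensor N ⟶ Y)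
    (g : (toHCat C).obj (M.shift n) ⟶ (toHCat C).obj N)
    (s : (X.cotensor M).shift n ⟶ X.cotensor (M.shift n)) (hs : X.cotensorShift M n ≫ s = 𝟙 _) :
    cotComp M (X.cotensorShift N (-n) ≫ Hom.shift u (-n)) (toShiftH g) =
      toShiftH ((toHCat D).map s ≫ cotComp (M.shift n) u g) := by
  obtain ⟨g, rfl⟩ := exists_toHCat_map g
  rw [toShiftH_map, cotComp_apply, cotComp_apply, cotH_map, cotH_map]
  simp only [← Functor.map_comp]
  rw [toShiftH_map]
  congr 1
  have hi := isIso_of_bijective _ (X.cotensorShift_bijective M n)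
  refine Hom.eq_toShift ((cancel_epi (X.cotensorShift M n)).1 ?_)
  rw [← Category.assoc _ s, hs, Category.id_comp, Hom.shift_comp, Hom.shift_comp, Category.assoc,
    Category.assoc, shift_shiftShiftZero, ← Category.assoc, ← cotensorShift_naturality,
    Category.assoc, cotensorShift_shiftShiftZero_assoc, ← Category.assoc, ← cotMap_comp,
    Hom.shift_toShift]

/-- Morphisms out of `M[n]` are morphisms into `N[-n]`, on both sides and compatibly with `X □ -`.
-/
lemma fullyFaithfulAt_shift (n : ℤ) {u : X.cotensor N ⟶ Y} (hu : IsQuasiIso u) (hY : Y.IsClosed) :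
    X.FullyFaithfulAt (M.shift n) N ↔ X.FullyFaithfulAt M (N.shift (-n)) := by
  have hi := isIso_of_bijective _ (X.cotensorShift_bijective M n)
  rw [fullyFaithfulAt_iff_cotComp _ hu hY, fullyFaithfulAt_iff_cotComp M
    (((IsQuasiIso.of_bijective (X.cotensorShift_bijective N (-n))).comp (hu.shift (-n))))
    (hY.shift (-n)), ← Function.Bijective.of_comp_iff _ (toShiftH_bijective M N n)]
  have h : cotComp M (X.cotensorShift N (-n) ≫ Hom.shift u (-n)) ∘ toShiftH =
      (toShiftH ∘ ((asIso ((toHCat D).map (X.cotensorShift M n))).homFromEquiv)) ∘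
        cotComp (M.shift n) u := by
    funext g
    refine (toShiftH_cotComp M u g (inv (X.cotensorShift M n)) (IsIso.hom_inv_id _)).trans ?_
    rw [Functor.map_inv]
    rfl
  rw [h]
  exact (Function.Bijective.of_comp_iff' ((toShiftH_bijective _ _ _).comp (Equiv.bijective _))
    _).symm

end DGBicomod

namespace DGBicomod

open DGComod

variable {C D : DGCoalg k} {X : DGBicomod D C}

/-! ### Cones -/

/-- The five lemma for the contravariant sequences of `f` and of `X □ f`, the isomorphism `X □ Co(f)
≅ Co(X □ f)` identifying the triangles. As `X □ N` is closed, all groups live in the homotopy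
categories. -/
lemma fullyFaithfulAt_cone_left {M₁ M₂ : DGComod C} (f : M₁ ⟶ M₂) {N : DGComod C}
    (hN : (X.cotensor N).IsClosed) (h₁ : X.FullyFaithfulAt M₁ N) (h₂ : X.FullyFaithfulAt M₂ N)
    (h₁' : X.FullyFaithfulAt (M₁.shift 1) N) (h₂' : X.FullyFaithfulAt (M₂.shift 1) N) :
    X.FullyFaithfulAt (Co f) N := by
  rw [fullyFaithfulAt_iff_cotH _ hN] at h₁ h₂ h₁' h₂' ⊢
  let σ₁ := asIso ((toHCat D).map (isoOfBijective _ (X.cotensorShift_bijective M₁ 1)).hom)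
  let σ₂ := asIso ((toHCat D).map (isoOfBijective _ (X.cotensorShift_bijective M₂ 1)).hom)
  let γ := asIso ((toHCat D).map (isoOfBijective _ (X.cotensorCone_bijective f)).hom)
  let Z := (toHCat D).obj (X.cotensor N)
  let v₁ := (Preadditive.leftComp Z σ₂.inv).comp
    (X.cotH : ((toHCat C).obj (M₂.shift 1) ⟶ (toHCat C).obj N) →+ _)
  let v₂ := (Preadditive.leftComp Z σ₁.inv).comp
    (X.cotH : ((toHCat C).obj (M₁.shift 1) ⟶ (toHCat C).obj N) →+ _)
  let v₃ := (Preadditive.leftComp Z γ.inv).comp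
    (X.cotH : ((toHCat C).obj (Co f) ⟶ (toHCat C).obj N) →+ _)
  have hb : ∀ {A B A' : HCat D} (e : A ≅ B), Function.Bijective (Preadditive.leftComp A' e.inv) :=
    fun e => e.homFromEquiv.bijective
  -- The squares `s₁`, `s₂`, `s₃` say that `X □ -` carries the triangle of `f` to that of `X □ f`.
  have s₁ : (toHCat D).map (Hom.shift (X.cotMap f) 1) ≫ σ₂.inv =
      σ₁.inv ≫ (toHCat D).map (X.cotMap (Hom.shift f 1)) := by
    rw [Iso.eq_inv_comp, ← Category.assoc, Iso.comp_inv_eq]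
    exact congrArg (toHCat D).map (X.cotensorShift_naturality f 1).symm
  have s₂ : (toHCat D).map (coneδ (X.cotMap f)) ≫ σ₁.inv =
      γ.inv ≫ (toHCat D).map (X.cotMap (coneδ f)) := by
    rw [Iso.eq_inv_comp, ← Category.assoc, Iso.comp_inv_eq]
    exact congrArg (toHCat D).map (X.cotensorCone_coneδ f)
  have s₃ : (toHCat D).map (coneι (X.cotMap f)) ≫ γ.inv =
      (toHCat D).map (X.cotMap (coneι f)) := by
    rw [Iso.comp_inv_eq]
    exact congrArg (toHCat D).map (X.map_coneι_cotensorCone f).symm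
  have key : Function.Bijective v₃ := by
    refine AddMonoidHom.bijective_of_surjective_of_bijective_of_bijective_of_injective
      (Preadditive.leftComp _ ((toHCat C).map (Hom.shift f 1)))
      (Preadditive.leftComp _ ((toHCat C).map (coneδ f)))
      (Preadditive.leftComp _ ((toHCat C).map (coneι f)))
      (Preadditive.leftComp _ ((toHCat C).map f))
      (Preadditive.leftComp _ ((toHCat D).map (Hom.shift (X.cotMap f) 1)))
      (Preadditive.leftComp _ ((toHCat D).map (coneδ (X.cotMap f))))
      (Preadditive.leftComp _ ((toHCat D).map (coneι (X.cotMap f))))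
      (Preadditive.leftComp _ ((toHCat D).map (X.cotMap f)))
      v₁ v₂ v₃ X.cotH X.cotH ?_ ?_ ?_ ?_ (exact_yoneda₃ f N) (exact_yoneda₂ f N)
      (exact_yoneda₁ f N) (exact_yoneda₃ _ _) (exact_yoneda₂ _ _) (exact_yoneda₁ _ _)
      ((hb σ₂).comp h₂').2 ((hb σ₁).comp h₁') h₂ h₁.1
    · ext g
      change (toHCat D).map (Hom.shift (X.cotMap f) 1) ≫ σ₂.inv ≫ X.cotH g =
        σ₁.inv ≫ X.cotH ((toHCat C).map (Hom.shift f 1) ≫ g)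
      rw [cotH_comp, cotH_map, ← Category.assoc, s₁, Category.assoc]
    · ext g
      change (toHCat D).map (coneδ (X.cotMap f)) ≫ σ₁.inv ≫ X.cotH g =
        γ.inv ≫ X.cotH ((toHCat C).map (coneδ f) ≫ g)
      rw [cotH_comp, cotH_map, ← Category.assoc, s₂, Category.assoc]
    · ext g
      change (toHCat D).map (coneι (X.cotMap f)) ≫ γ.inv ≫ X.cotH g =
        X.cotH ((toHCat C).map (coneι f) ≫ g)
      rw [cotH_comp, cotH_map, ← Category.assoc, s₃]
    · ext g
      exact (X.cotH_comp ((toHCat C).map f) g).symm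
  exact (Function.Bijective.of_comp_iff' (hb γ) _).1 key

/-- Here `X □ Nᵢ` need not be closed, so the five lemma is applied to closed replacements `Yᵢ`. The
map `X □ f` is transported to `y : Y₁ ⟶ Y₂` only up to homotopy, and the induced map of cones makes
`Co(y)` a closed replacement of `X □ Co(f)`. -/
lemma fullyFaithfulAt_cone_right {N₁ N₂ : DGComod C} (f : N₁ ⟶ N₂) {M : DGComod C}
    {Y₁ Y₂ : DGComod D} {u₁ : X.cotensor N₁ ⟶ Y₁} {u₂ : X.cotensor N₂ ⟶ Y₂} (hu₁ : IsQuasiIso u₁)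
    (hu₂ : IsQuasiIso u₂) (hY₁ : Y₁.IsClosed) (hY₂ : Y₂.IsClosed)
    (h₁ : X.FullyFaithfulAt M N₁) (h₂ : X.FullyFaithfulAt M N₂)
    (h₁' : X.FullyFaithfulAt M (N₁.shift 1)) (h₂' : X.FullyFaithfulAt M (N₂.shift 1)) :
    X.FullyFaithfulAt M (Co f) := by
  obtain ⟨y, hy⟩ := (hY₂.bijective_comp u₁ hu₁).2 ((toHCat D).map (X.cotMap f ≫ u₂))
  obtain ⟨y, rfl⟩ := exists_toHCat_map y
  have hy' : (toHCat D).map (X.cotMap f ≫ u₂) = (toHCat D).map (u₁ ≫ y) := by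
    rw [(toHCat D).map_comp u₁ y]
    exact hy.symm
  obtain ⟨H⟩ := (toHCat_eq_iff _ _).1 hy'
  have hs : ∀ {N : DGComod C} {Y : DGComod D} {u : X.cotensor N ⟶ Y} (_ : IsQuasiIso u),
      IsQuasiIso (X.cotensorShift N 1 ≫ Hom.shift u 1) := fun {N Y u} hu =>
    (IsQuasiIso.of_bijective (X.cotensorShift_bijective N 1)).comp (hu.shift 1)
  have hc : IsQuasiIso (X.cotensorCone f ≫ coneMap u₁ u₂ H) :=
    (IsQuasiIso.of_bijective (X.cotensorCone_bijective f)).comp (.coneMap hu₁ hu₂ H)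
  rw [fullyFaithfulAt_iff_cotComp _ hu₁ hY₁] at h₁
  rw [fullyFaithfulAt_iff_cotComp _ hu₂ hY₂] at h₂
  rw [fullyFaithfulAt_iff_cotComp _ (hs hu₁) (hY₁.shift 1)] at h₁'
  rw [fullyFaithfulAt_iff_cotComp _ (hs hu₂) (hY₂.shift 1)] at h₂'
  rw [fullyFaithfulAt_iff_cotComp _ hc (hY₁.cone y hY₂)]
  have sq : ∀ {P Q : DGComod C} {Z W : DGComod D} (a : P ⟶ Q) (b : Z ⟶ W) (v : X.cotensor P ⟶ Z)
      (w : X.cotensor Q ⟶ W), (toHCat D).map (v ≫ b) = (toHCat D).map (X.cotMap a ≫ w) →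
      (Preadditive.rightComp ((toHCat D).obj (X.cotensor M)) ((toHCat D).map b)).comp
        (cotComp M v) = (cotComp M w).comp
          (Preadditive.rightComp ((toHCat C).obj M) ((toHCat C).map a)) := by
    intro P Q Z W a b v w h
    ext g
    change (X.cotH g ≫ (toHCat D).map v) ≫ (toHCat D).map b =
      X.cotH (g ≫ (toHCat C).map a) ≫ (toHCat D).map w
    rw [cotH_comp, cotH_map, Category.assoc, Category.assoc, ← Functor.map_comp, h,
      Functor.map_comp]
  refine AddMonoidHom.bijective_of_surjective_of_bijective_of_bijective_of_injective
    (Preadditive.rightComp _ ((toHCat C).map f))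
    (Preadditive.rightComp _ ((toHCat C).map (coneι f)))
    (Preadditive.rightComp _ ((toHCat C).map (coneδ f)))
    (Preadditive.rightComp _ ((toHCat C).map (Hom.shift f 1)))
    (Preadditive.rightComp _ ((toHCat D).map y))
    (Preadditive.rightComp _ ((toHCat D).map (coneι y)))
    (Preadditive.rightComp _ ((toHCat D).map (coneδ y)))
    (Preadditive.rightComp _ ((toHCat D).map (Hom.shift y 1)))
    (cotComp M u₁) (cotComp M u₂) (cotComp M _) (cotComp M _) (cotComp M _)
    (sq _ _ _ _ hy'.symm) (sq _ _ _ _ ?_) (sq _ _ _ _ ?_) (sq _ _ _ _ ?_)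
    (exact_coyoneda₁ f M) (exact_coyoneda₂ f M) (exact_coyoneda₃ f M)
    (exact_coyoneda₁ y _) (exact_coyoneda₂ y _) (exact_coyoneda₃ y _) h₁.2 h₂ h₁' h₂'.1
  · rw [← Category.assoc, map_coneι_cotensorCone, coneι_coneMap]
  · rw [Category.assoc, coneMap_coneδ, ← Category.assoc, ← Category.assoc, cotensorCone_coneδ]
  · rw [← Category.assoc, cotensorShift_naturality, Category.assoc, Category.assoc,
      Functor.map_comp, (toHCat D).map_comp (X.cotensorShift N₁ 1)]
    have := (toHCat_eq_iff _ _).2 (Hom.shift_homotopic ((toHCat_eq_iff _ _).1 hy'.symm) 1)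
    rw [Hom.shift_comp, Hom.shift_comp] at this
    rw [this]

/-! ### Extensions -/

lemma _root_.DGComod.tensorIncl_unshift (M : DGComod C) {V : DGVect k} {q : ℤ}
    (hV : V.Concentrated q) (v : V.carrier) (z : (M.shift (-q)).carrier) :
    (M.tensorIncl hV v).lin z = M.unshift (-q) z ⊗ₜ[k] v := rfl

lemma cotensorι_cotensorTensor (M : DGComod C) (V : DGVect k)
    (w : (X.cotensor M).carrier ⊗[k] V.carrier) :
    (X.cotensorι (M.tensor V)).lin ((X.cotensorTensor M V).lin w) =
      TensorProduct.assoc k X.carrier M.carrier V.carrier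
        (TensorProduct.map (X.cotensorι M).lin LinearMap.id w) := rfl

lemma cotensorShift_tensorIncl (M : DGComod C) {V : DGVect k} {q : ℤ} (hV : V.Concentrated q)
    (v : V.carrier) : X.cotensorShift M (-q) ≫ (X.cotensor M).tensorIncl hV v ≫
      X.cotensorTensor M V = X.cotMap (M.tensorIncl hV v) := by
  refine hom_ext (LinearMap.ext fun z => X.cotensor_ext ?_)
  have h : ∀ t : X.carrier ⊗[k] (M.shift (-q)).carrier,
      TensorProduct.assoc k X.carrier M.carrier V.carrier
        (TensorProduct.map LinearMap.id (M.unshift (-q)) t ⊗ₜ v) =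
      TensorProduct.map LinearMap.id (M.tensorIncl hV v).lin t := fun t => by
    induction t using TensorProduct.induction_on with
    | zero => rw [map_zero, TensorProduct.zero_tmul, map_zero, map_zero]
    | tmul x m =>
      rw [TensorProduct.map_tmul, TensorProduct.assoc_tmul, TensorProduct.map_tmul,
        LinearMap.id_apply, tensorIncl_unshift]
    | add a b ha hb => rw [map_add, TensorProduct.add_tmul, map_add, map_add, ha, hb]
  rw [DGComod.comp_apply, DGComod.comp_apply, cotensorι_cotensorTensor, tensorIncl_unshift,
    TensorProduct.map_tmul, cotensorι_unshift, cotensorι_map]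
  rw [LinearMap.id_apply]
  exact h ((X.cotensorι (M.shift (-q))).lin z)

/-- For `V` in degree `q`, both `M ⊗ V` and `X □ (M ⊗ V) ≅ (X □ M) ⊗ V` are coproducts in the
homotopy category, over a basis of `V`, of copies of `M[-q]` and of `X □ M[-q]`. The map in question
is a product of maps which are bijective by hypothesis. -/
lemma fullyFaithfulAt_tensor (M : DGComod C) {N : DGComod C} (hN : (X.cotensor N).IsClosed)
    {V : DGVect k} {q : ℤ} (hV : V.Concentrated q) (h : X.FullyFaithfulAt (M.shift (-q)) N) :
    X.FullyFaithfulAt (M.tensor V) N := by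
  rw [fullyFaithfulAt_iff_cotH _ hN] at h ⊢
  let B := Module.Basis.ofVectorSpace k V.carrier
  have hσ := isIso_toHCat_of_bijective _ (X.cotensorShift_bijective M (-q))
  have hτ := isIso_toHCat_of_bijective _ (X.cotensorTensor_bijective M V)
  let σ := asIso ((toHCat D).map (X.cotensorShift M (-q)))
  let τ := asIso ((toHCat D).map (X.cotensorTensor M V))
  have h1 := (X.cotensor M).tensorIncl_bijective hV B (X.cotensor N)
  have h2 := M.tensorIncl_bijective hV B N
  have h3 : (fun g i => σ.symm.homFromEquiv (g i)) ∘
      (fun (f : (toHCat D).obj ((X.cotensor M).tensor V) ⟶ (toHCat D).obj (X.cotensor N)) i =>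
        (toHCat D).map ((X.cotensor M).tensorIncl hV (B i)) ≫ f) ∘
      τ.symm.homFromEquiv ∘ (X.cotH : ((toHCat C).obj (M.tensor V) ⟶ (toHCat C).obj N) →+ _) =
      (fun g i => X.cotH (g i)) ∘ fun f i => (toHCat C).map (M.tensorIncl hV (B i)) ≫ f := by
    funext f i
    change (toHCat D).map (X.cotensorShift M (-q)) ≫ (toHCat D).map _ ≫
      (toHCat D).map (X.cotensorTensor M V) ≫ X.cotH f = X.cotH (_ ≫ f)
    rw [cotH_comp, cotH_map, ← cotensorShift_tensorIncl, Functor.map_comp, Functor.map_comp,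
      Category.assoc, Category.assoc]
  have h4 := (Function.Bijective.piMap (fun _ => h)).comp h2
  have h5 := (Function.Bijective.piMap fun _ => σ.symm.homFromEquiv.bijective).comp
    (h1.comp τ.symm.homFromEquiv.bijective)
  refine (Function.Bijective.of_comp_iff' h5 _).1 ?_
  exact h3 ▸ h4

end DGBicomod

namespace DGComod

variable {C : DGCoalg k}

/-! ### Morphisms to comodules bounded above -/

section Degree

variable {M P N : DGComod C} (p : M ⟶ P)

/-- The kernel of `p` lives in degrees `≥ m`, which a map of degree `≥ -1` sends to degrees `≥ m -
1`, where `N` vanishes. The degree `-1` is allowed in order to treat homotopies. -/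
lemma map_eq_zero_of_degree {m : ℤ} (hk : ∀ i < m, ∀ x ∈ M.gr i, p.lin x = 0 → x = 0)
    (hN : ∀ i, m - 1 ≤ i → N.gr i = ⊥) {e : ℤ} (he : -1 ≤ e) {g : M.carrier →ₗ[k] N.carrier}
    (hg : ∀ {n : ℤ} {x : M.carrier}, x ∈ M.gr n → g x ∈ N.gr (n + e)) {x : M.carrier}
    (hx : p.lin x = 0) : g x = 0 := by
  refine N.eq_zero_of_proj fun n => ?_
  have h1 := DGVect.proj_map e hg (n - e) x
  rw [sub_add_cancel] at h1
  rw [h1]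
  by_cases hn : n - e < m
  · rw [hk _ hn _ (M.proj_mem _ x) (by rw [← p.toHom.proj, hx, map_zero]), map_zero]
  · have := hg (M.proj_mem (n - e) x)
    rwa [hN _ (by omega), Submodule.mem_bot] at this

lemma exists_lift_of_degree (hp : Function.Surjective p.lin) {m : ℤ}
    (hk : ∀ i < m, ∀ x ∈ M.gr i, p.lin x = 0 → x = 0)
    (hN : ∀ i, m - 1 ≤ i → N.gr i = ⊥) {e : ℤ} (he : -1 ≤ e) {g : M.carrier →ₗ[k] N.carrier}
    (hg : ∀ {n : ℤ} {x : M.carrier}, x ∈ M.gr n → g x ∈ N.gr (n + e)) :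
    ∃ g' : P.carrier →ₗ[k] N.carrier, ∀ x, g' (p.lin x) = g x := by
  obtain ⟨s, hs⟩ := p.lin.exists_rightInverse_of_surjective (LinearMap.range_eq_top.2 hp)
  refine ⟨g ∘ₗ s, fun x => ?_⟩
  rw [LinearMap.comp_apply, ← sub_eq_zero, ← map_sub]
  refine map_eq_zero_of_degree p hk hN he hg ?_
  rw [map_sub, sub_eq_zero]
  exact LinearMap.congr_fun hs (p.lin x)

/-- Both chain maps and homotopies to `N` factor through `p` for degree reasons; lifted homotopies
give injectivity, lifted chain maps surjectivity. -/
lemma bijective_comp_of_degree (hp : Function.Surjective p.lin) {m : ℤ}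
    (hk : ∀ i < m, ∀ x ∈ M.gr i, p.lin x = 0 → x = 0) (hN : ∀ i, m - 1 ≤ i → N.gr i = ⊥) :
    Function.Bijective
      (fun f : (toHCat C).obj P ⟶ (toHCat C).obj N => (toHCat C).map p ≫ f) := by
  have hm : ∀ {n : ℤ} {x : P.carrier}, x ∈ P.gr n → ∃ y ∈ M.gr n, p.lin y = x :=
    fun hx => exists_mem_of_surjective p hp hx
  constructor
  · intro f g hfg
    obtain ⟨f, rfl⟩ := exists_toHCat_map f
    obtain ⟨g, rfl⟩ := exists_toHCat_map g
    simp only [← Functor.map_comp] at hfg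
    obtain ⟨H⟩ := (toHCat_eq_iff _ _).1 hfg
    obtain ⟨h, hh⟩ := exists_lift_of_degree p hp hk hN (e := -1) le_rfl
      (fun {n x} hx => by rw [← sub_eq_add_neg]; exact H.mem hx)
    refine (toHCat_eq_iff _ _).2 ⟨⟨h, fun {n x} hx => ?_, fun x => ?_, fun x => ?_⟩⟩
    · obtain ⟨y, hy, rfl⟩ := hm hx
      rw [hh]
      exact H.mem hy
    · obtain ⟨x, rfl⟩ := hp x
      rw [hh, H.colin, p.colin, TensorProduct.map_map, LinearMap.comp_id,
        show h ∘ₗ p.lin = H.h from LinearMap.ext hh]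
    · obtain ⟨x, rfl⟩ := hp x
      rw [← p.comm, hh, hh]
      exact H.eq x
  · intro f
    obtain ⟨f, rfl⟩ := exists_toHCat_map f
    obtain ⟨g, hg⟩ := exists_lift_of_degree p hp hk hN (e := 0) (by omega)
      (fun {n x} hx => by rw [add_zero]; exact f.mem hx)
    refine ⟨(toHCat C).map (homDesc p hp f g hg hm), ?_⟩
    change (toHCat C).map p ≫ _ = _
    rw [← Functor.map_comp]
    exact congrArg (toHCat C).map (hom_ext (LinearMap.ext hg))

end Degree

end DGComod

namespace DGBicomod

open DGComod

variable {C D : DGCoalg k} {X : DGBicomod D C}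

/-! ### Towers -/

section Tower

variable {M : DGComod C} (G : M.Cogen) (hC : C.Positive)

lemma cotMap_toTow_surjective (n : ℤ) : Function.Surjective (X.cotMap (G.toTow hC n)).lin := by
  intro z
  refine ⟨X.cotensorEven (G.ofTow hC n) (G.colin_ofTow hC n) z, X.cotensor_ext ?_⟩
  rw [cotensorι_map, cotensorι_even, TensorProduct.map_map,
    show (G.toTow hC n).lin ∘ₗ G.ofTow hC n = LinearMap.id from
      LinearMap.ext (G.toTow_ofTow hC n), LinearMap.id_comp, TensorProduct.map_id,
    LinearMap.id_apply]

/-- As `X` begins in degree `a`, an element of `X ⊗ M` of degree `i < n + a` only involves elements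
of `M` of degree below `n`, on which `idem n` is the identity. -/
lemma eq_zero_of_cotMap_toTow {a : ℤ} (ha : ∀ n < a, X.gr n = ⊥) {n i : ℤ} (hi : i < n + a)
    {z : (X.cotensor M).carrier} (hz : z ∈ (X.cotensor M).gr i)
    (h : (X.cotMap (G.toTow hC n)).lin z = 0) : z = 0 := by
  have h1 : TensorProduct.map LinearMap.id (G.idem n) ((X.cotensorι M).lin z) = 0 := by
    have h2 := congrArg (fun w => TensorProduct.map LinearMap.id (G.ofTow hC n)
      ((X.cotensorι _).lin w)) h
    simp only [map_zero] at h2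
    rw [cotensorι_map, TensorProduct.map_map, LinearMap.id_comp] at h2
    exact h2
  have h3 : (TensorProduct.map LinearMap.id (G.idem n) - LinearMap.id :
      X.carrier ⊗[k] M.carrier →ₗ[k] X.carrier ⊗[k] M.carrier) ((X.cotensorι M).lin z) ∈
      (⊥ : Submodule k (X.carrier ⊗[k] M.carrier)) := by
    refine DGVect.tensorGr_le X.toDGVect M.toDGVect
      (TensorProduct.map LinearMap.id (G.idem n) - LinearMap.id) i ⊥
      (fun p q hpq x hx m hm => ?_) hz
    rw [Submodule.mem_bot, LinearMap.sub_apply, TensorProduct.map_tmul, LinearMap.id_apply,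
      LinearMap.id_apply]
    by_cases hp : p < a
    · rw [ha p hp, Submodule.mem_bot] at hx
      rw [hx, TensorProduct.zero_tmul, TensorProduct.zero_tmul, sub_zero]
    · rw [G.idem_of_lt hC (by omega) hm, sub_self]
  rw [Submodule.mem_bot, LinearMap.sub_apply, h1, zero_sub, neg_eq_zero] at h3
  refine X.cotensor_ext ?_
  rw [map_zero]
  exact h3

/-- As `N` and `X □ N` are bounded above, one sufficiently high stage of the tower computes both the
morphisms from `M` to `N` and those from `X □ M` to `X □ N`. -/
lemma fullyFaithfulAt_of_tower {N : DGComod C} (hN : (X.cotensor N).IsClosed) {a b c : ℤ}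
    (hNb : ∀ i, b ≤ i → N.gr i = ⊥) (hNb' : ∀ i, b ≤ i → (X.cotensor N).gr i = ⊥)
    (hX : ∀ n < c, X.gr n = ⊥) (h : ∀ m : ℕ, X.FullyFaithfulAt (G.tow hC (a + m)) N) :
    X.FullyFaithfulAt M N := by
  -- The stage must satisfy two bounds, one for `M` and one for `X □ M`, the second displaced by the
  -- lower bound `c` of `X`. Adding the two natural numbers covers either sign of `c`.
  obtain ⟨m, hm, hm'⟩ : ∃ m : ℕ, b ≤ a + m - 1 ∧ b ≤ a + m + c - 1 :=
    ⟨(b - a - c + 1).toNat + (b - a + 1).toNat, by omega, by omega⟩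
  have h0 := h m
  rw [fullyFaithfulAt_iff_cotH _ hN] at h0 ⊢
  have h1 := bijective_comp_of_degree (N := N) (G.toTow hC (a + m)) (G.toTow_surjective hC _)
    (m := a + m) (fun i hi x hx h => by
      rwa [G.toTow_eq_zero hC, G.idem_of_lt hC hi hx] at h) (fun i hi => hNb i (by omega))
  have h2 := bijective_comp_of_degree (N := X.cotensor N) (X.cotMap (G.toTow hC (a + m)))
    (cotMap_toTow_surjective G hC _) (m := a + m + c)
    (fun i hi x hx h => eq_zero_of_cotMap_toTow G hC hX hi hx h) (fun i hi => hNb' i (by omega))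
  refine (Function.Bijective.of_comp_iff _ h1).1 ?_
  have h3 : (X.cotH : ((toHCat C).obj M ⟶ (toHCat C).obj N) →+ _) ∘
      (fun f => (toHCat C).map (G.toTow hC (a + m)) ≫ f) =
      (fun f => (toHCat D).map (X.cotMap (G.toTow hC (a + m))) ≫ f) ∘ X.cotH := by
    funext f
    exact X.cotH_comp _ _
  rw [h3]
  exact h2.comp h0

end Tower

/-! ### Morphisms to shifts of `C` -/

/-- This is where the closedness of `X` enters: `X □ C[j]` is isomorphic to `X[j]`. -/
lemma isClosed_cotensor_self (hX : X.toDGComod.IsClosed) (j : ℤ) :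
    (X.cotensor (C.self.shift j)).IsClosed :=
  (hX.shift j).of_bijective (X.toCotensorShift j) (X.toCotensorShift_bijective j)

lemma cotensor_self_gr {i j : ℤ} (h : X.gr (j + i) = ⊥) :
    (X.cotensor (C.self.shift j)).gr i = ⊥ := by
  refine (Submodule.eq_bot_iff _).2 fun z hz => ?_
  obtain ⟨x, rfl⟩ := (X.toCotensorShift_bijective j).2 z
  have h1 : x ∈ (X.toDGComod.shift j).gr i :=
    (X.toCotensorShift j).toHom.mem_of_injective (X.toCotensorShift_bijective j).1 hz
  have h2 : (X.toDGComod.shift j).gr i = ⊥ := h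
  rw [h2, Submodule.mem_bot] at h1
  rw [h1, map_zero]

/-- Requiring the property for all `j` at once makes it stable under shifts of `M`, as these are
absorbed in the shift of the target. -/
lemma triangulated_fullyFaithfulAt_self (hX : X.toDGComod.IsClosed) :
    Triangulated fun M : DGComod C => ∀ j : ℤ, X.FullyFaithfulAt M (C.self.shift j) := by
  have hs : ∀ {M : DGComod C} (n : ℤ), (∀ j : ℤ, X.FullyFaithfulAt M (C.self.shift j)) →
      ∀ j, X.FullyFaithfulAt (M.shift n) (C.self.shift j) := by
    intro M n h j
    rw [fullyFaithfulAt_shift M n (u := 𝟙 (X.cotensor (C.self.shift j)))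
      (.of_bijective Function.bijective_id) (isClosed_cotensor_self hX j)]
    have := isIso_toHCat_of_bijective (C.self.shiftShift (rfl : j + -n = j + -n))
      Function.bijective_id
    exact (FullyFaithfulAt.iff_right
      ((toHCat C).map (C.self.shiftShift (rfl : j + -n = j + -n)))).2 (h (j + -n))
  refine ⟨fun {M N} f hf hM hN => ?_, fun n _ h => hs n h, fun f _ _ h₁ h₂ j => ?_⟩
  · have := hf.isIso_toHCat hM.closed hN.closed
    exact forall_congr' fun j => FullyFaithfulAt.iff_left ((toHCat C).map f)
  · exact fullyFaithfulAt_cone_left f (isClosed_cotensor_self hX j) (h₁ j) (h₂ j) (hs 1 h₁ j)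
      (hs 1 h₂ j)

/-- The first dévissage, in the source. The class contains `C`, hence the `C ⊗ V` and all finite
stages of towers. Products are avoided in the source: the passage to the limit rests on the upper
bounds of `C` and `X`. -/
lemma fullyFaithfulAt_self (hC : C.Positive) (hCb : C.Bounded) (hXb : X.Bounded)
    (hX : X.toDGComod.IsClosed) (h : ∀ j : ℤ, X.FullyFaithfulAt C.self (C.self.shift j))
    {M : DGComod C} (hM : M.Good) (j : ℤ) : X.FullyFaithfulAt M (C.self.shift j) := by
  have hT := triangulated_fullyFaithfulAt_self hX
  have hE : ∀ (V : DGVect k) (n : ℤ), V.Concentrated n →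
      ∀ j, X.FullyFaithfulAt (cofree C V) (C.self.shift j) := fun V n hV j =>
    fullyFaithfulAt_tensor C.self (isClosed_cotensor_self hX j) hV
      (hT.shift (-n) (good_self hC) h j)
  obtain ⟨a, ha⟩ := resCogen_boundedBelow hC hM.bounded
  obtain ⟨a₁, b₁, hb₁⟩ := hCb
  obtain ⟨a₂, b₂, hb₂⟩ := hXb
  refine (hT.quasiIso M.toRes M.toRes_isQuasiIso hM (good_res hC hM.bounded)).2 (fun j => ?_) j
  -- The degree `i` part of `C[j]` is that of `C` in degree `j + i`, and `X □ C[j]` is `X[j]`; so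
  -- both vanish once `j + i` exceeds the upper bounds `b₁` and `b₂`.
  refine fullyFaithfulAt_of_tower M.resCogen hC (isClosed_cotensor_self hX j)
    (b := max (b₁ - j + 1) (b₂ - j + 1)) (c := a₂) (fun i hi => hb₁ _ (Or.inr (by omega)))
    (fun i hi => ?_) (fun n hn => hb₂ n (Or.inl hn)) (fun m => hT.tow hC hE M.resCogen ha m j)
  exact cotensor_self_gr (hb₂ _ (Or.inr (by omega)))

end DGBicomod

namespace DGComod

variable {C : DGCoalg k}

/-! ### Cofree comodules as retracts of products -/

section Retract

variable {V : DGVect k} {q : ℤ} (hV : V.Concentrated q) {J : Type u}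

variable (J) in
/-- The counits of the factors of a product of shifts of `C`. -/
def piCounit (C : DGCoalg k) (q : ℤ) :
    (pi fun _ : J => C.self.shift (-q)).carrier →ₗ[k] J → k :=
  LinearMap.pi fun j => C.counit ∘ₗ C.self.unshift (-q) ∘ₗ (piπ _ j).lin

lemma piCounit_apply (x : (pi fun _ : J => C.self.shift (-q)).carrier) (j : J) :
    piCounit J C q x j = C.counit (C.self.unshift (-q) ((piπ _ j).lin x)) := rfl

/-- The morphism from a product of shifts of `C` to a cofree comodule given by a linear map. -/
def piToCofree (ρ : (J → k) →ₗ[k] V.carrier) :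
    (pi fun _ : J => C.self.shift (-q)) ⟶ cofree C V :=
  (pi fun _ : J => C.self.shift (-q)).toCofree ≫ cofreeMap
    { lin := ρ ∘ₗ piCounit J C q
      mem := fun {n x} hx => by
        by_cases hn : n = q
        · subst hn
          exact hV.mem _
        · have : piCounit J C q x = 0 := funext fun j => by
            rw [piCounit_apply]
            exact C.counit_of_mem (n := n + -q) (by omega)
              (C.self.unshift_mem (-q) ((piπ _ j).mem hx))
          rw [LinearMap.comp_apply, this, map_zero]
          exact zero_mem _
      comm := fun x => by
        have : piCounit J C q ((pi fun _ : J => C.self.shift (-q)).d x) = 0 := funext fun j => by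
          rw [piCounit_apply, (piπ _ j).comm, unshift_d]
          exact C.counit_d _
        rw [LinearMap.comp_apply, this, map_zero, hV.d_eq_zero] }

-- The coordinate inclusion of the `i`-th factor followed by the map defined by `ρ` is the inclusion
-- of the copy of `C` spanned by the vector `ρ eᵢ`.
open Classical in
lemma piLift_piToCofree (ρ : (J → k) →ₗ[k] V.carrier) (i : J) :
    piLift (fun j => if i = j then 𝟙 (C.self.shift (-q)) else 0) ≫ piToCofree (C := C) hV ρ =
      C.self.tensorIncl hV (ρ (Pi.single i 1)) := by
  rw [piToCofree, ← Category.assoc, toCofree_naturality, Category.assoc, cofreeMap_comp]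
  set δ : C.self.shift (-q) ⟶ pi fun _ : J => C.self.shift (-q) :=
    piLift (fun j => if i = j then 𝟙 (C.self.shift (-q)) else 0) with hδ
  have h1 : ∀ c, piCounit J C q (δ.lin c) = C.counit (C.self.unshift (-q) c) • Pi.single i 1 := by
    intro c
    funext j
    rw [piCounit_apply, ← DGComod.comp_apply, hδ, piLift_π, Pi.smul_apply]
    by_cases h : i = j
    · subst h
      rw [if_pos rfl, Pi.single_eq_same, smul_eq_mul, mul_one]
      rfl
    · rw [if_neg h, Pi.single_eq_of_ne (Ne.symm h), smul_zero, zero_lin, LinearMap.zero_apply,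
        map_zero, map_zero]
  have h2 : (ρ ∘ₗ piCounit J C q) ∘ₗ δ.lin =
      (LinearMap.toSpanSingleton k V.carrier (ρ (Pi.single i 1)) ∘ₗ C.counit) ∘ₗ
        C.self.unshift (-q) := by
    ext c
    rw [LinearMap.comp_apply, LinearMap.comp_apply, h1, map_smul]
    rfl
  refine hom_ext (LinearMap.ext fun c => ?_)
  rw [DGComod.comp_apply, tensorIncl_unshift]
  have h3 : ∀ t : C.carrier ⊗[k] C.carrier, TensorProduct.map LinearMap.id
      (LinearMap.toSpanSingleton k V.carrier (ρ (Pi.single i 1)) ∘ₗ C.counit) t =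
      TensorProduct.rid k C.carrier (TensorProduct.map LinearMap.id C.counit t) ⊗ₜ
        ρ (Pi.single i 1) := by
    intro t
    induction t using TensorProduct.induction_on with
    | zero => simp
    | tmul x y => simp [TensorProduct.smul_tmul]
    | add a b ha hb => simp only [map_add, TensorProduct.add_tmul, ha, hb]
  change TensorProduct.map LinearMap.id ((ρ ∘ₗ piCounit J C q) ∘ₗ δ.lin)
    ((C.self.shift (-q)).coact.lin c) = _
  rw [h2]
  refine (h3 (C.comul.lin c)).trans ?_
  rw [C.comul_counit]
  rfl

/-- A basis embeds `V` in `J → k`, with a linear retraction `ρ`. As `C ⊗ V` is a coproduct of copies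
of `C[-q]` in the homotopy category, its map to the product can be given by a matrix, and the
retraction identity can be tested on basis vectors. -/
lemma cofree_retract (hV : V.Concentrated q) (B : Module.Basis J k V.carrier) : ∃ (i : (toHCat C).obj (cofree C V) ⟶
      (toHCat C).obj (pi fun _ : J => C.self.shift (-q)))
    (r : (toHCat C).obj (pi fun _ : J => C.self.shift (-q)) ⟶ (toHCat C).obj (cofree C V)),
    i ≫ r = 𝟙 _ := by
  classical
  obtain ⟨ρ, hρ⟩ := (Finsupp.lcoeFun ∘ₗ B.repr.toLinearMap :
    V.carrier →ₗ[k] J → k).exists_leftInverse_of_injective (LinearMap.ker_eq_bot.2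
      ((DFunLike.coe_injective).comp B.repr.injective))
  have hρ' : ∀ i, ρ (Pi.single i 1) = B i := fun i => by
    have := LinearMap.congr_fun hρ (B i)
    simpa [Finsupp.lcoeFun, Finsupp.single_eq_pi_single] using this
  choose e he using fun j : J => (C.self.tensorIncl_bijective hV B (C.self.shift (-q))).2
    fun i => (toHCat C).map (if i = j then 𝟙 (C.self.shift (-q)) else 0)
  obtain ⟨i, hi⟩ := (pi_bijective (fun _ : J => C.self.shift (-q)) (cofree C V)).2 e
  refine ⟨i, (toHCat C).map (piToCofree hV ρ),
    (C.self.tensorIncl_bijective hV B (cofree C V)).1 (funext fun l => ?_)⟩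
  have h1 : (toHCat C).map (C.self.tensorIncl hV (B l)) ≫ i =
      (toHCat C).map (piLift (fun j => if l = j then 𝟙 (C.self.shift (-q)) else 0)) := by
    refine (pi_bijective (fun _ : J => C.self.shift (-q)) _).1 (funext fun j => ?_)
    have h2 := congrFun hi j
    have h3 := congrFun (he j) l
    simp only at h2 h3 ⊢
    rw [Category.assoc, h2, h3, ← Functor.map_comp, piLift_π]
  change _ ≫ i ≫ _ = _ ≫ 𝟙 _
  rw [← Category.assoc, h1, ← Functor.map_comp, piLift_piToCofree, hρ', Category.comp_id]

end Retract

end DGComod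

namespace DGBicomod

open DGComod

variable {C D : DGCoalg k} {X : DGBicomod D C}

/-! ### Full faithfulness -/

section Full

variable {hX : X.BoundedBelow} {F : DPlus C ⥤ DPlus D} {α : X.cotensorPlus hX ⟶ toDPlus C ⋙ F}

/-- `F` maps the product fan to a product fan, so morphisms into both are families of morphisms into
the factors, compatibly with `F`. -/
lemma fullyFaithfulAt_pi (hC : C.Positive) (hα : X.IsDerivedCotensor hX F α) {J : Type u}
    [Limits.PreservesLimitsOfShape (Discrete J) F] {M : DGComod C} (hM : M.Good)
    {N : J → DGComod C} (hN : ∀ j, (N j).Good) (hp : (pi N).BoundedBelow)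
    (h : ∀ j, X.FullyFaithfulAt M (N j)) : X.FullyFaithfulAt M (pi N) := by
  have hg : (pi N).Good := ⟨hp, isClosed_pi fun j => (hN j).closed⟩
  obtain ⟨hl⟩ := isLimit_piFan hN hp
  have h1 := bijective_of_isLimit_fan hl (M.inDPlus hM.bounded)
  have h2 := bijective_of_isLimit_fan (Limits.isLimitFanMkObjOfIsLimit F _ _ hl)
    (F.obj (M.inDPlus hM.bounded))
  rw [fullyFaithfulAt_iff hC hα hM hg]
  have h3 := (Function.Bijective.piMap fun j =>
    (fullyFaithfulAt_iff hC hα hM (hN j)).1 (h j)).comp h1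
  refine (Function.Bijective.of_comp_iff' h2 _).1 ?_
  refine Eq.subst (motive := Function.Bijective) (funext fun f => funext fun j => ?_) h3
  exact F.map_comp f (dmap hp (hN j).bounded ((toHCat C).map (piπ N j)))

/-- Requiring the property for all good sources makes it stable under shifts of the target, since
these can be moved to the source. Resolutions of `X □ N` serve as the closed replacements. -/
lemma triangulated_fullyFaithfulAt (hD : D.Positive) (hX : X.BoundedBelow) :
    Triangulated fun N : DGComod C => N.Good ∧ ∀ M : DGComod C, M.Good → X.FullyFaithfulAt M N := by
  have hY : ∀ {N : DGComod C}, N.Good → (X.cotensor N).res.IsClosed := fun hN =>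
    (good_res hD (BoundedBelow.cotensor hX hN.bounded)).closed
  have hs : ∀ {N : DGComod C} (n : ℤ), N.Good →
      (∀ M : DGComod C, M.Good → X.FullyFaithfulAt M N) →
      ∀ M : DGComod C, M.Good → X.FullyFaithfulAt M (N.shift n) := by
    intro N n hN h M hM
    have := (fullyFaithfulAt_shift M (-n) (X.cotensor N).toRes_isQuasiIso (hY hN)).1
      (h _ (hM.shift (-n)))
    rwa [neg_neg] at this
  refine ⟨fun {N N'} f hf hN hN' => ?_, fun n hN h => ⟨hN.shift n, hs n hN h.2⟩,
    fun f hN hN' h h' => ⟨hN.cone f hN', fun M hM => ?_⟩⟩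
  · have := hf.isIso_toHCat hN.closed hN'.closed
    exact and_congr (iff_of_true hN hN') (forall₂_congr fun M _ =>
      FullyFaithfulAt.iff_right ((toHCat C).map f))
  · exact fullyFaithfulAt_cone_right f (X.cotensor _).toRes_isQuasiIso
      (X.cotensor _).toRes_isQuasiIso (hY hN) (hY hN') (h.2 M hM) (h'.2 M hM)
      (hs 1 hN h.2 M hM) (hs 1 hN' h'.2 M hM)

/-- The second dévissage, in the target: from the `C[j]` to their products by (b), to the `C ⊗ V` as
retracts of such products, and from there to all good comodules. -/
theorem bijective_map (hC : C.Positive) (hD : D.Positive) (hCb : C.Bounded) (hXb : X.Bounded)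
    (hXcl : X.toDGComod.IsClosed) (hα : X.IsDerivedCotensor hX F α)
    (h : X.InducesIsos hX hC.boundedBelow α)
    (hF : ∀ J : Type u, Limits.PreservesLimitsOfShape (Discrete J) F) (A B : DPlus C) :
    Function.Bijective (fun f : A ⟶ B => F.map f) := by
  have hC' := good_self hC
  have h0 : ∀ j : ℤ, X.FullyFaithfulAt C.self (C.self.shift j) := fun j =>
    (fullyFaithfulAt_iff hC hα hC' (hC'.shift j)).2 ((inducesIsos_iff hC hα).1 h j)
  have h1 := fun (M : DGComod C) (hM : M.Good) (j : ℤ) =>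
    fullyFaithfulAt_self hC hCb hXb hXcl h0 hM j
  have hpi : ∀ {J : Type u} (N : J → DGComod C), (∃ a : ℤ, ∀ j, ∀ n < a, (N j).gr n = ⊥) →
      (∀ j, (N j).Good) → (∀ j, ∀ M : DGComod C, M.Good → X.FullyFaithfulAt M (N j)) →
      (pi N).Good ∧ ∀ M : DGComod C, M.Good → X.FullyFaithfulAt M (pi N) := by
    rintro J N ⟨a, ha⟩ hN hN'
    exact ⟨⟨⟨a, pi_gr hC ha⟩, isClosed_pi fun j => (hN j).closed⟩, fun M hM =>
      fullyFaithfulAt_pi hC hα hM hN ⟨a, pi_gr hC ha⟩ fun j => hN' j M hM⟩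
  have h2 : ∀ {N : DGComod C}, N.Good →
      N.Good ∧ ∀ M : DGComod C, M.Good → X.FullyFaithfulAt M N := fun {N} hN => by
    refine (triangulated_fullyFaithfulAt hD hX).of_good hC
      (fun M ha hM h => hpi M ha hM fun j => (h j).2) (fun V q hV => ?_) hN
    refine ⟨good_cofree hC hV.boundedBelow, fun M hM => ?_⟩
    obtain ⟨i, r, hir⟩ := cofree_retract (C := C) hV (Module.Basis.ofVectorSpace k V.carrier)
    obtain ⟨a, ha⟩ := (hC'.shift (-q)).bounded
    exact ((hpi _ ⟨a, fun _ => ha⟩ (fun _ => hC'.shift (-q)) fun _ M hM => h1 M hM (-q)).2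
      M hM).of_retract_right i r hir
  obtain ⟨M, hM, ⟨e⟩⟩ := exists_good hC A
  obtain ⟨N, hN, ⟨e'⟩⟩ := exists_good hC B
  have h3 := (fullyFaithfulAt_iff hC hα hM hN).1 ((h2 hN).2 M hM)
  refine (Function.Bijective.of_comp_iff'
    ((F.mapIso e).homCongr (F.mapIso e')).bijective _).1 ?_
  refine Eq.subst (motive := Function.Bijective) (funext fun f => ?_)
    (h3.comp (e.homCongr e').bijective)
  simp [Iso.homCongr]

end Full

end DGBicomod

/-! ### Bounds for resolutions and roofs of quasi-isomorphisms -/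

namespace DGComod

variable {C : DGCoalg k}

lemma Cogen.gr_eq_bot {M : DGComod C} (G : M.Cogen) (hC : C.Positive) {a : ℤ}
    (h : ∀ n < a, G.T.gr n = ⊥) : ∀ n < a, M.gr n = ⊥ := fun n hn =>
  (Submodule.eq_bot_iff _).2 fun x hx => G.equiv.injective (by
    rw [map_zero]
    refine DGVect.tensor_eq_zero hC LinearMap.id n (fun q hq c y hy => ?_) (G.equiv_mem hx)
    rw [h q (by omega), Submodule.mem_bot] at hy
    rw [hy, TensorProduct.tmul_zero, map_zero])

lemma res_gr {M : DGComod C} (hC : C.Positive) {a : ℤ} (h : ∀ n < a, M.gr n = ⊥) :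
    ∀ n < a, M.res.gr n = ⊥ := M.resCogen.gr_eq_bot hC (M.resCogen_gr h hC)

/-- The resolution of `N` is closed, so the isomorphism followed by the augmentation lifts to a
chain map. This turns isomorphisms in `D(C)` into pairs of quasi-isomorphisms, to which chain-level
operations can be applied. -/
lemma exists_roof (hC : C.Positive) {M N : DGComod C} (hN : N.BoundedBelow)
    (e : (chainToDCat C).obj M ≅ (chainToDCat C).obj N) :
    ∃ (Y : DGComod C) (u : M ⟶ Y) (v : N ⟶ Y), Y.Good ∧ IsQuasiIso u ∧ IsQuasiIso v ∧
      (chainToDCat C).map u = e.hom ≫ (chainToDCat C).map v := by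
  obtain ⟨u, hu, hu'⟩ := (good_res hC hN).closed.exists_quasiIso (e ≪≫ N.toRes_isQuasiIso.iso)
  exact ⟨N.res, u, N.toRes, good_res hC hN, hu, N.toRes_isQuasiIso, hu'⟩

/-! ### Homology and morphisms to shifts of `C` -/

lemma unit_shift_concentrated (k : Type u) [Field k] (n : ℤ) :
    ((DGVect.unit k).shift (-n)).Concentrated n := fun p hp => if_neg (by omega)

lemma tensorIncl_one_bijective (C : DGCoalg k) (n : ℤ) : Function.Bijective
    (C.self.tensorIncl (unit_shift_concentrated k n) (1 : k)).lin :=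
  (TensorProduct.rid k C.carrier).symm.bijective

/-- A comodule with no non-zero morphism to `C[-n]` in the homotopy category is exact in
degree `n`. -/
lemma exists_d_eq_of_subsingleton {M : DGComod C} {n : ℤ}
    (h : Subsingleton ((toHCat C).obj M ⟶ (toHCat C).obj (C.self.shift (-n)))) {x : M.carrier}
    (hx : x ∈ M.gr n) (hd : M.d x = 0) : ∃ y ∈ M.gr (n - 1), M.d y = x := by
  by_contra hxy
  have hx' : x ∉ LinearMap.range M.d := by
    rintro ⟨y, hy⟩
    refine hxy ⟨M.proj (n - 1) y, M.proj_mem _ y, ?_⟩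
    rw [← M.proj_d, hy, sub_add_cancel, M.proj_of_mem hx]
  -- A cycle which is not a boundary is detected by a linear form vanishing on boundaries. Its
  -- degree `n` part is a chain map from `M` to `k[-n]`, corresponding to a morphism from `M` to `C
  -- ⊗ k[-n] ≅ C[-n]`.
  obtain ⟨φ, hφ, hφ'⟩ := Submodule.exists_le_ker_of_notMem hx'
  let K := (DGVect.unit k).shift (-n)
  let ψ : DGVect.Hom M.toDGVect K :=
    { lin := φ ∘ₗ M.proj n
      mem := fun {m y} hy => by
        by_cases hm : m = n
        · subst hm
          exact (unit_shift_concentrated k m).mem _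
        · rw [LinearMap.comp_apply, M.proj_of_mem_ne hy hm, map_zero]
          exact zero_mem _
      comm := fun y => by
        have h1 : M.proj n (M.d y) = M.d (M.proj (n - 1) y) := by
          rw [← M.proj_d, sub_add_cancel]
        rw [LinearMap.comp_apply, h1]
        exact hφ' ⟨_, rfl⟩ }
  have hi := isIso_toHCat_of_bijective _ (tensorIncl_one_bijective C n)
  let e := asIso ((toHCat C).map (C.self.tensorIncl (unit_shift_concentrated k n) (1 : k)))
  have h0 : (toHCat C).map (M.toCofree ≫ cofreeMap ψ) = 0 :=
    e.homToEquiv.symm.injective (Subsingleton.elim _ _)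
  obtain ⟨H⟩ := (toHCat_eq_zero_iff _).1 h0
  -- Evaluating the null homotopy at the cycle and applying the counit yields a boundary in `k[-n]`,
  -- which is zero, contradicting `φ x ≠ 0`.
  have h1 := congrArg (cofreeCounit (C := C) K).lin (H.eq x)
  rw [DGComod.comp_apply, zero_lin, LinearMap.zero_apply, sub_zero, cofreeCounit_cofreeMap,
    cofreeCounit_toCofree, hd, map_zero, zero_add, (cofreeCounit K).comm] at h1
  refine hφ ?_
  have h2 : φ (M.proj n x) = 0 := h1
  rwa [M.proj_of_mem hx] at h2

end DGComod

namespace DGBicomod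

open DGComod

variable {C D : DGCoalg k} {X : DGBicomod D C}

/-! ### The essential image -/

variable (X) in
/-- The comodules isomorphic to `X □ N` in the derived category. -/
def Represented (M : DGComod D) : Prop :=
  ∃ N : DGComod C, N.Good ∧ Nonempty ((chainToDCat D).obj M ≅ (chainToDCat D).obj (X.cotensor N))

namespace Represented

variable {M M' : DGComod D}

lemma of_iso (h : X.Represented M) (e : (chainToDCat D).obj M ≅ (chainToDCat D).obj M') :
    X.Represented M' := by
  obtain ⟨N, hN, ⟨e'⟩⟩ := h
  exact ⟨N, hN, ⟨e.symm ≪≫ e'⟩⟩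

lemma shift (hD : D.Positive) (hX : X.BoundedBelow) (h : X.Represented M) (n : ℤ) :
    X.Represented (M.shift n) := by
  obtain ⟨N, hN, ⟨e⟩⟩ := h
  obtain ⟨Y, u, v, -, hu, hv, -⟩ := exists_roof hD (BoundedBelow.cotensor hX hN.bounded) e
  exact ⟨N.shift n, hN.shift n, ⟨(hu.shift n).iso ≪≫ (hv.shift n).iso.symm ≪≫
    (IsQuasiIso.of_bijective (X.cotensorShift_bijective N n)).iso.symm⟩⟩

/-- The preimage is first replaced by its resolution, because quasi-cofreeness is visibly preserved
by tensoring with `V`, and it implies closedness. -/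
lemma tensor (hC : C.Positive) (hD : D.Positive) (hX : X.BoundedBelow) (h : X.Represented M)
    {V : DGVect k} (hV : V.BoundedBelow) : X.Represented (M.tensor V) := by
  obtain ⟨N, hN, ⟨e⟩⟩ := h
  have := N.toRes_isQuasiIso.isIso_toHCat hN.closed (good_res hC hN.bounded).closed
  let i := X.cotensorH.mapIso (asIso ((toHCat C).map N.toRes))
  let e' : (chainToDCat D).obj M ≅ (chainToDCat D).obj (X.cotensor N.res) :=
    e ≪≫ (toDCat D).mapIso i
  obtain ⟨Y, u, v, -, hu, hv, -⟩ := exists_roof hD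
    (BoundedBelow.cotensor hX (good_res hC hN.bounded).bounded) e'
  exact ⟨N.res.tensor V, (N.resCogen.tensor V).good hC
    ((resCogen_boundedBelow hC hN.bounded).tensor hV),
    ⟨(hu.tensorMap V).iso ≪≫ (hv.tensorMap V).iso.symm ≪≫
      (IsQuasiIso.of_bijective (X.cotensorTensor_bijective N.res V)).iso⟩⟩

/-- By full faithfulness the morphism between the two objects comes from a morphism `g` of
`Chain(C)`. Two squares commuting up to homotopy compare the cone of `f` with that of `X □ g`, which
is `X □ Co(g)`. -/
lemma cone (hD : D.Positive) (hX : X.BoundedBelow)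
    (hF : ∀ N N' : DGComod C, N.Good → N'.Good → X.FullyFaithfulAt N N')
    (h : X.Represented M) (h' : X.Represented M') (f : M ⟶ M') : X.Represented (Co f) := by
  obtain ⟨N, hN, ⟨e⟩⟩ := h
  obtain ⟨N', hN', ⟨e'⟩⟩ := h'
  obtain ⟨Y, u, v, -, hu, hv, -⟩ := exists_roof hD (BoundedBelow.cotensor hX hN.bounded) e
  obtain ⟨Y', u', v', hY', hu', hv', -⟩ := exists_roof hD
    (BoundedBelow.cotensor hX hN'.bounded) e'
  obtain ⟨y, hy⟩ := (hY'.closed.bijective_comp u hu).2 ((toHCat D).map (f ≫ u'))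
  obtain ⟨y, rfl⟩ := exists_toHCat_map y
  have hy' : (toHCat D).map (f ≫ u') = (toHCat D).map (u ≫ y) := by
    rw [(toHCat D).map_comp u y]
    exact hy.symm
  obtain ⟨g, hg⟩ := ((fullyFaithfulAt_iff_cotComp N hv' hY'.closed).1 (hF N N' hN hN')).2
    ((toHCat D).map (v ≫ y))
  obtain ⟨g, rfl⟩ := exists_toHCat_map g
  rw [cotComp_apply, cotH_map, ← Functor.map_comp] at hg
  obtain ⟨H⟩ := (toHCat_eq_iff _ _).1 hy'
  obtain ⟨K⟩ := (toHCat_eq_iff _ _).1 hg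
  exact ⟨Co g, hN.cone g hN', ⟨(IsQuasiIso.coneMap hu hu' H).iso ≪≫
    (IsQuasiIso.coneMap hv hv' K).iso.symm ≪≫
    (IsQuasiIso.of_bijective (X.cotensorCone_bijective g)).iso.symm⟩⟩

lemma of_shift (hD : D.Positive) (hX : X.BoundedBelow) {n : ℤ} (h : X.Represented (M.shift n)) :
    X.Represented M :=
  (h.shift hD hX (-n)).of_iso (IsQuasiIso.of_bijective (f := M.shiftShiftZero (add_neg_cancel n))
    Function.bijective_id).iso

end Represented

end DGBicomod

/-! ### Factors of products as retracts -/

lemma nonempty_hom_dPlus {D : DGCoalg k} (A B : DPlus D) : Nonempty (A ⟶ B) := by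
  obtain ⟨A, M, -, ⟨e⟩⟩ := A
  obtain ⟨B, N, -, ⟨e'⟩⟩ := B
  exact ⟨(isDPlus D).homMk (e.hom ≫ (chainToDCat D).map 0 ≫ e'.inv)⟩

/-- When there are morphisms between any two objects, the identity of a factor extends to a family
of morphisms to all factors; so each factor is a retract of the product. -/
lemma exists_section_of_isLimit_fan {A : Type*} [Category A] (hA : ∀ a b : A, Nonempty (a ⟶ b))
    {J : Type*} {Z : J → A} {c : Limits.Fan Z} (hc : Limits.IsLimit c) (j : J) :
    ∃ s : Z j ⟶ c.pt, s ≫ c.proj j = 𝟙 (Z j) := by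
  classical
  have h : ∃ f : ∀ i, Z j ⟶ Z i, f j = 𝟙 (Z j) :=
    ⟨fun i => if h : j = i then eqToHom (by rw [h]) else (hA _ _).some, by simp⟩
  obtain ⟨f, hf⟩ := h
  exact ⟨Limits.Fan.IsLimit.lift hc f, (Limits.Fan.IsLimit.fac hc f j).trans hf⟩

namespace DGComod

variable {C : DGCoalg k}

/-- As the target is closed, every morphism is represented by a chain map, which vanishes because in
each degree the source or the target does. -/
lemma subsingleton_hom_of_gr {M N : DGComod C} (hM : M.BoundedBelow) (hN : N.BoundedBelow)
    (hN' : N.IsClosed) (h : ∀ n, M.gr n = ⊥ ∨ N.gr n = ⊥) :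
    Subsingleton (M.inDPlus hM ⟶ N.inDPlus hN) := by
  have h0 : ∀ f : M.inDPlus hM ⟶ N.inDPlus hN, f.hom = (chainToDCat C).map 0 := fun f => by
    obtain ⟨g, hg⟩ := hN'.exists_map f.hom
    have : g = 0 := hom_ext (M.linearMap_ext fun n x hx => by
      have hx' := g.mem hx
      rcases h n with h | h
      · rw [h, Submodule.mem_bot] at hx
        rw [hx, map_zero, map_zero]
      · rwa [h, Submodule.mem_bot] at hx')
    rw [← hg, this]
  exact ⟨fun f g => (isDPlus C).hom_ext ((h0 f).trans (h0 g).symm)⟩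

end DGComod

/-! ### Stability of the essential image -/

namespace DGBicomod

open DGComod Limits

variable {C D : DGCoalg k} {X : DGBicomod D C} {hX : X.BoundedBelow} {F : DPlus C ⥤ DPlus D}
  {α : X.cotensorPlus hX ⟶ toDPlus C ⋙ F}

lemma essImage_iff (hC : C.Positive) (hα : X.IsDerivedCotensor hX F α) {B : DPlus D}
    {M : DGComod D} (e : B.obj ≅ (chainToDCat D).obj M) : F.essImage B ↔ X.Represented M := by
  constructor
  · rintro ⟨A, ⟨i⟩⟩
    obtain ⟨N, hN, ⟨e'⟩⟩ := exists_good hC A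
    let j := i.symm ≪≫ F.mapIso e' ≪≫ (derIso hC hα hN).symm
    exact ⟨N, hN, ⟨e.symm ≪≫ (isDPlus D).ι.mapIso j⟩⟩
  · rintro ⟨N, hN, ⟨e'⟩⟩
    let j : B ≅ (X.cotensor N).inDPlus (BoundedBelow.cotensor hX hN.bounded) := isoDPlus (e ≪≫ e')
    exact ⟨_, ⟨(derIso hC hα hN).symm ≪≫ j.symm⟩⟩

/-- The objects of the essential image with a common bound for the degrees of the morphisms to the
shifts of `C` have uniformly bounded preimages. -/
lemma exists_bounded_preimage (hC : C.Positive) {N : DGComod C} (hN : N.Good) {a : ℤ}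
    (h : ∀ n < a, Subsingleton (N.inDPlus hN.bounded ⟶
      (C.self.shift (-n)).inDPlus (hC.boundedBelow.shift (-n)))) :
    ∃ (N' : DGComod C) (hN' : N'.Good), (∀ n < a, N'.gr n = ⊥) ∧
      Nonempty (N'.inDPlus hN'.bounded ≅ N.inDPlus hN.bounded) := by
  -- The absence of morphisms to `C[-n]` forces exactness in degree `n`, so that everything below
  -- `a` can be truncated away up to quasi-isomorphism.
  obtain ⟨N₁, f, hf, hN₁⟩ := exists_trunc (M := N) (a := a) hC fun n hn x hx hd => by
    have := h n hn
    exact exists_d_eq_of_subsingleton ((dmap_bijective hN.bounded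
      ((good_self hC).shift (-n))).1.subsingleton) hx hd
  exact ⟨N₁.res, good_res hC ⟨a, hN₁⟩, res_gr hC hN₁,
    ⟨(isoDPlus (A := N.inDPlus hN.bounded) (B := N₁.res.inDPlus (good_res hC ⟨a, hN₁⟩).bounded)
      (hf.comp N₁.toRes_isQuasiIso).iso).symm⟩⟩

/-- The preimages of the factors need not be uniformly bounded below, so their product could fall
outside `D⁺(C)`. The existence of the product in `D⁺(D)` provides a common bound, which full control
of morphisms to the `C[-n]` carries back to the preimages. -/
lemma essImage_product (hC : C.Positive) (hXb : X.Bounded) (hXcl : X.toDGComod.IsClosed)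
    (hα : X.IsDerivedCotensor hX F α)
    (hF : ∀ A B : DPlus C, Function.Injective (fun f : A ⟶ B => F.map f)) {J : Type u}
    [PreservesLimitsOfShape (Discrete J) F] (A : J → DPlus D) (c : Fan A) (hc : IsLimit c)
    (h : ∀ j, F.essImage (A j)) : F.essImage c.pt := by
  choose A' hA' using h
  choose N hN e using fun j => exists_good hC (A' j)
  let φ : ∀ j, F.obj ((N j).inDPlus (hN j).bounded) ≅ A j := fun j =>
    F.mapIso (e j).some.symm ≪≫ (hA' j).some
  obtain ⟨B, ⟨b, hb⟩, ⟨eB⟩⟩ := c.pt.property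
  obtain ⟨a₁, b₁, hb₁⟩ := hXb
  have hB : B.BoundedBelow := ⟨b, hb⟩
  let eB' : c.pt ≅ B.inDPlus hB := isoDPlus eB
  -- The product starts in degree `b`, whereas `F(C[-n]) ≅ X[-n]` ends in degree `b₁ + n < b`.
  have hS : ∀ n < b - b₁, Subsingleton
      (c.pt ⟶ F.obj ((C.self.shift (-n)).inDPlus (hC.boundedBelow.shift (-n)))) := by
    intro n hn
    have := subsingleton_hom_of_gr hB
      (BoundedBelow.cotensor hX (hC.boundedBelow.shift (-n)))
      (isClosed_cotensor_self hXcl (-n)) fun i => by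
        by_cases hi : i < b
        · exact Or.inl (hb i hi)
        · exact Or.inr (cotensor_self_gr (hb₁ _ (Or.inr (by omega))))
    exact (eB'.homCongr (derIso hC hα ((good_self hC).shift (-n))).symm).subsingleton
  -- The vanishing passes to each factor, a retract of the product, and then to its preimage by the
  -- injectivity of `F` on morphisms.
  have hS' : ∀ j, ∀ n < b - b₁, Subsingleton ((N j).inDPlus (hN j).bounded ⟶
      (C.self.shift (-n)).inDPlus (hC.boundedBelow.shift (-n))) := by
    intro j n hn
    have := hS n hn
    obtain ⟨s, hs⟩ := exists_section_of_isLimit_fan nonempty_hom_dPlus hc j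
    have h1 : Subsingleton
        (A j ⟶ F.obj ((C.self.shift (-n)).inDPlus (hC.boundedBelow.shift (-n)))) :=
      ⟨fun f g => by
        rw [← Category.id_comp f, ← Category.id_comp g, ← hs, Category.assoc, Category.assoc,
          Subsingleton.elim (c.proj j ≫ f) (c.proj j ≫ g)]⟩
    have h2 := ((φ j).homCongr
      (Iso.refl (F.obj ((C.self.shift (-n)).inDPlus (hC.boundedBelow.shift (-n)))))).subsingleton
    exact (hF _ _).subsingleton
  -- With uniformly bounded representatives the comodule product lies in `D⁺(C)`, and `F` maps it to
  -- a product of the given factors.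
  choose N' hN' hgr e' using fun j => exists_bounded_preimage hC (hN j) (hS' j)
  have hp : (pi N').BoundedBelow := ⟨b - b₁, pi_gr hC hgr⟩
  obtain ⟨hl⟩ := isLimit_piFan hN' hp
  exact ⟨(pi N').inDPlus hp, ⟨(isLimitFanMkObjOfIsLimit F _ _ hl).conePointsIsoOfNatIso hc
    (Discrete.natIso fun j => F.mapIso (e' j.as).some ≪≫ φ j.as)⟩⟩

lemma isStableTriangulated_essImage (hC : C.Positive) (hD : D.Positive) (hXb : X.Bounded)
    (hXcl : X.toDGComod.IsClosed) (hα : X.IsDerivedCotensor hX F α)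
    (hF : ∀ A B : DPlus C, Function.Bijective (fun f : A ⟶ B => F.map f))
    (hp : ∀ J : Type u, PreservesLimitsOfShape (Discrete J) F) :
    IsStableTriangulated F.essImage := by
  have hFF : ∀ N N' : DGComod C, N.Good → N'.Good → X.FullyFaithfulAt N N' := fun N N' hN hN' =>
    (fullyFaithfulAt_iff hC hα hN hN').2 (hF _ _)
  have hprod : ∀ {J : Type u} (A : J → DPlus D) (c : Fan A), IsLimit c →
      (∀ j, F.essImage (A j)) → F.essImage c.pt := fun A c hc h =>
    essImage_product hC hXb hXcl hα (fun A B => (hF A B).1) A c hc h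
  refine ⟨?_, ?_, ?_, ?_, ?_, ?_, hprod, ?_⟩
  · rintro A B e ⟨A', ⟨i⟩⟩
    exact ⟨A', ⟨i ≪≫ e⟩⟩
  · intro A hA
    -- A zero object is the empty product.
    obtain ⟨hl⟩ := isLimit_fan_of_bijective (Fan.mk A fun j : PEmpty.{u + 1} => j.elim :
      Fan fun j : PEmpty.{u + 1} => j.elim) fun B =>
        ⟨fun f g _ => hA.eq_of_tgt f g, fun g => ⟨hA.from_ B, Subsingleton.elim _ _⟩⟩
    exact hprod _ _ hl fun j => j.elim
  · intro A B M n e e' h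
    exact (essImage_iff hC hα e').2 (((essImage_iff hC hα e).1 h).shift hD hX n)
  · rintro A B E ⟨M, N, f, ⟨eA⟩, ⟨eB⟩, ⟨eE⟩⟩ hB hE
    -- Rotation: `M[1]` is quasi-isomorphic to the cone of `N ⟶ Co(f)`.
    refine (essImage_iff hC hα eA).2 (Represented.of_shift hD hX (n := 1) ?_)
    exact (((essImage_iff hC hα eB).1 hB).cone hD hX hFF ((essImage_iff hC hα eE).1 hE)
      (coneι f)).of_iso (shortExact_cone f).fromCone_isQuasiIso.iso
  · rintro A B E ⟨M, N, f, ⟨eA⟩, ⟨eB⟩, ⟨eE⟩⟩ hA hE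
    refine (essImage_iff hC hα eB).2 (Represented.of_shift hD hX (n := 1) ?_)
    -- Rotation in the other direction: `N[1]` is quasi-isomorphic to the cone of `Co(f) ⟶ M[1]`.
    have hE' := (essImage_iff hC hα (M := Co f) eE).1 hE
    exact (hE'.cone hD hX hFF (((essImage_iff hC hα eA).1 hA).shift hD hX 1)
      (coneδ f)).of_iso (shortExact_cone f).toCone_isQuasiIso.iso.symm
  · rintro A B E ⟨M, N, f, ⟨eA⟩, ⟨eB⟩, ⟨eE⟩⟩ hA hB
    exact (essImage_iff hC hα eE).2
      (((essImage_iff hC hα eA).1 hA).cone hD hX hFF ((essImage_iff hC hα eB).1 hB) f)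
  · intro A B M V hV e e' h
    exact (essImage_iff hC hα e').2 (((essImage_iff hC hα e).1 h).tensor hC hD hX hV)

end DGBicomod

/-! ### Generation of the derived category -/

namespace IsStableTriangulated

open DGComod

variable {C D : DGCoalg k} {P : ObjectProperty (DPlus D)}

/-- A stable triangulated subcategory of `D⁺(D)` which contains `D` is everything. -/
theorem of_self (hP : IsStableTriangulated P) (hD : D.Positive)
    (h : P (D.self.inDPlus hD.boundedBelow)) (A : DPlus D) : P A := by
  have hT : Triangulated fun M : DGComod D => ∃ hM : M.Good, P (M.inDPlus hM.bounded) := by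
    refine ⟨fun {M N} f hf hM hN => ?_, fun {M} n hM h => ?_, fun {M N} f hM hN h h' => ?_⟩
    · let e : M.inDPlus hM.bounded ≅ N.inDPlus hN.bounded := isoDPlus hf.iso
      exact ⟨fun ⟨_, h⟩ => ⟨hN, hP.of_iso e h⟩, fun ⟨_, h⟩ => ⟨hM, hP.of_iso e.symm h⟩⟩
    · exact ⟨hM.shift n, hP.shift M n (Iso.refl _) (Iso.refl _) h.2⟩
    · exact ⟨hM.cone f hN, hP.triangle₃ ⟨M, N, f, ⟨Iso.refl _⟩, ⟨Iso.refl _⟩, ⟨Iso.refl _⟩⟩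
        h.2 h'.2⟩
  obtain ⟨M, hM, ⟨e⟩⟩ := exists_good hD A
  refine hP.of_iso e.symm (hT.of_good hD (fun N ha hN hN' => ?_) (fun V q hV => ?_) hM).2
  · obtain ⟨a, ha⟩ := ha
    have hp : (pi N).BoundedBelow := ⟨a, pi_gr hD ha⟩
    obtain ⟨hl⟩ := isLimit_piFan hN hp
    exact ⟨⟨hp, isClosed_pi fun j => (hN j).closed⟩, hP.product _ _ hl fun j => (hN' j).2⟩
  · exact ⟨good_cofree hD hV.boundedBelow, hP.extension D.self V hV.boundedBelow (Iso.refl _)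
      (Iso.refl _) h⟩

variable {X : DGBicomod D C} {hX : X.BoundedBelow} {F : DPlus C ⥤ DPlus D}
  {α : X.cotensorPlus hX ⟶ toDPlus C ⋙ F}

open DGBicomod in
/-- A stable triangulated subcategory of `D⁺(D)` which contains `X` contains the image of
`X □ -`. -/
theorem of_cotensor (hP : IsStableTriangulated P) (hC : C.Positive)
    (hα : X.IsDerivedCotensor hX F α)
    (hF : ∀ J : Type u, Limits.PreservesLimitsOfShape (Discrete J) F)
    (h : P (X.toDGComod.inDPlus hX)) (A : DPlus C) : P (F.obj A) := by
  have hb : ∀ {N : DGComod C}, N.Good → (X.cotensor N).BoundedBelow := fun hN =>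
    BoundedBelow.cotensor hX hN.bounded
  have hT : Triangulated fun N : DGComod C =>
      ∃ hN : N.Good, P ((X.cotensor N).inDPlus (hb hN)) := by
    refine ⟨fun {M N} f hf hM hN => ?_, fun {M} n hM h => ?_, fun {M N} f hM hN h h' => ?_⟩
    · have := hf.isIso_toHCat hM.closed hN.closed
      let e : (X.cotensor M).inDPlus (hb hM) ≅ (X.cotensor N).inDPlus (hb hN) :=
        isoDPlus ((toDCat D).mapIso (X.cotensorH.mapIso (asIso ((toHCat C).map f))))
      exact ⟨fun ⟨_, h⟩ => ⟨hN, hP.of_iso e h⟩, fun ⟨_, h⟩ => ⟨hM, hP.of_iso e.symm h⟩⟩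
    · exact ⟨hM.shift n, hP.shift (X.cotensor M) n (Iso.refl _)
        (IsQuasiIso.of_bijective (X.cotensorShift_bijective M n)).iso h.2⟩
    · exact ⟨hM.cone f hN, hP.triangle₃ ⟨X.cotensor M, X.cotensor N, X.cotMap f, ⟨Iso.refl _⟩,
        ⟨Iso.refl _⟩, ⟨(IsQuasiIso.of_bijective (X.cotensorCone_bijective f)).iso⟩⟩ h.2 h'.2⟩
  obtain ⟨M, hM, ⟨e⟩⟩ := exists_good hC A
  refine hP.of_iso ((derIso hC hα hM) ≪≫ F.mapIso e.symm)
    (hT.of_good hC (fun N ha hN hN' => ?_) (fun V q hV => ?_) hM).2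
  · obtain ⟨a, ha⟩ := ha
    have hp : (pi N).BoundedBelow := ⟨a, pi_gr hC ha⟩
    have hg : (pi N).Good := ⟨hp, isClosed_pi fun j => (hN j).closed⟩
    obtain ⟨hl⟩ := isLimit_piFan hN hp
    -- `X □ -` itself is not compared with products: the product and its factors are good, so `X □
    -- -` may be replaced by `F`, which preserves products.
    exact ⟨hg, hP.of_iso (derIso hC hα hg).symm (hP.product _ _
      (Limits.isLimitFanMkObjOfIsLimit F _ _ hl) fun j =>
        hP.of_iso (derIso hC hα (hN j)) (hN' j).2)⟩
  -- On generators the functor is an extension of `X`: `X ⊗ V ≅ (X □ C) ⊗ V ≅ X □ (C ⊗ V)`.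
  · let t := (IsQuasiIso.of_bijective (tensorMap_bijective X.toCotensor V
      X.toCotensor_bijective)).iso ≪≫
      (IsQuasiIso.of_bijective (X.cotensorTensor_bijective C.self V)).iso
    exact ⟨good_cofree hC hV.boundedBelow, hP.extension X.toDGComod V hV.boundedBelow (Iso.refl _)
      t.symm h⟩

end IsStableTriangulated

end


theorem mainTheorem2 {k : Type u} [Field k] (C D : DGCoalg k) (hC : C.Positive)
    (hD : D.Positive) (hCb : C.Bounded) (X : DGBicomod D C) (hX : X.Bounded)
    (hXcl : X.toDGComod.IsClosed) :
    (∃ (F : DPlus C ⥤ DPlus D) (α : X.cotensorPlus hX.boundedBelow ⟶ toDPlus C ⋙ F),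
      X.IsDerivedCotensor hX.boundedBelow F α) ∧
    ∀ (F : DPlus C ⥤ DPlus D) (α : X.cotensorPlus hX.boundedBelow ⟶ toDPlus C ⋙ F),
      X.IsDerivedCotensor hX.boundedBelow F α →
      (F.IsEquivalence ↔
        X.InducesIsos hX.boundedBelow hC.boundedBelow α ∧
        (∀ J : Type u, Limits.PreservesLimitsOfShape (Discrete J) F) ∧
        generated (X.toDGComod.inDPlus hX.boundedBelow) (D.self.inDPlus hD.boundedBelow)) := by
  refine ⟨exists_isDerivedCotensor hC X hX.boundedBelow, fun F α hα => ⟨fun hF => ?_, ?_⟩⟩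
  · have hp : ∀ J : Type u, Limits.PreservesLimitsOfShape (Discrete J) F := fun J => inferInstance
    refine ⟨(DGBicomod.inducesIsos_iff hC hα).2 fun n =>
      ⟨F.map_injective, F.map_surjective⟩, hp, fun P hP hPX => ?_⟩
    -- `D` is isomorphic to the image of some object, and all images lie in any stable triangulated
    -- subcategory containing `X`.
    exact hP.of_iso (F.objObjPreimageIso _) (hP.of_cotensor hC hα hp hPX _)
  · rintro ⟨h, hp, hg⟩
    have hF := DGBicomod.bijective_map hC hD hCb hX hXcl hα h hp
    -- Condition (c) is applied to the essential image itself: it contains `X ≅ X □ C`, hence `D`,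
    -- hence all of `D⁺(D)`.
    have hP := DGBicomod.isStableTriangulated_essImage hC hD hX hXcl hα hF hp
    have hPX : F.essImage (X.toDGComod.inDPlus hX.boundedBelow) :=
      (DGBicomod.essImage_iff hC hα (Iso.refl _)).2 ⟨C.self, DGComod.good_self hC,
        ⟨(DGComod.IsQuasiIso.of_bijective X.toCotensor_bijective).iso⟩⟩
    exact { full := ⟨fun {A B} f => (hF A B).2 f⟩
            faithful := ⟨fun {A B} f g hfg => (hF A B).1 hfg⟩
            essSurj := ⟨fun B => hP.of_self hD (hg F.essImage hP hPX) B⟩ }
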